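/- **Setting.** A *spectral curve* $(C,x,y)$ is a reduced complex analytic curve $C$ (not necessarily connected, compact or irreducible) with normalisation $\pi:\tilde C\to C$, a meromorphic function $x:C\to\mathbb P^1$ all of whose fibres are finite, and a meromorphic function $y$. Put $\tilde x=x\circ\pi$, $\tilde y=y\circ\pi$. Let $\mathfrak b\subset\mathbb C$ be the set of $b$ such that the cardinality of the fibres of $x$ is constant on a punctured neighbourhood of $b$ and strictly smaller at $b$; assume $\mathfrak b$ finite. Put $\mathfrak a=x^{-1}(\mathfrak b)$, $\tilde{\mathfrak a}=\tilde x^{-1}(\mathfrak b)$, and $\tilde{\mathfrak a}_\alpha=\pi^{-1}(\alpha)$ for $\alpha\in\mathfrak a$. For $\mu\in\tilde{\mathfrak a}_\alpha$ let $r_\mu$ be the ramification order of $\tilde x$ at $\mu$, fix a coordinate $\zeta$ on a small neighbourhood $\tilde C_\mu$ of $\mu$ with $\tilde x=x(\alpha)+\zeta^{r_\mu}$ (the $\tilde C_\mu$ pairwise disjoint, and all those with $\mu\in\tilde{\mathfrak a}_\alpha$ having as image under $\tilde x$ the same disc $V_\alpha$ around $x(\alpha)$), and write $\tilde y=-t_\mu\zeta^{s_\mu-r_\mu}+(\text{higher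 order})$, $t_\mu\neq0$, with $s_\mu\in\mathbb Z$, or $s_\mu=+\infty$ if $\tilde y\equiv0$ near $\mu$. Let $r_\alpha=\sum_{\mu\in\tilde{\mathfrak a}_\alpha}r_\mu$, $\tilde U_\alpha=\bigsqcup_{\mu\in\tilde{\mathfrak a}_\alpha}\tilde C_\mu$, $\mathfrak f_\alpha(z)=\tilde x^{-1}(\tilde x(z))\cap\tilde U_\alpha$, $\mathfrak f'_\alpha(z)=\mathfrak f_\alpha(z)\setminus\{z\}$. Choose a total order $\preccurlyeq$ on each $\tilde{\mathfrak a}_\alpha$ such that $\mu\preccurlyeq\nu$ implies $s_\mu/r_\mu\le s_\nu/r_\nu$; write $[\mu)=\{\nu\prec\mu\}$, $\mathbf r_M=\sum_{\nu\in M}r_\nu$, $\mathbf s_M=\sum_{\nu\in M}s_\nu$. Define (with $0\cdot\infty=0$) $$\mathfrak v_\mu=(s_\mu-r_\mu)(r_\alpha-1)-\mathbf r_{[\mu)}s_\mu+\mathbf s_{[\mu)}r_\mu,$$ where, if $s_\mu=\infty$, the total coefficient of $s_\mu$ is collected first, and, for $i=\mathbf r_{[\lambda)}+i'$ with $\lambda\in\tilde{\mathfrak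 a}_\alpha$, $1\le i'\le r_\lambda$, $$\mathfrak d_\alpha(i)=-\Big\lfloor\frac{s_\lambda(i'-1)}{r_\lambda}\Big\rfloor-\mathbf s_{[\lambda)}+\delta_{i',1}.$$ **Non-degeneracy assumption.** For no $\alpha\in\mathfrak a$ does one of the following hold: (i) there are distinct $\mu,\nu\in\tilde{\mathfrak a}_\alpha$ with $s_\mu=s_\nu=+\infty$; (ii) there is $\mu\in\tilde{\mathfrak a}_\alpha$ with $s_\mu=+\infty$ and $r_\mu>1$; (iii) there are distinct $\mu,\nu\in\tilde{\mathfrak a}_\alpha$ with $s_\mu,s_\nu$ finite, $r_\mu s_\nu=r_\nu s_\mu$ and $t_\mu^{r_\nu}=t_\nu^{r_\nu}$; (iv) there is $\mu\in\tilde{\mathfrak a}_\alpha$ with $s_\mu$ finite and $\gcd(r_\mu,s_\mu)>1$. **Correlators.** A *family of correlators* is a family $\boldsymbol\omega=(\omega_{g,n})_{g\in\frac12\mathbb N,\,n\ge1}$ of multidifferentials on $\tilde C^n$ such that $\omega_{0,1}=\tilde y\,d\tilde x$; $\omega_{0,2}$ is a symmetric bidifferential, holomorphic except for a double pole with biresidue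 $1$ on the diagonal; $\omega_{\frac12,1}$ is a meromorphic differential with at most simple poles at $\tilde{\mathfrak a}$ and $\sum_{\mu\in\tilde{\mathfrak a}_\alpha}\operatorname{Res}_\mu\omega_{\frac12,1}=0$ for every $\alpha\in\mathfrak a$; and, for $2g-2+n>0$, $\omega_{g,n}$ is symmetric and meromorphic, with poles only when some variable lies in $\tilde{\mathfrak a}$. It has the *projection property* if for $2g-2+n>0$ $$\omega_{g,n}(z_1,z_{[2,n]})=\sum_{\mu\in\tilde{\mathfrak a}}\operatorname{Res}_{z=\mu}\Big(\int_\mu^z\omega_{0,2}(\cdot,z_1)\Big)\omega_{g,n}(z,z_{[2,n]}).$$ For $m\ge1$, put $$\mathcal W_{g,m,n}(z_{[m]};w_{[n]})=\sum\prod_{L\in\mathbf L}\omega_{g_L,|L|+|N_L|}(z_L,w_{N_L}),$$ summed over set partitions $\mathbf L$ of $[m]$, decompositions $[n]=\bigsqcup_{L\in\mathbf L}N_L$ and $g_L\in\frac12\mathbb N$ with $m+\sum_L(g_L-1)=g$; $\mathcal W'_{g,m,n}$ is the same sum without the summands containing a factor $\omega_{0,1}$. Put $$\mathcal E^{(i)}_{\alpha;g,n}(x_0;z_{[n]})=\sum_{Z\subseteq\tilde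 x^{-1}(x_0)\cap\tilde U_\alpha,\ |Z|=i}\mathcal W_{g,i,n}(Z;z_{[n]}),\qquad \tilde{\mathcal E}^{(i)}_{\alpha;g,n}(z_0;z_{[n]})=\sum_{Z\subseteq\mathfrak f_\alpha(z_0),\ |Z|=i}\mathcal W_{g,i,n}(Z;z_{[n]}).$$ In the following, $g\in\frac12\mathbb N$ and $n\ge0$ range over all pairs with $2g-2+(n+1)>0$, and $z_1,\dots,z_n\in\tilde C\setminus\tilde{\mathfrak a}$. * *Abstract loop equations*: for all $\alpha\in\mathfrak a$ and $1\le i\le r_\alpha$, with $\tau=x_0-x(\alpha)\to0$, $$\mathcal E^{(i)}_{\alpha;g,n}(x_0;z_{[n]})=\mathcal O\Big(\tau^{-(\mathfrak d_\alpha(i)-1-\delta_{i,1})}\Big(\frac{dx_0}{\tau}\Big)^i\Big).$$ * *Master loop equations*: for all $\alpha\in\mathfrak a$, $\mu\in\tilde{\mathfrak a}_\alpha$, as $z_0\in\tilde C_\mu\setminus\{\mu\}$ tends to $\mu$, $$\sum_{i=1}^{r_\alpha}\tilde{\mathcal E}^{(i)}_{\alpha;g,n}(z_0;z_{[n]})\big(-\omega_{0,1}(z_0)\big)^{r_\alpha-i}=\mathcal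 O\big(\zeta^{-1+\mathfrak v_\mu+(r_\mu-1)(r_\alpha-1)}(d\zeta)^{r_\alpha}\big).$$ * *Topological recursion (TR)*: for $z_0\in\tilde C\setminus\tilde{\mathfrak a}$, $$\omega_{g,n+1}(z_0,z_{[n]})=\sum_{\alpha\in\mathfrak a}\sum_{\mu\in\tilde{\mathfrak a}_\alpha}\operatorname{Res}_{z=\mu}\ \sum_{\emptyset\ne Z\subseteq\mathfrak f'_\alpha(z)}K_\mu^{(|Z|+1)}(z_0;z,Z)\,\mathcal W'_{g,|Z|+1,n}(z,Z;z_{[n]}),$$ $$K_\mu^{(|Z|+1)}(z_0;z,Z)=-\frac{\int_\mu^z\omega_{0,2}(\cdot,z_0)}{\prod_{z'\in Z}\big((\tilde y(z')-\tilde y(z))\,d\tilde x(z)\big)}.$$ **Proposition.** Under the non-degeneracy assumption: 1. every family of correlators satisfying the abstract loop equations satisfies the master loop equations; 2. every family of correlators satisfying the master loop equations and the projection property is given by (TR); 3. a family of correlators satisfies the abstract loop equations and the projection property if and only if it is given by (TR); 4. two families of correlators with the same $(\omega_{0,1},\omega_{0,2},\omega_{\frac12,1})$ that both satisfy the abstract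 loop equations and the projection property have the same $\omega_{g,n}$ for all $2g-2+n>0$. So, for fixed $(\omega_{0,1},\omega_{0,2},\omega_{\frac12,1})$, there is at most one family of correlators solving the abstract loop equations with the projection property; it exists exactly when the recursion (TR) produces a family of correlators (in particular symmetric multidifferentials), and then (TR) computes it. -/

import Mathlib

open Filter Topology
open scoped Manifold

noncomputable section

namespace LoopEq

/-! ## Spectral curves

The points of `ℙ¹ = ℂ ∪ {∞}` are modelled by `OnePoint ℂ`.  A Riemann surface is a Hausdorff
one-dimensional complex manifold; smoothness exponent `⊤ : WithTop ℕ∞` means that the transition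
maps are analytic over `ℂ`. -/

/-- The complex number underlying a finite point of `ℙ¹` (and `0` at `∞`, which is never used). -/
def finVal : OnePoint ℂ → ℂ
  | none => 0
  | some c => c

section Surface

variable {Ct : Type*} [TopologicalSpace Ct] [ChartedSpace ℂ Ct]

/-- `f : Ct → ℙ¹` is a meromorphic function: it is continuous and, in a chart around any point, it
is given off that point by a `ℂ`-valued meromorphic germ (so it is nowhere locally `∞`). -/
def IsMeromorphicFn (f : Ct → OnePoint ℂ) : Prop :=
  ∀ p : Ct, ContinuousAt f p ∧
    ∃ F : ℂ → ℂ, MeromorphicAt F (chartAt ℂ p p) ∧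
      ∀ᶠ u in 𝓝[≠] (chartAt ℂ p p), f ((chartAt ℂ p).symm u) = ((F u : ℂ) : OnePoint ℂ)

/-- The coordinate tangent vector `∂_φ` at the point of `Ct` with coordinate `u` in the chart `φ`.
The value of a differential on it is the coefficient of `dφ` in that differential. -/
def coordVec (φ : OpenPartialHomeomorph Ct ℂ) (u : ℂ) : TangentBundle 𝓘(ℂ) Ct :=
  ⟨φ.symm u, mfderiv 𝓘(ℂ) 𝓘(ℂ) φ.symm u (1 : ℂ)⟩

end Surface

/-- `b ∈ ℂ` belongs to the set `𝔟`: near `b` the fibres of `x` over points other than `b` have a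
constant cardinality, and the fibre over `b` is strictly smaller. -/
def IsBranchValue {C : Type*} (x : C → OnePoint ℂ) (b : ℂ) : Prop :=
  ∃ U ∈ 𝓝 b, ∃ N : ℕ,
    (∀ b' ∈ U, b' ≠ b → (x ⁻¹' {((b' : ℂ) : OnePoint ℂ)}).ncard = N) ∧
    (x ⁻¹' {((b : ℂ) : OnePoint ℂ)}).ncard < N

/-- A spectral curve `(C, x, y)`, presented through the normalisation `proj : Ct → C` of the reduced
analytic curve `C`.  Here `Ct` is a Riemann surface (not necessarily connected or compact), and
`proj` is onto, has finite fibres, and identifies points only along a closed discrete set.  The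
function `x : C → ℙ¹` is meromorphic (after pullback to `Ct`) with finite fibres; a meromorphic
function `y` on `C` is the same thing as a meromorphic function on `Ct`. -/
structure SpectralCurve (Ct C : Type*) [TopologicalSpace Ct] [ChartedSpace ℂ Ct] where
  proj : Ct → C
  proj_surjective : Function.Surjective proj
  proj_finite : ∀ c : C, (proj ⁻¹' {c}).Finite
  proj_discrete : ∀ p : Ct, ∀ᶠ q in 𝓝[≠] p, ∀ q' : Ct, proj q' = proj q → q' = q
  x : C → OnePoint ℂ
  y : Ct → OnePoint ℂ
  x_meromorphic : IsMeromorphicFn (fun p => x (proj p))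
  y_meromorphic : IsMeromorphicFn y
  x_fibres_finite : ∀ v : OnePoint ℂ, (x ⁻¹' {v}).Finite
  branchValues_finite : {b : ℂ | IsBranchValue x b}.Finite

namespace SpectralCurve

variable {Ct C : Type*} [TopologicalSpace Ct] [ChartedSpace ℂ Ct] (Γ : SpectralCurve Ct C)

/-- The function `x` on the normalisation. -/
def xt (p : Ct) : OnePoint ℂ := Γ.x (Γ.proj p)

/-- Complex value of `x` on the normalisation (meaningful away from its poles). -/
def xval (p : Ct) : ℂ := finVal (Γ.xt p)

/-- Complex value of `y` on the normalisation (meaningful away from its poles). -/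
def yval (p : Ct) : ℂ := finVal (Γ.y p)

theorem finite_xt_fibre (v : OnePoint ℂ) : {p : Ct | Γ.xt p = v}.Finite :=
  Set.Finite.preimage' (f := Γ.proj) (Γ.x_fibres_finite v) fun c _ => Γ.proj_finite c

theorem finite_a : (Γ.x ⁻¹' ((fun b : ℂ => (b : OnePoint ℂ)) '' {b : ℂ | IsBranchValue Γ.x b})).Finite :=
  Set.Finite.preimage' (Γ.branchValues_finite.image _) fun v _ => Γ.x_fibres_finite v

/-- `𝔞 = x⁻¹(𝔟) ⊆ C`. -/
def ramPts : Finset C := Γ.finite_a.toFinset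

/-- `𝔞̃_α = π⁻¹(α) ⊆ Ct`: the branches above `α`. -/
def branches (α : C) : Finset Ct := (Γ.proj_finite α).toFinset

/-- `𝔞̃ ⊆ Ct`, the preimage of `𝔞`. -/
def ramSet : Set Ct := {p | Γ.proj p ∈ Γ.ramPts}

/-- `𝔞̃` as a finite set. -/
def ram : Finset Ct :=
  (Set.Finite.preimage' (f := Γ.proj) Γ.ramPts.finite_toSet
    fun c _ => Γ.proj_finite c : (Γ.proj ⁻¹' (Γ.ramPts : Set C)).Finite).toFinset

/-- The ramification order `r_μ` of `x` at `μ`: the order of vanishing of `x - x(μ)` at `μ`. -/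
def r (μ : Ct) : ℕ :=
  analyticOrderNatAt (fun u => Γ.xval ((chartAt ℂ μ).symm u) - Γ.xval μ) (chartAt ℂ μ μ)

/-- `r_α = ∑_{μ ∈ 𝔞̃_α} r_μ`. -/
def rTot (α : C) : ℕ := ∑ μ ∈ Γ.branches α, Γ.r μ

/-- The differential `dx` evaluated on a tangent vector of `Ct` (at a point where `x` is finite). -/
def dx (v : TangentBundle 𝓘(ℂ) Ct) : ℂ := mfderiv 𝓘(ℂ) 𝓘(ℂ) Γ.xval v.proj v.snd

/-- The tangent vector `∂_x` at `p`, normalised by `dx(∂_x) = 1` (used where `dx ≠ 0`). The value of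
an `i`-differential on `(∂_x, …, ∂_x)` is its coefficient relative to `(dx)^i`. -/
def ddx (p : Ct) : TangentBundle 𝓘(ℂ) Ct :=
  ⟨p, ((Γ.dx ⟨p, (1 : ℂ)⟩)⁻¹ : ℂ)⟩

end SpectralCurve

/-! ## Local coordinates, local invariants, degeneracies -/

/-- A choice, for every `μ ∈ 𝔞̃`, of a neighbourhood `C̃_μ = (ζ μ).source` and a local coordinate
`ζ` on it with `x = x(μ) + ζ ^ r_μ`.  The neighbourhoods are pairwise disjoint, and for all
`μ ∈ 𝔞̃_α` the image of `C̃_μ` under `x` is the same disc `V_α` of radius `radius α`. -/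
structure LocalCoords {Ct C : Type*} [TopologicalSpace Ct] [ChartedSpace ℂ Ct]
    (Γ : SpectralCurve Ct C) where
  ζ : Ct → OpenPartialHomeomorph Ct ℂ
  radius : C → ℝ
  radius_pos : ∀ α, 0 < radius α
  holomorphic : ∀ μ ∈ Γ.ram, ζ μ ∈ IsManifold.maximalAtlas 𝓘(ℂ) ⊤ Ct
  mem_source : ∀ μ ∈ Γ.ram, μ ∈ (ζ μ).source
  map_self : ∀ μ ∈ Γ.ram, ζ μ μ = 0
  target_eq : ∀ μ ∈ Γ.ram, (ζ μ).target = {u : ℂ | ‖u‖ ^ Γ.r μ < radius (Γ.proj μ)}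
  x_eq : ∀ μ ∈ Γ.ram, ∀ u ∈ (ζ μ).target,
    Γ.xt ((ζ μ).symm u) = ((Γ.xval μ + u ^ Γ.r μ : ℂ) : OnePoint ℂ)
  disjoint : ∀ μ ∈ Γ.ram, ∀ ν ∈ Γ.ram, μ ≠ ν → Disjoint (ζ μ).source (ζ ν).source

/-- The residue at `0` of `F(u) du`, as the limit of `(2πi)⁻¹ ∮ F(u) du` over circles of radius
tending to `0` (eventually constant when `F` is meromorphic at `0`). -/
def res (F : ℂ → ℂ) : ℂ :=
  limUnder (𝓝[>] (0 : ℝ)) fun ρ : ℝ =>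
    (2 * (Real.pi : ℂ) * Complex.I)⁻¹ * ∮ u in C(0, ρ), F u

namespace LocalCoords

variable {Ct C : Type*} [TopologicalSpace Ct] [ChartedSpace ℂ Ct] {Γ : SpectralCurve Ct C}
  (K : LocalCoords Γ)

/-- The point of `C̃_μ` with coordinate `u`. -/
def pt (μ : Ct) (u : ℂ) : Ct := (K.ζ μ).symm u

/-- The tangent vector `∂_ζ` at the point of `C̃_μ` with coordinate `u`. -/
def ddζ (μ : Ct) (u : ℂ) : TangentBundle 𝓘(ℂ) Ct := coordVec (K.ζ μ) u

/-- `s_μ ∈ ℤ ∪ {+∞}`: the leading exponent of `y ∼ ∑_k (1/r_μ) F_k ζ^{k - r_μ}` is `s_μ - r_μ`. -/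
def s (μ : Ct) : WithTop ℤ :=
  meromorphicOrderAt (fun u => Γ.yval (K.pt μ u)) 0 + ((Γ.r μ : ℤ) : WithTop ℤ)

/-- `s_μ` as an integer when it is finite, and `0` when `s_μ = +∞` (in every formula below the
coefficient multiplying an infinite `s_μ` vanishes if the degeneracies (i), (ii) are excluded, and
the convention is `0 · ∞ = 0`). -/
def sInt (μ : Ct) : ℤ := (K.s μ).untopD 0

/-- `t_μ`, minus the leading coefficient of `y` in the coordinate `ζ`. -/
def t (μ : Ct) : ℂ := -meromorphicTrailingCoeffAt (fun u => Γ.yval (K.pt μ u)) 0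

/-- (i) two distinct branches with `s = +∞`. -/
def DegI (α : C) : Prop :=
  ∃ μ ∈ Γ.branches α, ∃ ν ∈ Γ.branches α, μ ≠ ν ∧ K.s μ = ⊤ ∧ K.s ν = ⊤

/-- (ii) a ramified branch with `s = +∞`. -/
def DegII (α : C) : Prop :=
  ∃ μ ∈ Γ.branches α, K.s μ = ⊤ ∧ 1 < Γ.r μ

/-- (iii) two distinct branches with finite `s`, equal slopes (the equality
`r_μ / s_μ = r_ν / s_ν` is cross-multiplied) and equal leading coefficients up to a root of unity. -/
def DegIII (α : C) : Prop :=
  ∃ μ ∈ Γ.branches α, ∃ ν ∈ Γ.branches α, μ ≠ ν ∧ K.s μ ≠ ⊤ ∧ K.s ν ≠ ⊤ ∧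
    (Γ.r μ : ℤ) * K.sInt ν = (Γ.r ν : ℤ) * K.sInt μ ∧ K.t μ ^ Γ.r ν = K.t ν ^ Γ.r ν

/-- (iv) a branch with finite `s` not coprime to `r`. -/
def DegIV (α : C) : Prop :=
  ∃ μ ∈ Γ.branches α, K.s μ ≠ ⊤ ∧ 1 < Int.gcd (Γ.r μ : ℤ) (K.sInt μ)

/-- None of the degeneracies (i)-(iv) occurs above any `α ∈ 𝔞`. -/
def Nondegenerate : Prop :=
  ∀ α ∈ Γ.ramPts, ¬ K.DegI α ∧ ¬ K.DegII α ∧ ¬ K.DegIII α ∧ ¬ K.DegIV α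

end LocalCoords

/-- A choice, for every `α ∈ 𝔞`, of a total order `≼` on `𝔞̃_α` for which the slope `s_μ / r_μ` is
nondecreasing (an infinite `s` comes last). -/
structure BranchOrder {Ct C : Type*} [TopologicalSpace Ct] [ChartedSpace ℂ Ct]
    {Γ : SpectralCurve Ct C} (K : LocalCoords Γ) where
  le : Ct → Ct → Prop
  refl : ∀ α ∈ Γ.ramPts, ∀ μ ∈ Γ.branches α, le μ μ
  antisymm : ∀ α ∈ Γ.ramPts, ∀ μ ∈ Γ.branches α, ∀ ν ∈ Γ.branches α, le μ ν → le ν μ → μ = ν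
  trans : ∀ α ∈ Γ.ramPts, ∀ lam ∈ Γ.branches α, ∀ μ ∈ Γ.branches α, ∀ ν ∈ Γ.branches α,
    le lam μ → le μ ν → le lam ν
  total : ∀ α ∈ Γ.ramPts, ∀ μ ∈ Γ.branches α, ∀ ν ∈ Γ.branches α, le μ ν ∨ le ν μ
  slope : ∀ α ∈ Γ.ramPts, ∀ μ ∈ Γ.branches α, ∀ ν ∈ Γ.branches α, le μ ν →
    K.s ν = ⊤ ∨ (K.s μ ≠ ⊤ ∧ K.s ν ≠ ⊤ ∧ K.sInt μ * (Γ.r ν : ℤ) ≤ K.sInt ν * (Γ.r μ : ℤ))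

namespace BranchOrder

variable {Ct C : Type*} [TopologicalSpace Ct] [ChartedSpace ℂ Ct] {Γ : SpectralCurve Ct C}
  {K : LocalCoords Γ} (O : BranchOrder K)

open scoped Classical in
/-- The segment `[μ) = {ν ∈ 𝔞̃_α : ν ≺ μ}`, where `μ` lies above `α`. -/
def seg (μ : Ct) : Finset Ct := (Γ.branches (Γ.proj μ)).filter fun ν => O.le ν μ ∧ ν ≠ μ

/-- `𝐫_{[μ)}`. -/
def rSeg (μ : Ct) : ℕ := ∑ ν ∈ O.seg μ, Γ.r ν

/-- `𝐬_{[μ)}`. -/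
def sSeg (μ : Ct) : ℤ := ∑ ν ∈ O.seg μ, K.sInt ν

/-- `Δ_μ = 𝐫_{[μ]} s_μ - 𝐬_{[μ]} r_μ` (the contribution of `μ` itself cancels). -/
def Delta (μ : Ct) : ℤ := (O.rSeg μ : ℤ) * K.sInt μ - O.sSeg μ * (Γ.r μ : ℤ)

/-- `𝔳_μ = (s_μ - r_μ)(r_α - 1) - Δ_μ`, where `μ` lies above `α`. -/
def vExp (μ : Ct) : ℤ :=
  (K.sInt μ - (Γ.r μ : ℤ)) * ((Γ.rTot (Γ.proj μ) : ℤ) - 1) - O.Delta μ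

/-- `𝔡_α(i)` for `i = 𝐫_{[λ)} + i'`, `i' ∈ [r_λ]`, namely
`-⌊s_λ (i' - 1) / r_λ⌋ - 𝐬_{[λ)} + δ_{i',1}`. -/
def dExp (lam : Ct) (i : ℕ) : ℤ :=
  -⌊((K.sInt lam : ℚ) * ((i : ℚ) - (O.rSeg lam : ℚ) - 1)) / (Γ.r lam : ℚ)⌋ - O.sSeg lam
    + (if i = O.rSeg lam + 1 then 1 else 0)

end BranchOrder

/-! ## Correlators

A symmetric multidifferential in `n` variables on `Ct` is a function of `n` tangent vectors, linear
in each of them and invariant under permutations, i.e. a function on multisets of `n` tangent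
vectors.  A family `ω_{g,n}`, `g ∈ ½ℕ`, is a function `om : ℕ → Multiset (TangentBundle 𝓘(ℂ) Ct) → ℂ`,
where `om h` on multisets of cardinality `n` is `ω_{h/2,n}`; thus `2g - 2 + n > 0` reads
`2 < h + n`.  Values at tangent vectors based at poles are irrelevant. -/

section Families

variable {Ct C : Type*} [TopologicalSpace Ct] [ChartedSpace ℂ Ct]

/-- The multidifferential `F` in `n` variables is a section of `(K(*S))^{⊠ n}`: near every
`(p_1, …, p_n)` its coefficient in charts is holomorphic after multiplication by a power of the
local coordinate in every variable `i` with `p_i ∈ S`. -/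
def IsMultidifferential (S : Set Ct) (n : ℕ) (F : Multiset (TangentBundle 𝓘(ℂ) Ct) → ℂ) : Prop :=
  ∀ p : Fin n → Ct, ∃ (k : ℕ) (G : (Fin n → ℂ) → ℂ),
    AnalyticAt ℂ G (fun i => chartAt ℂ (p i) (p i)) ∧
    ∀ᶠ u : Fin n → ℂ in 𝓝 (fun i => chartAt ℂ (p i) (p i)),
      (∀ i, p i ∈ S → u i ≠ chartAt ℂ (p i) (p i)) →
        F (Finset.univ.val.map fun i => coordVec (chartAt ℂ (p i)) (u i)) *
          ∏ i : Fin n, (u i - chartAt ℂ (p i) (p i)) ^ (S.indicator (fun _ => k) (p i)) = G u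

/-- `F` (on pairs) is a fundamental bidifferential of the second kind: a symmetric section of
`K^{⊠ 2}(2Δ)` with biresidue `1` on the diagonal. -/
def IsFundamentalBidifferential (F : Multiset (TangentBundle 𝓘(ℂ) Ct) → ℂ) : Prop :=
  (∀ p q : Ct, p ≠ q → AnalyticAt ℂ
    (fun u : ℂ × ℂ => F {coordVec (chartAt ℂ p) u.1, coordVec (chartAt ℂ q) u.2})
    (chartAt ℂ p p, chartAt ℂ q q)) ∧
  ∀ p : Ct, ∃ G : ℂ × ℂ → ℂ,
    AnalyticAt ℂ G (chartAt ℂ p p, chartAt ℂ p p) ∧ G (chartAt ℂ p p, chartAt ℂ p p) = 1 ∧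
    ∀ᶠ u : ℂ × ℂ in 𝓝 (chartAt ℂ p p, chartAt ℂ p p), u.1 ≠ u.2 →
      F {coordVec (chartAt ℂ p) u.1, coordVec (chartAt ℂ p) u.2} * (u.1 - u.2) ^ 2 = G u

/-- `F` (on single vectors) is a crosscap differential: a meromorphic differential on `Ct`, with at
most simple poles at `𝔞̃` (and arbitrary poles elsewhere), such that for every `α ∈ 𝔞` the residues
at the points of `𝔞̃_α` sum to zero. -/
def IsCrosscap {Γ : SpectralCurve Ct C} (K : LocalCoords Γ)
    (F : Multiset (TangentBundle 𝓘(ℂ) Ct) → ℂ) : Prop :=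
  (∀ p : Ct, MeromorphicAt (fun u => F {coordVec (chartAt ℂ p) u}) (chartAt ℂ p p)) ∧
  (∀ μ ∈ Γ.ram,
    (-1 : WithTop ℤ) ≤ meromorphicOrderAt (fun u => F {coordVec (chartAt ℂ μ) u}) (chartAt ℂ μ μ)) ∧
  ∀ α ∈ Γ.ramPts, ∑ μ ∈ Γ.branches α, res (fun u => F {K.ddζ μ u}) = 0

/-- Families of correlators. -/
structure IsCorrelatorFamily {Γ : SpectralCurve Ct C} (K : LocalCoords Γ)
    (om : ℕ → Multiset (TangentBundle 𝓘(ℂ) Ct) → ℂ) : Prop where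
  /-- linearity in each (one-dimensional) tangent space -/
  linear : ∀ (h : ℕ) (p : Ct) (c : ℂ) (v : TangentSpace 𝓘(ℂ) p)
    (m : Multiset (TangentBundle 𝓘(ℂ) Ct)), om h (⟨p, c • v⟩ ::ₘ m) = c * om h (⟨p, v⟩ ::ₘ m)
  /-- `ω_{0,1} = y dx` -/
  zero_one : ∀ v : TangentBundle 𝓘(ℂ) Ct, Γ.xt v.proj ≠ OnePoint.infty → Γ.y v.proj ≠ OnePoint.infty →
    om 0 {v} = Γ.yval v.proj * Γ.dx v
  zero_two : IsFundamentalBidifferential (om 0)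
  half_one : IsCrosscap K (om 1)
  stable : ∀ h n : ℕ, 1 ≤ n → 2 < h + n → IsMultidifferential Γ.ramSet n (om h)

/-- The primitive `∫_μ^z ω_{0,2}(·, v)` at the point `z` of `C̃_μ` with coordinate `u`, computed along
the straight segment from `0` to `u` in the coordinate `ζ`. -/
def primitive {Γ : SpectralCurve Ct C} (K : LocalCoords Γ)
    (om : ℕ → Multiset (TangentBundle 𝓘(ℂ) Ct) → ℂ) (μ : Ct) (v : TangentBundle 𝓘(ℂ) Ct) (u : ℂ) : ℂ :=
  ∫ τ in (0 : ℝ)..1, u * om 0 {K.ddζ μ ((τ : ℂ) * u), v}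

/-- The projection property, for `2g - 2 + n > 0`. -/
def ProjectionProperty {Γ : SpectralCurve Ct C} (K : LocalCoords Γ)
    (om : ℕ → Multiset (TangentBundle 𝓘(ℂ) Ct) → ℂ) : Prop :=
  ∀ (h : ℕ) (v : TangentBundle 𝓘(ℂ) Ct) (m : Multiset (TangentBundle 𝓘(ℂ) Ct)),
    2 < h + (m.card + 1) → v.proj ∉ Γ.ramSet → (∀ w ∈ m, w.proj ∉ Γ.ramSet) →
    om h (v ::ₘ m) =
      ∑ μ ∈ Γ.ram, res (fun u => primitive K om μ v u * om h (K.ddζ μ u ::ₘ m))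

/-- The arguments `(z_L, w_{N_L})` of the factor indexed by the block `L`, where `N` sends `j ∈ [n]`
to the block that contains it. -/
def blockArgs {ι : Type*} [DecidableEq ι] {Z : Finset ι} {n : ℕ} (P : Finpartition Z)
    (N : Fin n → P.parts) (z : ι → TangentBundle 𝓘(ℂ) Ct) (w : Fin n → TangentBundle 𝓘(ℂ) Ct)
    (L : P.parts) : Multiset (TangentBundle 𝓘(ℂ) Ct) :=
  L.1.val.map z + (Finset.univ.filter fun j => N j = L).val.map w

open scoped Classical in
/-- `𝒲_{g,m,n}(z_Z; w_{[n]})`, `g = h/2`, `m = |Z|`: the sum over set partitions `P` of `Z`, over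
distributions `N` of `[n]` among the blocks, and over genera `g_L = k_L/2` of the blocks with
`m + ∑_L (g_L - 1) = g` (which forces `g_L ≤ g`). -/
def disconn (om : ℕ → Multiset (TangentBundle 𝓘(ℂ) Ct) → ℂ) (h : ℕ) {ι : Type*} (Z : Finset ι)
    (z : ι → TangentBundle 𝓘(ℂ) Ct) {n : ℕ} (w : Fin n → TangentBundle 𝓘(ℂ) Ct) : ℂ :=
  ∑ P : Finpartition Z, ∑ N : Fin n → P.parts, ∑ k : P.parts → Fin (h + 1),
    if 2 * Z.card + ∑ L, (k L : ℕ) = h + 2 * P.parts.card then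
      ∏ L : P.parts, om (k L : ℕ) (blockArgs P N z w L)
    else 0

open scoped Classical in
/-- `𝒲'_{g,m,n}`: the same sum without the summands that contain a factor `ω_{0,1}`. -/
def disconn' (om : ℕ → Multiset (TangentBundle 𝓘(ℂ) Ct) → ℂ) (h : ℕ) {ι : Type*} (Z : Finset ι)
    (z : ι → TangentBundle 𝓘(ℂ) Ct) {n : ℕ} (w : Fin n → TangentBundle 𝓘(ℂ) Ct) : ℂ :=
  ∑ P : Finpartition Z, ∑ N : Fin n → P.parts, ∑ k : P.parts → Fin (h + 1),
    if 2 * Z.card + ∑ L, (k L : ℕ) = h + 2 * P.parts.card ∧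
        ∀ L : P.parts, ¬ ((k L : ℕ) = 0 ∧ (blockArgs P N z w L).card = 1) then
      ∏ L : P.parts, om (k L : ℕ) (blockArgs P N z w L)
    else 0

/-- The fibre `x⁻¹(x₀) ∩ Ũ_α`, where `Ũ_α` is the union of the `C̃_μ`, `μ ∈ 𝔞̃_α`. -/
def fibre {Γ : SpectralCurve Ct C} (K : LocalCoords Γ) (α : C) (x₀ : ℂ) : Finset Ct :=
  (show {p : Ct | Γ.xt p = (x₀ : OnePoint ℂ) ∧ ∃ μ ∈ Γ.branches α, p ∈ (K.ζ μ).source}.Finite from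
    (Γ.finite_xt_fibre (x₀ : OnePoint ℂ)).subset fun _ hp => hp.1).toFinset

/-- The coefficient of `(dx₀)^i` in
`ℰ^{(i)}_{α;g,n}(x₀; w_{[n]}) = ∑_{Z ⊆ x⁻¹(x₀) ∩ Ũ_α, |Z| = i} 𝒲_{g,i,n}(Z; w_{[n]})`. -/
def loopCoeff {Γ : SpectralCurve Ct C} (K : LocalCoords Γ)
    (om : ℕ → Multiset (TangentBundle 𝓘(ℂ) Ct) → ℂ) (α : C) (h i : ℕ) {n : ℕ}
    (w : Fin n → TangentBundle 𝓘(ℂ) Ct) (x₀ : ℂ) : ℂ :=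
  ∑ Z ∈ (fibre K α x₀).powersetCard i, disconn om h Z Γ.ddx w

/-- The master loop equations.  The coefficient of `(dζ)^{r_α}` at the point `z₀` of `C̃_μ` with
coordinate `u` is the coefficient of `(dx)^{r_α}` times `dx(∂_ζ)^{r_α}`. -/
def MasterLoopEquations {Γ : SpectralCurve Ct C} {K : LocalCoords Γ} (O : BranchOrder K)
    (om : ℕ → Multiset (TangentBundle 𝓘(ℂ) Ct) → ℂ) : Prop :=
  ∀ (h n : ℕ) (w : Fin n → TangentBundle 𝓘(ℂ) Ct), 2 < h + (n + 1) →
    (∀ j, (w j).proj ∉ Γ.ramSet) → ∀ α ∈ Γ.ramPts, ∀ μ ∈ Γ.branches α,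
    (fun u : ℂ =>
      (∑ i ∈ Finset.Icc 1 (Γ.rTot α), loopCoeff K om α h i w (Γ.xval (K.pt μ u)) *
        (-om 0 {Γ.ddx (K.pt μ u)}) ^ (Γ.rTot α - i)) * Γ.dx (K.ddζ μ u) ^ Γ.rTot α)
    =O[𝓝[≠] (0 : ℂ)]
    (fun u : ℂ => u ^ (-1 + O.vExp μ + ((Γ.r μ : ℤ) - 1) * ((Γ.rTot α : ℤ) - 1)))

/-- The abstract loop equations: for `x₀ = x(α) + τ` and `τ → 0`,
`ℰ^{(i)}_{α;g,n}(x₀; w_{[n]}) = O(τ^{-(𝔡_α(i) - 1 - δ_{i,1})} (dx₀/τ)^i)`; here `i ∈ [r_α]` and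
`λ` is the branch with `𝐫_{[λ)} < i ≤ 𝐫_{[λ]}`. -/
def AbstractLoopEquations {Γ : SpectralCurve Ct C} {K : LocalCoords Γ} (O : BranchOrder K)
    (om : ℕ → Multiset (TangentBundle 𝓘(ℂ) Ct) → ℂ) : Prop :=
  ∀ (h n : ℕ) (w : Fin n → TangentBundle 𝓘(ℂ) Ct), 2 < h + (n + 1) →
    (∀ j, (w j).proj ∉ Γ.ramSet) → ∀ α ∈ Γ.ramPts, ∀ i ∈ Finset.Icc 1 (Γ.rTot α),
    ∀ lam ∈ Γ.branches α, O.rSeg lam < i → i ≤ O.rSeg lam + Γ.r lam →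
    (fun τ : ℂ => loopCoeff K om α h i w (finVal (Γ.x α) + τ))
    =O[𝓝[≠] (0 : ℂ)]
    (fun τ : ℂ => τ ^ (-(O.dExp lam i - 1 - (if i = 1 then 1 else 0)) - (i : ℤ)))

open scoped Classical in
/-- The integrand of the recursion formula near `μ ∈ 𝔞̃_α`, as the coefficient of `dζ(z)` at the
point `z` of `C̃_μ` with coordinate `u`:
`∑_{∅ ≠ Z ⊆ 𝔣'_α(z)} K_μ^{(|Z|+1)}(v; z, Z) 𝒲'_{g,|Z|+1,n}(z, Z; w_{[n]})` with
`K_μ^{(|Z|+1)}(v; z, Z) = - ∫_μ^z ω_{0,2}(·, v) / ∏_{z' ∈ Z} ((y(z') - y(z)) dx(z))`. -/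
def recursionIntegrand {Γ : SpectralCurve Ct C} (K : LocalCoords Γ)
    (om : ℕ → Multiset (TangentBundle 𝓘(ℂ) Ct) → ℂ) (α : C) (μ : Ct) (h : ℕ)
    (v : TangentBundle 𝓘(ℂ) Ct) {n : ℕ} (w : Fin n → TangentBundle 𝓘(ℂ) Ct) (u : ℂ) : ℂ :=
  (∑ Z ∈ ((fibre K α (Γ.xval (K.pt μ u))).erase (K.pt μ u)).powerset.filter Finset.Nonempty,
    -(primitive K om μ v u / ∏ z' ∈ Z, (Γ.yval z' - Γ.yval (K.pt μ u))) *
      disconn' om h (insert (K.pt μ u) Z) Γ.ddx w) * Γ.dx (K.ddζ μ u)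

/-- The family `om` is given by the topological recursion formula
`ω_{g,n+1}(z₀, z_{[n]}) = ∑_{α ∈ 𝔞} ∑_{μ ∈ 𝔞̃_α} Res_{z = μ} (…)` for all `2g - 2 + (n + 1) > 0`. -/
def TopologicalRecursion {Γ : SpectralCurve Ct C} (K : LocalCoords Γ)
    (om : ℕ → Multiset (TangentBundle 𝓘(ℂ) Ct) → ℂ) : Prop :=
  ∀ (h n : ℕ) (v : TangentBundle 𝓘(ℂ) Ct) (w : Fin n → TangentBundle 𝓘(ℂ) Ct),
    2 < h + (n + 1) → v.proj ∉ Γ.ramSet → (∀ j, (w j).proj ∉ Γ.ramSet) →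
    om h (v ::ₘ Finset.univ.val.map w) =
      ∑ α ∈ Γ.ramPts, ∑ μ ∈ Γ.branches α, res (recursionIntegrand K om α μ h v w)

/-- Two families have the same `ω_{0,1}, ω_{0,2}, ω_{1/2,1}` (`ω_{0,1} = y dx` is common to all
families; the meromorphic differentials `ω_{1/2,1}` are compared off isolated points). -/
def SameUnstable (om om' : ℕ → Multiset (TangentBundle 𝓘(ℂ) Ct) → ℂ) : Prop :=
  (∀ v w : TangentBundle 𝓘(ℂ) Ct, v.proj ≠ w.proj → om 0 {v, w} = om' 0 {v, w}) ∧
  ∀ p : Ct, ∀ᶠ q in 𝓝[≠] p, ∀ v : TangentSpace 𝓘(ℂ) q, om 1 {⟨q, v⟩} = om' 1 {⟨q, v⟩}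

end Families

end LoopEq

end

noncomputable section

namespace LoopEq

/-! ## Disconnected correlators as sums over configurations of blocks -/

/-! Fix `α` and put `R = r_α`. Near `α` the fibres of `x` are parametrised by one common root `u`,
with `x = x(α) + u^N` and `N` the product of the ramification orders. A sheet `j` is a branch `ν`
with an `r_ν`-th root of unity `θ`; its point has coordinate `ζ = θ u^(N/r_ν)`, and `Y_j(u)` is the
value of `y` there. After division by powers of `dx` the differential `ω_{0,1}` becomes `Y_j`.

Splitting off the factors `ω_{0,1}` gives `𝒲(Z) = ∑_{A ⊆ Z} 𝒲'(A) ∏_{Z∖A} Y`. Hence the sum `∑_i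
ℰ^{(i)} (-Y_j)^{R-i}` equals `∏_{k≠j} (Y_k - Y_j) · D_j` with `D_j = ∑_{A ∌ j} 𝒲'(j ∪ A) / ∏_{k∈A}
(Y_k - Y_j)` (`sum_powersetCard_mul_pow_eq_prod_mul`, `sum_loopCoeff_mul_pow`). The term `A = ∅` of
`D_j` is `ω_{g,n+1}`; the others are minus the recursion integrand without its primitive. So `D_j
dx` is the `defect`: correlator minus recursion form.

By non-degeneracy each `Y_k - Y_j` has exactly the order dictated by the earlier of the two
branches, so the product has exact order `(N/r_μ) 𝔳_μ` (`tendsto_prod_sheetY_sub`), and the master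
loop equations force the defects to have at most simple poles. The primitive of `ω_{0,2}` vanishes
at `μ`, so such a defect has no residue against it, and the projection formula and the recursion
formula agree term by term (`res_primitive_mul_eq`).

That abstract loop equations imply master loop equations is a comparison of exponents: the points
`(𝐫_{[λ)}, 𝐬_{[λ)})` are the vertices of a convex broken line, the `𝔡_α(i)` are its values rounded
to integers, and `𝔳_μ` encodes its tangent of slope `s_μ/r_μ` (`tangent_le`, `master_exponent_le`).

Conversely, let the recursion formula hold. Multiply it by `v^k` and integrate over a circle that
encloses the residue contour. The `k`-th moment of the primitive is `u^k` on the same branch for `k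
≥ 1`, and `0` otherwise (`circleIntegral_pow_mul_primitive`). So the moments `k ≥ 1` of correlator
and recursion form agree, and the correlator has no residue
(`res_pow_mul_om_of_topologicalRecursion`). The defects therefore have at most simple poles, which
returns the projection property. Lagrange interpolation recovers `ℰ^{(i)} = ∑_j D_j e_{i-1}(Y_k : k
≠ j)` with `D_j = O(u^{-N})`; bounding `i - 1` slopes from below and using that orders in `τ` are
integers yields the abstract loop equations for `i ≥ 2` (`exponent_lt_sum_slopes`,
`isBigO_zpow_of_comp_pow`). For `i = 1` a possible simple pole in `τ` is excluded by the vanishing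
residue.

Uniqueness is an induction on `2g + n`, since the right side of the recursion contains only
correlators of smaller complexity and the unstable data. -/

/-- A block `(L, M, k)`: a set `L` of indices, a set `M ⊆ [n]` of spectators, and twice a genus. -/
abbrev Block (ι : Type*) (n : ℕ) := Finset ι × Finset (Fin n) × ℕ

/-- The contribution `2 |L| + k - 2` of a block to twice the total genus. -/
def blockDegree {ι : Type*} {n : ℕ} (b : Block ι n) : ℤ := 2 * (b.1.card : ℤ) + (b.2.2 : ℤ) - 2

/-- A set of blocks that partitions `Z` and `[n]` and has total degree `h`. -/
structure IsConfig {ι : Type*} {n : ℕ} (h : ℕ) (Z : Finset ι) (c : Finset (Block ι n)) : Prop where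
  nonempty : ∀ b ∈ c, b.1.Nonempty
  disj : ∀ b ∈ c, ∀ b' ∈ c, ∀ i, i ∈ b.1 → i ∈ b'.1 → b = b'
  cover : ∀ i, i ∈ Z ↔ ∃ b ∈ c, i ∈ b.1
  disjM : ∀ b ∈ c, ∀ b' ∈ c, ∀ j, j ∈ b.2.1 → j ∈ b'.2.1 → b = b'
  coverM : ∀ j, ∃ b ∈ c, j ∈ b.2.1
  degree : ∑ b ∈ c, blockDegree b = h

namespace IsConfig

variable {ι : Type*} {n h : ℕ} {Z : Finset ι} {c : Finset (Block ι n)}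

/-- A nonempty block contributes `2|L| - 2 ≥ 0` besides its genus. All degrees are thus nonnegative,
each genus is bounded by the total degree, and the range `Fin (h + 1)` of the genera loses nothing.
-/
theorem blockDegree_nonneg (hc : IsConfig h Z c) {b : Block ι n} (hb : b ∈ c) :
    (b.2.2 : ℤ) ≤ blockDegree b := by
  have := (hc.nonempty b hb).card_pos
  unfold blockDegree
  omega

theorem genus_le (hc : IsConfig h Z c) {b : Block ι n} (hb : b ∈ c) : b.2.2 ≤ h := by
  have h1 : blockDegree b ≤ ∑ b ∈ c, blockDegree b :=
    Finset.single_le_sum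
      (fun b' hb' => (Int.natCast_nonneg _).trans (hc.blockDegree_nonneg hb')) hb
  rw [hc.degree] at h1
  have := (hc.blockDegree_nonneg hb).trans h1
  exact_mod_cast this

theorem subset (hc : IsConfig h Z c) {b : Block ι n} (hb : b ∈ c) : b.1 ⊆ Z :=
  fun i hi => (hc.cover i).2 ⟨b, hb, hi⟩

theorem card_eq (hc : IsConfig h Z c) : Z.card = ∑ b ∈ c, b.1.card := by
  classical
  have : Z = c.biUnion (fun b => b.1) := by
    ext i; rw [hc.cover]; simp
  rw [this, Finset.card_biUnion]
  intro b hb b' hb' hne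
  rw [Function.onFun, Finset.disjoint_left]
  exact fun i hi hi' => hne (hc.disj b hb b' hb' i hi hi')

theorem card_eq' (hc : IsConfig h Z c) : n = ∑ b ∈ c, b.2.1.card := by
  classical
  have : (Finset.univ : Finset (Fin n)) = c.biUnion (fun b => b.2.1) := by
    ext i; simpa using hc.coverM i
  have h2 := congrArg Finset.card this
  rw [Finset.card_biUnion] at h2
  · simpa using h2
  intro b hb b' hb' hne
  rw [Function.onFun, Finset.disjoint_left]
  exact fun i hi hi' => hne (hc.disjM b hb b' hb' i hi hi')

end IsConfig

theorem finite_configs {ι : Type*} {n : ℕ} (h : ℕ) (Z : Finset ι) :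
    {c : Finset (Block ι n) | IsConfig h Z c}.Finite := by
  classical
  refine (Finset.finite_toSet
    (Finset.powerset (Z.powerset ×ˢ ((Finset.univ : Finset (Finset (Fin n))) ×ˢ
      Finset.range (h + 1))))).subset fun c hc => ?_
  simp only [Finset.coe_powerset, Set.mem_preimage, Set.mem_powerset_iff, Finset.coe_subset]
  intro b hb
  simp only [Finset.mem_product, Finset.mem_powerset, Finset.mem_univ, true_and, Finset.mem_range]
  exact ⟨hc.subset hb, Nat.lt_succ_of_le (hc.genus_le hb)⟩

/-- The finite set of configurations. -/
def configs {ι : Type*} (n h : ℕ) (Z : Finset ι) : Finset (Finset (Block ι n)) :=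
  (finite_configs h Z).toFinset

theorem mem_configs {ι : Type*} {n h : ℕ} {Z : Finset ι} {c : Finset (Block ι n)} :
    c ∈ configs n h Z ↔ IsConfig h Z c := by
  simp [configs]

section Flatten

variable {ι : Type*} {n : ℕ}

open scoped Classical in
/-- The configuration attached to a set partition with a distribution of spectators and genera. -/
def toConfig {Z : Finset ι} {h : ℕ} (x : Σ P : Finpartition Z, (Fin n → P.parts) × (P.parts → Fin (h + 1))) :
    Finset (Block ι n) :=
  Finset.univ.image fun L : x.1.parts =>
    (L.1, (Finset.univ.filter fun j => x.2.1 j = L), (x.2.2 L : ℕ))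

open scoped Classical in
theorem mem_toConfig {Z : Finset ι} {h : ℕ}
    {x : Σ P : Finpartition Z, (Fin n → P.parts) × (P.parts → Fin (h + 1))} {b : Block ι n} :
    b ∈ toConfig x ↔ ∃ L : x.1.parts,
      (L.1, (Finset.univ.filter fun j => x.2.1 j = L), (x.2.2 L : ℕ)) = b := by
  simp only [toConfig, Finset.mem_image, Finset.mem_univ, true_and]

-- Formulated for an arbitrary commutative monoid, so that `Multiplicative ℤ` and `Multiplicative ℕ`
-- turn it into the additive statement needed for degrees and genera.
open scoped Classical in
theorem sum_toConfig {M : Type*} [CommMonoid M] {Z : Finset ι} {h : ℕ}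
    (x : Σ P : Finpartition Z, (Fin n → P.parts) × (P.parts → Fin (h + 1))) (f : Block ι n → M) :
    ∏ b ∈ toConfig x, f b = ∏ L : x.1.parts,
      f (L.1, (Finset.univ.filter fun j => x.2.1 j = L), (x.2.2 L : ℕ)) := by
  rw [toConfig, Finset.prod_image]
  intro L _ L' _ hL
  exact Subtype.ext (congrArg Prod.fst hL)

-- The condition on the genera is the degree condition in disguise: summing `2|L| + k_L - 2` over
-- the blocks gives `2|Z| + ∑ k_L - 2 #P`.
open scoped Classical in
theorem isConfig_toConfig {Z : Finset ι} {h : ℕ}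
    (x : Σ P : Finpartition Z, (Fin n → P.parts) × (P.parts → Fin (h + 1)))
    (hx : 2 * Z.card + ∑ L, (x.2.2 L : ℕ) = h + 2 * x.1.parts.card) :
    IsConfig h Z (toConfig x) := by
  obtain ⟨P, N, k⟩ := x
  dsimp only at hx
  refine ⟨?_, ?_, ?_, ?_, ?_, ?_⟩
  · intro b hb
    obtain ⟨L, rfl⟩ := mem_toConfig.1 hb
    exact P.nonempty_of_mem_parts L.2
  · intro b hb b' hb' i hi hi'
    obtain ⟨L, rfl⟩ := mem_toConfig.1 hb
    obtain ⟨L', rfl⟩ := mem_toConfig.1 hb'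
    have : L = L' := Subtype.ext (P.eq_of_mem_parts L.2 L'.2 hi hi')
    rw [this]
  · intro i
    constructor
    · intro hi
      obtain ⟨L, hL, hiL⟩ := P.exists_mem hi
      exact ⟨_, mem_toConfig.2 ⟨⟨L, hL⟩, rfl⟩, hiL⟩
    · rintro ⟨b, hb, hi⟩
      obtain ⟨L, rfl⟩ := mem_toConfig.1 hb
      exact P.le L.2 hi
  · intro b hb b' hb' j hj hj'
    obtain ⟨L, rfl⟩ := mem_toConfig.1 hb
    obtain ⟨L', rfl⟩ := mem_toConfig.1 hb'
    simp only [Finset.mem_filter, Finset.mem_univ, true_and] at hj hj'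
    rw [← hj, ← hj']
  · intro j
    exact ⟨_, mem_toConfig.2 ⟨N j, rfl⟩, by simp⟩
  · have key := sum_toConfig (M := Multiplicative ℤ) ⟨P, N, k⟩
      (fun b => Multiplicative.ofAdd (blockDegree b))
    have key2 : ∑ b ∈ toConfig ⟨P, N, k⟩, blockDegree b = ∑ L : P.parts,
        blockDegree ((L.1, (Finset.univ.filter fun j => N j = L), (k L : ℕ)) : Block ι n) := by
      rw [← ofAdd_sum, ← ofAdd_sum] at key
      exact Multiplicative.ofAdd.injective key
    rw [key2]
    simp only [blockDegree, Finset.sum_sub_distrib, Finset.sum_add_distrib, Finset.sum_const,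
      Finset.card_univ, Fintype.card_coe, ← Finset.mul_sum]
    have h3 : ∑ L : P.parts, (L.1.card : ℤ) = Z.card := by
      rw [← P.sum_card_parts]
      push_cast
      exact Finset.sum_coe_sort P.parts (fun L => (L.card : ℤ))
    rw [h3]
    zify at hx
    simp only [nsmul_eq_mul]
    linarith

-- The parts are the first components of the blocks, and each block remembers its spectators and its
-- genus.
open scoped Classical in
theorem toConfig_injective {Z : Finset ι} {h : ℕ} :
    Function.Injective (toConfig : (Σ P : Finpartition Z, (Fin n → P.parts) × (P.parts → Fin (h + 1))) →
      Finset (Block ι n)) := by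
  rintro ⟨P, N, k⟩ ⟨P', N', k'⟩ hx
  have hsub : ∀ x x' : (Σ P : Finpartition Z, (Fin n → P.parts) × (P.parts → Fin (h + 1))),
      toConfig x = toConfig x' → x.1.parts ⊆ x'.1.parts := by
    intro x x' hxx L hL
    have := mem_toConfig.2 ⟨⟨L, hL⟩, rfl⟩
    rw [hxx] at this
    obtain ⟨L', hL'⟩ := mem_toConfig.1 this
    have h1 : L'.1 = L := congrArg Prod.fst hL'
    rw [← h1]; exact L'.2
  have hP : P = P' := by
    ext1
    exact (hsub _ _ hx).antisymm (hsub _ _ hx.symm)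
  subst hP
  have hL : ∀ L : P.parts, (Finset.univ.filter fun j => N j = L) = (Finset.univ.filter fun j => N' j = L)
      ∧ (k L : ℕ) = k' L := by
    intro L
    have : _ ∈ toConfig (⟨P, N, k⟩ : Σ P : Finpartition Z, (Fin n → P.parts) × (P.parts → Fin (h + 1))) :=
      mem_toConfig.2 ⟨L, rfl⟩
    rw [hx] at this
    obtain ⟨L', hL'⟩ := mem_toConfig.1 this
    obtain rfl : L' = L := Subtype.ext (congrArg Prod.fst hL')
    simp only [Prod.mk.injEq, true_and] at hL'
    exact ⟨hL'.1.symm, hL'.2.symm⟩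
  have hN : N = N' := by
    funext j
    have : j ∈ Finset.univ.filter fun i => N i = N j := by simp
    rw [(hL (N j)).1] at this
    exact (Finset.mem_filter.1 this).2.symm
  have hk : k = k' := funext fun L => Fin.ext (hL L).2
  rw [hN, hk]

open scoped Classical in
theorem exists_toConfig_eq {Z : Finset ι} {h : ℕ} {c : Finset (Block ι n)} (hc : IsConfig h Z c) :
    ∃ x : Σ P : Finpartition Z, (Fin n → P.parts) × (P.parts → Fin (h + 1)),
      2 * Z.card + ∑ L, (x.2.2 L : ℕ) = h + 2 * x.1.parts.card ∧ toConfig x = c := by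
  let P : Finpartition Z := Finpartition.ofExistsUnique (c.image Prod.fst)
    (by
      intro L hL
      obtain ⟨b, hb, rfl⟩ := Finset.mem_image.1 hL
      exact hc.subset hb)
    (by
      intro i hi
      obtain ⟨b, hb, hib⟩ := (hc.cover i).1 hi
      refine ⟨b.1, ⟨Finset.mem_image_of_mem _ hb, hib⟩, ?_⟩
      rintro L ⟨hL, hiL⟩
      obtain ⟨b', hb', rfl⟩ := Finset.mem_image.1 hL
      rw [hc.disj b' hb' b hb i hiL hib])
    (by
      intro hL
      obtain ⟨b, hb, hb0⟩ := Finset.mem_image.1 hL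
      have := hc.nonempty b hb
      simp [hb0] at this)
  have hPp : P.parts = c.image Prod.fst := rfl
  have hbl : ∀ L : P.parts, ∃ b ∈ c, b.1 = L.1 := by
    intro L
    simpa using (Finset.ext_iff.1 hPp L.1).1 L.2
  choose B hB hBL using hbl
  -- A block is determined by its first component, since blocks are nonempty and distinct ones are
  -- disjoint.
  have hBu : ∀ b, ∀ hb : b ∈ c, B ⟨b.1, by rw [hPp]; exact Finset.mem_image_of_mem _ hb⟩ = b := by
    intro b hb
    obtain ⟨i, hi⟩ := hc.nonempty b hb
    refine hc.disj _ (hB _) b hb i ?_ hi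
    rw [hBL]; exact hi
  choose M hM hMj using hc.coverM
  let N : Fin n → P.parts := fun j =>
    ⟨(M j).1, by rw [hPp]; exact Finset.mem_image_of_mem _ (hM j)⟩
  let k : P.parts → Fin (h + 1) := fun L => ⟨(B L).2.2, Nat.lt_succ_of_le (hc.genus_le (hB L))⟩
  have hfilter : ∀ L : P.parts, (Finset.univ.filter fun j => N j = L) = (B L).2.1 := by
    intro L
    ext j
    simp only [Finset.mem_filter, Finset.mem_univ, true_and]
    constructor
    · intro hj
      have h1 : B (N j) = M j := hBu (M j) (hM j)
      rw [← hj, h1]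
      exact hMj j
    · intro hj
      have h1 : B L = M j := hc.disjM _ (hB L) _ (hM j) j hj (hMj j)
      apply Subtype.ext
      change (M j).1 = L.1
      rw [← h1, hBL]
  have hxc : toConfig (⟨P, N, k⟩ : Σ P : Finpartition Z, (Fin n → P.parts) × (P.parts → Fin (h + 1))) = c := by
    ext b
    rw [mem_toConfig]
    constructor
    · rintro ⟨L, rfl⟩
      have : ((L.1, (Finset.univ.filter fun j => N j = L), (k L : ℕ)) : Block ι n) = B L := by
        rw [hfilter, ← hBL]
      change ((L.1, (Finset.univ.filter fun j => N j = L), (k L : ℕ)) : Block ι n) ∈ c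
      rw [this]; exact hB L
    · intro hb
      refine ⟨⟨b.1, by rw [hPp]; exact Finset.mem_image_of_mem _ hb⟩, ?_⟩
      change ((b.1, (Finset.univ.filter fun j => N j = _), ((B _).2.2 : ℕ)) : Block ι n) = b
      rw [hfilter, hBu b hb]
  refine ⟨⟨P, N, k⟩, ?_, hxc⟩
  have hinj : Set.InjOn (Prod.fst : Block ι n → Finset ι) c := by
    intro b hb b' hb' hbb
    obtain ⟨i, hi⟩ := hc.nonempty b hb
    exact hc.disj b hb b' hb' i hi (hbb ▸ hi)
  have hd := hc.degree
  have h1 : P.parts.card = c.card := by rw [hPp, Finset.card_image_of_injOn hinj]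
  have h2 : ∑ L : P.parts, (k L : ℕ) = ∑ b ∈ c, b.2.2 := by
    have key := sum_toConfig (M := Multiplicative ℕ) ⟨P, N, k⟩
      (fun b => Multiplicative.ofAdd b.2.2)
    rw [← ofAdd_sum, ← ofAdd_sum, hxc] at key
    exact (Multiplicative.ofAdd.injective key).symm
  have h3 := hc.card_eq
  dsimp only
  rw [h1, h2, h3]
  zify
  simp only [blockDegree, Finset.sum_sub_distrib, Finset.sum_add_distrib, Finset.sum_const,
    ← Finset.mul_sum, nsmul_eq_mul] at hd
  linarith

-- Replaces the dependent sum over partitions, distributions and genera by one over plain finite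
-- sets of blocks, on which relabelling and removal of blocks are set operations.
open scoped Classical in
theorem sum_finpartition_eq_sum_configs (h : ℕ) (Z : Finset ι) (f : Block ι n → ℂ) :
    (∑ P : Finpartition Z, ∑ N : Fin n → P.parts, ∑ k : P.parts → Fin (h + 1),
      if 2 * Z.card + ∑ L, (k L : ℕ) = h + 2 * P.parts.card then
        ∏ L : P.parts, f (L.1, (Finset.univ.filter fun j => N j = L), (k L : ℕ)) else 0) =
    ∑ c ∈ configs n h Z, ∏ b ∈ c, f b := by
  let g : (Σ P : Finpartition Z, (Fin n → P.parts) × (P.parts → Fin (h + 1))) → ℂ := fun x =>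
    if 2 * Z.card + ∑ L, (x.2.2 L : ℕ) = h + 2 * x.1.parts.card then
      ∏ L : x.1.parts, f (L.1, (Finset.univ.filter fun j => x.2.1 j = L), (x.2.2 L : ℕ)) else 0
  have hg : ∑ x, g x = ∑ P : Finpartition Z, ∑ N : Fin n → P.parts, ∑ k : P.parts → Fin (h + 1),
      g ⟨P, (N, k)⟩ := by
    rw [Fintype.sum_sigma]
    refine Finset.sum_congr rfl fun P _ => ?_
    rw [Fintype.sum_prod_type]
  refine hg.symm.trans ?_
  simp only [g]
  rw [← Finset.sum_filter]
  refine Finset.sum_bij (fun x _ => toConfig x) ?_ ?_ ?_ ?_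
  · intro x hx
    exact mem_configs.2 (isConfig_toConfig x (Finset.mem_filter.1 hx).2)
  · intro x _ x' _ hxx
    exact toConfig_injective hxx
  · intro c hc
    obtain ⟨x, hx, rfl⟩ := exists_toConfig_eq (mem_configs.1 hc)
    exact ⟨x, Finset.mem_filter.2 ⟨Finset.mem_univ _, hx⟩, rfl⟩
  · intro x _
    exact (sum_toConfig x f).symm

end Flatten

end LoopEq
end

noncomputable section

namespace LoopEq

/-! ### Relabelling of points and removal of the factors `ω_{0,1}`. -/

section Disconnected

variable {Ct : Type*} [TopologicalSpace Ct] [ChartedSpace ℂ Ct]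
variable {ι : Type*} {n : ℕ}

/-- The factor attached to a block. -/
def blockWeight (om : ℕ → Multiset (TangentBundle 𝓘(ℂ) Ct) → ℂ) (z : ι → TangentBundle 𝓘(ℂ) Ct)
    (w : Fin n → TangentBundle 𝓘(ℂ) Ct) (b : Block ι n) : ℂ :=
  om b.2.2 (b.1.val.map z + b.2.1.val.map w)

/-- A block with a single argument and genus zero. -/
def Block.IsTrivial (b : Block ι n) : Prop := b.2.2 = 0 ∧ b.1.card + b.2.1.card = 1

open scoped Classical in
/-- The factor attached to a block, with the factors `ω_{0,1}` removed. -/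
def blockWeight' (om : ℕ → Multiset (TangentBundle 𝓘(ℂ) Ct) → ℂ) (z : ι → TangentBundle 𝓘(ℂ) Ct)
    (w : Fin n → TangentBundle 𝓘(ℂ) Ct) (b : Block ι n) : ℂ :=
  if b.IsTrivial then 0 else blockWeight om z w b

theorem disconn_eq_sum_configs (om : ℕ → Multiset (TangentBundle 𝓘(ℂ) Ct) → ℂ) (h : ℕ)
    (Z : Finset ι) (z : ι → TangentBundle 𝓘(ℂ) Ct) (w : Fin n → TangentBundle 𝓘(ℂ) Ct) :
    disconn om h Z z w = ∑ c ∈ configs n h Z, ∏ b ∈ c, blockWeight om z w b := by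
  classical
  rw [← sum_finpartition_eq_sum_configs, disconn]
  rfl

/-- Forbidding factors `ω_{0,1}` is the same as giving them weight zero, so `𝒲'` is again a sum of
products over all configurations. -/
theorem disconn'_eq_sum_configs (om : ℕ → Multiset (TangentBundle 𝓘(ℂ) Ct) → ℂ) (h : ℕ)
    (Z : Finset ι) (z : ι → TangentBundle 𝓘(ℂ) Ct) (w : Fin n → TangentBundle 𝓘(ℂ) Ct) :
    disconn' om h Z z w = ∑ c ∈ configs n h Z, ∏ b ∈ c, blockWeight' om z w b := by
  classical
  rw [← sum_finpartition_eq_sum_configs, disconn']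
  refine Finset.sum_congr rfl fun P _ => Finset.sum_congr rfl fun N _ =>
    Finset.sum_congr rfl fun k _ => ?_
  have hiff : ∀ L : P.parts, (((k L : ℕ) = 0 ∧ (blockArgs P N z w L).card = 1) ↔
      Block.IsTrivial ((L.1, (Finset.univ.filter fun j => N j = L), (k L : ℕ)) : Block ι n)) := by
    intro L
    simp only [Block.IsTrivial, blockArgs, Multiset.card_add, Multiset.card_map, Finset.card_val]
  by_cases h1 : 2 * Z.card + ∑ L, (k L : ℕ) = h + 2 * P.parts.card
  · by_cases h2 : ∀ L : P.parts, ¬ ((k L : ℕ) = 0 ∧ (blockArgs P N z w L).card = 1)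
    · rw [if_pos ⟨h1, h2⟩, if_pos h1]
      refine Finset.prod_congr rfl fun L _ => ?_
      rw [blockWeight', if_neg (fun hc => h2 L ((hiff L).2 hc))]
      rfl
    · rw [if_neg (fun hc => h2 hc.2), if_pos h1]
      push Not at h2
      obtain ⟨L, hL⟩ := h2
      refine (Finset.prod_eq_zero (Finset.mem_univ L) ?_).symm
      rw [blockWeight', if_pos ((hiff L).1 hL)]
  · rw [if_neg (fun hc => h1 hc.1), if_neg h1]

/-- The block relabelled along `f`. -/
def Block.relabel {ι' : Type*} [DecidableEq ι'] (f : ι → ι') (b : Block ι n) : Block ι' n :=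
  (b.1.image f, b.2)

theorem IsConfig.relabel {ι' : Type*} [DecidableEq ι'] {h : ℕ} {Z : Finset ι} {f : ι → ι'}
    (hf : Set.InjOn f Z) {c : Finset (Block ι n)} (hc : IsConfig h Z c) :
    IsConfig h (Z.image f) (c.image (Block.relabel f)) := by
  have hmem : ∀ b ∈ c, ∀ i ∈ Z, f i ∈ b.1.image f → i ∈ b.1 := by
    intro b hb i hi hfi
    obtain ⟨i', hi', he⟩ := Finset.mem_image.1 hfi
    rwa [← hf (hc.subset hb hi') hi he]
  have hinj : Set.InjOn (Block.relabel f (n := n)) c := by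
    intro b hb b' hb' he
    obtain ⟨i, hi⟩ := hc.nonempty b hb
    refine hc.disj b hb b' hb' i hi (hmem b' hb' i (hc.subset hb hi) ?_)
    have : b.1.image f = b'.1.image f := congrArg Prod.fst he
    rw [← this]; exact Finset.mem_image_of_mem _ hi
  refine ⟨?_, ?_, ?_, ?_, ?_, ?_⟩
  · intro b hb
    replace hb := Finset.mem_image.1 hb; obtain ⟨b, hb, rfl⟩ := hb
    exact (hc.nonempty b hb).image f
  · intro b hb b' hb' i hi hi'
    replace hb := Finset.mem_image.1 hb; obtain ⟨b, hb, rfl⟩ := hb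
    replace hb' := Finset.mem_image.1 hb'; obtain ⟨b', hb', rfl⟩ := hb'
    obtain ⟨i, hib, rfl⟩ := Finset.mem_image.1 hi
    rw [hc.disj b hb b' hb' i hib (hmem b' hb' i (hc.subset hb hib) hi')]
  · intro i
    constructor
    · intro hi
      replace hi := Finset.mem_image.1 hi; obtain ⟨i, hi, rfl⟩ := hi
      obtain ⟨b, hb, hib⟩ := (hc.cover i).1 hi
      exact ⟨_, Finset.mem_image_of_mem _ hb, Finset.mem_image_of_mem _ hib⟩
    · rintro ⟨b, hb, hi⟩
      replace hb := Finset.mem_image.1 hb; obtain ⟨b, hb, rfl⟩ := hb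
      obtain ⟨i, hib, rfl⟩ := Finset.mem_image.1 hi
      exact Finset.mem_image_of_mem _ (hc.subset hb hib)
  · intro b hb b' hb' j hj hj'
    replace hb := Finset.mem_image.1 hb; obtain ⟨b, hb, rfl⟩ := hb
    replace hb' := Finset.mem_image.1 hb'; obtain ⟨b', hb', rfl⟩ := hb'
    rw [hc.disjM b hb b' hb' j hj hj']
  · intro j
    obtain ⟨b, hb, hj⟩ := hc.coverM j
    exact ⟨_, Finset.mem_image_of_mem _ hb, hj⟩
  · rw [Finset.sum_image hinj, ← hc.degree]
    refine Finset.sum_congr rfl fun b hb => ?_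
    simp only [blockDegree, Block.relabel]
    rw [Finset.card_image_of_injOn (hf.mono (hc.subset hb))]

/-- Serves to pass from subsets of a fibre in `Ct` to subsets of the fixed index set of sheets.
Injectivity on `Z` suffices because every block lies in `Z`. -/
theorem sum_configs_image {ι' : Type*} [DecidableEq ι'] (h : ℕ) (Z : Finset ι) {f : ι → ι'}
    (hf : Set.InjOn f Z) (g : Block ι' n → ℂ) :
    ∑ c ∈ configs n h (Z.image f), ∏ b ∈ c, g b =
      ∑ c ∈ configs n h Z, ∏ b ∈ c, g (b.relabel f) := by
  classical
  have hrel : ∀ L : Finset ι, L ⊆ Z → ∀ L' ⊆ Z, L.image f = L'.image f → L = L' := by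
    intro L hL L' hL' he
    have hsub : ∀ A B : Finset ι, A ⊆ Z → B ⊆ Z → A.image f = B.image f → A ⊆ B := by
      intro A B hA hB he i hi
      have : f i ∈ B.image f := he ▸ Finset.mem_image_of_mem _ hi
      obtain ⟨i', hi', he'⟩ := Finset.mem_image.1 this
      rwa [← hf (hB hi') (hA hi) he']
    exact (hsub _ _ hL hL' he).antisymm (hsub _ _ hL' hL he.symm)
  symm
  refine Finset.sum_bij (fun c _ => c.image (Block.relabel f)) ?_ ?_ ?_ ?_
  · intro c hc
    exact mem_configs.2 ((mem_configs.1 hc).relabel hf)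
  · have hsub : ∀ c c' : Finset (Block ι n), IsConfig h Z c → IsConfig h Z c' →
        c.image (Block.relabel f) = c'.image (Block.relabel f) → c ⊆ c' := by
      intro c c' hc hc' he b hb
      have : b.relabel f ∈ c'.image (Block.relabel f) := he ▸ Finset.mem_image_of_mem _ hb
      obtain ⟨b', hb', hbb⟩ := Finset.mem_image.1 this
      have h1 : b'.1 = b.1 := hrel _ (hc'.subset hb') _ (hc.subset hb) (congrArg Prod.fst hbb)
      have h2 : (b'.relabel f).2 = (b.relabel f).2 := congrArg Prod.snd hbb
      rwa [← Prod.ext h1 h2]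
    intro c hc c' hc' he
    exact (hsub _ _ (mem_configs.1 hc) (mem_configs.1 hc') he).antisymm
      (hsub _ _ (mem_configs.1 hc') (mem_configs.1 hc) he.symm)
  · intro d hd
    have hd := mem_configs.1 hd
    -- The inverse of relabelling: pull a block back to its preimage inside `Z`.
    let back : Block ι' n → Block ι n := fun b => (Z.filter fun i => f i ∈ b.1, b.2)
    have hback : ∀ b ∈ d, (back b).relabel f = b := by
      intro b hb
      refine Prod.ext ?_ rfl
      ext i'
      simp only [back, Block.relabel, Finset.mem_image, Finset.mem_filter]
      constructor
      · rintro ⟨i, ⟨_, hi⟩, rfl⟩; exact hi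
      · intro hi'
        obtain ⟨i, hi, rfl⟩ := Finset.mem_image.1 (hd.subset hb hi')
        exact ⟨i, ⟨hi, hi'⟩, rfl⟩
    have himg : (d.image back).image (Block.relabel f) = d := by
      rw [Finset.image_image]
      ext b
      simp only [Finset.mem_image, Function.comp]
      constructor
      · rintro ⟨b', hb', rfl⟩; rw [hback b' hb']; exact hb'
      · intro hb; exact ⟨b, hb, hback b hb⟩
    have hbinj : Set.InjOn back d := by
      intro b hb b' hb' he
      rw [← hback b hb, ← hback b' hb', he]
    refine ⟨d.image back, mem_configs.2 ⟨?_, ?_, ?_, ?_, ?_, ?_⟩, himg⟩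
    · intro b hb
      replace hb := Finset.mem_image.1 hb; obtain ⟨b, hb, rfl⟩ := hb
      have := hd.nonempty b hb
      rw [← hback b hb] at this
      exact Finset.image_nonempty.1 this
    · intro b hb b' hb' i hi hi'
      replace hb := Finset.mem_image.1 hb; obtain ⟨b, hb, rfl⟩ := hb
      replace hb' := Finset.mem_image.1 hb'; obtain ⟨b', hb', rfl⟩ := hb'
      rw [hd.disj b hb b' hb' (f i) (Finset.mem_filter.1 hi).2 (Finset.mem_filter.1 hi').2]
    · intro i
      constructor
      · intro hi
        obtain ⟨b, hb, hib⟩ := (hd.cover (f i)).1 (Finset.mem_image_of_mem _ hi)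
        exact ⟨_, Finset.mem_image_of_mem _ hb, Finset.mem_filter.2 ⟨hi, hib⟩⟩
      · rintro ⟨b, hb, hi⟩
        replace hb := Finset.mem_image.1 hb; obtain ⟨b, hb, rfl⟩ := hb
        exact (Finset.mem_filter.1 hi).1
    · intro b hb b' hb' j hj hj'
      replace hb := Finset.mem_image.1 hb; obtain ⟨b, hb, rfl⟩ := hb
      replace hb' := Finset.mem_image.1 hb'; obtain ⟨b', hb', rfl⟩ := hb'
      rw [hd.disjM b hb b' hb' j hj hj']
    · intro j
      obtain ⟨b, hb, hj⟩ := hd.coverM j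
      exact ⟨_, Finset.mem_image_of_mem _ hb, hj⟩
    · rw [Finset.sum_image hbinj, ← hd.degree]
      refine Finset.sum_congr rfl fun b hb => ?_
      have h1 : b.1.card = (back b).1.card := by
        conv_lhs => rw [← hback b hb]
        exact Finset.card_image_of_injOn (hf.mono (Finset.filter_subset _ _))
      simp only [blockDegree]
      rw [h1]
  · intro c hc
    have hc := mem_configs.1 hc
    rw [Finset.prod_image]
    intro b hb b' hb' hbb
    exact Prod.ext (hrel _ (hc.subset hb) _ (hc.subset hb') (congrArg Prod.fst hbb))
      (congrArg Prod.snd hbb : (b.relabel f).2 = (b'.relabel f).2)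

theorem sum_configs_congr {h : ℕ} {Z : Finset ι} {f g : Block ι n → ℂ}
    (hfg : ∀ c, IsConfig h Z c → ∀ b ∈ c, f b = g b) :
    ∑ c ∈ configs n h Z, ∏ b ∈ c, f b = ∑ c ∈ configs n h Z, ∏ b ∈ c, g b :=
  Finset.sum_congr rfl fun c hc => Finset.prod_congr rfl fun b hb => hfg c (mem_configs.1 hc) b hb

theorem blockWeight_relabel {ι' : Type*} [DecidableEq ι']
    (om : ℕ → Multiset (TangentBundle 𝓘(ℂ) Ct) → ℂ) {f : ι → ι'} {b : Block ι n}
    (hf : Set.InjOn f b.1)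
    (z : ι' → TangentBundle 𝓘(ℂ) Ct) (w : Fin n → TangentBundle 𝓘(ℂ) Ct) :
    blockWeight om z w (b.relabel f) = blockWeight om (fun i => z (f i)) w b := by
  simp only [blockWeight, Block.relabel]
  rw [Finset.image_val_of_injOn hf, Multiset.map_map]
  rfl

theorem isTrivial_relabel {ι' : Type*} [DecidableEq ι'] {f : ι → ι'} {b : Block ι n}
    (hf : Set.InjOn f b.1) : (b.relabel f).IsTrivial ↔ b.IsTrivial := by
  simp only [Block.IsTrivial, Block.relabel, Finset.card_image_of_injOn hf]

theorem disconn_image {ι' : Type*} [DecidableEq ι']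
    (om : ℕ → Multiset (TangentBundle 𝓘(ℂ) Ct) → ℂ) (h : ℕ)
    (Z : Finset ι) {f : ι → ι'} (hf : Set.InjOn f Z) (z : ι' → TangentBundle 𝓘(ℂ) Ct)
    (w : Fin n → TangentBundle 𝓘(ℂ) Ct) :
    disconn om h (Z.image f) z w = disconn om h Z (fun i => z (f i)) w := by
  rw [disconn_eq_sum_configs, disconn_eq_sum_configs, sum_configs_image h Z hf]
  exact sum_configs_congr fun c hc b hb => blockWeight_relabel om (hf.mono (hc.subset hb)) z w

theorem disconn'_image {ι' : Type*} [DecidableEq ι']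
    (om : ℕ → Multiset (TangentBundle 𝓘(ℂ) Ct) → ℂ) (h : ℕ)
    (Z : Finset ι) {f : ι → ι'} (hf : Set.InjOn f Z) (z : ι' → TangentBundle 𝓘(ℂ) Ct)
    (w : Fin n → TangentBundle 𝓘(ℂ) Ct) :
    disconn' om h (Z.image f) z w = disconn' om h Z (fun i => z (f i)) w := by
  rw [disconn'_eq_sum_configs, disconn'_eq_sum_configs, sum_configs_image h Z hf]
  refine sum_configs_congr fun c hc b hb => ?_
  have hb' := hf.mono (hc.subset hb)
  rw [blockWeight', blockWeight', blockWeight_relabel om hb' z w]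
  classical exact if_congr (isTrivial_relabel hb') rfl rfl

/-- The block of a single point of genus zero. -/
def singleBlock (n : ℕ) (i : ι) : Block ι n := ({i}, ∅, 0)

theorem blockDegree_singleBlock (i : ι) : blockDegree (singleBlock n i) = 0 := by
  simp [blockDegree, singleBlock]

theorem isTrivial_singleBlock (i : ι) : (singleBlock n i).IsTrivial := by
  simp [Block.IsTrivial, singleBlock]

theorem Block.IsTrivial.eq_singleBlock {b : Block ι n} (hb : b.IsTrivial) (hne : b.1.Nonempty) :
    ∃ i, b = singleBlock n i := by
  obtain ⟨L, M, k⟩ := b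
  obtain ⟨h1, h2⟩ := hb
  dsimp only at h1 h2 hne
  have := hne.card_pos
  have hL : L.card = 1 := by omega
  have hM : M.card = 0 := by omega
  obtain ⟨i, rfl⟩ := Finset.card_eq_one.1 hL
  exact ⟨i, by rw [Finset.card_eq_zero.1 hM, h1]; rfl⟩

theorem singleBlock_injective : Function.Injective (singleBlock n : ι → Block ι n) := by
  intro i j hij
  simpa [singleBlock] using hij

theorem blockWeight_singleBlock (om : ℕ → Multiset (TangentBundle 𝓘(ℂ) Ct) → ℂ)
    (z : ι → TangentBundle 𝓘(ℂ) Ct) (w : Fin n → TangentBundle 𝓘(ℂ) Ct) (i : ι) :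
    blockWeight om z w (singleBlock n i) = om 0 {z i} := by
  simp [blockWeight, singleBlock]

/-- The factors `ω_{0,1}` split off. -/
theorem disconn_eq_sum_powerset [DecidableEq ι] (om : ℕ → Multiset (TangentBundle 𝓘(ℂ) Ct) → ℂ)
    (h : ℕ) (Z : Finset ι) (z : ι → TangentBundle 𝓘(ℂ) Ct) (w : Fin n → TangentBundle 𝓘(ℂ) Ct) :
    disconn om h Z z w =
      ∑ A ∈ Z.powerset, disconn' om h A z w * ∏ i ∈ Z \ A, om 0 {z i} := by
  classical
  rw [disconn_eq_sum_configs]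
  simp only [disconn'_eq_sum_configs, Finset.sum_mul]
  -- Configurations with a trivial block contribute zero to `𝒲'` and can be dropped.
  have hstep : ∀ A ∈ Z.powerset, ∑ c ∈ configs n h A, (∏ b ∈ c, blockWeight' om z w b) *
      ∏ i ∈ Z \ A, om 0 {z i} = ∑ c ∈ (configs n h A).filter (fun c => ∀ b ∈ c, ¬ b.IsTrivial),
      (∏ b ∈ c, blockWeight om z w b) * ∏ i ∈ Z \ A, om 0 {z i} := by
    intro A _
    rw [Finset.sum_filter]
    refine Finset.sum_congr rfl fun c hc => ?_
    split_ifs with hb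
    · congr 1
      exact Finset.prod_congr rfl fun b hbc => if_neg (hb b hbc)
    · push Not at hb
      obtain ⟨b, hbc, hbt⟩ := hb
      rw [Finset.prod_eq_zero hbc (show blockWeight' om z w b = 0 from if_pos hbt), zero_mul]
  rw [Finset.sum_congr rfl hstep, Finset.sum_sigma']
  symm
  -- A configuration of `Z` is a configuration of some `A` without trivial blocks, completed by one
  -- trivial block for each point of `Z \ A`.
  refine Finset.sum_bij (fun x _ => x.2 ∪ (Z \ x.1).image (singleBlock n)) ?_ ?_ ?_ ?_
  · rintro ⟨A, c⟩ hx
    simp only [Finset.mem_sigma, Finset.mem_powerset, Finset.mem_filter, mem_configs] at hx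
    obtain ⟨hA, hc, hnt⟩ := hx
    rw [mem_configs]
    have hdis : Disjoint c ((Z \ A).image (singleBlock n)) := by
      rw [Finset.disjoint_left]
      intro b hb hb'
      obtain ⟨i, _, rfl⟩ := Finset.mem_image.1 hb'
      exact hnt _ hb (isTrivial_singleBlock i)
    refine ⟨?_, ?_, ?_, ?_, ?_, ?_⟩
    · intro b hb
      rcases Finset.mem_union.1 hb with hb | hb
      · exact hc.nonempty b hb
      · obtain ⟨i, _, rfl⟩ := Finset.mem_image.1 hb
        exact Finset.singleton_nonempty i
    · intro b hb b' hb' i hi hi'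
      rcases Finset.mem_union.1 hb with hb | hb <;> rcases Finset.mem_union.1 hb' with hb' | hb'
      · exact hc.disj b hb b' hb' i hi hi'
      · obtain ⟨j, hj, rfl⟩ := Finset.mem_image.1 hb'
        obtain rfl : i = j := by simpa [singleBlock] using hi'
        exact absurd (hc.subset hb hi) (Finset.mem_sdiff.1 hj).2
      · obtain ⟨j, hj, rfl⟩ := Finset.mem_image.1 hb
        obtain rfl : i = j := by simpa [singleBlock] using hi
        exact absurd (hc.subset hb' hi') (Finset.mem_sdiff.1 hj).2
      · obtain ⟨j, hj, rfl⟩ := Finset.mem_image.1 hb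
        obtain ⟨j', hj', rfl⟩ := Finset.mem_image.1 hb'
        obtain rfl : i = j := by simpa [singleBlock] using hi
        obtain rfl : i = j' := by simpa [singleBlock] using hi'
        rfl
    · intro i
      constructor
      · intro hi
        by_cases hiA : i ∈ A
        · obtain ⟨b, hb, hib⟩ := (hc.cover i).1 hiA
          exact ⟨b, Finset.mem_union_left _ hb, hib⟩
        · exact ⟨singleBlock n i, Finset.mem_union_right _ (Finset.mem_image_of_mem _
            (Finset.mem_sdiff.2 ⟨hi, hiA⟩)), Finset.mem_singleton_self i⟩
      · rintro ⟨b, hb, hi⟩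
        rcases Finset.mem_union.1 hb with hb | hb
        · exact hA (hc.subset hb hi)
        · obtain ⟨j, hj, rfl⟩ := Finset.mem_image.1 hb
          obtain rfl : i = j := by simpa [singleBlock] using hi
          exact (Finset.mem_sdiff.1 hj).1
    · intro b hb b' hb' j hj hj'
      rcases Finset.mem_union.1 hb with hb | hb <;> rcases Finset.mem_union.1 hb' with hb' | hb'
      · exact hc.disjM b hb b' hb' j hj hj'
      · obtain ⟨i, hi, rfl⟩ := Finset.mem_image.1 hb'
        simp [singleBlock] at hj'
      · obtain ⟨i, hi, rfl⟩ := Finset.mem_image.1 hb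
        simp [singleBlock] at hj
      · obtain ⟨i, hi, rfl⟩ := Finset.mem_image.1 hb
        simp [singleBlock] at hj
    · intro j
      obtain ⟨b, hb, hj⟩ := hc.coverM j
      exact ⟨b, Finset.mem_union_left _ hb, hj⟩
    · rw [Finset.sum_union hdis, hc.degree, Finset.sum_image singleBlock_injective.injOn]
      simp [blockDegree_singleBlock]
  · have hfil : ∀ (A : Finset ι) (c : Finset (Block ι n)), (∀ b ∈ c, ¬ b.IsTrivial) →
        (c ∪ (Z \ A).image (singleBlock n)).filter (fun b => ¬ b.IsTrivial) = c := by
      intro A c hnt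
      rw [Finset.filter_union, Finset.filter_true_of_mem hnt, Finset.filter_false_of_mem,
        Finset.union_empty]
      intro b hb
      obtain ⟨i, _, rfl⟩ := Finset.mem_image.1 hb
      exact not_not.2 (isTrivial_singleBlock i)
    rintro ⟨A, c⟩ hx ⟨A', c'⟩ hx' he
    simp only [Finset.mem_sigma, Finset.mem_powerset, Finset.mem_filter, mem_configs] at hx hx'
    have hcc : c = c' := by
      have := congrArg (fun s => s.filter (fun b : Block ι n => ¬ b.IsTrivial)) he
      simpa only [hfil A c hx.2.2, hfil A' c' hx'.2.2] using this
    subst hcc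
    have : A = A' := by
      ext i; rw [hx.2.1.cover, hx'.2.1.cover]
    rw [this]
  · intro c hc
    have hc := mem_configs.1 hc
    -- The inverse map: `A` is the union of the nontrivial blocks.
    let A : Finset ι := (c.filter fun b => ¬ b.IsTrivial).biUnion fun b => b.1
    have hmemA : ∀ i, i ∈ A ↔ ∃ b ∈ c.filter (fun b => ¬ b.IsTrivial), i ∈ b.1 := by
      intro i; simp only [A, Finset.mem_biUnion]
    have hAZ : A ⊆ Z := by
      intro i hi
      obtain ⟨b, hb, hib⟩ := (hmemA i).1 hi
      exact hc.subset (Finset.mem_filter.1 hb).1 hib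
    have hsing : ∀ b ∈ c, b.IsTrivial → ∃ i ∈ Z \ A, b = singleBlock n i := by
      intro b hb hbt
      obtain ⟨i, rfl⟩ := hbt.eq_singleBlock (hc.nonempty b hb)
      have hib : i ∈ (singleBlock n i).1 := Finset.mem_singleton_self i
      refine ⟨i, Finset.mem_sdiff.2 ⟨hc.subset hb hib, fun hiA => ?_⟩, rfl⟩
      obtain ⟨b', hb', hib'⟩ := (hmemA i).1 hiA
      obtain ⟨hb', hnt⟩ := Finset.mem_filter.1 hb'
      exact hnt (hc.disj _ hb b' hb' i hib hib' ▸ hbt)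
    refine ⟨⟨A, c.filter fun b => ¬ b.IsTrivial⟩, ?_, ?_⟩
    · simp only [Finset.mem_sigma, Finset.mem_powerset, Finset.mem_filter, mem_configs]
      refine ⟨hAZ, ⟨?_, ?_, hmemA, ?_, ?_, ?_⟩, fun b hb => hb.2⟩
      · exact fun b hb => hc.nonempty b (Finset.mem_filter.1 hb).1
      · exact fun b hb b' hb' => hc.disj b (Finset.mem_filter.1 hb).1 b' (Finset.mem_filter.1 hb').1
      · exact fun b hb b' hb' => hc.disjM b (Finset.mem_filter.1 hb).1 b' (Finset.mem_filter.1 hb').1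
      · intro j
        obtain ⟨b, hb, hj⟩ := hc.coverM j
        refine ⟨b, Finset.mem_filter.2 ⟨hb, fun hbt => ?_⟩, hj⟩
        obtain ⟨i, _, rfl⟩ := hsing b hb hbt
        simp [singleBlock] at hj
      · rw [← hc.degree, Finset.sum_filter]
        refine Finset.sum_congr rfl fun b hb => ?_
        split_ifs with hbt
        · obtain ⟨i, _, rfl⟩ := hsing b hb hbt
          exact (blockDegree_singleBlock i).symm
        · rfl
    · ext b
      simp only [Finset.mem_union, Finset.mem_filter, Finset.mem_image]
      constructor
      · rintro (hb | ⟨i, hi, rfl⟩)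
        · exact hb.1
        · obtain ⟨hiZ, hiA⟩ := Finset.mem_sdiff.1 hi
          obtain ⟨b, hb, hib⟩ := (hc.cover i).1 hiZ
          by_cases hbt : b.IsTrivial
          · obtain ⟨i', _, rfl⟩ := hsing b hb hbt
            obtain rfl : i = i' := by simpa [singleBlock] using hib
            exact hb
          · exact absurd ((hmemA i).2 ⟨b, Finset.mem_filter.2 ⟨hb, hbt⟩, hib⟩) hiA
      · intro hb
        by_cases hbt : b.IsTrivial
        · obtain ⟨i, hi, rfl⟩ := hsing b hb hbt
          exact Or.inr ⟨i, hi, rfl⟩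
        · exact Or.inl ⟨hb, hbt⟩
  · rintro ⟨A, c⟩ hx
    simp only [Finset.mem_sigma, Finset.mem_powerset, Finset.mem_filter, mem_configs] at hx
    obtain ⟨hA, hc, hnt⟩ := hx
    have hdis : Disjoint c ((Z \ A).image (singleBlock n)) := by
      rw [Finset.disjoint_left]
      intro b hb hb'
      obtain ⟨i, _, rfl⟩ := Finset.mem_image.1 hb'
      exact hnt _ hb (isTrivial_singleBlock i)
    rw [Finset.prod_union hdis, Finset.prod_image singleBlock_injective.injOn]
    simp only [blockWeight_singleBlock]

end Disconnected

end LoopEq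
end

noncomputable section

namespace LoopEq

/-! ### Values of `𝒲'` on few points, and the complexity of its factors. -/

section Disconnected

variable {Ct : Type*} [TopologicalSpace Ct] [ChartedSpace ℂ Ct]
variable {ι : Type*} {n : ℕ}

/-- Without points there are no blocks, hence nothing to carry a spectator or a positive degree. -/
theorem disconn'_empty (om : ℕ → Multiset (TangentBundle 𝓘(ℂ) Ct) → ℂ) {h : ℕ}
    (hn : 0 < h + n) (z : ι → TangentBundle 𝓘(ℂ) Ct) (w : Fin n → TangentBundle 𝓘(ℂ) Ct) :
    disconn' om h ∅ z w = 0 := by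
  rw [disconn'_eq_sum_configs]
  refine Finset.sum_eq_zero fun c hc => ?_
  have hc := mem_configs.1 hc
  have hc0 : c = ∅ := by
    rw [Finset.eq_empty_iff_forall_notMem]
    intro b hb
    obtain ⟨i, hi⟩ := hc.nonempty b hb
    exact absurd ((hc.cover i).2 ⟨b, hb, hi⟩) (Finset.notMem_empty i)
  exfalso
  have h1 := hc.degree
  have h2 := hc.card_eq'
  simp [hc0] at h1 h2
  omega

theorem configs_singleton (i : ι) (h : ℕ) :
    configs n h ({i} : Finset ι) = {{(({i}, Finset.univ, h) : Block ι n)}} := by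
  classical
  ext c
  rw [mem_configs, Finset.mem_singleton]
  constructor
  · intro hc
    obtain ⟨b, hb, hib⟩ := (hc.cover i).1 (Finset.mem_singleton_self i)
    have hall : ∀ b' ∈ c, b' = b := by
      intro b' hb'
      obtain ⟨i', hi'⟩ := hc.nonempty b' hb'
      obtain rfl : i' = i := Finset.mem_singleton.1 (hc.subset hb' hi')
      exact hc.disj b' hb' b hb i' hi' hib
    have hcb : c = {b} := by
      ext b'
      rw [Finset.mem_singleton]
      exact ⟨hall b', fun h => h ▸ hb⟩
    have hb1 : b.1 = {i} := by
      refine (hc.subset hb).antisymm ?_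
      simpa using hib
    have hb2 : b.2.1 = Finset.univ := by
      ext j
      obtain ⟨b', hb', hj⟩ := hc.coverM j
      rw [hall b' hb'] at hj
      simp [hj]
    have hb3 := hc.degree
    rw [hcb, Finset.sum_singleton, blockDegree, hb1, Finset.card_singleton] at hb3
    rw [hcb]
    congr 1
    exact Prod.ext hb1 (Prod.ext hb2 (by push_cast at hb3; dsimp only; omega))
  · rintro rfl
    refine ⟨?_, ?_, ?_, ?_, ?_, ?_⟩ <;> simp [blockDegree]

theorem disconn'_singleton (om : ℕ → Multiset (TangentBundle 𝓘(ℂ) Ct) → ℂ) {h : ℕ}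
    (hn : 0 < h + n) (i : ι) (z : ι → TangentBundle 𝓘(ℂ) Ct)
    (w : Fin n → TangentBundle 𝓘(ℂ) Ct) :
    disconn' om h {i} z w = om h (z i ::ₘ Finset.univ.val.map w) := by
  rw [disconn'_eq_sum_configs, configs_singleton, Finset.sum_singleton, Finset.prod_singleton,
    blockWeight', if_neg]
  · simp [blockWeight]
  · simp only [Block.IsTrivial, Finset.card_singleton, Finset.card_univ, Fintype.card_fin]
    omega

/-- Only correlators of smaller complexity enter `𝒲'` when there are at least two points. -/
theorem disconn'_congr {om om' : ℕ → Multiset (TangentBundle 𝓘(ℂ) Ct) → ℂ} {h : ℕ} {Z : Finset ι}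
    {z : ι → TangentBundle 𝓘(ℂ) Ct} {w : Fin n → TangentBundle 𝓘(ℂ) Ct} (hZ : 2 ≤ Z.card)
    (heq : ∀ (A : Finset ι) (M : Finset (Fin n)) (k : ℕ), A.Nonempty → A ⊆ Z →
      2 ≤ k + (A.card + M.card) → k + (A.card + M.card) ≤ h + n →
      om k (A.val.map z + M.val.map w) = om' k (A.val.map z + M.val.map w)) :
    disconn' om h Z z w = disconn' om' h Z z w := by
  rw [disconn'_eq_sum_configs, disconn'_eq_sum_configs]
  refine Finset.sum_congr rfl fun c hc => ?_
  have hc := mem_configs.1 hc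
  by_cases hnt : ∀ b ∈ c, ¬ b.IsTrivial
  · refine Finset.prod_congr rfl fun b hb => ?_
    rw [blockWeight', blockWeight', if_neg (hnt b hb), if_neg (hnt b hb)]
    have htwo : ∀ b ∈ c, 2 ≤ b.2.2 + (b.1.card + b.2.1.card) := by
      intro b hb
      have h1 := (hc.nonempty b hb).card_pos
      have h2 := hnt b hb
      simp only [Block.IsTrivial, not_and] at h2
      omega
    refine heq b.1 b.2.1 b.2.2 (hc.nonempty b hb) (hc.subset hb) (htwo b hb) ?_
    have h1 := hc.degree
    have h2 := hc.card_eq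
    have h3 := hc.card_eq'
    -- The excesses `k + |A| + |M| - 2` are nonnegative and add up to `h - |Z| + n`, so each is at
    -- most that. With `|Z| ≥ 2` every factor has complexity at most `h + n`, one less than that of
    -- the correlator being computed.
    have h4 : ∀ b' ∈ c, (0 : ℤ) ≤ (b'.2.2 : ℤ) + (b'.1.card + b'.2.1.card) - 2 := by
      intro b' hb'; have := htwo b' hb'; omega
    have h5 := Finset.single_le_sum h4 hb
    simp only [Finset.sum_sub_distrib, Finset.sum_add_distrib, blockDegree,
      ← Finset.mul_sum, Finset.sum_const, nsmul_eq_mul] at h1 h5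
    zify at h2 h3
    omega
  · push Not at hnt
    obtain ⟨b, hb, hbt⟩ := hnt
    rw [Finset.prod_eq_zero hb (show blockWeight' om z w b = 0 from if_pos hbt),
      Finset.prod_eq_zero hb (show blockWeight' om' z w b = 0 from if_pos hbt)]

end Disconnected

/-! ### Loop sums as values of a polynomial, and interpolation. -/

section Algebra

variable {ι : Type*} [DecidableEq ι]

/-- The sum of the loop coefficients against powers of one of the branches, rewritten without the
factors `ω_{0,1}`. -/
theorem sum_powersetCard_mul_pow (J : Finset ι) {j : ι} (hj : j ∈ J) (Y : ι → ℂ)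
    (W W' : Finset ι → ℂ) (h0 : W' ∅ = 0)
    (hW : ∀ Z ⊆ J, W Z = ∑ A ∈ Z.powerset, W' A * ∏ i ∈ Z \ A, Y i) :
    ∑ i ∈ Finset.Icc 1 J.card, (∑ Z ∈ J.powersetCard i, W Z) * (-Y j) ^ (J.card - i) =
      ∑ A ∈ (J.erase j).powerset, W' (insert j A) * ∏ k ∈ (J.erase j) \ A, (Y k - Y j) := by
  -- The missing term `i = 0` is zero, so the sum may be taken over all subsets of `J`.
  have hW0 : W ∅ = 0 := by rw [hW ∅ (Finset.empty_subset _)]; simp [h0]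
  have h1 : ∑ i ∈ Finset.Icc 1 J.card, (∑ Z ∈ J.powersetCard i, W Z) * (-Y j) ^ (J.card - i) =
      ∑ Z ∈ J.powerset, W Z * (-Y j) ^ (J.card - Z.card) := by
    rw [Finset.sum_powerset, Finset.sum_range_succ']
    simp only [Finset.powersetCard_zero, Finset.sum_singleton, hW0, zero_mul, add_zero]
    rw [Finset.range_eq_Ico, Finset.sum_Ico_add' (fun i => ∑ Z ∈ J.powersetCard i,
      W Z * (-Y j) ^ (J.card - Z.card)) 0 J.card 1]
    refine Finset.sum_congr (by ext; simp) fun i _ => ?_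
    rw [Finset.sum_mul]
    refine Finset.sum_congr rfl fun Z hZ => ?_
    rw [(Finset.mem_powersetCard.1 hZ).2]
  rw [h1]
  have h2 : ∀ Z ∈ J.powerset, W Z * (-Y j) ^ (J.card - Z.card) =
      ∑ A ∈ J.powerset, if A ⊆ Z then W' A * (∏ i ∈ Z \ A, Y i) * (-Y j) ^ (J.card - Z.card) else 0 := by
    intro Z hZ
    have hZ := Finset.mem_powerset.1 hZ
    rw [hW Z hZ, Finset.sum_mul, ← Finset.sum_filter]
    refine Finset.sum_congr ?_ fun _ _ => rfl
    ext A
    simp only [Finset.mem_powerset, Finset.mem_filter]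
    exact ⟨fun h => ⟨h.trans hZ, h⟩, fun h => h.2⟩
  rw [Finset.sum_congr rfl h2, Finset.sum_comm]
  have h3 : ∀ A ∈ J.powerset, (∑ Z ∈ J.powerset, if A ⊆ Z then
      W' A * (∏ i ∈ Z \ A, Y i) * (-Y j) ^ (J.card - Z.card) else 0) =
      W' A * ∏ k ∈ J \ A, (Y k - Y j) := by
    intro A hA
    have hA := Finset.mem_powerset.1 hA
    simp only [sub_eq_add_neg]
    -- Expanding `∏ (Y k - Y j)` over `J \ A` chooses the subset `Z \ A` on which `Y k` is taken;
    -- the remaining indices give the power of `-Y j`.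
    rw [Finset.prod_add, Finset.mul_sum, ← Finset.sum_filter]
    refine Finset.sum_bij' (fun Z _ => Z \ A) (fun B _ => B ∪ A) ?_ ?_ ?_ ?_ ?_
    · intro Z hZ
      simp only [Finset.mem_filter, Finset.mem_powerset] at hZ ⊢
      exact Finset.sdiff_subset_sdiff hZ.1 (Finset.Subset.refl _)
    · intro B hB
      simp only [Finset.mem_filter, Finset.mem_powerset] at hB ⊢
      exact ⟨Finset.union_subset (hB.trans Finset.sdiff_subset) hA, Finset.subset_union_right⟩
    · intro Z hZ
      simp only [Finset.mem_filter, Finset.mem_powerset] at hZ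
      exact Finset.sdiff_union_of_subset hZ.2
    · intro B hB
      simp only [Finset.mem_powerset] at hB
      rw [Finset.union_sdiff_right]
      exact Finset.sdiff_eq_self_of_disjoint (Finset.disjoint_of_subset_left hB
        Finset.sdiff_disjoint)
    · intro Z hZ
      simp only [Finset.mem_filter, Finset.mem_powerset] at hZ
      rw [Finset.prod_const, mul_assoc]
      congr 3
      rw [sdiff_sdiff_left, Finset.sup_eq_union, Finset.union_sdiff_of_subset hZ.2,
        Finset.card_sdiff_of_subset hZ.1]
  rw [Finset.sum_congr rfl h3]
  -- If `j ∉ A`, the factor `k = j` of the product is zero.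
  have h4 : ∑ A ∈ J.powerset, W' A * ∏ k ∈ J \ A, (Y k - Y j) =
      ∑ A ∈ J.powerset.filter (fun A => j ∈ A), W' A * ∏ k ∈ J \ A, (Y k - Y j) := by
    symm
    refine Finset.sum_subset (Finset.filter_subset _ _) fun A hA hA' => ?_
    have hjA : j ∉ A := fun h => hA' (Finset.mem_filter.2 ⟨hA, h⟩)
    rw [Finset.prod_eq_zero (Finset.mem_sdiff.2 ⟨hj, hjA⟩) (sub_self _), mul_zero]
  rw [h4]
  refine Finset.sum_bij' (fun A _ => A.erase j) (fun B _ => insert j B) ?_ ?_ ?_ ?_ ?_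
  · intro A hA
    simp only [Finset.mem_filter, Finset.mem_powerset] at hA ⊢
    exact Finset.erase_subset_erase _ hA.1
  · intro B hB
    simp only [Finset.mem_filter, Finset.mem_powerset] at hB ⊢
    exact ⟨Finset.insert_subset hj (hB.trans (Finset.erase_subset _ _)), Finset.mem_insert_self _ _⟩
  · intro A hA
    exact Finset.insert_erase (Finset.mem_filter.1 hA).2
  · intro B hB
    refine Finset.erase_insert fun h => ?_
    exact Finset.notMem_erase j J (Finset.mem_powerset.1 hB h)
  · intro A hA
    have hjA := (Finset.mem_filter.1 hA).2
    rw [Finset.insert_erase hjA]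
    congr 2
    ext k
    simp only [Finset.mem_sdiff, Finset.mem_erase]
    constructor
    · rintro ⟨h1, h2⟩
      exact ⟨⟨fun h => h2 (h ▸ hjA), h1⟩, fun h => h2 h.2⟩
    · rintro ⟨⟨h1, h2⟩, h3⟩
      exact ⟨h2, fun h => h3 ⟨h1, h⟩⟩

/-- The same sum with the Vandermonde factor pulled out. -/
theorem sum_powersetCard_mul_pow_eq_prod_mul (J : Finset ι) {j : ι} (hj : j ∈ J) (Y : ι → ℂ)
    (W W' : Finset ι → ℂ) (h0 : W' ∅ = 0)
    (hW : ∀ Z ⊆ J, W Z = ∑ A ∈ Z.powerset, W' A * ∏ i ∈ Z \ A, Y i)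
    (hY : ∀ k ∈ J.erase j, Y k ≠ Y j) :
    ∑ i ∈ Finset.Icc 1 J.card, (∑ Z ∈ J.powersetCard i, W Z) * (-Y j) ^ (J.card - i) =
      (∏ k ∈ J.erase j, (Y k - Y j)) *
        (W' {j} + ∑ A ∈ (J.erase j).powerset.filter Finset.Nonempty,
          W' (insert j A) / ∏ k ∈ A, (Y k - Y j)) := by
  rw [sum_powersetCard_mul_pow J hj Y W W' h0 hW, mul_add, Finset.mul_sum]
  have hne : ∀ A ⊆ J.erase j, ∏ k ∈ A, (Y k - Y j) ≠ 0 := fun A hA =>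
    Finset.prod_ne_zero_iff.2 fun k hk => sub_ne_zero.2 (hY k (hA hk))
  have hterm : ∀ A ∈ (J.erase j).powerset, W' (insert j A) * ∏ k ∈ (J.erase j) \ A, (Y k - Y j) =
      (∏ k ∈ J.erase j, (Y k - Y j)) * (W' (insert j A) / ∏ k ∈ A, (Y k - Y j)) := by
    intro A hA
    have hA := Finset.mem_powerset.1 hA
    rw [← Finset.prod_sdiff hA]
    have := hne A hA
    field_simp
  rw [Finset.sum_congr rfl hterm, ← Finset.sum_filter_add_sum_filter_not _ Finset.Nonempty,
    add_comm]
  congr 1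
  have : (J.erase j).powerset.filter (fun A => ¬ A.Nonempty) = {∅} := by
    ext A
    simp only [Finset.mem_filter, Finset.mem_powerset, Finset.not_nonempty_iff_eq_empty,
      Finset.mem_singleton]
    exact ⟨fun h => h.2, fun h => by simp [h]⟩
  rw [this, Finset.sum_singleton]
  simp

open Polynomial in
/-- Recovering coefficients from the values at the branches, by Lagrange interpolation. -/
theorem coeff_eq_sum_of_values (J : Finset ι) (Y : ι → ℂ) (hY : Set.InjOn Y J)
    (E : ℕ → ℂ) (c : ι → ℂ)
    (hc : ∀ j ∈ J, ∑ i ∈ Finset.Icc 1 J.card, E i * (-Y j) ^ (J.card - i) =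
      (∏ k ∈ J.erase j, (Y k - Y j)) * c j) {i : ℕ} (hi : i ∈ Finset.Icc 1 J.card) :
    E i = ∑ j ∈ J, c j * ∑ S ∈ (J.erase j).powersetCard (i - 1), ∏ k ∈ S, Y k := by
  set P : ℂ[X] := ∑ i ∈ Finset.Icc 1 J.card, C (E i) * X ^ (J.card - i) with hP
  -- The Lagrange interpolant at the nodes `-Y j`: there only the `j`-th summand survives, and its
  -- product is `∏ (Y k - Y j)`. Both polynomials have degree below `|J|`; for `P` this holds
  -- because its sum starts at `i = 1`.
  set Q : ℂ[X] := ∑ j ∈ J, C (c j) * ∏ k ∈ J.erase j, (X + C (Y k)) with hQ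
  have hmin : Set.InjOn (fun j => -Y j) (J : Set ι) := fun a ha b hb h => hY ha hb (neg_injective h)
  have hPQ : P = Q := by
    refine Polynomial.eq_of_degrees_lt_of_eval_index_eq J hmin ?_ ?_ ?_
    · rw [hP]
      refine lt_of_le_of_lt (Polynomial.degree_sum_le _ _) ?_
      rw [Finset.sup_lt_iff (WithBot.bot_lt_coe _)]
      intro i hi
      refine lt_of_le_of_lt (Polynomial.degree_C_mul_X_pow_le _ _) ?_
      have := Finset.mem_Icc.1 hi
      exact_mod_cast (by omega : J.card - i < J.card)
    · rw [hQ]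
      refine lt_of_le_of_lt (Polynomial.degree_sum_le _ _) ?_
      rw [Finset.sup_lt_iff (WithBot.bot_lt_coe _)]
      intro j hj
      refine lt_of_le_of_lt (Polynomial.degree_mul_le _ _) ?_
      refine lt_of_le_of_lt (add_le_add Polynomial.degree_C_le
        (Polynomial.degree_prod_le _ _)) ?_
      simp only [Polynomial.degree_X_add_C, Finset.sum_const, zero_add, nsmul_eq_mul, mul_one]
      rw [Finset.card_erase_of_mem hj]
      have := Finset.card_pos.2 ⟨j, hj⟩
      exact_mod_cast (by omega : J.card - 1 < J.card)
    · intro j hj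
      simp only [hP, hQ, Polynomial.eval_finsetSum, Polynomial.eval_mul, Polynomial.eval_C,
        Polynomial.eval_pow, Polynomial.eval_X, Polynomial.eval_prod, Polynomial.eval_add]
      rw [hc j hj, Finset.sum_eq_single_of_mem j hj]
      · rw [mul_comm]
        congr 1
        exact Finset.prod_congr rfl fun k _ => by ring
      · intro j' hj' hne
        rw [Finset.prod_eq_zero (Finset.mem_erase.2 ⟨hne.symm, hj⟩) (by ring), mul_zero]
  have hi' := Finset.mem_Icc.1 hi
  have h1 : P.coeff (J.card - i) = E i := by
    simp only [hP, Polynomial.finsetSum_coeff, Polynomial.coeff_C_mul_X_pow]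
    rw [Finset.sum_eq_single_of_mem i hi, if_pos rfl]
    intro i' hi2 hne
    have := Finset.mem_Icc.1 hi2
    rw [if_neg]; omega
  rw [← h1, hPQ]
  simp only [hQ, Polynomial.finsetSum_coeff, Polynomial.coeff_C_mul]
  refine Finset.sum_congr rfl fun j hj => ?_
  congr 1
  -- The coefficient of `X ^ (|J| - i)` in a product of `|J| - 1` linear factors is elementary
  -- symmetric of degree `i - 1`.
  rw [Finset.prod_X_add_C_coeff _ _ (by rw [Finset.card_erase_of_mem hj]; omega)]
  rw [Finset.card_erase_of_mem hj]
  congr 2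
  omega

end Algebra

end LoopEq
end

noncomputable section

namespace LoopEq

/-! ## Residues and orders of meromorphic germs at the origin -/

section Complex

open Asymptotics Complex

theorem exists_differentiable_punctured {f : ℂ → ℂ} (hf : MeromorphicAt f 0) :
    ∃ R > 0, ∀ u : ℂ, u ≠ 0 → ‖u‖ < R → DifferentiableAt ℂ f u := by
  have h := hf.eventually_analyticAt
  rw [eventually_nhdsWithin_iff, Metric.eventually_nhds_iff] at h
  obtain ⟨R, hR, h⟩ := h
  exact ⟨R, hR, fun u hu huR => (h (by simpa using huR) hu).differentiableAt⟩

theorem circleIntegrable_of_punctured {f : ℂ → ℂ} {R : ℝ}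
    (hd : ∀ u : ℂ, u ≠ 0 → ‖u‖ < R → DifferentiableAt ℂ f u) {ρ : ℝ} (h0 : 0 < ρ) (hρ : ρ < R) :
    CircleIntegrable f 0 ρ := by
  refine ContinuousOn.circleIntegrable h0.le fun u hu => ?_
  have hu' : ‖u‖ = ρ := by simpa using hu
  refine (hd u ?_ (hu' ▸ hρ)).continuousAt.continuousWithinAt
  rw [← norm_pos_iff, hu']; exact h0

theorem circleIntegral_eq_of_punctured {f : ℂ → ℂ} {R : ℝ}
    (hd : ∀ u : ℂ, u ≠ 0 → ‖u‖ < R → DifferentiableAt ℂ f u) {ρ ρ' : ℝ} (h0 : 0 < ρ)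
    (hle : ρ ≤ ρ') (hρ : ρ' < R) : (∮ u in C(0, ρ'), f u) = ∮ u in C(0, ρ), f u := by
  refine circleIntegral_eq_of_differentiable_on_annulus_off_countable h0 hle
    Set.countable_empty (fun u hu => ?_) fun u hu => ?_
  · have h1 : ‖u‖ ≤ ρ' := by simpa using hu.1
    have h2 : ρ ≤ ‖u‖ := by simpa using hu.2
    exact (hd u (norm_pos_iff.1 (h0.trans_le h2)) (h1.trans_lt hρ)).continuousAt.continuousWithinAt
  · have h1 : ‖u‖ < ρ' := by simpa using hu.1.1
    have h2 : ρ < ‖u‖ := by simpa using hu.1.2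
    exact hd u (norm_pos_iff.1 (h0.trans h2)) (h1.trans hρ)

/-- By Cauchy's theorem on an annulus the integrals in the definition of `res` do not depend on
small radii, so the limit is attained at any circle inside the punctured disc of holomorphy. -/
theorem res_eq_circleIntegral {f : ℂ → ℂ} {R : ℝ}
    (hd : ∀ u : ℂ, u ≠ 0 → ‖u‖ < R → DifferentiableAt ℂ f u) {ρ : ℝ} (h0 : 0 < ρ) (hρ : ρ < R) :
    res f = (2 * (Real.pi : ℂ) * Complex.I)⁻¹ * ∮ u in C(0, ρ), f u := by
  refine Tendsto.limUnder_eq (tendsto_const_nhds.congr' ?_)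
  filter_upwards [Ioo_mem_nhdsGT (h0.trans hρ)] with ρ' hρ'
  congr 1
  rcases le_total ρ ρ' with h | h
  · exact (circleIntegral_eq_of_punctured hd h0 h hρ'.2).symm
  · exact circleIntegral_eq_of_punctured hd hρ'.1 h hρ

theorem res_congr {f g : ℂ → ℂ} (h : f =ᶠ[𝓝[≠] 0] g) : res f = res g := by
  have : (fun ρ : ℝ => (2 * (Real.pi : ℂ) * Complex.I)⁻¹ * ∮ u in C(0, ρ), f u) =ᶠ[𝓝[>] (0 : ℝ)]
      fun ρ : ℝ => (2 * (Real.pi : ℂ) * Complex.I)⁻¹ * ∮ u in C(0, ρ), g u := by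
    rw [EventuallyEq, eventually_nhdsWithin_iff, Metric.eventually_nhds_iff] at h
    obtain ⟨R, hR, h⟩ := h
    filter_upwards [Ioo_mem_nhdsGT hR] with ρ hρ
    congr 1
    refine circleIntegral.integral_congr hρ.1.le fun u hu => ?_
    have hu' : ‖u‖ = ρ := by simpa using hu
    refine h (by simpa [hu'] using hρ.2) ?_
    exact norm_pos_iff.1 (hu' ▸ hρ.1)
  rw [res, res, limUnder, limUnder, Filter.map_congr this]

theorem res_add {f g : ℂ → ℂ} (hf : MeromorphicAt f 0) (hg : MeromorphicAt g 0) :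
    res (fun u => f u + g u) = res f + res g := by
  obtain ⟨R, hR, hdf⟩ := exists_differentiable_punctured hf
  obtain ⟨R', hR', hdg⟩ := exists_differentiable_punctured hg
  obtain ⟨ρ, h0, hρ⟩ := exists_between (lt_min hR hR')
  have hρ1 := hρ.trans_le (min_le_left _ _)
  have hρ2 := hρ.trans_le (min_le_right _ _)
  rw [res_eq_circleIntegral hdf h0 hρ1, res_eq_circleIntegral hdg h0 hρ2,
    res_eq_circleIntegral (f := fun u => f u + g u) (R := min R R') _ h0 hρ, ← mul_add,
    circleIntegral.integral_add (circleIntegrable_of_punctured hdf h0 hρ1)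
      (circleIntegrable_of_punctured hdg h0 hρ2)]
  intro u hu huR
  exact (hdf u hu (huR.trans_le (min_le_left _ _))).add (hdg u hu (huR.trans_le (min_le_right _ _)))

theorem res_const_mul {f : ℂ → ℂ} (hf : MeromorphicAt f 0) (c : ℂ) :
    res (fun u => c * f u) = c * res f := by
  obtain ⟨R, hR, hdf⟩ := exists_differentiable_punctured hf
  obtain ⟨ρ, h0, hρ⟩ := exists_between hR
  rw [res_eq_circleIntegral hdf h0 hρ, res_eq_circleIntegral (f := fun u => c * f u) (R := R) _ h0 hρ,
    circleIntegral.integral_const_mul]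
  · ring
  · intro u hu huR
    exact (hdf u hu huR).const_mul c

theorem res_sum {ι : Type*} (s : Finset ι) {f : ι → ℂ → ℂ}
    (hf : ∀ i ∈ s, MeromorphicAt (f i) 0) :
    res (fun u => ∑ i ∈ s, f i u) = ∑ i ∈ s, res (f i) := by
  classical
  induction s using Finset.induction_on with
  | empty =>
    have := res_const_mul (MeromorphicAt.const (0 : ℂ) (0 : ℂ)) 0
    simpa using this
  | insert i s hi ih =>
    rw [Finset.sum_insert hi, ← ih fun j hj => hf j (Finset.mem_insert_of_mem hj),
      ← res_add (hf i (Finset.mem_insert_self _ _))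
        (MeromorphicAt.fun_sum fun j hj => hf j (Finset.mem_insert_of_mem hj))]
    simp only [Finset.sum_insert hi]

/-- The contour integral of a bounded function is at most a constant times the radius. -/
theorem res_eq_zero_of_isBigO_one {f : ℂ → ℂ} (hf : MeromorphicAt f 0)
    (hb : f =O[𝓝[≠] 0] (fun _ => (1 : ℂ))) : res f = 0 := by
  obtain ⟨R, hR, hdf⟩ := exists_differentiable_punctured hf
  obtain ⟨C, hC⟩ := hb.bound
  rw [eventually_nhdsWithin_iff, Metric.eventually_nhds_iff] at hC
  obtain ⟨R', hR', hC⟩ := hC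
  have hle : ∀ᶠ ρ : ℝ in 𝓝[>] 0, ‖res f‖ ≤ ρ * C := by
    filter_upwards [Ioo_mem_nhdsGT (lt_min hR hR')] with ρ hρ
    rw [res_eq_circleIntegral hdf hρ.1 (hρ.2.trans_le (min_le_left _ _)), ← smul_eq_mul]
    refine circleIntegral.norm_two_pi_i_inv_smul_integral_le_of_norm_le_const hρ.1.le fun u hu => ?_
    have hu' : ‖u‖ = ρ := by simpa using hu
    have := hC (y := u) (by simpa [hu'] using hρ.2.trans_le (min_le_right _ _))
      (norm_pos_iff.1 (hu' ▸ hρ.1))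
    simpa using this
  have hlim : Tendsto (fun ρ : ℝ => ρ * C) (𝓝[>] 0) (𝓝 0) := by
    have : Tendsto (fun ρ : ℝ => ρ * C) (𝓝 0) (𝓝 (0 * C)) := (continuous_id.mul continuous_const).tendsto 0
    rw [zero_mul] at this
    exact this.mono_left nhdsWithin_le_nhds
  exact norm_le_zero_iff.1 (ge_of_tendsto hlim hle)

theorem meromorphicAt_zpow (k : ℤ) : MeromorphicAt (fun u : ℂ => u ^ k) 0 :=
  (MeromorphicAt.id (0 : ℂ)).zpow k

theorem meromorphicOrderAt_zpow_id (k : ℤ) :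
    meromorphicOrderAt (fun u : ℂ => u ^ k) 0 = k :=
  (meromorphicOrderAt_eq_int_iff (meromorphicAt_zpow k)).2
    ⟨fun _ => 1, analyticAt_const, one_ne_zero, by simp⟩

theorem isBigO_one_iff_order_nonneg {f : ℂ → ℂ} (hf : MeromorphicAt f 0) :
    f =O[𝓝[≠] 0] (fun _ => (1 : ℂ)) ↔ 0 ≤ meromorphicOrderAt f 0 := by
  constructor
  · intro h
    by_contra hlt
    rw [not_le] at hlt
    have h1 := (tendsto_cobounded_of_meromorphicOrderAt_neg hlt)
    rw [← tendsto_norm_atTop_iff_cobounded] at h1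
    obtain ⟨C, hC⟩ := h.bound
    obtain ⟨u, hu1, hu2⟩ := (hC.and (h1.eventually (eventually_gt_atTop C))).exists
    simp at hu1
    linarith
  · intro h
    obtain ⟨c, hc⟩ := tendsto_nhds_of_meromorphicOrderAt_nonneg hf h
    exact hc.isBigO_one ℂ

theorem isBigO_zpow_iff_isBigO_one {f : ℂ → ℂ} (k : ℤ) :
    f =O[𝓝[≠] 0] (fun u => u ^ k) ↔ (fun u => f u * u ^ (-k)) =O[𝓝[≠] 0] (fun _ => (1 : ℂ)) := by
  have hne : ∀ᶠ u : ℂ in 𝓝[≠] 0, u ≠ 0 := self_mem_nhdsWithin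
  constructor
  · intro h
    refine (h.mul (isBigO_refl (fun u : ℂ => u ^ (-k)) _)).congr' EventuallyEq.rfl ?_
    filter_upwards [hne] with u hu
    rw [← zpow_add₀ hu]; simp
  · intro h
    refine (h.mul (isBigO_refl (fun u : ℂ => u ^ k) _)).congr' ?_ ?_
    · filter_upwards [hne] with u hu
      rw [mul_assoc, ← zpow_add₀ hu]; simp
    · filter_upwards with u; simp

/-- The dictionary between growth bounds, in which the loop equations are stated, and orders of
meromorphic germs, which are integers. -/
theorem isBigO_zpow_iff_le_order {f : ℂ → ℂ} (hf : MeromorphicAt f 0) (k : ℤ) :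
    f =O[𝓝[≠] 0] (fun u => u ^ k) ↔ (k : WithTop ℤ) ≤ meromorphicOrderAt f 0 := by
  have hm : MeromorphicAt (fun u => f u * u ^ (-k)) 0 := hf.mul (meromorphicAt_zpow (-k))
  rw [isBigO_zpow_iff_isBigO_one, isBigO_one_iff_order_nonneg hm]
  have : meromorphicOrderAt (fun u => f u * u ^ (-k)) 0 =
      meromorphicOrderAt f 0 + ((-k : ℤ) : WithTop ℤ) := by
    rw [← meromorphicOrderAt_zpow_id (-k)]
    exact meromorphicOrderAt_mul hf (meromorphicAt_zpow (-k))
  rw [this]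
  cases h : meromorphicOrderAt f 0 with
  | top => simp
  | coe n =>
    rw [← WithTop.coe_add, WithTop.coe_le_coe, ← WithTop.coe_zero, WithTop.coe_le_coe]
    omega

theorem zpow_isBigO_zpow_iff {a b : ℤ} :
    (fun u : ℂ => u ^ a) =O[𝓝[≠] 0] (fun u => u ^ b) ↔ b ≤ a := by
  rw [isBigO_zpow_iff_le_order (meromorphicAt_zpow a), meromorphicOrderAt_zpow_id]
  exact WithTop.coe_le_coe

/-- A pole of order greater than `K` has its leading coefficient detected by a residue against `u ^
k` with `k ≥ K`. -/
theorem isBigO_of_res_pow_mul_eq_zero {f : ℂ → ℂ} (hf : MeromorphicAt f 0) (K : ℕ)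
    (h : ∀ k : ℕ, K ≤ k → res (fun u => u ^ k * f u) = 0) :
    f =O[𝓝[≠] 0] (fun u => u ^ (-(K : ℤ))) := by
  rw [isBigO_zpow_iff_le_order hf]
  by_contra hlt
  rw [not_le] at hlt
  obtain ⟨n, hn⟩ := WithTop.ne_top_iff_exists.1 hlt.ne_top
  rw [← hn, WithTop.coe_lt_coe] at hlt
  obtain ⟨g, hg, hg0, hfg⟩ := (meromorphicOrderAt_eq_int_iff hf).1 hn.symm
  obtain ⟨k, hk⟩ := Int.eq_ofNat_of_zero_le (show (0 : ℤ) ≤ -n - 1 by omega)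
  have hkK : K ≤ k := by omega
  have h1 := h k hkK
  have h2 : (fun u => u ^ k * f u) =ᶠ[𝓝[≠] 0] fun u => (u - 0)⁻¹ • g u := by
    filter_upwards [hfg, self_mem_nhdsWithin] with u hu hu0
    rw [hu, sub_zero, smul_eq_mul, smul_eq_mul, ← mul_assoc, ← zpow_natCast, ← zpow_add₀ hu0, ← hk,
      ← zpow_neg_one]
    congr 2; ring
  rw [res_congr h2] at h1
  obtain ⟨R, hR, hgR⟩ := Metric.eventually_nhds_iff.1 hg.eventually_analyticAt
  obtain ⟨ρ, h0, hρ⟩ := exists_between hR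
  rw [res_eq_circleIntegral (R := R) _ h0 hρ] at h1
  · have hdg : DifferentiableOn ℂ g (Metric.closedBall 0 ρ) := fun u hu =>
      (hgR (lt_of_le_of_lt hu hρ)).differentiableAt.differentiableWithinAt
    rw [hdg.circleIntegral_sub_inv_smul (Metric.mem_ball_self h0)] at h1
    have : (2 * (Real.pi : ℂ) * Complex.I) ≠ 0 := Complex.two_pi_I_ne_zero
    rw [smul_eq_mul, inv_mul_cancel_left₀ this] at h1
    exact hg0 h1
  · intro u hu huR
    have h3 : DifferentiableAt ℂ (fun u : ℂ => (u - 0)⁻¹) u :=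
      (differentiableAt_id.sub_const 0).inv (by simpa using hu)
    exact h3.smul (hgR (by simpa using huR)).differentiableAt

/-- The map `u ↦ a u ^ m` wraps the circle `m` times around one of radius `ρ ^ m`; the phase of `a`
only shifts the starting point, which is irrelevant by periodicity. -/
theorem circleIntegral_comp_mul_pow (f : ℂ → ℂ) {a : ℂ} (ha : ‖a‖ = 1) {m : ℕ} (hm : m ≠ 0) {ρ : ℝ}
    (hρ : 0 ≤ ρ) (hc : ContinuousOn f (Metric.sphere 0 (ρ ^ m))) :
    (∮ u in C(0, ρ), f (a * u ^ m) * (a * m * u ^ (m - 1))) = m * ∮ u in C(0, ρ ^ m), f u := by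
  obtain ⟨φ, rfl⟩ : ∃ φ : ℝ, a = Complex.exp (φ * Complex.I) := by
    refine ⟨Complex.arg a, ?_⟩
    have := Complex.norm_mul_exp_arg_mul_I a
    rw [ha] at this
    simpa using this.symm
  set G : ℝ → ℂ := fun t => circleMap 0 (ρ ^ m) t * Complex.I * f (circleMap 0 (ρ ^ m) t) with hG
  have hper : Function.Periodic G (2 * Real.pi) := by
    intro t
    simp only [hG, periodic_circleMap 0 (ρ ^ m) t]
  have hGc : Continuous G := by
    refine (by fun_prop : Continuous fun t : ℝ => circleMap 0 (ρ ^ m) t * Complex.I).mul ?_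
    exact hc.comp_continuous (continuous_circleMap 0 (ρ ^ m)) fun t =>
      circleMap_mem_sphere 0 (pow_nonneg hρ m) t
  have hcm : ∀ t : ℝ, Complex.exp (φ * Complex.I) * circleMap 0 ρ t ^ m =
      circleMap 0 (ρ ^ m) (m * t + φ) := by
    intro t
    simp only [circleMap, zero_add, mul_pow, ← Complex.exp_nat_mul]
    push_cast
    rw [show ((m : ℂ) * t + φ) * Complex.I = φ * Complex.I + m * (t * Complex.I) by ring, Complex.exp_add]
    ring
  have hint : ∀ t : ℝ, deriv (circleMap 0 ρ) t • (f (Complex.exp (φ * Complex.I) * circleMap 0 ρ t ^ m) *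
      (Complex.exp (φ * Complex.I) * m * circleMap 0 ρ t ^ (m - 1))) = m * G (m * t + φ) := by
    intro t
    rw [deriv_circleMap, smul_eq_mul, hG]
    dsimp only
    rw [← hcm t]
    obtain ⟨m', rfl⟩ := Nat.exists_eq_succ_of_ne_zero hm
    simp only [Nat.succ_eq_add_one, Nat.add_sub_cancel, pow_succ]
    ring
  simp only [circleIntegral, hint]
  rw [intervalIntegral.integral_const_mul]
  congr 1
  rw [intervalIntegral.integral_comp_mul_add G (Nat.cast_ne_zero.2 hm) φ]
  -- An interval of length `2π m` is `m` full periods.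
  have h1 : ∫ x in (m : ℝ) * 0 + φ..(m : ℝ) * (2 * Real.pi) + φ, G x =
      (m : ℤ) • ∫ x in φ..φ + 2 * Real.pi, G x := by
    rw [← hper.intervalIntegral_add_zsmul_eq]
    congr 1
    · ring
    · simp; ring
    · exact fun _ _ => hGc.intervalIntegrable _ _
  rw [h1, hper.intervalIntegral_add_eq φ 0, zero_add]
  simp only [hG, deriv_circleMap, smul_eq_mul]
  rw [natCast_zsmul, ← Nat.cast_smul_eq_nsmul ℝ, inv_smul_smul₀ (Nat.cast_ne_zero.2 hm)]

theorem res_comp_mul_pow {f : ℂ → ℂ} (hf : MeromorphicAt f 0) {a : ℂ} (ha : ‖a‖ = 1) {m : ℕ}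
    (hm : m ≠ 0) :
    res (fun u => f (a * u ^ m) * (a * m * u ^ (m - 1))) = m * res f := by
  obtain ⟨R, hR, hd⟩ := exists_differentiable_punctured hf
  -- A radius below `1`, so that `t ^ m ≤ t` stays inside the disc where `f` is holomorphic.
  obtain ⟨R₁, hR₁0, hR₁⟩ := exists_between (lt_min hR one_pos)
  obtain ⟨ρ, h0, hρ⟩ := exists_between hR₁0
  have hR1 : R₁ < 1 := hR₁.trans_le (min_le_right _ _)
  have hRR : R₁ < R := hR₁.trans_le (min_le_left _ _)
  have hpow : ∀ t : ℝ, 0 ≤ t → t < R₁ → t ^ m < R := by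
    intro t ht htR
    exact (pow_le_of_le_one ht (htR.trans hR1).le hm).trans_lt (htR.trans hRR)
  rw [res_eq_circleIntegral (R := R₁) _ h0 hρ, circleIntegral_comp_mul_pow f ha hm h0.le,
    res_eq_circleIntegral hd (pow_pos h0 m) (hpow ρ h0.le hρ)]
  · ring
  · intro u hu
    have hu' : ‖u‖ = ρ ^ m := by simpa using hu
    exact (hd u (norm_pos_iff.1 (hu' ▸ pow_pos h0 m)) (hu' ▸ hpow ρ h0.le hρ)).continuousAt.continuousWithinAt
  · intro u hu huR
    have ha0 : a ≠ 0 := norm_pos_iff.1 (by rw [ha]; exact one_pos)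
    have h1 : DifferentiableAt ℂ f (a * u ^ m) := by
      refine hd _ (mul_ne_zero ha0 (pow_ne_zero _ hu)) ?_
      rw [norm_mul, ha, one_mul, norm_pow]
      exact hpow _ (norm_nonneg _) huR
    refine DifferentiableAt.mul ?_ (by fun_prop)
    exact DifferentiableAt.comp u (g := f) (f := fun u => a * u ^ m) h1 (by fun_prop)

theorem tendsto_mul_pow_nhdsNE {a : ℂ} (ha : a ≠ 0) {m : ℕ} (hm : m ≠ 0) :
    Tendsto (fun u : ℂ => a * u ^ m) (𝓝[≠] 0) (𝓝[≠] 0) := by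
  refine tendsto_nhdsWithin_iff.2 ⟨?_, ?_⟩
  · have : Tendsto (fun u : ℂ => a * u ^ m) (𝓝 0) (𝓝 (a * 0 ^ m)) :=
      (by fun_prop : Continuous fun u : ℂ => a * u ^ m).tendsto 0
    rw [zero_pow hm, mul_zero] at this
    exact this.mono_left nhdsWithin_le_nhds
  · filter_upwards [self_mem_nhdsWithin] with u hu
    exact mul_ne_zero ha (pow_ne_zero _ hu)

/-- Equality, not just convergence: every small `τ ≠ 0` has an `m`-th root, which is small too.
Hence asymptotics can be moved along a power map in both directions. -/
theorem map_mul_pow_nhdsNE {a : ℂ} (ha : a ≠ 0) {m : ℕ} (hm : m ≠ 0) :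
    Filter.map (fun u : ℂ => a * u ^ m) (𝓝[≠] 0) = 𝓝[≠] 0 := by
  refine le_antisymm (tendsto_mul_pow_nhdsNE ha hm) fun s hs => ?_
  rw [Filter.mem_map, mem_nhdsWithin_iff_eventually, Metric.eventually_nhds_iff] at hs
  obtain ⟨ε, hε, hs⟩ := hs
  rw [mem_nhdsWithin_iff_eventually, Metric.eventually_nhds_iff]
  have hna := norm_pos_iff.2 ha
  refine ⟨‖a‖ * ε ^ m, mul_pos hna (pow_pos hε m), fun τ hτ hτ0 => ?_⟩
  obtain ⟨u, hu⟩ := IsAlgClosed.exists_pow_nat_eq (τ / a) (Nat.pos_of_ne_zero hm)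
  have hau : a * u ^ m = τ := by rw [hu, mul_div_cancel₀ _ ha]
  have hu0 : u ≠ 0 := by
    rintro rfl
    rw [zero_pow hm, mul_zero] at hau
    exact hτ0 hau.symm
  have hlt : ‖u‖ < ε := by
    have h1 : ‖a‖ * ‖u‖ ^ m < ‖a‖ * ε ^ m := by
      rw [← norm_pow, ← norm_mul, hau]; simpa using hτ
    exact lt_of_pow_lt_pow_left₀ m hε.le (lt_of_mul_lt_mul_left h1 hna.le)
  have := hs (y := u) (by simpa using hlt) hu0
  simp only [Set.mem_preimage] at this
  rwa [hau] at this

theorem map_pow_nhdsNE {m : ℕ} (hm : m ≠ 0) :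
    Filter.map (fun u : ℂ => u ^ m) (𝓝[≠] 0) = 𝓝[≠] 0 := by
  simpa using map_mul_pow_nhdsNE one_ne_zero hm

theorem isBigO_zpow_comp_pow_iff {f : ℂ → ℂ} {m : ℕ} (hm : m ≠ 0) (e : ℤ) :
    (fun u => f (u ^ m)) =O[𝓝[≠] 0] (fun u : ℂ => u ^ ((m : ℤ) * e)) ↔
      f =O[𝓝[≠] 0] (fun u : ℂ => u ^ e) := by
  conv_rhs => rw [← map_pow_nhdsNE hm, isBigO_map]
  simp only [zpow_mul, zpow_natCast]
  rfl

/-- Off the origin the power map is a local biholomorphism, so `f` is holomorphic there. Its growth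
is polynomial, and after multiplication by a power of `τ` the singularity is removable. -/
theorem meromorphicAt_of_comp_pow {f : ℂ → ℂ} {m : ℕ} (hm : m ≠ 0)
    (hf : MeromorphicAt (fun u => f (u ^ m)) 0) : MeromorphicAt f 0 := by
  have han : ∀ᶠ τ in 𝓝[≠] (0 : ℂ), DifferentiableAt ℂ f τ := by
    rw [← map_pow_nhdsNE hm, eventually_map]
    filter_upwards [hf.eventually_analyticAt, self_mem_nhdsWithin] with u hu hu0
    have hd : deriv (fun u : ℂ => u ^ m) u ≠ 0 := by
      rw [deriv_pow_field]
      exact mul_ne_zero (Nat.cast_ne_zero.2 hm) (pow_ne_zero _ hu0)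
    have : AnalyticAt ℂ (f ∘ fun u : ℂ => u ^ m) u := hu
    rw [analyticAt_comp_iff_of_deriv_ne_zero (by fun_prop) hd] at this
    exact this.differentiableAt
  obtain ⟨k, hk⟩ : ∃ k : ℤ, (k : WithTop ℤ) ≤ meromorphicOrderAt (fun u => f (u ^ m)) 0 := by
    cases h : meromorphicOrderAt (fun u => f (u ^ m)) 0 with
    | top => exact ⟨0, le_top⟩
    | coe n => exact ⟨n, le_rfl⟩
  -- One more than the bound for the pole order, so that `τ ^ l * f τ` tends to `0` and extends
  -- continuously by `0`.
  set l : ℕ := k.natAbs + 1 with hl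
  have hO : f =O[𝓝[≠] 0] fun u : ℂ => u ^ (-(k.natAbs : ℤ)) := by
    rw [← isBigO_zpow_comp_pow_iff hm, isBigO_zpow_iff_le_order hf]
    refine le_trans (WithTop.coe_le_coe.2 ?_) hk
    have h1 : (1 : ℤ) ≤ m := by exact_mod_cast Nat.one_le_iff_ne_zero.2 hm
    nlinarith [neg_abs_le k, Int.natCast_natAbs k, abs_nonneg k]
  set g : ℂ → ℂ := fun τ => τ ^ l * f τ with hg
  have hlim : Tendsto g (𝓝[≠] 0) (𝓝 0) := by
    have h1 : g =O[𝓝[≠] 0] fun u : ℂ => u := by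
      refine ((isBigO_refl (fun u : ℂ => u ^ l) _).mul hO).congr' EventuallyEq.rfl ?_
      filter_upwards [self_mem_nhdsWithin] with u hu
      rw [← zpow_natCast, ← zpow_add₀ hu, hl]
      simp
    exact h1.trans_tendsto (tendsto_id.mono_left nhdsWithin_le_nhds)
  set g' : ℂ → ℂ := Function.update g 0 0 with hg'
  have heq : ∀ τ : ℂ, τ ≠ 0 → g' =ᶠ[𝓝 τ] g := by
    intro τ hτ
    filter_upwards [isOpen_ne.mem_nhds hτ] with u hu
    exact Function.update_of_ne hu _ _
  have hgan : AnalyticAt ℂ g' 0 := by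
    refine Complex.analyticAt_of_differentiable_on_punctured_nhds_of_continuousAt ?_ ?_
    · filter_upwards [han, self_mem_nhdsWithin] with τ hτ hτ0
      refine DifferentiableAt.congr_of_eventuallyEq ?_ (heq τ hτ0)
      exact (by fun_prop : DifferentiableAt ℂ (fun τ : ℂ => τ ^ l) τ).mul hτ
    · exact continuousAt_update_same.2 hlim
  refine (((meromorphicAt_zpow (-(l : ℤ))).mul hgan.meromorphicAt)).congr ?_
  filter_upwards [self_mem_nhdsWithin] with τ hτ
  simp only [Pi.mul_apply, hg', hg]
  rw [Function.update_of_ne hτ, zpow_neg, zpow_natCast, inv_mul_cancel_left₀ (pow_ne_zero _ hτ)]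

/-- The order of the pullback is `N` times an integer. A bound that exceeds `N (k - 1)` by any
amount therefore forces the order of `f` to be at least `k`. -/
theorem isBigO_zpow_of_comp_pow {f : ℂ → ℂ} (hf : MeromorphicAt f 0) {N : ℕ} (hN : N ≠ 0) {e k : ℤ}
    (he : (fun u => f (u ^ N)) =O[𝓝[≠] 0] (fun u : ℂ => u ^ e)) (hk : (N : ℤ) * (k - 1) < e) :
    f =O[𝓝[≠] 0] (fun u : ℂ => u ^ k) := by
  rw [isBigO_zpow_iff_le_order hf]
  by_contra hlt
  rw [not_le] at hlt
  obtain ⟨n, hn⟩ := WithTop.ne_top_iff_exists.1 hlt.ne_top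
  rw [← hn, WithTop.coe_lt_coe] at hlt
  have h1 : (fun u : ℂ => u ^ n) =O[𝓝[≠] 0] f := by
    obtain ⟨g, hg, hg0, hfg⟩ := (meromorphicOrderAt_eq_int_iff hf).1 hn.symm
    have hgi : (fun u => (g u)⁻¹) =O[𝓝[≠] 0] fun _ => (1 : ℂ) :=
      ((hg.continuousAt.inv₀ hg0).tendsto.mono_left nhdsWithin_le_nhds).isBigO_one ℂ
    have hgne : ∀ᶠ u in 𝓝[≠] (0 : ℂ), g u ≠ 0 :=
      (hg.continuousAt.eventually_ne hg0).filter_mono nhdsWithin_le_nhds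
    refine ((isBigO_refl f (𝓝[≠] 0)).mul hgi).congr' ?_ (by filter_upwards with u; simp)
    filter_upwards [hfg, hgne] with u hu hgu
    rw [hu, sub_zero, smul_eq_mul, mul_assoc, mul_inv_cancel₀ hgu, mul_one]
  have h2 : (fun u : ℂ => (u ^ N) ^ n) =O[𝓝[≠] 0] fun u => f (u ^ N) := by
    rw [← map_pow_nhdsNE hN, isBigO_map] at h1
    exact h1
  have h3 := h2.trans he
  have h4 : (fun u : ℂ => u ^ ((N : ℤ) * n)) =O[𝓝[≠] 0] (fun u : ℂ => u ^ e) := by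
    simpa only [zpow_mul, zpow_natCast] using h3
  rw [zpow_isBigO_zpow_iff] at h4
  have : (N : ℤ) * n ≤ N * (k - 1) := mul_le_mul_of_nonneg_left (by omega) (by positivity)
  omega

end Complex

end LoopEq
end

noncomputable section

namespace LoopEq

/-! ## Coordinate vectors -/

section Charts

variable {Ct : Type*} [TopologicalSpace Ct] [ChartedSpace ℂ Ct]

/-- A tangent vector multiplied by a scalar. -/
def smulVec (c : ℂ) (v : TangentBundle 𝓘(ℂ) Ct) : TangentBundle 𝓘(ℂ) Ct :=
  ⟨v.proj, c • v.snd⟩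

theorem smulVec_proj (c : ℂ) (v : TangentBundle 𝓘(ℂ) Ct) : (smulVec c v).proj = v.proj := rfl

theorem smulVec_smulVec (c d : ℂ) (v : TangentBundle 𝓘(ℂ) Ct) :
    smulVec c (smulVec d v) = smulVec (c * d) v := by
  refine Bundle.TotalSpace.ext rfl (heq_of_eq ?_)
  exact (mul_smul c d v.snd).symm

/-- The component of a tangent vector in the preferred chart at its base point. -/
def vecCoord (v : TangentBundle 𝓘(ℂ) Ct) : ℂ := v.snd

theorem vecCoord_smulVec (c : ℂ) (v : TangentBundle 𝓘(ℂ) Ct) :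
    vecCoord (smulVec c v) = c * vecCoord v := rfl

theorem vec_ext {v w : TangentBundle 𝓘(ℂ) Ct} (h1 : v.proj = w.proj)
    (h2 : vecCoord v = vecCoord w) : v = w :=
  Bundle.TotalSpace.ext h1 (heq_of_eq h2)

theorem coordVec_proj (φ : OpenPartialHomeomorph Ct ℂ) (u : ℂ) : (coordVec φ u).proj = φ.symm u :=
  rfl

theorem analyticAt_transition {φ ψ : OpenPartialHomeomorph Ct ℂ}
    (hφ : φ ∈ IsManifold.maximalAtlas 𝓘(ℂ) ⊤ Ct) (hψ : ψ ∈ IsManifold.maximalAtlas 𝓘(ℂ) ⊤ Ct)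
    {u : ℂ} (hu : u ∈ ψ.target) (hu' : ψ.symm u ∈ φ.source) :
    AnalyticAt ℂ (fun v => φ (ψ.symm v)) u := by
  have h1 := (contMDiffAt_of_mem_maximalAtlas hφ hu').comp u
    (contMDiffAt_symm_of_mem_maximalAtlas hψ hu)
  exact ContDiffAt.analyticAt (contMDiffAt_iff_contDiffAt.1 h1)

theorem mdifferentiableAt_symm {ψ : OpenPartialHomeomorph Ct ℂ}
    (hψ : ψ ∈ IsManifold.maximalAtlas 𝓘(ℂ) ⊤ Ct) {u : ℂ} (hu : u ∈ ψ.target) :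
    MDifferentiableAt 𝓘(ℂ) 𝓘(ℂ) ψ.symm u :=
  (contMDiffAt_symm_of_mem_maximalAtlas hψ hu).mdifferentiableAt (by simp)

theorem mdifferentiableAt_chart {ψ : OpenPartialHomeomorph Ct ℂ}
    (hψ : ψ ∈ IsManifold.maximalAtlas 𝓘(ℂ) ⊤ Ct) {p : Ct} (hp : p ∈ ψ.source) :
    MDifferentiableAt 𝓘(ℂ) 𝓘(ℂ) ψ p :=
  (contMDiffAt_of_mem_maximalAtlas hψ hp).mdifferentiableAt (by simp)

theorem tangentMap_congr_of_eventuallyEq {f g : ℂ → Ct} {u : ℂ} (h : f =ᶠ[𝓝 u] g)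
    (a : ℂ) :
    tangentMap 𝓘(ℂ) 𝓘(ℂ) f (⟨u, a⟩ : TangentBundle 𝓘(ℂ) ℂ) =
      tangentMap 𝓘(ℂ) 𝓘(ℂ) g (⟨u, a⟩ : TangentBundle 𝓘(ℂ) ℂ) := by
  have h1 : f u = g u := h.eq_of_nhds
  have h2 := h.mfderiv_eq (I := 𝓘(ℂ)) (I' := 𝓘(ℂ))
  refine Bundle.TotalSpace.ext h1 (heq_of_eq ?_)
  have h3 := congrArg (fun L : ℂ →L[ℂ] ℂ => L a) h2
  exact h3

/-- Change of coordinates. -/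
theorem coordVec_eq_smulVec {φ ψ : OpenPartialHomeomorph Ct ℂ}
    (hφ : φ ∈ IsManifold.maximalAtlas 𝓘(ℂ) ⊤ Ct) (hψ : ψ ∈ IsManifold.maximalAtlas 𝓘(ℂ) ⊤ Ct)
    {u : ℂ} (hu : u ∈ ψ.target) (hu' : ψ.symm u ∈ φ.source) :
    coordVec ψ u = smulVec (deriv (fun v => φ (ψ.symm v)) u) (coordVec φ (φ (ψ.symm u))) := by
  have htr := analyticAt_transition hφ hψ hu hu'
  have hev : (ψ.symm : ℂ → Ct) =ᶠ[𝓝 u] φ.symm ∘ fun v => φ (ψ.symm v) := by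
    filter_upwards [(ψ.continuousAt_symm hu).eventually (φ.open_source.mem_nhds hu')] with v hv
    exact (φ.left_inv hv).symm
  have h1 : coordVec ψ u = tangentMap 𝓘(ℂ) 𝓘(ℂ) (φ.symm ∘ fun v => φ (ψ.symm v))
      (⟨u, (1 : ℂ)⟩ : TangentBundle 𝓘(ℂ) ℂ) := by
    rw [← tangentMap_congr_of_eventuallyEq hev]
    rfl
  refine h1.trans ((tangentMap_comp_at (I := 𝓘(ℂ)) (I' := 𝓘(ℂ)) (I'' := 𝓘(ℂ))
    (f := fun v => φ (ψ.symm v)) (g := φ.symm) (⟨u, (1 : ℂ)⟩ : TangentBundle 𝓘(ℂ) ℂ)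
    (mdifferentiableAt_symm hφ (φ.map_source hu'))
    htr.differentiableAt.mdifferentiableAt).trans ?_)
  refine Bundle.TotalSpace.ext rfl (heq_of_eq ?_)
  change (mfderiv 𝓘(ℂ) 𝓘(ℂ) φ.symm (φ (ψ.symm u))) ((mfderiv 𝓘(ℂ) 𝓘(ℂ) (fun v => φ (ψ.symm v)) u) (1 : ℂ)) =
    deriv (fun v => φ (ψ.symm v)) u • (mfderiv 𝓘(ℂ) 𝓘(ℂ) φ.symm (φ (ψ.symm u)) (1 : ℂ))
  rw [mfderiv_eq_fderiv]
  have h2 : (fderiv ℂ (fun v => φ (ψ.symm v)) u) (1 : ℂ) =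
      deriv (fun v => φ (ψ.symm v)) u • (1 : ℂ) := by simp
  exact (congrArg _ h2).trans (map_smul _ _ _)

/-- Chain rule for `ψ ∘ ψ.symm = id`. As tangent spaces are lines, coordinate vectors span them. -/
theorem coordVec_ne_zero {ψ : OpenPartialHomeomorph Ct ℂ}
    (hψ : ψ ∈ IsManifold.maximalAtlas 𝓘(ℂ) ⊤ Ct) {u : ℂ} (hu : u ∈ ψ.target) :
    vecCoord (coordVec ψ u) ≠ 0 := by
  intro h0
  have hev : (ψ ∘ ψ.symm : ℂ → ℂ) =ᶠ[𝓝 u] id := by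
    filter_upwards [ψ.open_target.mem_nhds hu] with v hv
    exact ψ.right_inv hv
  have h1 := mfderiv_comp_apply (I := 𝓘(ℂ)) (I' := 𝓘(ℂ)) (I'' := 𝓘(ℂ)) u
    (mdifferentiableAt_chart hψ (ψ.map_target hu)) (mdifferentiableAt_symm hψ hu) (1 : ℂ)
  rw [hev.mfderiv_eq] at h1
  have h2 : mfderiv 𝓘(ℂ) 𝓘(ℂ) ψ.symm u (1 : ℂ) = (0 : ℂ) := h0
  have h3 : (mfderiv 𝓘(ℂ) 𝓘(ℂ) ψ (ψ.symm u)) (mfderiv 𝓘(ℂ) 𝓘(ℂ) ψ.symm u (1 : ℂ)) = (0 : ℂ) :=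
    (congrArg _ h2).trans (map_zero _)
  have h4 : mfderiv 𝓘(ℂ) 𝓘(ℂ) (id : ℂ → ℂ) u (1 : ℂ) = (1 : ℂ) := by
    rw [mfderiv_eq_fderiv, fderiv_id]; rfl
  have h5 : (1 : ℂ) = 0 := h4.symm.trans (h1.trans h3)
  exact one_ne_zero h5

/-- Every tangent vector is a multiple of a coordinate vector. -/
theorem exists_eq_smulVec_coordVec {ψ : OpenPartialHomeomorph Ct ℂ}
    (hψ : ψ ∈ IsManifold.maximalAtlas 𝓘(ℂ) ⊤ Ct) (w : TangentBundle 𝓘(ℂ) Ct)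
    (hw : w.proj ∈ ψ.source) : ∃ c : ℂ, w = smulVec c (coordVec ψ (ψ w.proj)) := by
  have h1 := coordVec_ne_zero hψ (ψ.map_source hw)
  refine ⟨vecCoord w / vecCoord (coordVec ψ (ψ w.proj)), ?_⟩
  refine vec_ext (ψ.left_inv hw).symm ?_
  rw [vecCoord_smulVec, div_mul_cancel₀ _ h1]

theorem deriv_transition_ne_zero {φ ψ : OpenPartialHomeomorph Ct ℂ}
    (hφ : φ ∈ IsManifold.maximalAtlas 𝓘(ℂ) ⊤ Ct) (hψ : ψ ∈ IsManifold.maximalAtlas 𝓘(ℂ) ⊤ Ct)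
    {u : ℂ} (hu : u ∈ ψ.target) (hu' : ψ.symm u ∈ φ.source) :
    deriv (fun v => φ (ψ.symm v)) u ≠ 0 := by
  intro h0
  have h1 := coordVec_ne_zero hψ hu
  have h2 := coordVec_eq_smulVec hφ hψ hu hu'
  rw [h2, vecCoord_smulVec, h0, zero_mul] at h1
  exact h1 rfl

end Charts

/-! ## Elementary properties of the local coordinates -/

namespace SpectralCurve

variable {Ct C : Type*} [TopologicalSpace Ct] [ChartedSpace ℂ Ct] (Γ : SpectralCurve Ct C)

theorem mem_branches {α : C} {μ : Ct} : μ ∈ Γ.branches α ↔ Γ.proj μ = α := by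
  simp [branches]

theorem mem_ram {μ : Ct} : μ ∈ Γ.ram ↔ Γ.proj μ ∈ Γ.ramPts := by
  simp [ram]

theorem mem_ramSet {μ : Ct} : μ ∈ Γ.ramSet ↔ μ ∈ Γ.ram := by
  rw [mem_ram]; rfl

theorem mem_ram_of_mem_branches {α : C} (hα : α ∈ Γ.ramPts) {μ : Ct} (hμ : μ ∈ Γ.branches α) :
    μ ∈ Γ.ram := by
  rw [mem_ram, Γ.mem_branches.1 hμ]; exact hα

theorem sum_ram {M : Type*} [AddCommMonoid M] (f : Ct → M) :
    ∑ μ ∈ Γ.ram, f μ = ∑ α ∈ Γ.ramPts, ∑ μ ∈ Γ.branches α, f μ := by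
  classical
  rw [← Finset.sum_biUnion]
  · refine Finset.sum_congr ?_ fun _ _ => rfl
    ext μ
    rw [Finset.mem_biUnion, mem_ram]
    constructor
    · exact fun h => ⟨_, h, Γ.mem_branches.2 rfl⟩
    · rintro ⟨α, hα, hμ⟩
      rwa [Γ.mem_branches.1 hμ]
  · intro α _ β _ hne
    rw [Function.onFun, Finset.disjoint_left]
    intro μ hμ hμ'
    exact hne ((Γ.mem_branches.1 hμ).symm.trans (Γ.mem_branches.1 hμ'))

theorem dx_smulVec (c : ℂ) (v : TangentBundle 𝓘(ℂ) Ct) : Γ.dx (smulVec c v) = c * Γ.dx v := by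
  change mfderiv 𝓘(ℂ) 𝓘(ℂ) Γ.xval v.proj (c • v.snd) = c • mfderiv 𝓘(ℂ) 𝓘(ℂ) Γ.xval v.proj v.snd
  exact map_smul _ _ _

theorem ddx_eq_smulVec {v : TangentBundle 𝓘(ℂ) Ct} (hv : Γ.dx v ≠ 0) :
    Γ.ddx v.proj = smulVec (Γ.dx v)⁻¹ v := by
  have h1 : Γ.dx v = vecCoord v * Γ.dx ⟨v.proj, (1 : ℂ)⟩ := by
    rw [← dx_smulVec]
    congr 1
    refine vec_ext rfl ?_
    rw [vecCoord_smulVec]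
    exact (mul_one _).symm
  refine vec_ext rfl ?_
  rw [vecCoord_smulVec]
  change (Γ.dx ⟨v.proj, (1 : ℂ)⟩)⁻¹ = (Γ.dx v)⁻¹ * vecCoord v
  have h2 : vecCoord v ≠ 0 := by
    intro h; rw [h, zero_mul] at h1; exact hv h1
  rw [h1, mul_inv, mul_comm ((vecCoord v)⁻¹), inv_mul_cancel_right₀ h2]

end SpectralCurve

namespace LocalCoords

variable {Ct C : Type*} [TopologicalSpace Ct] [ChartedSpace ℂ Ct] {Γ : SpectralCurve Ct C}
  (K : LocalCoords Γ) {μ : Ct}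

theorem zero_mem_target (hμ : μ ∈ Γ.ram) : (0 : ℂ) ∈ (K.ζ μ).target := by
  rw [← K.map_self μ hμ]
  exact (K.ζ μ).map_source (K.mem_source μ hμ)

theorem pt_zero (hμ : μ ∈ Γ.ram) : K.pt μ 0 = μ := by
  rw [pt, ← K.map_self μ hμ]
  exact (K.ζ μ).left_inv (K.mem_source μ hμ)

theorem xval_pt (hμ : μ ∈ Γ.ram) {u : ℂ} (hu : u ∈ (K.ζ μ).target) :
    Γ.xval (K.pt μ u) = Γ.xval μ + u ^ Γ.r μ := by
  rw [SpectralCurve.xval, pt, K.x_eq μ hμ u hu]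
  rfl

/-- With exponent `0` the equation `x = x(μ) + ζ ^ 0` would fail at `ζ = 0`. This also excludes the
default value `0` that `analyticOrderNatAt` assigns to an infinite order. -/
theorem r_pos (K : LocalCoords Γ) (hμ : μ ∈ Γ.ram) : 0 < Γ.r μ := by
  rw [Nat.pos_iff_ne_zero]
  intro h0
  have h1 := K.xval_pt hμ (K.zero_mem_target hμ)
  rw [K.pt_zero hμ, h0, pow_zero] at h1
  simp at h1

theorem finVal_x {α : C} (hμ : μ ∈ Γ.branches α) : finVal (Γ.x α) = Γ.xval μ := by
  rw [SpectralCurve.xval, SpectralCurve.xt, Γ.mem_branches.1 hμ]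

theorem mem_target_iff (hμ : μ ∈ Γ.ram) {u : ℂ} :
    u ∈ (K.ζ μ).target ↔ ‖u‖ ^ Γ.r μ < K.radius (Γ.proj μ) := by
  rw [K.target_eq μ hμ]; rfl

theorem pt_mem_source {u : ℂ} (hu : u ∈ (K.ζ μ).target) : K.pt μ u ∈ (K.ζ μ).source :=
  (K.ζ μ).map_target hu

theorem pt_injOn : Set.InjOn (K.pt μ) (K.ζ μ).target := (K.ζ μ).symm.injOn

/-- The coordinate neighbourhoods are disjoint, so each contains a single point of `𝔞̃`, at its
origin. -/
theorem pt_notMem_ramSet (hμ : μ ∈ Γ.ram) {u : ℂ} (hu : u ∈ (K.ζ μ).target) (hu0 : u ≠ 0) :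
    K.pt μ u ∉ Γ.ramSet := by
  intro h
  rw [Γ.mem_ramSet] at h
  by_cases he : K.pt μ u = μ
  · refine hu0 (K.pt_injOn hu (K.zero_mem_target hμ) ?_)
    rw [he, K.pt_zero hμ]
  · exact Set.disjoint_left.1 (K.disjoint _ h μ hμ he) (K.mem_source _ h) (K.pt_mem_source hu)

theorem eventually_mem_target (hμ : μ ∈ Γ.ram) : ∀ᶠ u in 𝓝 (0 : ℂ), u ∈ (K.ζ μ).target :=
  (K.ζ μ).open_target.mem_nhds (K.zero_mem_target hμ)

theorem continuousAt_pt {u : ℂ} (hu : u ∈ (K.ζ μ).target) : ContinuousAt (K.pt μ) u :=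
  (K.ζ μ).continuousAt_symm hu

theorem dx_ddζ (hμ : μ ∈ Γ.ram) {u : ℂ} (hu : u ∈ (K.ζ μ).target) :
    Γ.dx (K.ddζ μ u) = Γ.r μ * u ^ (Γ.r μ - 1) := by
  have hζ := K.holomorphic μ hμ
  have hp := K.pt_mem_source hu
  have h1 : Γ.xval =ᶠ[𝓝 (K.pt μ u)] (fun v => Γ.xval μ + v ^ Γ.r μ) ∘ K.ζ μ := by
    filter_upwards [(K.ζ μ).open_source.mem_nhds hp] with q hq
    have := K.xval_pt hμ ((K.ζ μ).map_source hq)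
    rw [pt, (K.ζ μ).left_inv hq] at this
    exact this
  have hpoly : ∀ v : ℂ, DifferentiableAt ℂ (fun v : ℂ => Γ.xval μ + v ^ Γ.r μ) v := fun v => by fun_prop
  have hmd : MDifferentiableAt 𝓘(ℂ) 𝓘(ℂ) Γ.xval (K.pt μ u) :=
    (MDifferentiableAt.comp _ (hpoly _).mdifferentiableAt
      (mdifferentiableAt_chart hζ hp)).congr_of_eventuallyEq h1
  have h2 : Γ.xval ∘ K.pt μ =ᶠ[𝓝 u] (fun v => Γ.xval μ + v ^ Γ.r μ) := by
    filter_upwards [(K.ζ μ).open_target.mem_nhds hu] with v hv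
    exact K.xval_pt hμ hv
  have h3 := mfderiv_comp_apply (I := 𝓘(ℂ)) (I' := 𝓘(ℂ)) (I'' := 𝓘(ℂ)) u (f := K.pt μ) hmd
    (mdifferentiableAt_symm hζ hu) (1 : ℂ)
  rw [h2.mfderiv_eq, mfderiv_eq_fderiv] at h3
  refine h3.symm.trans ?_
  have h4 : deriv (fun v : ℂ => Γ.xval μ + v ^ Γ.r μ) u = Γ.r μ * u ^ (Γ.r μ - 1) := by
    rw [deriv_const_add, deriv_pow_field]
  have h5 : (fderiv ℂ (fun v : ℂ => Γ.xval μ + v ^ Γ.r μ) u) (1 : ℂ) =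
      deriv (fun v : ℂ => Γ.xval μ + v ^ Γ.r μ) u := fderiv_apply_one_eq_deriv
  exact h5.trans h4

theorem dx_ddζ_ne_zero (hμ : μ ∈ Γ.ram) {u : ℂ} (hu : u ∈ (K.ζ μ).target) (hu0 : u ≠ 0) :
    Γ.dx (K.ddζ μ u) ≠ 0 := by
  rw [K.dx_ddζ hμ hu]
  exact mul_ne_zero (Nat.cast_ne_zero.2 (K.r_pos hμ).ne') (pow_ne_zero _ hu0)

theorem ddx_pt (hμ : μ ∈ Γ.ram) {u : ℂ} (hu : u ∈ (K.ζ μ).target) (hu0 : u ≠ 0) :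
    Γ.ddx (K.pt μ u) = smulVec (Γ.dx (K.ddζ μ u))⁻¹ (K.ddζ μ u) :=
  Γ.ddx_eq_smulVec (K.dx_ddζ_ne_zero hμ hu hu0)

end LocalCoords

end LoopEq
end

noncomputable section

namespace LoopEq

/-! ## Correlators along meromorphic curves of tangent vectors -/

section Curves

variable {Ct : Type*} [TopologicalSpace Ct] [ChartedSpace ℂ Ct]

/-- A meromorphic germ of curves of tangent vectors whose base point tends to `p`, and which stays
away from `p` if `p ∈ S`. -/
def IsVecCurve (S : Set Ct) (p : Ct) (V : ℂ → TangentBundle 𝓘(ℂ) Ct) : Prop :=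
  ∃ q c : ℂ → ℂ, AnalyticAt ℂ q 0 ∧ MeromorphicAt c 0 ∧ q 0 = chartAt ℂ p p ∧
    (p ∈ S → ∀ᶠ u in 𝓝[≠] (0 : ℂ), q u ≠ chartAt ℂ p p) ∧
    ∀ᶠ u in 𝓝[≠] (0 : ℂ), V u = smulVec (c u) (coordVec (chartAt ℂ p) (q u))

theorem IsVecCurve.smul {S : Set Ct} {p : Ct} {V : ℂ → TangentBundle 𝓘(ℂ) Ct}
    (hV : IsVecCurve S p V) {c : ℂ → ℂ} (hc : MeromorphicAt c 0) :
    IsVecCurve S p (fun u => smulVec (c u) (V u)) := by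
  obtain ⟨q, d, hq, hd, h0, hS, hV⟩ := hV
  refine ⟨q, fun u => c u * d u, hq, hc.mul hd, h0, hS, ?_⟩
  filter_upwards [hV] with u hu
  rw [hu, smulVec_smulVec]

theorem IsVecCurve.congr {S : Set Ct} {p : Ct} {V W : ℂ → TangentBundle 𝓘(ℂ) Ct}
    (hV : IsVecCurve S p V) (h : V =ᶠ[𝓝[≠] 0] W) : IsVecCurve S p W := by
  obtain ⟨q, d, hq, hd, h0, hS, hV⟩ := hV
  refine ⟨q, d, hq, hd, h0, hS, ?_⟩
  filter_upwards [hV, h] with u hu hu'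
  rw [← hu', hu]

theorem isVecCurve_const [IsManifold 𝓘(ℂ) ⊤ Ct] {S : Set Ct} {w : TangentBundle 𝓘(ℂ) Ct}
    (hw : w.proj ∉ S) : IsVecCurve S w.proj (fun _ => w) := by
  obtain ⟨c, hc⟩ := exists_eq_smulVec_coordVec (IsManifold.chart_mem_maximalAtlas w.proj) w
    (mem_chart_source ℂ w.proj)
  exact ⟨fun _ => chartAt ℂ w.proj w.proj, fun _ => c, analyticAt_const, MeromorphicAt.const _ _, rfl,
    fun h => absurd h hw, Eventually.of_forall fun _ => hc⟩

section Linear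

theorem smulVec_cons (F : Multiset (TangentBundle 𝓘(ℂ) Ct) → ℂ)
    (hF : ∀ (p : Ct) (c : ℂ) (v : TangentSpace 𝓘(ℂ) p)
    (m : Multiset (TangentBundle 𝓘(ℂ) Ct)), F (⟨p, c • v⟩ ::ₘ m) = c * F (⟨p, v⟩ ::ₘ m))
    (c : ℂ) (v : TangentBundle 𝓘(ℂ) Ct) (m : Multiset (TangentBundle 𝓘(ℂ) Ct)) :
    F (smulVec c v ::ₘ m) = c * F (v ::ₘ m) := hF v.proj c v.snd m

theorem smulVec_pair (F : Multiset (TangentBundle 𝓘(ℂ) Ct) → ℂ)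
    (hF : ∀ (p : Ct) (c : ℂ) (v : TangentSpace 𝓘(ℂ) p)
    (m : Multiset (TangentBundle 𝓘(ℂ) Ct)), F (⟨p, c • v⟩ ::ₘ m) = c * F (⟨p, v⟩ ::ₘ m))
    (c d : ℂ) (v w : TangentBundle 𝓘(ℂ) Ct) :
    F {smulVec c v, smulVec d w} = c * d * F {v, w} := by
  have h1 : F {smulVec c v, smulVec d w} = c * F {v, smulVec d w} := smulVec_cons F hF c v _
  have h2 : F {v, smulVec d w} = d * F {v, w} := by
    rw [Multiset.pair_comm, Multiset.pair_comm v w]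
    exact smulVec_cons F hF d w _
  rw [h1, h2, mul_assoc]

theorem map_smulVec (F : Multiset (TangentBundle 𝓘(ℂ) Ct) → ℂ)
    (hF : ∀ (p : Ct) (c : ℂ) (v : TangentSpace 𝓘(ℂ) p)
    (m : Multiset (TangentBundle 𝓘(ℂ) Ct)), F (⟨p, c • v⟩ ::ₘ m) = c * F (⟨p, v⟩ ::ₘ m))
    {ι : Type*} (s : Finset ι) (c : ι → ℂ) (v : ι → TangentBundle 𝓘(ℂ) Ct)
    (m : Multiset (TangentBundle 𝓘(ℂ) Ct)) :
    F (s.val.map (fun i => smulVec (c i) (v i)) + m) = (∏ i ∈ s, c i) * F (s.val.map v + m) := by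
  classical
  induction s using Finset.induction_on generalizing m with
  | empty => simp
  | insert i s hi ih =>
    rw [Finset.insert_val_of_notMem hi, Multiset.map_cons, Multiset.map_cons, Multiset.cons_add,
      smulVec_cons F hF, Multiset.cons_add, ← Multiset.add_cons, ih, Finset.prod_insert hi, mul_assoc,
      Multiset.add_cons]

end Linear

/-- Only one-variable germs are needed: along the curves the regularised coefficient `G` is analytic
in `u`, and it is divided by powers of coordinate differences that do not vanish for small `u ≠ 0`.
-/
theorem meromorphicAt_multidifferential_fin {S : Set Ct} {n : ℕ}
    {F : Multiset (TangentBundle 𝓘(ℂ) Ct) → ℂ}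
    (hF : ∀ (p : Ct) (c : ℂ) (v : TangentSpace 𝓘(ℂ) p)
    (m : Multiset (TangentBundle 𝓘(ℂ) Ct)), F (⟨p, c • v⟩ ::ₘ m) = c * F (⟨p, v⟩ ::ₘ m))
    (hm : IsMultidifferential S n F) {p : Fin n → Ct} {V : Fin n → ℂ → TangentBundle 𝓘(ℂ) Ct}
    (hV : ∀ i, IsVecCurve S (p i) (V i)) :
    MeromorphicAt (fun u => F (Finset.univ.val.map fun i => V i u)) 0 := by
  choose q c hq hc h0 hS hVe using hV
  obtain ⟨k, G, hG, hFG⟩ := hm p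
  have hqa : AnalyticAt ℂ (fun u i => q i u) 0 := AnalyticAt.pi hq
  have hq0 : (fun i => q i 0) = fun i => chartAt ℂ (p i) (p i) := funext h0
  have hGq : AnalyticAt ℂ (fun u => G (fun i => q i u)) 0 := by
    refine AnalyticAt.fun_comp ?_ hqa
    rw [hq0]; exact hG
  have hlim : Tendsto (fun u i => q i u) (𝓝[≠] 0) (𝓝 fun i => chartAt ℂ (p i) (p i)) := by
    have := hqa.continuousAt.tendsto
    rw [hq0] at this
    exact this.mono_left nhdsWithin_le_nhds
  have hmain : (fun u => (∏ i, c i u) * (G (fun i => q i u) /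
      ∏ i : Fin n, (q i u - chartAt ℂ (p i) (p i)) ^ (S.indicator (fun _ => k) (p i)))) =ᶠ[𝓝[≠] 0]
      fun u => F (Finset.univ.val.map fun i => V i u) := by
    have hne : ∀ i, ∀ᶠ u in 𝓝[≠] (0 : ℂ), p i ∈ S → q i u ≠ chartAt ℂ (p i) (p i) := by
      intro i
      by_cases h : p i ∈ S
      · filter_upwards [hS i h] with u hu _ using hu
      · exact Eventually.of_forall fun _ h' => absurd h' h
    filter_upwards [hlim.eventually hFG, eventually_all.2 hne, eventually_all.2 hVe] with u h1 h2 h3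
    have h4 := h1 h2
    have h5 : (Finset.univ.val.map fun i => V i u) =
        Finset.univ.val.map (fun i => smulVec (c i u) (coordVec (chartAt ℂ (p i)) (q i u))) :=
      Multiset.map_congr rfl fun i _ => h3 i
    have h6 := map_smulVec F hF Finset.univ (fun i => c i u)
      (fun i => coordVec (chartAt ℂ (p i)) (q i u)) 0
    rw [add_zero, add_zero] at h6
    rw [h5, h6, ← h4, mul_div_cancel_right₀]
    refine Finset.prod_ne_zero_iff.2 fun i _ => ?_
    by_cases h : p i ∈ S
    · exact pow_ne_zero _ (sub_ne_zero.2 (h2 i h))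
    · rw [Set.indicator_of_notMem h, pow_zero]; exact one_ne_zero
  refine MeromorphicAt.congr ?_ hmain
  refine (MeromorphicAt.fun_prod fun i _ => hc i).mul (hGq.meromorphicAt.div ?_)
  refine MeromorphicAt.fun_prod fun i _ => ?_
  exact (((hq i).sub analyticAt_const).pow _).meromorphicAt

theorem meromorphicAt_multidifferential {S : Set Ct} {ι : Type*} [Fintype ι]
    {F : Multiset (TangentBundle 𝓘(ℂ) Ct) → ℂ}
    (hF : ∀ (p : Ct) (c : ℂ) (v : TangentSpace 𝓘(ℂ) p)
    (m : Multiset (TangentBundle 𝓘(ℂ) Ct)), F (⟨p, c • v⟩ ::ₘ m) = c * F (⟨p, v⟩ ::ₘ m))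
    (hm : IsMultidifferential S (Fintype.card ι) F) {p : ι → Ct}
    {V : ι → ℂ → TangentBundle 𝓘(ℂ) Ct} (hV : ∀ i, IsVecCurve S (p i) (V i)) :
    MeromorphicAt (fun u => F (Finset.univ.val.map fun i => V i u)) 0 := by
  have h := meromorphicAt_multidifferential_fin hF hm
    (p := fun i => p ((Fintype.equivFin ι).symm i)) (V := fun i => V ((Fintype.equivFin ι).symm i))
    fun i => hV _
  convert h using 3 with u
  have h1 : (Finset.univ : Finset ι) = Finset.univ.map (Fintype.equivFin ι).symm.toEmbedding := by simp
  rw [h1, Finset.map_val, Multiset.map_map]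
  rfl

/-- The form in which factors occur: the points `A` of the fibre move while the spectators `M` may
stay fixed. Both are merged into the index type `A ⊕ M`. -/
theorem meromorphicAt_multidifferential_add {S : Set Ct} {ι : Type*} {n : ℕ}
    {F : Multiset (TangentBundle 𝓘(ℂ) Ct) → ℂ}
    (hF : ∀ (p : Ct) (c : ℂ) (v : TangentSpace 𝓘(ℂ) p)
    (m : Multiset (TangentBundle 𝓘(ℂ) Ct)), F (⟨p, c • v⟩ ::ₘ m) = c * F (⟨p, v⟩ ::ₘ m))
    (A : Finset ι) (M : Finset (Fin n)) (hm : IsMultidifferential S (A.card + M.card) F) {p : ι → Ct}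
    {V : ι → ℂ → TangentBundle 𝓘(ℂ) Ct} (hV : ∀ i ∈ A, IsVecCurve S (p i) (V i))
    {p' : Fin n → Ct} {W : Fin n → ℂ → TangentBundle 𝓘(ℂ) Ct} (hW : ∀ i, IsVecCurve S (p' i) (W i)) :
    MeromorphicAt (fun u => F (A.val.map (fun i => V i u) + M.val.map (fun i => W i u))) 0 := by
  have h := meromorphicAt_multidifferential (ι := A ⊕ M) hF (S := S) (by simpa using hm)
    (p := Sum.elim (fun i => p i) (fun i => p' i)) (V := Sum.elim (fun i => V i) (fun i => W i))
    (by rintro (i | i); exacts [hV i i.2, hW i])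
  convert h using 3 with u
  rw [← Finset.univ_disjSum_univ]
  simp only [Finset.disjSum, Multiset.disjSum, Multiset.map_add, Multiset.map_map, Function.comp_def,
    Sum.elim_inl, Sum.elim_inr, Finset.univ_eq_attach, Finset.attach_val]
  congr 1
  · exact (Multiset.attach_map_val' A.val (fun i => V i u)).symm
  · exact (Multiset.attach_map_val' M.val (fun i => W i u)).symm

/-- Off the diagonal the bidifferential is analytic. If both curves tend to the same point, it is
analytic after multiplication by `(q u - q' u) ^ 2`, and the curves do not meet for small `u ≠ 0`.
-/
theorem analyticAt_bidifferential {F : Multiset (TangentBundle 𝓘(ℂ) Ct) → ℂ}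
    (hF : ∀ (p : Ct) (c : ℂ) (v : TangentSpace 𝓘(ℂ) p)
    (m : Multiset (TangentBundle 𝓘(ℂ) Ct)), F (⟨p, c • v⟩ ::ₘ m) = c * F (⟨p, v⟩ ::ₘ m))
    (hb : IsFundamentalBidifferential F) {S : Set Ct} {p p' : Ct}
    {V V' : ℂ → TangentBundle 𝓘(ℂ) Ct} (hV : IsVecCurve S p V) (hV' : IsVecCurve S p' V')
    (hne : ∀ᶠ u in 𝓝[≠] (0 : ℂ), (V u).proj ≠ (V' u).proj) :
    MeromorphicAt (fun u => F {V u, V' u}) 0 := by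
  obtain ⟨q, c, hq, hc, h0, hS, hVe⟩ := hV
  obtain ⟨q', c', hq', hc', h0', hS', hVe'⟩ := hV'
  have hstep : (fun u => c u * c' u *
      F {coordVec (chartAt ℂ p) (q u), coordVec (chartAt ℂ p') (q' u)}) =ᶠ[𝓝[≠] 0]
      fun u => F {V u, V' u} := by
    filter_upwards [hVe, hVe'] with u h1 h2
    rw [h1, h2, smulVec_pair F hF]
  refine MeromorphicAt.congr ((hc.mul hc').mul ?_) hstep
  by_cases hpp : p = p'
  · subst hpp
    obtain ⟨G, hG, -, hFG⟩ := hb.2 p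
    have hqq : AnalyticAt ℂ (fun u => (q u, q' u)) 0 := hq.prod hq'
    have hGq : AnalyticAt ℂ (fun u => G (q u, q' u)) 0 := by
      refine AnalyticAt.fun_comp ?_ hqq
      rw [h0, h0']; exact hG
    have hlim : Tendsto (fun u => (q u, q' u)) (𝓝[≠] 0) (𝓝 (chartAt ℂ p p, chartAt ℂ p p)) := by
      have := hqq.continuousAt.tendsto
      rw [h0, h0'] at this
      exact this.mono_left nhdsWithin_le_nhds
    refine MeromorphicAt.congr (hGq.meromorphicAt.div ((hq.sub hq').pow 2).meromorphicAt) ?_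
    filter_upwards [hlim.eventually hFG, hne, hVe, hVe'] with u h1 h2 h3 h4
    have h5 : q u ≠ q' u := by
      intro h
      rw [h3, h4, smulVec_proj, smulVec_proj, coordVec_proj, coordVec_proj, h] at h2
      exact h2 rfl
    have h6 := h1 h5
    simp only [Pi.div_apply, Pi.pow_apply, Pi.sub_apply]
    rw [← h6, mul_div_cancel_right₀]
    exact pow_ne_zero _ (sub_ne_zero.2 h5)
  · have h1 := hb.1 p p' hpp
    refine AnalyticAt.meromorphicAt ?_
    refine AnalyticAt.fun_comp (f := fun u => (q u, q' u)) (g := fun u : ℂ × ℂ =>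
      F {coordVec (chartAt ℂ p) u.1, coordVec (chartAt ℂ p') u.2}) ?_ (hq.prod hq')
    rw [h0, h0']; exact h1

theorem meromorphicAt_differential {F : Multiset (TangentBundle 𝓘(ℂ) Ct) → ℂ}
    (hF : ∀ (p : Ct) (c : ℂ) (v : TangentSpace 𝓘(ℂ) p)
    (m : Multiset (TangentBundle 𝓘(ℂ) Ct)), F (⟨p, c • v⟩ ::ₘ m) = c * F (⟨p, v⟩ ::ₘ m))
    {S : Set Ct} {p : Ct}
    (hm : MeromorphicAt (fun u => F {coordVec (chartAt ℂ p) u}) (chartAt ℂ p p))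
    {V : ℂ → TangentBundle 𝓘(ℂ) Ct} (hV : IsVecCurve S p V) :
    MeromorphicAt (fun u => F {V u}) 0 := by
  obtain ⟨q, c, hq, hc, h0, hS, hVe⟩ := hV
  have hstep : (fun u => c u * F {coordVec (chartAt ℂ p) (q u)}) =ᶠ[𝓝[≠] 0] fun u => F {V u} := by
    filter_upwards [hVe] with u h1
    rw [h1]
    exact (smulVec_cons F hF _ _ 0).symm
  refine MeromorphicAt.congr (hc.mul ?_) hstep
  exact MeromorphicAt.comp_analyticAt (f := fun u => F {coordVec (chartAt ℂ p) u}) (by rw [h0]; exact hm) hq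

end Curves

/-! ### Meromorphy of connected and disconnected correlators along curves. -/

section Family

variable {Ct C : Type*} [TopologicalSpace Ct] [ChartedSpace ℂ Ct]
variable {Γ : SpectralCurve Ct C} {K : LocalCoords Γ}
  {om : ℕ → Multiset (TangentBundle 𝓘(ℂ) Ct) → ℂ}

/-- Stable factors are multidifferentials. A nonempty `A` leaves only four unstable cases: `ω_{0,2}`
at two moving points, `ω_{0,1}`, `ω_{1/2,1}`, and `ω_{0,2}` at a moving point and a spectator. -/
theorem meromorphicAt_om [IsManifold 𝓘(ℂ) ⊤ Ct] (hom : IsCorrelatorFamily K om) {n : ℕ}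
    {w : Fin n → TangentBundle 𝓘(ℂ) Ct} (hw : ∀ j, (w j).proj ∉ Γ.ramSet)
    {ι : Type*} {p : ι → Ct} {z : ι → ℂ → TangentBundle 𝓘(ℂ) Ct}
    (hz : ∀ i, IsVecCurve Γ.ramSet (p i) (z i))
    (hz1 : ∀ i, MeromorphicAt (fun u => om 0 {z i u}) 0)
    (hdist : ∀ i i', i ≠ i' → ∀ᶠ u in 𝓝[≠] (0 : ℂ), (z i u).proj ≠ (z i' u).proj)
    (hdist' : ∀ i j, ∀ᶠ u in 𝓝[≠] (0 : ℂ), (z i u).proj ≠ (w j).proj)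
    {A : Finset ι} (hA : A.Nonempty) (M : Finset (Fin n)) (k : ℕ) :
    MeromorphicAt (fun u => om k (A.val.map (fun i => z i u) + M.val.map w)) 0 := by
  classical
  have hA' := hA.card_pos
  by_cases hst : 2 < k + (A.card + M.card)
  · exact meromorphicAt_multidifferential_add (hom.linear k) A M (hom.stable k _ (by omega) hst)
      (fun i _ => hz i) (W := fun j _ => w j) fun j => isVecCurve_const (hw j)
  · rw [not_lt] at hst
    rcases Nat.lt_or_ge 1 A.card with h2 | h1
    · have hA2 : A.card = 2 := by omega
      have hM : M = ∅ := Finset.card_eq_zero.1 (by omega)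
      have hk : k = 0 := by omega
      obtain ⟨i, i', hne, rfl⟩ := Finset.card_eq_two.1 hA2
      subst hM hk
      have := analyticAt_bidifferential (hom.linear 0) hom.zero_two (hz i) (hz i') (hdist i i' hne)
      convert this using 3 with u
      rw [Finset.insert_val_of_notMem (by simpa using hne)]
      simp
    · obtain ⟨i, rfl⟩ := Finset.card_eq_one.1 (show A.card = 1 by omega)
      simp only [Finset.card_singleton] at hst
      rcases Nat.eq_zero_or_pos M.card with hM0 | hM1
      · have hM : M = ∅ := Finset.card_eq_zero.1 hM0
        subst hM
        have hk : k = 0 ∨ k = 1 := by simp at hst; omega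
        rcases hk with rfl | rfl
        · simpa using hz1 i
        · simpa using meromorphicAt_differential (hom.linear 1) (hom.half_one.1 (p i)) (hz i)
      · obtain ⟨j, rfl⟩ := Finset.card_eq_one.1 (show M.card = 1 by omega)
        have hk : k = 0 := by simp at hst; omega
        subst hk
        have := analyticAt_bidifferential (hom.linear 0) hom.zero_two (hz i)
          (isVecCurve_const (hw j)) (hdist' i j)
        exact this

theorem meromorphicAt_disconn' [IsManifold 𝓘(ℂ) ⊤ Ct] (hom : IsCorrelatorFamily K om) {n : ℕ}
    {w : Fin n → TangentBundle 𝓘(ℂ) Ct} (hw : ∀ j, (w j).proj ∉ Γ.ramSet)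
    {ι : Type*} {p : ι → Ct} {z : ι → ℂ → TangentBundle 𝓘(ℂ) Ct}
    (hz : ∀ i, IsVecCurve Γ.ramSet (p i) (z i))
    (hz1 : ∀ i, MeromorphicAt (fun u => om 0 {z i u}) 0)
    (hdist : ∀ i i', i ≠ i' → ∀ᶠ u in 𝓝[≠] (0 : ℂ), (z i u).proj ≠ (z i' u).proj)
    (hdist' : ∀ i j, ∀ᶠ u in 𝓝[≠] (0 : ℂ), (z i u).proj ≠ (w j).proj) (h : ℕ) (Z : Finset ι) :
    MeromorphicAt (fun u => disconn' om h Z (fun i => z i u) w) 0 := by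
  classical
  simp only [disconn'_eq_sum_configs]
  refine MeromorphicAt.fun_sum fun c hc => MeromorphicAt.fun_prod fun b hb => ?_
  by_cases hbt : b.IsTrivial
  · simp only [blockWeight', if_pos hbt]
    exact MeromorphicAt.const _ _
  · simp only [blockWeight', if_neg hbt]
    exact meromorphicAt_om hom hw hz hz1 hdist hdist' ((mem_configs.1 hc).nonempty b hb) _ _

theorem meromorphicAt_disconn [IsManifold 𝓘(ℂ) ⊤ Ct] (hom : IsCorrelatorFamily K om) {n : ℕ}
    {w : Fin n → TangentBundle 𝓘(ℂ) Ct} (hw : ∀ j, (w j).proj ∉ Γ.ramSet)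
    {ι : Type*} {p : ι → Ct} {z : ι → ℂ → TangentBundle 𝓘(ℂ) Ct}
    (hz : ∀ i, IsVecCurve Γ.ramSet (p i) (z i))
    (hz1 : ∀ i, MeromorphicAt (fun u => om 0 {z i u}) 0)
    (hdist : ∀ i i', i ≠ i' → ∀ᶠ u in 𝓝[≠] (0 : ℂ), (z i u).proj ≠ (z i' u).proj)
    (hdist' : ∀ i j, ∀ᶠ u in 𝓝[≠] (0 : ℂ), (z i u).proj ≠ (w j).proj) (h : ℕ) (Z : Finset ι) :
    MeromorphicAt (fun u => disconn om h Z (fun i => z i u) w) 0 := by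
  classical
  simp only [disconn_eq_sum_powerset]
  exact MeromorphicAt.fun_sum fun A _ =>
    (meromorphicAt_disconn' hom hw hz hz1 hdist hdist' h A).mul
      (MeromorphicAt.fun_prod fun i _ => hz1 i)

end Family

end LoopEq
end

noncomputable section

namespace LoopEq

/-! ## Parametrisation of the fibres by a common root of `x - x(α)` -/

namespace SpectralCurve

variable {Ct C : Type*} [TopologicalSpace Ct] [ChartedSpace ℂ Ct] (Γ : SpectralCurve Ct C)

/-- The sheets above `α`: a branch `ν` together with an `r_ν`-th root of unity. -/
def sheets (α : C) : Finset (Σ _ : Ct, ℂ) :=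
  (Γ.branches α).sigma fun ν => Polynomial.nthRootsFinset (Γ.r ν) (1 : ℂ)

/-- The type of sheets above `α`. -/
abbrev Sheet (α : C) : Type _ := {j // j ∈ Γ.sheets α}

/-- A common multiple of the ramification orders above `α`. -/
def coverDeg (α : C) : ℕ := ∏ ν ∈ Γ.branches α, Γ.r ν

/-- The exponent of the uniformiser in the coordinate of the branch `ν`. -/
def coverExp (α : C) (ν : Ct) : ℕ := Γ.coverDeg α / Γ.r ν

variable {Γ}

theorem coverExp_mul_r {α : C} {ν : Ct} (hν : ν ∈ Γ.branches α) :
    Γ.coverExp α ν * Γ.r ν = Γ.coverDeg α :=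
  Nat.div_mul_cancel (Finset.dvd_prod_of_mem _ hν)

end SpectralCurve

namespace LocalCoords

variable {Ct C : Type*} [TopologicalSpace Ct] [ChartedSpace ℂ Ct] {Γ : SpectralCurve Ct C}
  (K : LocalCoords Γ) {α : C} (hα : α ∈ Γ.ramPts)

theorem coverDeg_ne_zero (K : LocalCoords Γ) (hα : α ∈ Γ.ramPts) : Γ.coverDeg α ≠ 0 :=
  Finset.prod_ne_zero_iff.2 fun _ hν => (K.r_pos (Γ.mem_ram_of_mem_branches hα hν)).ne'

theorem coverExp_ne_zero (K : LocalCoords Γ) (hα : α ∈ Γ.ramPts) {ν : Ct} (hν : ν ∈ Γ.branches α) :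
    Γ.coverExp α ν ≠ 0 := by
  intro h
  have := SpectralCurve.coverExp_mul_r hν
  rw [h, zero_mul] at this
  exact K.coverDeg_ne_zero hα this.symm

theorem mem_sheets (K : LocalCoords Γ) (hα : α ∈ Γ.ramPts) {j : Σ _ : Ct, ℂ} :
    j ∈ Γ.sheets α ↔ j.1 ∈ Γ.branches α ∧ j.2 ^ Γ.r j.1 = 1 := by
  rw [SpectralCurve.sheets, Finset.mem_sigma]
  refine and_congr_right fun h => ?_
  rw [Polynomial.mem_nthRootsFinset (K.r_pos (Γ.mem_ram_of_mem_branches hα h))]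

theorem card_nthRoots (K : LocalCoords Γ) (hα : α ∈ Γ.ramPts) {ν : Ct} (hν : ν ∈ Γ.branches α) :
    (Polynomial.nthRootsFinset (Γ.r ν) (1 : ℂ)).card = Γ.r ν :=
  (Complex.isPrimitiveRoot_exp _ (K.r_pos (Γ.mem_ram_of_mem_branches hα hν)).ne').card_nthRootsFinset

theorem card_sheets (K : LocalCoords Γ) (hα : α ∈ Γ.ramPts) : (Γ.sheets α).card = Γ.rTot α := by
  rw [SpectralCurve.sheets, Finset.card_sigma]
  exact Finset.sum_congr rfl fun ν hν => K.card_nthRoots hα hν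

theorem sheet_branch (j : Γ.Sheet α) : j.1.1 ∈ Γ.branches α :=
  (Finset.mem_sigma.1 j.2).1

theorem sheet_root (K : LocalCoords Γ) (hα : α ∈ Γ.ramPts) (j : Γ.Sheet α) :
    j.1.2 ^ Γ.r j.1.1 = 1 :=
  ((K.mem_sheets hα).1 j.2).2

theorem sheet_ram (hα : α ∈ Γ.ramPts) (j : Γ.Sheet α) : j.1.1 ∈ Γ.ram :=
  Γ.mem_ram_of_mem_branches hα (sheet_branch j)

theorem norm_sheet_root (K : LocalCoords Γ) (hα : α ∈ Γ.ramPts) (j : Γ.Sheet α) : ‖j.1.2‖ = 1 :=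
  (pow_eq_one_iff_of_nonneg (norm_nonneg _) (K.r_pos (sheet_ram hα j)).ne').1
    (by rw [← norm_pow, K.sheet_root hα j, norm_one])

theorem sheet_root_ne_zero (K : LocalCoords Γ) (hα : α ∈ Γ.ramPts) (j : Γ.Sheet α) : j.1.2 ≠ 0 :=
  norm_pos_iff.1 (by rw [K.norm_sheet_root hα j]; exact one_pos)

/-- The local coordinate of the point of the sheet `j` with parameter `u`. -/
def sheetCoord (j : Γ.Sheet α) (u : ℂ) : ℂ := j.1.2 * u ^ Γ.coverExp α j.1.1

/-- The point of the sheet `j` with parameter `u`. -/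
def sheetPt (j : Γ.Sheet α) (u : ℂ) : Ct := K.pt j.1.1 (sheetCoord j u)

theorem sheetCoord_pow (K : LocalCoords Γ) (hα : α ∈ Γ.ramPts) (j : Γ.Sheet α) (u : ℂ) :
    sheetCoord j u ^ Γ.r j.1.1 = u ^ Γ.coverDeg α := by
  rw [sheetCoord, mul_pow, K.sheet_root hα j, one_mul, ← pow_mul,
    SpectralCurve.coverExp_mul_r (sheet_branch j)]

theorem sheetCoord_ne_zero (K : LocalCoords Γ) (hα : α ∈ Γ.ramPts) (j : Γ.Sheet α) {u : ℂ}
    (hu : u ≠ 0) : sheetCoord j u ≠ 0 :=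
  mul_ne_zero (K.sheet_root_ne_zero hα j) (pow_ne_zero _ hu)

theorem tendsto_sheetCoord (K : LocalCoords Γ) (hα : α ∈ Γ.ramPts) (j : Γ.Sheet α) :
    Tendsto (sheetCoord j) (𝓝[≠] 0) (𝓝[≠] 0) :=
  tendsto_mul_pow_nhdsNE (K.sheet_root_ne_zero hα j) (K.coverExp_ne_zero hα (sheet_branch j))

theorem analyticAt_sheetCoord (j : Γ.Sheet α) (u : ℂ) : AnalyticAt ℂ (sheetCoord j) u := by
  unfold sheetCoord
  fun_prop

theorem sheetCoord_zero (K : LocalCoords Γ) (hα : α ∈ Γ.ramPts) (j : Γ.Sheet α) :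
    sheetCoord j 0 = 0 := by
  rw [sheetCoord, zero_pow (K.coverExp_ne_zero hα (sheet_branch j)), mul_zero]

theorem eventually_small (K : LocalCoords Γ) (hα : α ∈ Γ.ramPts) :
    ∀ᶠ u in 𝓝[≠] (0 : ℂ), ‖u‖ ^ Γ.coverDeg α < K.radius α ∧ u ≠ 0 := by
  refine Eventually.and (Filter.Eventually.filter_mono nhdsWithin_le_nhds ?_) self_mem_nhdsWithin
  have : Tendsto (fun u : ℂ => ‖u‖ ^ Γ.coverDeg α) (𝓝 0) (𝓝 (‖(0 : ℂ)‖ ^ Γ.coverDeg α)) :=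
    (by fun_prop : Continuous fun u : ℂ => ‖u‖ ^ Γ.coverDeg α).tendsto 0
  rw [norm_zero, zero_pow (K.coverDeg_ne_zero hα)] at this
  exact this.eventually_lt_const (K.radius_pos α)

theorem sheetCoord_mem_target (K : LocalCoords Γ) (hα : α ∈ Γ.ramPts) (j : Γ.Sheet α) {u : ℂ}
    (hu : ‖u‖ ^ Γ.coverDeg α < K.radius α) : sheetCoord j u ∈ (K.ζ j.1.1).target := by
  rw [K.mem_target_iff (sheet_ram hα j), ← norm_pow, K.sheetCoord_pow hα, norm_pow,
    Γ.mem_branches.1 (sheet_branch j)]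
  exact hu

theorem xval_sheetPt (hα : α ∈ Γ.ramPts) (j : Γ.Sheet α) {u : ℂ}
    (hu : ‖u‖ ^ Γ.coverDeg α < K.radius α) :
    Γ.xval (K.sheetPt j u) = finVal (Γ.x α) + u ^ Γ.coverDeg α := by
  rw [sheetPt, K.xval_pt (sheet_ram hα j) (K.sheetCoord_mem_target hα j hu), K.sheetCoord_pow hα,
    finVal_x (sheet_branch j)]

theorem sheetPt_injective (hα : α ∈ Γ.ramPts) {u : ℂ} (hu : ‖u‖ ^ Γ.coverDeg α < K.radius α)
    (hu0 : u ≠ 0) : Function.Injective fun j : Γ.Sheet α => K.sheetPt j u := by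
  rintro ⟨⟨ν, θ⟩, hj⟩ ⟨⟨ν', θ'⟩, hj'⟩ h
  have h1 := K.pt_mem_source (K.sheetCoord_mem_target hα ⟨⟨ν, θ⟩, hj⟩ hu)
  have h2 := K.pt_mem_source (K.sheetCoord_mem_target hα ⟨⟨ν', θ'⟩, hj'⟩ hu)
  have hνν : ν = ν' := by
    by_contra hne
    refine Set.disjoint_left.1 (K.disjoint ν (sheet_ram hα ⟨⟨ν, θ⟩, hj⟩) ν'
      (sheet_ram hα ⟨⟨ν', θ'⟩, hj'⟩) hne) h1 ?_
    have h3 : K.pt ν (sheetCoord ⟨⟨ν, θ⟩, hj⟩ u) = K.pt ν' (sheetCoord ⟨⟨ν', θ'⟩, hj'⟩ u) := h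
    rw [h3]; exact h2
  subst hνν
  have h3 := K.pt_injOn (K.sheetCoord_mem_target hα ⟨⟨ν, θ⟩, hj⟩ hu)
    (K.sheetCoord_mem_target hα ⟨⟨ν, θ'⟩, hj'⟩ hu) h
  have h4 : θ = θ' := mul_right_cancel₀ (pow_ne_zero _ hu0) h3
  subst h4
  rfl

open scoped Classical in
theorem fibre_eq_image (hα : α ∈ Γ.ramPts) {u : ℂ} (hu : ‖u‖ ^ Γ.coverDeg α < K.radius α)
    (hu0 : u ≠ 0) : fibre K α (finVal (Γ.x α) + u ^ Γ.coverDeg α) =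
      (Finset.univ : Finset (Γ.Sheet α)).image fun j => K.sheetPt j u := by
  ext p
  simp only [fibre, Set.Finite.mem_toFinset, Set.mem_ofPred_eq, Finset.mem_image, Finset.mem_univ,
    true_and]
  constructor
  · rintro ⟨hx, μ, hμ, hp⟩
    have hram := Γ.mem_ram_of_mem_branches hα hμ
    have hξ := (K.ζ μ).map_source hp
    have h1 := K.x_eq μ hram _ hξ
    rw [(K.ζ μ).left_inv hp, hx, finVal_x hμ, OnePoint.coe_eq_coe] at h1
    have h2 : (K.ζ μ p) ^ Γ.r μ = u ^ Γ.coverDeg α := (add_left_cancel h1).symm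
    have hm := SpectralCurve.coverExp_mul_r hμ
    -- Both `ζ(p)` and `u ^ coverExp` have `r_μ`-th power `u ^ N`, so their quotient is the root of
    -- unity that selects the sheet.
    have hj : (⟨μ, K.ζ μ p / u ^ Γ.coverExp α μ⟩ : Σ _ : Ct, ℂ) ∈ Γ.sheets α := by
      rw [K.mem_sheets hα]
      refine ⟨hμ, ?_⟩
      dsimp only
      rw [div_pow, h2, ← pow_mul, hm, div_self (pow_ne_zero _ hu0)]
    refine ⟨⟨_, hj⟩, ?_⟩
    rw [sheetPt, sheetCoord, div_mul_cancel₀ _ (pow_ne_zero _ hu0)]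
    exact (K.ζ μ).left_inv hp
  · rintro ⟨j, rfl⟩
    have ht := K.sheetCoord_mem_target hα j hu
    refine ⟨?_, j.1.1, sheet_branch j, K.pt_mem_source ht⟩
    rw [sheetPt, pt, K.x_eq _ (sheet_ram hα j) _ ht, K.sheetCoord_pow hα, finVal_x (sheet_branch j)]

/-- The tangent vector `∂_x` along a sheet. -/
def sheetVec (j : Γ.Sheet α) (u : ℂ) : TangentBundle 𝓘(ℂ) Ct := Γ.ddx (K.sheetPt j u)

theorem isVecCurve_ddζ [IsManifold 𝓘(ℂ) ⊤ Ct] (hα : α ∈ Γ.ramPts) (j : Γ.Sheet α) :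
    IsVecCurve Γ.ramSet j.1.1 (fun u => K.ddζ j.1.1 (sheetCoord j u)) := by
  set μ := j.1.1 with hμdef
  have hμ : μ ∈ Γ.ram := sheet_ram hα j
  have hζ := K.holomorphic μ hμ
  have hch := IsManifold.chart_mem_maximalAtlas (I := 𝓘(ℂ)) (n := ⊤) (M := Ct) μ
  have hsrc : (K.ζ μ).symm 0 ∈ (chartAt ℂ μ).source := by
    have : (K.ζ μ).symm 0 = μ := K.pt_zero hμ
    rw [this]; exact mem_chart_source ℂ μ
  have htr := analyticAt_transition hch hζ (K.zero_mem_target hμ) hsrc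
  have hc0 := K.sheetCoord_zero hα j
  have hev : ∀ᶠ ξ in 𝓝 (0 : ℂ), ξ ∈ (K.ζ μ).target ∧ (K.ζ μ).symm ξ ∈ (chartAt ℂ μ).source :=
    (K.eventually_mem_target hμ).and
      ((K.continuousAt_pt (K.zero_mem_target hμ)).eventually ((chartAt ℂ μ).open_source.mem_nhds hsrc))
  refine ⟨fun u => chartAt ℂ μ ((K.ζ μ).symm (sheetCoord j u)),
    fun u => deriv (fun v => chartAt ℂ μ ((K.ζ μ).symm v)) (sheetCoord j u), ?_, ?_, ?_, ?_, ?_⟩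
  · exact AnalyticAt.fun_comp (g := fun v => chartAt ℂ μ ((K.ζ μ).symm v)) (by rw [hc0]; exact htr)
      (analyticAt_sheetCoord j 0)
  · exact (AnalyticAt.fun_comp (g := deriv fun v => chartAt ℂ μ ((K.ζ μ).symm v))
      (by rw [hc0]; exact htr.deriv) (analyticAt_sheetCoord j 0)).meromorphicAt
  · dsimp only
    rw [hc0]
    exact congrArg _ (K.pt_zero hμ)
  · intro _
    filter_upwards [(K.tendsto_sheetCoord hα j).eventually
      ((hev.filter_mono nhdsWithin_le_nhds).and self_mem_nhdsWithin)] with u hu h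
    have h1 := (chartAt ℂ μ).injOn hu.1.2 (mem_chart_source ℂ μ) h
    exact hu.2 (K.pt_injOn hu.1.1 (K.zero_mem_target hμ) (h1.trans (K.pt_zero hμ).symm))
  · filter_upwards [(K.tendsto_sheetCoord hα j).eventually (hev.filter_mono nhdsWithin_le_nhds)] with u hu
    exact coordVec_eq_smulVec hch hζ hu.1 hu.2

theorem sheetVec_eq (hα : α ∈ Γ.ramPts) (j : Γ.Sheet α) {u : ℂ}
    (hu : ‖u‖ ^ Γ.coverDeg α < K.radius α) (hu0 : u ≠ 0) :
    K.sheetVec j u = smulVec (Γ.r j.1.1 * sheetCoord j u ^ (Γ.r j.1.1 - 1))⁻¹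
      (K.ddζ j.1.1 (sheetCoord j u)) := by
  have ht := K.sheetCoord_mem_target hα j hu
  rw [sheetVec, sheetPt, K.ddx_pt (sheet_ram hα j) ht (K.sheetCoord_ne_zero hα j hu0),
    K.dx_ddζ (sheet_ram hα j) ht]

theorem isVecCurve_sheetVec [IsManifold 𝓘(ℂ) ⊤ Ct] (hα : α ∈ Γ.ramPts) (j : Γ.Sheet α) :
    IsVecCurve Γ.ramSet j.1.1 (K.sheetVec j) := by
  refine ((K.isVecCurve_ddζ hα j).smul
    (c := fun u => (Γ.r j.1.1 * sheetCoord j u ^ (Γ.r j.1.1 - 1))⁻¹) ?_).congr ?_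
  · have h := (analyticAt_sheetCoord j 0).meromorphicAt
    exact ((MeromorphicAt.const _ _).mul (h.pow _)).inv
  · filter_upwards [K.eventually_small hα] with u hu
    exact (K.sheetVec_eq hα j hu.1 hu.2).symm

theorem dx_sheetVec (hα : α ∈ Γ.ramPts) (j : Γ.Sheet α) {u : ℂ}
    (hu : ‖u‖ ^ Γ.coverDeg α < K.radius α) (hu0 : u ≠ 0) : Γ.dx (K.sheetVec j u) = 1 := by
  have ht := K.sheetCoord_mem_target hα j hu
  have h0 := K.sheetCoord_ne_zero hα j hu0
  rw [sheetVec, sheetPt, K.ddx_pt (sheet_ram hα j) ht h0, Γ.dx_smulVec,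
    inv_mul_cancel₀ (K.dx_ddζ_ne_zero (sheet_ram hα j) ht h0)]

/-! ### The function `y` near the ramification points -/

theorem meromorphicAt_yval [IsManifold 𝓘(ℂ) ⊤ Ct] {μ : Ct} (hμ : μ ∈ Γ.ram) :
    MeromorphicAt (fun ξ => Γ.yval (K.pt μ ξ)) 0 ∧
      ∀ᶠ ξ in 𝓝[≠] (0 : ℂ), Γ.y (K.pt μ ξ) ≠ OnePoint.infty := by
  obtain ⟨-, F, hF, hy⟩ := Γ.y_meromorphic μ
  have hζ := K.holomorphic μ hμ
  have hch := IsManifold.chart_mem_maximalAtlas (I := 𝓘(ℂ)) (n := ⊤) (M := Ct) μ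
  have h0 : (K.ζ μ).symm 0 = μ := K.pt_zero hμ
  have hsrc : (K.ζ μ).symm 0 ∈ (chartAt ℂ μ).source := by rw [h0]; exact mem_chart_source ℂ μ
  have htr := analyticAt_transition hch hζ (K.zero_mem_target hμ) hsrc
  have hev : ∀ᶠ ξ in 𝓝[≠] (0 : ℂ), ξ ∈ (K.ζ μ).target ∧ (K.ζ μ).symm ξ ∈ (chartAt ℂ μ).source :=
    ((K.eventually_mem_target hμ).and
      ((K.continuousAt_pt (K.zero_mem_target hμ)).eventually
        ((chartAt ℂ μ).open_source.mem_nhds hsrc))).filter_mono nhdsWithin_le_nhds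
  have hlim : Tendsto (fun ξ => chartAt ℂ μ ((K.ζ μ).symm ξ)) (𝓝[≠] 0) (𝓝[≠] (chartAt ℂ μ μ)) := by
    refine tendsto_nhdsWithin_iff.2 ⟨?_, ?_⟩
    · have := htr.continuousAt.tendsto
      rw [h0] at this
      exact this.mono_left nhdsWithin_le_nhds
    · filter_upwards [hev, self_mem_nhdsWithin] with ξ hξ hξ0 h
      have h1 := (chartAt ℂ μ).injOn hξ.2 (mem_chart_source ℂ μ) h
      exact hξ0 (K.pt_injOn hξ.1 (K.zero_mem_target hμ) (h1.trans (K.pt_zero hμ).symm))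
  have hval : ∀ᶠ ξ in 𝓝[≠] (0 : ℂ),
      Γ.y (K.pt μ ξ) = ((F (chartAt ℂ μ ((K.ζ μ).symm ξ)) : ℂ) : OnePoint ℂ) := by
    filter_upwards [hlim.eventually hy, hev] with ξ h1 h2
    rw [← h1, (chartAt ℂ μ).left_inv h2.2]
    rfl
  constructor
  · refine MeromorphicAt.congr (f := fun ξ => F (chartAt ℂ μ ((K.ζ μ).symm ξ))) ?_ ?_
    · exact MeromorphicAt.comp_analyticAt (f := F) (by rw [h0]; exact hF) htr
    · filter_upwards [hval] with ξ hξ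
      rw [SpectralCurve.yval, hξ]
      rfl
  · filter_upwards [hval] with ξ hξ
    rw [hξ]
    exact OnePoint.coe_ne_infty _

/-- The value of `y` along a sheet. -/
def sheetY (j : Γ.Sheet α) (u : ℂ) : ℂ := Γ.yval (K.sheetPt j u)

theorem meromorphicAt_sheetY [IsManifold 𝓘(ℂ) ⊤ Ct] (hα : α ∈ Γ.ramPts) (j : Γ.Sheet α) :
    MeromorphicAt (K.sheetY j) 0 :=
  MeromorphicAt.comp_analyticAt (f := fun ξ => Γ.yval (K.pt j.1.1 ξ))
    (by rw [K.sheetCoord_zero hα]; exact (K.meromorphicAt_yval (sheet_ram hα j)).1)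
    (analyticAt_sheetCoord j 0)

theorem xt_pt_ne_infty {μ : Ct} (hμ : μ ∈ Γ.ram) {u : ℂ} (hu : u ∈ (K.ζ μ).target) :
    Γ.xt (K.pt μ u) ≠ OnePoint.infty := by
  rw [pt, K.x_eq μ hμ u hu]
  exact OnePoint.coe_ne_infty _

/-- On vectors normalised by `dx = 1` the differential `y dx` is just the value of `y`. -/
theorem om_zero_sheetVec [IsManifold 𝓘(ℂ) ⊤ Ct] {om : ℕ → Multiset (TangentBundle 𝓘(ℂ) Ct) → ℂ}
    (hom : IsCorrelatorFamily K om) (hα : α ∈ Γ.ramPts) (j : Γ.Sheet α) :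
    ∀ᶠ u in 𝓝[≠] (0 : ℂ), om 0 {K.sheetVec j u} = K.sheetY j u := by
  filter_upwards [K.eventually_small hα, (K.tendsto_sheetCoord hα j).eventually
    (K.meromorphicAt_yval (sheet_ram hα j)).2] with u hu hy
  rw [hom.zero_one _ (K.xt_pt_ne_infty (sheet_ram hα j) (K.sheetCoord_mem_target hα j hu.1)) hy,
    K.dx_sheetVec hα j hu.1 hu.2, mul_one]
  rfl

theorem sInt_eq {μ : Ct} (hs : K.s μ ≠ ⊤) :
    meromorphicOrderAt (fun u => Γ.yval (K.pt μ u)) 0 = ((K.sInt μ - Γ.r μ : ℤ) : WithTop ℤ) := by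
  unfold sInt
  cases h : meromorphicOrderAt (fun u => Γ.yval (K.pt μ u)) 0 with
  | top => exact absurd (by rw [s, h, WithTop.top_add]) hs
  | coe n =>
    have : K.s μ = ((n + (Γ.r μ : ℤ) : ℤ) : WithTop ℤ) := by rw [s, h]; rfl
    rw [this, WithTop.untopD_coe]
    congr 1
    ring

theorem t_ne_zero [IsManifold 𝓘(ℂ) ⊤ Ct] {μ : Ct} (hμ : μ ∈ Γ.ram) (hs : K.s μ ≠ ⊤) : K.t μ ≠ 0 := by
  refine neg_ne_zero.2 ((K.meromorphicAt_yval hμ).1.meromorphicTrailingCoeffAt_ne_zero ?_)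
  rw [K.sInt_eq hs]
  exact WithTop.coe_ne_top

theorem tendsto_yval [IsManifold 𝓘(ℂ) ⊤ Ct] {μ : Ct} (hμ : μ ∈ Γ.ram) (hs : K.s μ ≠ ⊤) :
    Tendsto (fun ξ => Γ.yval (K.pt μ ξ) * ξ ^ (-(K.sInt μ - (Γ.r μ : ℤ)))) (𝓝[≠] 0) (𝓝 (-K.t μ)) := by
  have h := (K.meromorphicAt_yval hμ).1.tendsto_nhds_meromorphicTrailingCoeffAt
  rw [K.sInt_eq hs, WithTop.untop₀_coe] at h
  rw [t, neg_neg]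
  refine h.congr fun ξ => ?_
  simp [mul_comm]

theorem eventually_yval_eq_zero {μ : Ct} (hs : K.s μ = ⊤) :
    ∀ᶠ ξ in 𝓝[≠] (0 : ℂ), Γ.yval (K.pt μ ξ) = 0 := by
  refine meromorphicOrderAt_eq_top_iff.1 ?_
  by_contra h
  obtain ⟨n, hn⟩ := WithTop.ne_top_iff_exists.1 h
  rw [s, ← hn] at hs
  exact WithTop.coe_ne_top hs

/-- The leading exponent of `y` along a sheet, in the uniformiser. -/
def sheetExp (K : LocalCoords Γ) (j : Γ.Sheet α) : ℤ :=
  Γ.coverExp α j.1.1 * (K.sInt j.1.1 - (Γ.r j.1.1 : ℤ))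

/-- The leading coefficient of `y` along a sheet, in the uniformiser. -/
def sheetLead (K : LocalCoords Γ) (j : Γ.Sheet α) : ℂ :=
  -K.t j.1.1 * j.1.2 ^ (K.sInt j.1.1 - (Γ.r j.1.1 : ℤ))

/-- Substitute `ζ = θ u ^ m` into the leading term `-t ζ ^ (s - r)`; the root `θ` contributes the
factor that distinguishes the sheets of one branch. -/
theorem tendsto_sheetY [IsManifold 𝓘(ℂ) ⊤ Ct] (hα : α ∈ Γ.ramPts) (j : Γ.Sheet α)
    (hs : K.s j.1.1 ≠ ⊤) :
    Tendsto (fun u => K.sheetY j u * u ^ (-K.sheetExp j)) (𝓝[≠] 0) (𝓝 (K.sheetLead j)) := by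
  have h := ((K.tendsto_yval (sheet_ram hα j) hs).comp (K.tendsto_sheetCoord hα j)).mul_const
    (j.1.2 ^ (K.sInt j.1.1 - (Γ.r j.1.1 : ℤ)))
  refine h.congr' ?_
  filter_upwards [self_mem_nhdsWithin] with u hu
  have hθ := K.sheet_root_ne_zero hα j
  simp only [Function.comp, sheetY, sheetPt, sheetExp, sheetCoord, mul_zpow]
  rw [← zpow_natCast u, ← zpow_mul, mul_assoc, mul_right_comm _ _ (j.1.2 ^ _), ← zpow_add₀ hθ,
    neg_add_cancel, zpow_zero, one_mul, mul_neg]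

theorem sheetLead_ne_zero [IsManifold 𝓘(ℂ) ⊤ Ct] (hα : α ∈ Γ.ramPts) (j : Γ.Sheet α)
    (hs : K.s j.1.1 ≠ ⊤) : K.sheetLead j ≠ 0 :=
  mul_ne_zero (neg_ne_zero.2 (K.t_ne_zero (sheet_ram hα j) hs))
    (zpow_ne_zero _ (K.sheet_root_ne_zero hα j))

theorem eventually_sheetY_eq_zero (hα : α ∈ Γ.ramPts) (j : Γ.Sheet α) (hs : K.s j.1.1 = ⊤) :
    ∀ᶠ u in 𝓝[≠] (0 : ℂ), K.sheetY j u = 0 :=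
  (K.tendsto_sheetCoord hα j).eventually (K.eventually_yval_eq_zero hs)

end LocalCoords

end LoopEq
end

noncomputable section

namespace LoopEq

/-! ## Combinatorics of the slopes -/

/-- The common part cancels. It expresses that a set containing the negative terms and none of the
positive ones minimises a sum, which is the convexity argument used below. -/
theorem sum_le_sum_of_sign {ι : Type*} [DecidableEq ι] (T S : Finset ι) (f : ι → ℚ)
    (h1 : ∀ i ∈ T, i ∉ S → f i ≤ 0) (h2 : ∀ i ∈ S, i ∉ T → 0 ≤ f i) :
    ∑ i ∈ T, f i ≤ ∑ i ∈ S, f i := by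
  rw [← Finset.sum_inter_add_sum_sdiff T S, ← Finset.sum_inter_add_sum_sdiff S T, Finset.inter_comm]
  have h3 : ∑ i ∈ T \ S, f i ≤ 0 := Finset.sum_nonpos fun i hi =>
    h1 i (Finset.mem_sdiff.1 hi).1 (Finset.mem_sdiff.1 hi).2
  have h4 : 0 ≤ ∑ i ∈ S \ T, f i := Finset.sum_nonneg fun i hi =>
    h2 i (Finset.mem_sdiff.1 hi).1 (Finset.mem_sdiff.1 hi).2
  linarith

namespace BranchOrder

variable {Ct C : Type*} [TopologicalSpace Ct] [ChartedSpace ℂ Ct] {Γ : SpectralCurve Ct C}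
  {K : LocalCoords Γ} (O : BranchOrder K) {α : C}

/-- The slope `s_ν / r_ν`. -/
def slopeQ (K : LocalCoords Γ) (ν : Ct) : ℚ := (K.sInt ν : ℚ) / (Γ.r ν : ℚ)

theorem r_pos_of_mem (K : LocalCoords Γ) (hα : α ∈ Γ.ramPts) {ν : Ct} (hν : ν ∈ Γ.branches α) : 0 < Γ.r ν :=
  K.r_pos (Γ.mem_ram_of_mem_branches hα hν)

theorem slopeQ_mul_r (K : LocalCoords Γ) (hα : α ∈ Γ.ramPts) {ν : Ct} (hν : ν ∈ Γ.branches α) :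
    slopeQ K ν * Γ.r ν = K.sInt ν :=
  div_mul_cancel₀ _ (Nat.cast_ne_zero.2 (r_pos_of_mem K hα hν).ne')

theorem mem_seg {μ ν : Ct} (hμ : μ ∈ Γ.branches α) :
    ν ∈ O.seg μ ↔ ν ∈ Γ.branches α ∧ O.le ν μ ∧ ν ≠ μ := by
  classical
  rw [seg, Finset.mem_filter, Γ.mem_branches.1 hμ]

theorem seg_subset {μ : Ct} (hμ : μ ∈ Γ.branches α) : O.seg μ ⊆ Γ.branches α :=
  fun _ hν => ((O.mem_seg hμ).1 hν).1

theorem self_notMem_seg {μ : Ct} (hμ : μ ∈ Γ.branches α) : μ ∉ O.seg μ :=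
  fun h => ((O.mem_seg hμ).1 h).2.2 rfl

/-- An infinite slope comes last in the order and, by (i), at most once, so it never precedes
anything. -/
theorem s_ne_top_of_mem_seg (hnd : K.Nondegenerate) (hα : α ∈ Γ.ramPts) {μ ν : Ct}
    (hμ : μ ∈ Γ.branches α) (hν : ν ∈ O.seg μ) : K.s ν ≠ ⊤ := by
  intro hs
  obtain ⟨h1, h2, h3⟩ := (O.mem_seg hμ).1 hν
  rcases O.slope α hα ν h1 μ hμ h2 with h | h
  · exact (hnd α hα).1 ⟨ν, h1, μ, hμ, h3, hs, h⟩
  · exact h.1 hs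

theorem slopeQ_le_of_cross (hα : α ∈ Γ.ramPts) {μ ν : Ct}
    (hμ : μ ∈ Γ.branches α) (hν : ν ∈ Γ.branches α)
    (h : K.sInt ν * (Γ.r μ : ℤ) ≤ K.sInt μ * (Γ.r ν : ℤ)) : slopeQ K ν ≤ slopeQ K μ := by
  have h1 : (0 : ℚ) < Γ.r ν := Nat.cast_pos.2 (r_pos_of_mem K hα hν)
  have h2 : (0 : ℚ) < Γ.r μ := Nat.cast_pos.2 (r_pos_of_mem K hα hμ)
  rw [slopeQ, slopeQ, div_le_div_iff₀ h1 h2]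
  exact_mod_cast h

theorem slopeQ_le_of_mem_seg (hα : α ∈ Γ.ramPts) {μ ν : Ct}
    (hμ : μ ∈ Γ.branches α) (hν : ν ∈ O.seg μ) (hs : K.s μ ≠ ⊤) : slopeQ K ν ≤ slopeQ K μ := by
  obtain ⟨h1, h2, h3⟩ := (O.mem_seg hμ).1 hν
  rcases O.slope α hα ν h1 μ hμ h2 with h | h
  · exact absurd h hs
  · exact slopeQ_le_of_cross hα hμ h1 h.2.2

theorem le_of_notMem_seg (hα : α ∈ Γ.ramPts) {μ ν : Ct}
    (hμ : μ ∈ Γ.branches α) (hν : ν ∈ Γ.branches α) (hνs : ν ∉ O.seg μ) : O.le μ ν := by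
  rcases O.total α hα μ hμ ν hν with h | h
  · exact h
  · by_cases he : ν = μ
    · exact he ▸ O.refl α hα ν hν
    · exact absurd ((O.mem_seg hμ).2 ⟨hν, h, he⟩) hνs

theorem s_ne_top_of_notMem_seg (hα : α ∈ Γ.ramPts) {μ ν : Ct}
    (hμ : μ ∈ Γ.branches α) (hν : ν ∈ Γ.branches α) (hνs : ν ∉ O.seg μ) (hs : K.s ν ≠ ⊤) :
    K.s μ ≠ ⊤ := by
  rcases O.slope α hα μ hμ ν hν (O.le_of_notMem_seg hα hμ hν hνs) with h | h
  · exact absurd h hs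
  · exact h.1

theorem slopeQ_ge_of_notMem_seg (hα : α ∈ Γ.ramPts) {μ ν : Ct}
    (hμ : μ ∈ Γ.branches α) (hν : ν ∈ Γ.branches α) (hνs : ν ∉ O.seg μ) (hs : K.s ν ≠ ⊤) :
    slopeQ K μ ≤ slopeQ K ν := by
  rcases O.slope α hα μ hμ ν hν (O.le_of_notMem_seg hα hμ hν hνs) with h | h
  · exact absurd h hs
  · exact slopeQ_le_of_cross hα hν hμ h.2.2

theorem r_eq_one_of_top (hnd : K.Nondegenerate) (hα : α ∈ Γ.ramPts) {μ : Ct}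
    (hμ : μ ∈ Γ.branches α) (hs : K.s μ = ⊤) : Γ.r μ = 1 := by
  by_contra h
  have := r_pos_of_mem K hα hμ
  exact (hnd α hα).2.1 ⟨μ, hμ, hs, by omega⟩

/-- By (i) every other branch has finite slope, and an infinite slope cannot precede a finite one.
-/
theorem mem_seg_of_top (hnd : K.Nondegenerate) (hα : α ∈ Γ.ramPts) {μ ν : Ct}
    (hμ : μ ∈ Γ.branches α) (hs : K.s μ = ⊤) (hν : ν ∈ Γ.branches α) (hne : ν ≠ μ) :
    ν ∈ O.seg μ := by
  by_contra h
  have h1 : K.s ν ≠ ⊤ := fun h1 => (hnd α hα).1 ⟨ν, hν, μ, hμ, hne, h1, hs⟩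
  exact O.s_ne_top_of_notMem_seg hα hμ hν h h1 hs

theorem rSeg_add_r_le_rSeg (hα : α ∈ Γ.ramPts) {μ ν : Ct}
    (hμ : μ ∈ Γ.branches α) (hν : ν ∈ O.seg μ) : O.rSeg ν + Γ.r ν ≤ O.rSeg μ := by
  classical
  obtain ⟨h1, h2, h3⟩ := (O.mem_seg hμ).1 hν
  rw [rSeg, rSeg, add_comm, ← Finset.sum_insert (O.self_notMem_seg h1)]
  refine Finset.sum_le_sum_of_subset fun κ hκ => ?_
  rcases Finset.mem_insert.1 hκ with rfl | hκ
  · exact hν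
  · obtain ⟨g1, g2, g3⟩ := (O.mem_seg h1).1 hκ
    refine (O.mem_seg hμ).2 ⟨g1, O.trans α hα κ g1 ν h1 μ hμ g2 h2, ?_⟩
    rintro rfl
    exact h3 (O.antisymm α hα ν h1 κ g1 h2 g2)

theorem rSeg_add_one_of_top (hnd : K.Nondegenerate) (hα : α ∈ Γ.ramPts) {μ : Ct}
    (hμ : μ ∈ Γ.branches α) (hs : K.s μ = ⊤) : O.rSeg μ + 1 = Γ.rTot α := by
  classical
  rw [← r_eq_one_of_top hnd hα hμ hs, rSeg, SpectralCurve.rTot, add_comm,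
    ← Finset.sum_insert (O.self_notMem_seg hμ)]
  refine Finset.sum_congr ?_ fun _ _ => rfl
  refine (Finset.insert_subset hμ (O.seg_subset hμ)).antisymm fun ν hν => ?_
  rw [Finset.mem_insert]
  by_cases h : ν = μ
  · exact Or.inl h
  · exact Or.inr (O.mem_seg_of_top hnd hα hμ hs hν h)

/-- Every `i ∈ [r_α]` belongs to the range of exactly one branch; here, existence. -/
theorem exists_branch (hα : α ∈ Γ.ramPts) {i : ℕ} (hi : i ∈ Finset.Icc 1 (Γ.rTot α)) :
    ∃ lam ∈ Γ.branches α, O.rSeg lam < i ∧ i ≤ O.rSeg lam + Γ.r lam := by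
  classical
  obtain ⟨hi1, hi2⟩ := Finset.mem_Icc.1 hi
  have hrpos : ∀ ν ∈ Γ.branches α, 0 < Γ.r ν := fun ν hν => r_pos_of_mem K hα hν
  have hne : (Γ.branches α).Nonempty := by
    rw [Finset.nonempty_iff_ne_empty]
    intro h
    rw [SpectralCurve.rTot, h, Finset.sum_empty] at hi2
    omega
  have hmono : ∀ μ ∈ Γ.branches α, ∀ ν ∈ O.seg μ, O.rSeg ν < O.rSeg μ := by
    intro μ hμ ν hν
    have h1 := O.rSeg_add_r_le_rSeg hα hμ hν
    have h2 := hrpos ν (O.seg_subset hμ hν)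
    omega
  -- the candidates
  let S := (Γ.branches α).filter fun ν => O.rSeg ν < i
  have hS : S.Nonempty := by
    obtain ⟨μ, hμ, hmin⟩ := Finset.exists_min_image (Γ.branches α) O.rSeg hne
    refine ⟨μ, Finset.mem_filter.2 ⟨hμ, ?_⟩⟩
    have : O.seg μ = ∅ := by
      rw [Finset.eq_empty_iff_forall_notMem]
      intro ν hν
      have h1 := hmono μ hμ ν hν
      have h2 := hmin ν (O.seg_subset hμ hν)
      omega
    rw [rSeg, this, Finset.sum_empty]
    omega
  obtain ⟨lam, hlam, hmax⟩ := Finset.exists_max_image S O.rSeg hS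
  obtain ⟨hlam1, hlam2⟩ := Finset.mem_filter.1 hlam
  refine ⟨lam, hlam1, hlam2, ?_⟩
  by_contra hlt
  rw [not_le] at hlt
  -- The branches after `lam`. If `i` lay beyond the range of `lam`, the first of them, `κ`, would
  -- satisfy `rSeg κ ≤ rSeg lam + r lam < i` and contradict the maximality of `lam`.
  let T := (Γ.branches α).filter fun ν => ν ∉ O.seg lam ∧ ν ≠ lam
  have hT : T.Nonempty := by
    rw [Finset.nonempty_iff_ne_empty]
    intro h
    have hsub : Γ.branches α ⊆ insert lam (O.seg lam) := by
      intro ν hν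
      by_contra hν'
      rw [Finset.mem_insert, not_or] at hν'
      have : ν ∈ T := Finset.mem_filter.2 ⟨hν, hν'.2, hν'.1⟩
      rw [h] at this
      exact Finset.notMem_empty _ this
    have h1 : Γ.rTot α ≤ ∑ ν ∈ insert lam (O.seg lam), Γ.r ν :=
      Finset.sum_le_sum_of_subset hsub
    rw [Finset.sum_insert (O.self_notMem_seg hlam1)] at h1
    have : ∑ ν ∈ O.seg lam, Γ.r ν = O.rSeg lam := rfl
    omega
  obtain ⟨κ, hκ, hmin⟩ := Finset.exists_min_image T O.rSeg hT
  obtain ⟨hκ1, hκ2, hκ3⟩ := Finset.mem_filter.1 hκ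
  have hle := O.le_of_notMem_seg hα hlam1 hκ1 hκ2
  have hlk : lam ∈ O.seg κ := (O.mem_seg hκ1).2 ⟨hlam1, hle, hκ3.symm⟩
  have hsub : O.seg κ ⊆ insert lam (O.seg lam) := by
    intro ν hν
    by_contra hν'
    rw [Finset.mem_insert, not_or] at hν'
    have h1 := hmin ν (Finset.mem_filter.2 ⟨O.seg_subset hκ1 hν, hν'.2, hν'.1⟩)
    have h2 := hmono κ hκ1 ν hν
    omega
  have h1 : O.rSeg κ ≤ ∑ ν ∈ insert lam (O.seg lam), Γ.r ν := Finset.sum_le_sum_of_subset hsub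
  rw [Finset.sum_insert (O.self_notMem_seg hlam1)] at h1
  have h2 : ∑ ν ∈ O.seg lam, Γ.r ν = O.rSeg lam := rfl
  have h3 := hmax κ (Finset.mem_filter.2 ⟨hκ1, by omega⟩)
  have h4 := hmono κ hκ1 lam hlk
  omega

theorem sum_seg_sub (hα : α ∈ Γ.ramPts) {μ : Ct} (hμ : μ ∈ Γ.branches α) (σ : ℚ) :
    ∑ ν ∈ O.seg μ, (Γ.r ν : ℚ) * (slopeQ K ν - σ) = (O.sSeg μ : ℚ) - σ * O.rSeg μ := by
  rw [sSeg, rSeg]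
  push_cast
  rw [Finset.mul_sum, ← Finset.sum_sub_distrib]
  refine Finset.sum_congr rfl fun ν hν => ?_
  rw [← slopeQ_mul_r K hα (O.seg_subset hμ hν)]
  ring

/-- The broken line through the points `(𝐫_{[λ)}, 𝐬_{[λ)})` lies above its tangents. -/
theorem tangent_le (hnd : K.Nondegenerate) (hα : α ∈ Γ.ramPts) {μ lam : Ct}
    (hμ : μ ∈ Γ.branches α) (hlam : lam ∈ Γ.branches α) (hs : K.s μ ≠ ⊤) {t : ℚ} (ht0 : 0 ≤ t)
    (ht1 : t ≤ 1) (ht : K.s lam = ⊤ → t = 0) :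
    (O.sSeg μ : ℚ) - slopeQ K μ * O.rSeg μ ≤
      (O.sSeg lam : ℚ) - slopeQ K μ * O.rSeg lam + t * (K.sInt lam - slopeQ K μ * Γ.r lam) := by
  classical
  -- The segment `[μ)` has no branch of slope above that of `μ`, and no branch outside it has
  -- smaller slope. So it minimises the weighted sum of slope differences.
  have key : ∀ A ⊆ Γ.branches α, (∀ ν ∈ A, K.s ν ≠ ⊤) →
      (O.sSeg μ : ℚ) - slopeQ K μ * O.rSeg μ ≤ ∑ ν ∈ A, (Γ.r ν : ℚ) * (slopeQ K ν - slopeQ K μ) := by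
    intro A hA hAs
    rw [← O.sum_seg_sub hα hμ]
    refine sum_le_sum_of_sign _ _ _ (fun ν hν _ => ?_) fun ν hν hν' => ?_
    · exact mul_nonpos_of_nonneg_of_nonpos (Nat.cast_nonneg _)
        (sub_nonpos.2 (O.slopeQ_le_of_mem_seg hα hμ hν hs))
    · exact mul_nonneg (Nat.cast_nonneg _)
        (sub_nonneg.2 (O.slopeQ_ge_of_notMem_seg hα hμ (hA hν) hν' (hAs ν hν)))
  have h1 := key (O.seg lam) (O.seg_subset hlam) fun ν hν => O.s_ne_top_of_mem_seg hnd hα hlam hν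
  rw [O.sum_seg_sub hα hlam] at h1
  -- The parameter `t` interpolates between the vertices of `[lam)` and of `[lam) ∪ {lam}`. For
  -- infinite slope the second vertex makes no sense, but then `t = 0`.
  by_cases hls : K.s lam = ⊤
  · rw [ht hls]; linarith
  · have h2 := key (insert lam (O.seg lam)) (Finset.insert_subset hlam (O.seg_subset hlam)) (by
      intro ν hν
      rcases Finset.mem_insert.1 hν with rfl | hν
      · exact hls
      · exact O.s_ne_top_of_mem_seg hnd hα hlam hν)
    rw [Finset.sum_insert (O.self_notMem_seg hlam), O.sum_seg_sub hα hlam] at h2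
    have h3 := slopeQ_mul_r K hα hlam
    have h4 : (Γ.r lam : ℚ) * (slopeQ K lam - slopeQ K μ) = K.sInt lam - slopeQ K μ * Γ.r lam := by
      rw [← h3]; ring
    rw [h4] at h2
    nlinarith

/-- The exponent in the abstract loop equations, in units of the pole order in `τ`. -/
theorem one_add_sub_dExp (lam : Ct) (i : ℕ) :
    1 + (if i = 1 then 1 else 0) - O.dExp lam i =
      O.sSeg lam + ⌊((K.sInt lam : ℚ) * ((i : ℚ) - (O.rSeg lam : ℚ) - 1)) / (Γ.r lam : ℚ)⌋ + 1 +
        (if i = 1 then 1 else 0) - (if i = O.rSeg lam + 1 then 1 else 0) := by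
  unfold dExp
  ring

/-- Since `⌊x⌋ + 1 > x`, the exponent lies above the broken line at `i - 1`. At a vertex the floor
is exact and `δ_{i',1}` removes the extra `1`; the term for `i = 1` only helps. -/
theorem line_le {lam : Ct} {i : ℕ} :
    (O.sSeg lam : ℚ) + slopeQ K lam * ((i : ℚ) - 1 - O.rSeg lam) ≤
      ((1 + (if i = 1 then 1 else 0) - O.dExp lam i : ℤ) : ℚ) := by
  rw [O.one_add_sub_dExp]
  have hδ : (0 : ℤ) ≤ if i = 1 then 1 else 0 := by split_ifs <;> norm_num
  have hδ' : (0 : ℚ) ≤ ((if i = 1 then 1 else 0 : ℤ) : ℚ) := by exact_mod_cast hδ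
  have hx : (K.sInt lam : ℚ) * ((i : ℚ) - (O.rSeg lam : ℚ) - 1) / (Γ.r lam : ℚ) =
      slopeQ K lam * ((i : ℚ) - 1 - O.rSeg lam) := by
    unfold slopeQ; ring
  by_cases hi1 : i = O.rSeg lam + 1
  · have h0 : (i : ℚ) - 1 - O.rSeg lam = 0 := by rw [hi1]; push_cast; ring
    rw [hx, h0, mul_zero, Int.floor_zero, if_pos hi1]
    push_cast at hδ' ⊢
    linarith
  · have h1 := Int.lt_floor_add_one (slopeQ K lam * ((i : ℚ) - 1 - O.rSeg lam))
    rw [hx, if_neg hi1]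
    push_cast at hδ' ⊢
    linarith

/-- The exponents of the abstract loop equations dominate those of the master loop equations. -/
theorem master_exponent_le (hnd : K.Nondegenerate) (hα : α ∈ Γ.ramPts) {μ lam : Ct}
    (hμ : μ ∈ Γ.branches α) (hlam : lam ∈ Γ.branches α) {i : ℕ} (hi : O.rSeg lam < i)
    (hi' : i ≤ O.rSeg lam + Γ.r lam) (hs : K.s μ = ⊤ → i = Γ.rTot α) :
    K.sInt μ * ((i : ℤ) - 1 - O.rSeg μ) + O.sSeg μ * (Γ.r μ : ℤ) ≤
      (Γ.r μ : ℤ) * (1 + (if i = 1 then 1 else 0) - O.dExp lam i) := by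
  have hline := O.line_le (lam := lam) (i := i)
  have hrμ : (0 : ℚ) < Γ.r μ := Nat.cast_pos.2 (r_pos_of_mem K hα hμ)
  have hrl : (0 : ℚ) < Γ.r lam := Nat.cast_pos.2 (r_pos_of_mem K hα hlam)
  have hgoal : (O.sSeg μ : ℚ) + slopeQ K μ * ((i : ℚ) - 1 - O.rSeg μ) ≤
      (O.sSeg lam : ℚ) + slopeQ K lam * ((i : ℚ) - 1 - O.rSeg lam) := by
    -- If `s_μ` is infinite, `i = r_α` is the last index, which belongs to the last branch; hence
    -- `lam = μ`.
    by_cases hsμ : K.s μ = ⊤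
    · have h1 := hs hsμ
      have h2 := O.rSeg_add_one_of_top hnd hα hμ hsμ
      have : lam = μ := by
        by_contra hne
        have h3 := O.rSeg_add_r_le_rSeg hα hμ (O.mem_seg_of_top hnd hα hμ hsμ hlam hne)
        omega
      rw [this]
    · have hi1 : (O.rSeg lam : ℚ) + 1 ≤ i := by exact_mod_cast hi
      have hi2 : (i : ℚ) ≤ O.rSeg lam + Γ.r lam := by exact_mod_cast hi'
      -- The value of `t` is the position of `i - 1` on the edge of the broken line that belongs to
      -- `lam`.
      have h1 := O.tangent_le hnd hα hμ hlam hsμ (t := ((i : ℚ) - 1 - O.rSeg lam) / Γ.r lam)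
        (div_nonneg (by linarith) hrl.le) (by rw [div_le_one hrl]; linarith) (by
          intro htop
          have hr1 := r_eq_one_of_top hnd hα hlam htop
          have : i = O.rSeg lam + 1 := by omega
          rw [this]; push_cast; simp)
      have h2 : ((i : ℚ) - 1 - O.rSeg lam) / Γ.r lam * (K.sInt lam - slopeQ K μ * Γ.r lam) =
          slopeQ K lam * ((i : ℚ) - 1 - O.rSeg lam) - slopeQ K μ * ((i : ℚ) - 1 - O.rSeg lam) := by
        rw [← slopeQ_mul_r K hα hlam]
        field_simp
      rw [h2] at h1
      linarith
  have h3 := hgoal.trans hline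
  have h4 : (K.sInt μ : ℚ) * ((i : ℚ) - 1 - O.rSeg μ) + O.sSeg μ * (Γ.r μ : ℚ) ≤
      (Γ.r μ : ℚ) * ((1 + (if i = 1 then 1 else 0) - O.dExp lam i : ℤ) : ℚ) := by
    have h5 := mul_le_mul_of_nonneg_left h3 hrμ.le
    refine le_trans (le_of_eq ?_) h5
    rw [← slopeQ_mul_r K hα hμ]
    ring
  exact_mod_cast h4

/-- The slopes of `i - 1` sheets add up to more than one less than the exponent of the abstract
loop equation. -/
theorem exponent_lt_sum_slopes (hnd : K.Nondegenerate) (hα : α ∈ Γ.ramPts) {lam : Ct}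
    (hlam : lam ∈ Γ.branches α) {i : ℕ} (hi : O.rSeg lam < i) (hi' : i ≤ O.rSeg lam + Γ.r lam)
    (hi1 : i ≠ 1) (S : Finset (Γ.Sheet α)) (hS : S.card = i - 1)
    (hfin : ∀ k ∈ S, K.s k.1.1 ≠ ⊤) :
    ((1 + (if i = 1 then 1 else 0) - O.dExp lam i : ℤ) : ℚ) - 1 < ∑ k ∈ S, slopeQ K k.1.1 := by
  classical
  have hrl : (0 : ℚ) < Γ.r lam := Nat.cast_pos.2 (r_pos_of_mem K hα hlam)
  have hScard : (S.card : ℚ) = (i : ℚ) - 1 := by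
    rw [hS, Nat.cast_sub (by omega)]; simp
  -- sums over the sheets above a set of branches
  have hsheet : ∀ σ : ℚ, ∑ k ∈ (Finset.univ : Finset (Γ.Sheet α)).filter (fun k => k.1.1 ∈ O.seg lam),
      (slopeQ K k.1.1 - σ) = (O.sSeg lam : ℚ) - σ * O.rSeg lam := by
    intro σ
    rw [← O.sum_seg_sub hα hlam, Finset.sum_filter,
      Finset.sum_coe_sort (Γ.sheets α) (fun k => if k.1 ∈ O.seg lam then slopeQ K k.1 - σ else 0),
      SpectralCurve.sheets, Finset.sum_sigma]
    have h1 : ∀ ν ∈ Γ.branches α, ∑ θ ∈ Polynomial.nthRootsFinset (Γ.r ν) (1 : ℂ),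
        (if ν ∈ O.seg lam then slopeQ K ν - σ else 0) =
        if ν ∈ O.seg lam then (Γ.r ν : ℚ) * (slopeQ K ν - σ) else 0 := by
      intro ν hν
      rw [Finset.sum_const, K.card_nthRoots hα hν]
      split_ifs <;> simp
    rw [Finset.sum_congr rfl h1, ← Finset.sum_filter]
    refine Finset.sum_congr ?_ fun _ _ => rfl
    ext ν
    rw [Finset.mem_filter]
    exact ⟨fun h => h.2, fun h => ⟨O.seg_subset hlam h, h⟩⟩
  -- The broken line at `i - 1` is the sum of the `i - 1` smallest slopes: all sheets over `[lam)`,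
  -- then sheets over `lam`.
  have hf : (O.sSeg lam : ℚ) + slopeQ K lam * ((i : ℚ) - 1 - O.rSeg lam) ≤ ∑ k ∈ S, slopeQ K k.1.1 := by
    by_cases hls : K.s lam = ⊤
    · have hr1 := r_eq_one_of_top hnd hα hlam hls
      have hiseg : i = O.rSeg lam + 1 := by omega
      have h0 : (i : ℚ) - 1 - O.rSeg lam = 0 := by rw [hiseg]; push_cast; ring
      -- The number of sheets over `[lam)` is the difference of the identity `hsheet` at `σ = 0` and
      -- at `σ = 1`.
      have hcard : ((Finset.univ : Finset (Γ.Sheet α)).filter (fun k => k.1.1 ∈ O.seg lam)).card =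
          O.rSeg lam := by
        have h1 := hsheet 0
        have h2 := hsheet 1
        have h3 : ∑ k ∈ (Finset.univ : Finset (Γ.Sheet α)).filter (fun k => k.1.1 ∈ O.seg lam),
            (slopeQ K k.1.1 - 1) = ∑ k ∈ (Finset.univ : Finset (Γ.Sheet α)).filter
              (fun k => k.1.1 ∈ O.seg lam), (slopeQ K k.1.1 - 0) -
            ((Finset.univ : Finset (Γ.Sheet α)).filter (fun k => k.1.1 ∈ O.seg lam)).card := by
          simp [Finset.sum_sub_distrib]
        rw [h1, h2] at h3
        have h4 : (((Finset.univ : Finset (Γ.Sheet α)).filter (fun k => k.1.1 ∈ O.seg lam)).card : ℚ) =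
            O.rSeg lam := by linarith
        exact_mod_cast h4
      have hSsub : S ⊆ (Finset.univ : Finset (Γ.Sheet α)).filter (fun k => k.1.1 ∈ O.seg lam) := by
        intro k hk
        refine Finset.mem_filter.2 ⟨Finset.mem_univ _, ?_⟩
        refine O.mem_seg_of_top hnd hα hlam hls (LocalCoords.sheet_branch k) ?_
        intro h
        exact hfin k hk (h ▸ hls)
      -- Here `i - 1` is the number of all sheets of finite slope, so `S` has no choice.
      have hSeq := Finset.eq_of_subset_of_card_le hSsub (by rw [hcard, hS]; omega)
      rw [h0, mul_zero, add_zero, hSeq]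
      have := hsheet 0
      simp only [sub_zero, zero_mul] at this
      exact this.ge
    · have h1 : ∑ k ∈ (Finset.univ : Finset (Γ.Sheet α)).filter (fun k => k.1.1 ∈ O.seg lam),
          (slopeQ K k.1.1 - slopeQ K lam) ≤ ∑ k ∈ S, (slopeQ K k.1.1 - slopeQ K lam) := by
        refine sum_le_sum_of_sign _ _ _ (fun k hk _ => ?_) fun k hk hk' => ?_
        · exact sub_nonpos.2 (O.slopeQ_le_of_mem_seg hα hlam (Finset.mem_filter.1 hk).2 hls)
        · refine sub_nonneg.2 (O.slopeQ_ge_of_notMem_seg hα hlam (LocalCoords.sheet_branch k) ?_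
            (hfin k hk))
          intro h
          exact hk' (Finset.mem_filter.2 ⟨Finset.mem_univ _, h⟩)
      rw [hsheet, Finset.sum_sub_distrib, Finset.sum_const, nsmul_eq_mul, hScard] at h1
      linarith
  refine lt_of_lt_of_le ?_ hf
  rw [O.one_add_sub_dExp, if_neg hi1]
  have hx : (K.sInt lam : ℚ) * ((i : ℚ) - (O.rSeg lam : ℚ) - 1) / (Γ.r lam : ℚ) =
      slopeQ K lam * ((i : ℚ) - 1 - O.rSeg lam) := by
    unfold slopeQ; ring
  rw [hx]
  by_cases hi1' : i = O.rSeg lam + 1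
  · have h0 : (i : ℚ) - 1 - O.rSeg lam = 0 := by rw [hi1']; push_cast; ring
    rw [h0, mul_zero, Int.floor_zero, if_pos hi1']
    push_cast
    linarith
  · rw [if_neg hi1']
    -- Strictness comes from (iv): for `0 < i' - 1 < r` an integral value of `s (i' - 1) / r` would
    -- make `r` divide `i' - 1`, as `r` and `s` are coprime.
    have hlt : (⌊slopeQ K lam * ((i : ℚ) - 1 - O.rSeg lam)⌋ : ℚ) <
        slopeQ K lam * ((i : ℚ) - 1 - O.rSeg lam) := by
      refine lt_of_le_of_ne (Int.floor_le _) fun heq => ?_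
      have hr2 : 1 < Γ.r lam := by omega
      have hls : K.s lam ≠ ⊤ := by
        intro h
        have := r_eq_one_of_top hnd hα hlam h
        omega
      have hg : Int.gcd (Γ.r lam : ℤ) (K.sInt lam) = 1 := by
        have h1 : ¬ 1 < Int.gcd (Γ.r lam : ℤ) (K.sInt lam) := fun h =>
          (hnd α hα).2.2.2 ⟨lam, hlam, hls, h⟩
        have h2 : 0 < Int.gcd (Γ.r lam : ℤ) (K.sInt lam) := by
          rw [Int.gcd_pos_iff]; left; exact_mod_cast (by omega : Γ.r lam ≠ 0)
        omega
      set f : ℤ := ⌊slopeQ K lam * ((i : ℚ) - 1 - O.rSeg lam)⌋ with hfdef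
      have h1 : (f : ℚ) * Γ.r lam = K.sInt lam * ((i : ℚ) - 1 - O.rSeg lam) := by
        rw [heq, ← slopeQ_mul_r K hα hlam]; ring
      have h2 : f * (Γ.r lam : ℤ) = K.sInt lam * ((i : ℤ) - 1 - O.rSeg lam) := by exact_mod_cast h1
      have h3 : (Γ.r lam : ℤ) ∣ K.sInt lam * ((i : ℤ) - 1 - O.rSeg lam) := ⟨f, by rw [← h2]; ring⟩
      have h4 : (Γ.r lam : ℤ) ∣ (i : ℤ) - 1 - O.rSeg lam :=
        Int.dvd_of_dvd_mul_right_of_gcd_one h3 hg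
      have h5 := Int.le_of_dvd (by omega) h4
      omega
    push_cast
    linarith

end BranchOrder

end LoopEq
end

noncomputable section

namespace LoopEq

/-! ## Asymptotics of the differences of the values of `y` on the sheets -/

namespace LocalCoords

variable {Ct C : Type*} [TopologicalSpace Ct] [ChartedSpace ℂ Ct] {Γ : SpectralCurve Ct C}
  {K : LocalCoords Γ} {α : C}

theorem sum_sheets (K : LocalCoords Γ) (hα : α ∈ Γ.ramPts) (f : Ct → ℤ) :
    ∑ k : Γ.Sheet α, f k.1.1 = ∑ ν ∈ Γ.branches α, (Γ.r ν : ℤ) * f ν := by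
  rw [Finset.sum_coe_sort (Γ.sheets α) (fun k => f k.1), SpectralCurve.sheets, Finset.sum_sigma]
  refine Finset.sum_congr rfl fun ν hν => ?_
  dsimp only
  rw [Finset.sum_const, K.card_nthRoots hα hν, nsmul_eq_mul]

theorem sheetExp_mul_r (j : Γ.Sheet α) :
    K.sheetExp j * Γ.r j.1.1 = Γ.coverDeg α * (K.sInt j.1.1 - (Γ.r j.1.1 : ℤ)) := by
  have h : ((Γ.coverExp α j.1.1 : ℤ)) * Γ.r j.1.1 = Γ.coverDeg α :=
    mod_cast SpectralCurve.coverExp_mul_r (sheet_branch j)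
  rw [sheetExp, ← h]
  ring

theorem sheetExp_sub_mul (j k : Γ.Sheet α) :
    (K.sheetExp k - K.sheetExp j) * (Γ.r j.1.1 * Γ.r k.1.1) =
      Γ.coverDeg α * (K.sInt k.1.1 * Γ.r j.1.1 - K.sInt j.1.1 * Γ.r k.1.1) := by
  have h1 := K.sheetExp_mul_r j
  have h2 := K.sheetExp_mul_r k
  linear_combination (Γ.r j.1.1 : ℤ) * h2 - (Γ.r k.1.1 : ℤ) * h1

theorem isCoprime_r_sInt (hnd : K.Nondegenerate) (hα : α ∈ Γ.ramPts) {μ : Ct}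
    (hμ : μ ∈ Γ.branches α) (hs : K.s μ ≠ ⊤) : IsCoprime (Γ.r μ : ℤ) (K.sInt μ) := by
  rw [Int.isCoprime_iff_gcd_eq_one]
  have h1 : ¬ 1 < Int.gcd (Γ.r μ : ℤ) (K.sInt μ) := fun h => (hnd α hα).2.2.2 ⟨μ, hμ, hs, h⟩
  have h2 : 0 < Int.gcd (Γ.r μ : ℤ) (K.sInt μ) := Int.gcd_pos_of_ne_zero_left _
    (by have := K.r_pos (Γ.mem_ram_of_mem_branches hα hμ); omega)
  omega

/-- Equal slopes in lowest terms have equal `r` and `s`. On one branch the quotient of the two roots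
of unity is killed by the coprime exponents `r` and `s`, hence is `1`. On two branches the `r`-th
power of the equation of leading coefficients is the equality `t_μ^r = t_ν^r` excluded by (iii). -/
theorem sheetLead_ne [IsManifold 𝓘(ℂ) ⊤ Ct] (hnd : K.Nondegenerate) (hα : α ∈ Γ.ramPts)
    {j k : Γ.Sheet α} (hjk : j ≠ k) (hj : K.s j.1.1 ≠ ⊤) (hk : K.s k.1.1 ≠ ⊤)
    (hcross : K.sInt j.1.1 * (Γ.r k.1.1 : ℤ) = K.sInt k.1.1 * (Γ.r j.1.1 : ℤ)) :
    K.sheetLead k ≠ K.sheetLead j := by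
  intro hlead
  have cj := isCoprime_r_sInt hnd hα (sheet_branch j) hj
  have ck := isCoprime_r_sInt hnd hα (sheet_branch k) hk
  have hr0 : 0 < Γ.r k.1.1 := K.r_pos (sheet_ram hα k)
  have hr : Γ.r j.1.1 = Γ.r k.1.1 := by
    refine Nat.dvd_antisymm ?_ ?_
    · exact Int.natCast_dvd_natCast.1 (cj.dvd_of_dvd_mul_left ⟨K.sInt k.1.1, by rw [hcross]; ring⟩)
    · exact Int.natCast_dvd_natCast.1 (ck.dvd_of_dvd_mul_left ⟨K.sInt j.1.1, by rw [← hcross]; ring⟩)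
  have hsI : K.sInt j.1.1 = K.sInt k.1.1 := by
    rw [hr] at hcross
    exact mul_right_cancel₀ (Nat.cast_ne_zero.2 hr0.ne') hcross
  have hθj := K.sheet_root_ne_zero hα j
  have hθk := K.sheet_root_ne_zero hα k
  have rj := K.sheet_root hα j
  have rk := K.sheet_root hα k
  rw [sheetLead, sheetLead, hsI, hr] at hlead
  rw [hr] at rj
  by_cases hb : j.1.1 = k.1.1
  · rw [hb] at hlead
    have h1 := mul_left_cancel₀ (neg_ne_zero.2 (K.t_ne_zero (sheet_ram hα k) hk)) hlead
    have hq1 : (k.1.2 / j.1.2) ^ (Γ.r k.1.1 : ℤ) = 1 := by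
      rw [zpow_natCast, div_pow, rj, rk, div_one]
    have hq2 : (k.1.2 / j.1.2) ^ (K.sInt k.1.1) = 1 := by
      have h3 : (k.1.2 / j.1.2) ^ (K.sInt k.1.1 - (Γ.r k.1.1 : ℤ)) = 1 := by
        rw [div_zpow, h1, div_self (zpow_ne_zero _ hθj)]
      rwa [zpow_sub₀ (div_ne_zero hθk hθj), hq1, div_one] at h3
    obtain ⟨a, b, hab⟩ := ck
    have hq : k.1.2 / j.1.2 = 1 := by
      rw [← zpow_one (k.1.2 / j.1.2), ← hab, zpow_add₀ (div_ne_zero hθk hθj), mul_comm a, mul_comm b,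
        zpow_mul, zpow_mul, hq1, hq2, one_zpow, one_zpow, one_mul]
    refine hjk (Subtype.ext (Sigma.ext hb (heq_of_eq ?_)))
    exact ((div_eq_one_iff_eq hθj).1 hq).symm
  · refine (hnd α hα).2.2.1 ⟨j.1.1, sheet_branch j, k.1.1, sheet_branch k, hb, hj, hk, ?_, ?_⟩
    · rw [mul_comm, mul_comm (Γ.r k.1.1 : ℤ)]; exact hcross.symm
    · have h1 := congrArg (fun z => z ^ Γ.r k.1.1) hlead
      simp only [mul_pow, ← zpow_natCast (_ ^ (_ : ℤ)), ← zpow_mul] at h1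
      rw [mul_comm (_ - _), zpow_mul, zpow_mul, zpow_natCast, zpow_natCast, rj, rk, one_zpow, mul_one,
        mul_one, neg_pow, neg_pow (K.t j.1.1)] at h1
      exact (mul_left_cancel₀ (pow_ne_zero _ (neg_ne_zero.2 one_ne_zero)) h1).symm

theorem tendsto_zpow_nhdsNE_of_pos {e : ℤ} (he : 0 < e) :
    Tendsto (fun u : ℂ => u ^ e) (𝓝[≠] 0) (𝓝 0) := by
  obtain ⟨n, rfl⟩ := Int.eq_ofNat_of_zero_le he.le
  have h : Tendsto (fun u : ℂ => u ^ n) (𝓝 0) (𝓝 (0 ^ n)) := (continuous_pow n).tendsto 0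
  rw [zero_pow (by omega)] at h
  simpa using h.mono_left nhdsWithin_le_nhds

/-- The smaller slope dominates; for equal slopes the leading coefficients do not cancel; and `Y_k`
is eventually zero when the slope of `k` is infinite. -/
theorem tendsto_sheetY_sub [IsManifold 𝓘(ℂ) ⊤ Ct] (hnd : K.Nondegenerate) (hα : α ∈ Γ.ramPts)
    {j k : Γ.Sheet α} (hjk : j ≠ k) (hj : K.s j.1.1 ≠ ⊤)
    (hk : K.s k.1.1 = ⊤ ∨
      K.s k.1.1 ≠ ⊤ ∧ K.sInt j.1.1 * (Γ.r k.1.1 : ℤ) ≤ K.sInt k.1.1 * (Γ.r j.1.1 : ℤ)) :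
    ∃ c : ℂ, c ≠ 0 ∧ Tendsto (fun u => (K.sheetY k u - K.sheetY j u) * u ^ (-K.sheetExp j))
      (𝓝[≠] 0) (𝓝 c) := by
  have hlim := K.tendsto_sheetY hα j hj
  have hl0 := K.sheetLead_ne_zero hα j hj
  rcases hk with hk | ⟨hk, hle⟩
  · refine ⟨-K.sheetLead j, neg_ne_zero.2 hl0, hlim.neg.congr' ?_⟩
    filter_upwards [K.eventually_sheetY_eq_zero hα k hk] with u hu
    rw [hu]; ring
  have hlimk := K.tendsto_sheetY hα k hk
  have hN : (0 : ℤ) < Γ.coverDeg α := by have := K.coverDeg_ne_zero hα; omega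
  have hrr : (0 : ℤ) < Γ.r j.1.1 * Γ.r k.1.1 :=
    mul_pos (by have := K.r_pos (sheet_ram hα j); omega) (by have := K.r_pos (sheet_ram hα k); omega)
  have hsub := K.sheetExp_sub_mul j k
  rcases hle.lt_or_eq with hlt | heq
  · have he : 0 < K.sheetExp k - K.sheetExp j := by
      refine pos_of_mul_pos_left ?_ hrr.le
      rw [hsub]
      exact mul_pos hN (sub_pos.2 hlt)
    refine ⟨K.sheetLead k * 0 - K.sheetLead j, by simpa using hl0,
      ((hlimk.mul (tendsto_zpow_nhdsNE_of_pos he)).sub hlim).congr' ?_⟩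
    filter_upwards [self_mem_nhdsWithin] with u hu
    rw [mul_assoc, ← zpow_add₀ hu, sub_mul]
    congr 3
    ring
  · have he : K.sheetExp k = K.sheetExp j := by
      rw [heq, sub_self, mul_zero] at hsub
      exact sub_eq_zero.1 ((mul_eq_zero.1 hsub).resolve_right hrr.ne')
    refine ⟨K.sheetLead k - K.sheetLead j, sub_ne_zero.2 (sheetLead_ne hnd hα hjk hj hk heq),
      (hlimk.sub hlim).congr fun u => ?_⟩
    rw [he, sub_mul]

end LocalCoords

theorem zpow_sum_eq_prod {ι : Type*} {u : ℂ} (hu : u ≠ 0) (s : Finset ι) (e : ι → ℤ) :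
    u ^ ∑ i ∈ s, e i = ∏ i ∈ s, u ^ e i := by
  classical
  induction s using Finset.induction_on with
  | empty => simp
  | insert i s hi ih => rw [Finset.sum_insert hi, Finset.prod_insert hi, zpow_add₀ hu, ih]

namespace BranchOrder

open LocalCoords

variable {Ct C : Type*} [TopologicalSpace Ct] [ChartedSpace ℂ Ct] {Γ : SpectralCurve Ct C}
  {K : LocalCoords Γ} (O : BranchOrder K) {α : C}

open scoped Classical in
/-- The exponent of the difference of the values of `y` on the sheets `k` and `j`. -/
def diffExp (j k : Γ.Sheet α) : ℤ :=
  if k.1.1 ∈ O.seg j.1.1 then K.sheetExp k else K.sheetExp j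

/-- The branch that comes first in the order has the smaller slope, so it dictates the order of the
difference. -/
theorem tendsto_sheetY_sub [IsManifold 𝓘(ℂ) ⊤ Ct] (hnd : K.Nondegenerate) (hα : α ∈ Γ.ramPts)
    {j k : Γ.Sheet α} (hkj : k ≠ j) :
    ∃ c : ℂ, c ≠ 0 ∧ Tendsto (fun u => (K.sheetY k u - K.sheetY j u) * u ^ (-O.diffExp j k))
      (𝓝[≠] 0) (𝓝 c) := by
  have bj := sheet_branch j
  have bk := sheet_branch k
  by_cases hseg : k.1.1 ∈ O.seg j.1.1
  · obtain ⟨c, hc, hlim⟩ := LocalCoords.tendsto_sheetY_sub hnd hα hkj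
      (O.s_ne_top_of_mem_seg hnd hα bj hseg)
      ((O.slope α hα _ bk _ bj ((O.mem_seg bj).1 hseg).2.1).imp_right fun h => h.2)
    refine ⟨-c, neg_ne_zero.2 hc, hlim.neg.congr fun u => ?_⟩
    rw [diffExp, if_pos hseg]
    ring
  · have hsj : K.s j.1.1 ≠ ⊤ := by
      -- An infinite `s_j` would put all other branches into `[j)`, so `k` would lie on the branch
      -- of `j`; that branch is unramified by (ii) and has a single sheet.
      intro hs
      have hb : k.1.1 = j.1.1 := by
        by_contra hne
        exact hseg (O.mem_seg_of_top hnd hα bj hs bk hne)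
      have h1 := r_eq_one_of_top hnd hα bj hs
      have h2 := K.sheet_root hα j
      have h3 := K.sheet_root hα k
      rw [hb] at h3
      rw [h1, pow_one] at h2 h3
      exact hkj (Subtype.ext (Sigma.ext hb (heq_of_eq (h3.trans h2.symm))))
    obtain ⟨c, hc, hlim⟩ := LocalCoords.tendsto_sheetY_sub hnd hα hkj.symm hsj
      ((O.slope α hα _ bj _ bk (O.le_of_notMem_seg hα bj bk hseg)).imp_right fun h => h.2)
    refine ⟨c, hc, hlim.congr fun u => ?_⟩
    rw [diffExp, if_neg hseg]

-- Explains `𝔳_μ`: a sheet over `ν ∈ [μ)` contributes `N (s_ν/r_ν - 1)`, every other sheet except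
-- `j` contributes the exponent of `j` itself, and the total is `N/r_μ` times `𝔳_μ`.
open scoped Classical in
theorem sum_diffExp (hα : α ∈ Γ.ramPts) (j : Γ.Sheet α) :
    ∑ k ∈ Finset.univ.erase j, O.diffExp j k = Γ.coverExp α j.1.1 * O.vExp j.1.1 := by
  set μ := j.1.1 with hμdef
  have hμ : μ ∈ Γ.branches α := sheet_branch j
  have hself : O.diffExp j j = K.sheetExp j := by rw [diffExp, if_neg (O.self_notMem_seg hμ)]
  have h1 : ∑ k ∈ Finset.univ.erase j, O.diffExp j k = (∑ k, O.diffExp j k) - K.sheetExp j := by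
    rw [← Finset.sum_erase_add _ _ (Finset.mem_univ j), hself]; ring
  have h2 : ∑ k, O.diffExp j k = ∑ ν ∈ Γ.branches α, (Γ.r ν : ℤ) *
      (if ν ∈ O.seg μ then (Γ.coverExp α ν : ℤ) * (K.sInt ν - Γ.r ν) else K.sheetExp j) :=
    K.sum_sheets hα (fun ν => if ν ∈ O.seg μ then (Γ.coverExp α ν : ℤ) * (K.sInt ν - Γ.r ν)
      else K.sheetExp j)
  have h3 : ∑ ν ∈ Γ.branches α, (Γ.r ν : ℤ) *
      (if ν ∈ O.seg μ then (Γ.coverExp α ν : ℤ) * (K.sInt ν - Γ.r ν) else K.sheetExp j) =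
      ∑ ν ∈ Γ.branches α, ((Γ.r ν : ℤ) * K.sheetExp j + if ν ∈ O.seg μ then
        (Γ.coverDeg α : ℤ) * (K.sInt ν - Γ.r ν) - (Γ.r ν : ℤ) * K.sheetExp j else 0) := by
    refine Finset.sum_congr rfl fun ν hν => ?_
    have h : ((Γ.coverExp α ν : ℤ)) * Γ.r ν = Γ.coverDeg α :=
      mod_cast SpectralCurve.coverExp_mul_r hν
    split_ifs
    · rw [← h]; ring
    · ring
  have hseg : (Γ.branches α).filter (fun ν => ν ∈ O.seg μ) = O.seg μ := by
    ext ν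
    rw [Finset.mem_filter]
    exact ⟨fun h => h.2, fun h => ⟨O.seg_subset hμ h, h⟩⟩
  have h4 : ∑ ν ∈ O.seg μ, ((Γ.coverDeg α : ℤ) * (K.sInt ν - Γ.r ν) - (Γ.r ν : ℤ) * K.sheetExp j) =
      Γ.coverDeg α * (O.sSeg μ - O.rSeg μ) - O.rSeg μ * K.sheetExp j := by
    rw [sSeg, rSeg, Finset.sum_sub_distrib, ← Finset.mul_sum, Finset.sum_sub_distrib, ← Finset.sum_mul]
    push_cast
    rfl
  have hT : ∑ ν ∈ Γ.branches α, (Γ.r ν : ℤ) = Γ.rTot α := by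
    rw [SpectralCurve.rTot]; push_cast; rfl
  have hN : ((Γ.coverExp α μ : ℤ)) * Γ.r μ = Γ.coverDeg α :=
    mod_cast SpectralCurve.coverExp_mul_r hμ
  rw [h1, h2, h3, Finset.sum_add_distrib, ← Finset.sum_filter, hseg, h4, ← Finset.sum_mul, hT, vExp,
    Delta, Γ.mem_branches.1 hμ, sheetExp, ← hμdef, ← hN]
  ring

-- The limit is nonzero, so the product has exact order and can be inverted with a sharp bound. Here
-- non-degeneracy enters the passage from master loop equations to defects.
open scoped Classical in
theorem tendsto_prod_sheetY_sub [IsManifold 𝓘(ℂ) ⊤ Ct] (hnd : K.Nondegenerate) (hα : α ∈ Γ.ramPts)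
    (j : Γ.Sheet α) : ∃ c : ℂ, c ≠ 0 ∧
      Tendsto (fun u => (∏ k ∈ Finset.univ.erase j, (K.sheetY k u - K.sheetY j u)) *
        u ^ (-((Γ.coverExp α j.1.1 : ℤ) * O.vExp j.1.1))) (𝓝[≠] 0) (𝓝 c) := by
  have h : ∀ k : Γ.Sheet α, ∃ c : ℂ, k ≠ j → c ≠ 0 ∧
      Tendsto (fun u => (K.sheetY k u - K.sheetY j u) * u ^ (-O.diffExp j k)) (𝓝[≠] 0) (𝓝 c) := by
    intro k
    by_cases hk : k = j
    · exact ⟨0, fun h => absurd hk h⟩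
    · obtain ⟨c, hc⟩ := O.tendsto_sheetY_sub hnd hα hk
      exact ⟨c, fun _ => hc⟩
  choose c hc using h
  refine ⟨∏ k ∈ Finset.univ.erase j, c k,
    Finset.prod_ne_zero_iff.2 fun k hk => (hc k (Finset.ne_of_mem_erase hk)).1, ?_⟩
  refine (tendsto_finsetProd _ fun k hk => (hc k (Finset.ne_of_mem_erase hk)).2).congr' ?_
  filter_upwards [self_mem_nhdsWithin] with u hu
  rw [Finset.prod_mul_distrib, ← O.sum_diffExp hα j, ← Finset.sum_neg_distrib]
  congr 1
  exact (zpow_sum_eq_prod hu _ _).symm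

theorem eventually_sheetY_ne (O : BranchOrder K) [IsManifold 𝓘(ℂ) ⊤ Ct] (hnd : K.Nondegenerate) (hα : α ∈ Γ.ramPts)
    {j k : Γ.Sheet α} (hkj : k ≠ j) : ∀ᶠ u in 𝓝[≠] (0 : ℂ), K.sheetY k u ≠ K.sheetY j u := by
  obtain ⟨c, hc, hlim⟩ := O.tendsto_sheetY_sub hnd hα hkj
  filter_upwards [hlim.eventually_ne hc] with u hu h
  rw [h, sub_self, zero_mul] at hu
  exact hu rfl

end BranchOrder

end LoopEq
end

noncomputable section

namespace LoopEq

/-! ## The loop expressions on the sheets -/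

open LocalCoords

variable {Ct C : Type*} [TopologicalSpace Ct] [ChartedSpace ℂ Ct] {Γ : SpectralCurve Ct C}

open scoped Classical in
/-- The factor of the recursion integrand that does not involve the primitive of `ω_{0,2}`. -/
def recursionForm (K : LocalCoords Γ) (om : ℕ → Multiset (TangentBundle 𝓘(ℂ) Ct) → ℂ) (α : C)
    (μ : Ct) (h : ℕ) {n : ℕ} (w : Fin n → TangentBundle 𝓘(ℂ) Ct) (ξ : ℂ) : ℂ :=
  -(∑ Z ∈ ((fibre K α (Γ.xval (K.pt μ ξ))).erase (K.pt μ ξ)).powerset.filter Finset.Nonempty,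
    disconn' om h (insert (K.pt μ ξ) Z) Γ.ddx w / ∏ z' ∈ Z, (Γ.yval z' - Γ.yval (K.pt μ ξ))) *
    Γ.dx (K.ddζ μ ξ)

theorem recursionIntegrand_eq (K : LocalCoords Γ)
    (om : ℕ → Multiset (TangentBundle 𝓘(ℂ) Ct) → ℂ) (α : C) (μ : Ct) (h : ℕ)
    (v : TangentBundle 𝓘(ℂ) Ct) {n : ℕ} (w : Fin n → TangentBundle 𝓘(ℂ) Ct) (ξ : ℂ) :
    recursionIntegrand K om α μ h v w ξ = primitive K om μ v ξ * recursionForm K om α μ h w ξ := by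
  classical
  rw [recursionIntegrand, recursionForm, ← mul_assoc, mul_neg, Finset.mul_sum,
    ← Finset.sum_neg_distrib]
  congr 1
  refine Finset.sum_congr rfl fun Z _ => ?_
  ring

/-- The difference between a correlator and the corresponding recursion form. -/
def defect (K : LocalCoords Γ) (om : ℕ → Multiset (TangentBundle 𝓘(ℂ) Ct) → ℂ) (α : C)
    (μ : Ct) (h : ℕ) {n : ℕ} (w : Fin n → TangentBundle 𝓘(ℂ) Ct) (ξ : ℂ) : ℂ :=
  om h (K.ddζ μ ξ ::ₘ Finset.univ.val.map w) - recursionForm K om α μ h w ξ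

open scoped Classical in
/-- The quotient of the defect by `dx`, expressed through the sheets. -/
def sheetDefect (K : LocalCoords Γ) (om : ℕ → Multiset (TangentBundle 𝓘(ℂ) Ct) → ℂ) {α : C} (h : ℕ)
    {n : ℕ} (w : Fin n → TangentBundle 𝓘(ℂ) Ct) (j : Γ.Sheet α) (u : ℂ) : ℂ :=
  disconn' om h {j} (fun k => K.sheetVec k u) w +
    ∑ A ∈ (Finset.univ.erase j).powerset.filter Finset.Nonempty,
      disconn' om h (insert j A) (fun k => K.sheetVec k u) w /
        ∏ k ∈ A, (K.sheetY k u - K.sheetY j u)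

/-! ### Loop sums and recursion forms rewritten on the sheets. -/

section Combinatorial

variable {K : LocalCoords Γ} {om : ℕ → Multiset (TangentBundle 𝓘(ℂ) Ct) → ℂ} {α : C}

theorem loopCoeff_eq_sum_sheets (hα : α ∈ Γ.ramPts) (h i : ℕ) {n : ℕ}
    (w : Fin n → TangentBundle 𝓘(ℂ) Ct) {u : ℂ}
    (hu : ‖u‖ ^ Γ.coverDeg α < K.radius α) (hu0 : u ≠ 0) :
    loopCoeff K om α h i w (finVal (Γ.x α) + u ^ Γ.coverDeg α) =
      ∑ Z ∈ (Finset.univ : Finset (Γ.Sheet α)).powersetCard i,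
        disconn om h Z (fun k => K.sheetVec k u) w := by
  classical
  have hinj := K.sheetPt_injective hα hu hu0
  have himg : (Finset.univ : Finset (Γ.Sheet α)).image (fun j => K.sheetPt j u) =
      Finset.univ.map ⟨_, hinj⟩ := (Finset.map_eq_image ⟨_, hinj⟩ _).symm
  rw [loopCoeff, K.fibre_eq_image hα hu hu0, himg, Finset.powersetCard_map, Finset.sum_map]
  refine Finset.sum_congr rfl fun Z _ => ?_
  have h1 : (Finset.mapEmbedding ⟨_, hinj⟩).toEmbedding Z = Z.image (fun j => K.sheetPt j u) :=
    Finset.map_eq_image ⟨_, hinj⟩ _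
  rw [h1, disconn_image om h Z hinj.injOn]
  rfl

/-- The sheets other than `j` run through `𝔣'_α(z)`, so the nonempty subsets `Z` correspond to the
nonempty sets `A` of sheets. The term `A = ∅` of `sheetDefect` is the correlator and is taken out.
-/
theorem recursionForm_sheetCoord (hα : α ∈ Γ.ramPts) (h : ℕ) {n : ℕ}
    (w : Fin n → TangentBundle 𝓘(ℂ) Ct) (j : Γ.Sheet α) {u : ℂ}
    (hu : ‖u‖ ^ Γ.coverDeg α < K.radius α) (hu0 : u ≠ 0) :
    recursionForm K om α j.1.1 h w (sheetCoord j u) =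
      -(sheetDefect K om h w j u - disconn' om h {j} (fun k => K.sheetVec k u) w) *
        Γ.dx (K.ddζ j.1.1 (sheetCoord j u)) := by
  classical
  have hinj := K.sheetPt_injective hα hu hu0
  have hx : Γ.xval (K.pt j.1.1 (sheetCoord j u)) = finVal (Γ.x α) + u ^ Γ.coverDeg α :=
    K.xval_sheetPt hα j hu
  have himg : (((Finset.univ : Finset (Γ.Sheet α)).image fun j => K.sheetPt j u).erase
      (K.pt j.1.1 (sheetCoord j u))) = (Finset.univ.erase j).image fun j => K.sheetPt j u :=
    (Finset.image_erase hinj _ j).symm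
  rw [recursionForm, hx, K.fibre_eq_image hα hu hu0, sheetDefect, add_sub_cancel_left]
  congr 2
  have h2 : ((((Finset.univ : Finset (Γ.Sheet α)).image fun j => K.sheetPt j u).erase
      (K.pt j.1.1 (sheetCoord j u))).powerset.filter Finset.Nonempty) =
      ((Finset.univ.erase j).powerset.filter Finset.Nonempty).image
        (Finset.image fun j => K.sheetPt j u) := by
    rw [himg, Finset.powerset_image, Finset.filter_image]
    congr 1
    refine Finset.filter_congr fun A _ => ?_
    exact Finset.image_nonempty
  rw [h2, Finset.sum_image (Finset.image_injective hinj).injOn]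
  refine Finset.sum_congr rfl fun A _ => ?_
  have h3 : insert (K.pt j.1.1 (sheetCoord j u)) (A.image fun j => K.sheetPt j u) =
      (insert j A).image fun j => K.sheetPt j u := (Finset.image_insert _ _ _).symm
  rw [h3, disconn'_image om h _ hinj.injOn, Finset.prod_image hinj.injOn]
  rfl

theorem defect_sheetCoord (hom : IsCorrelatorFamily K om) (hα : α ∈ Γ.ramPts) {h n : ℕ}
    (hn : 2 < h + (n + 1)) (w : Fin n → TangentBundle 𝓘(ℂ) Ct) (j : Γ.Sheet α) {u : ℂ}
    (hu : ‖u‖ ^ Γ.coverDeg α < K.radius α) (hu0 : u ≠ 0) :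
    defect K om α j.1.1 h w (sheetCoord j u) =
      sheetDefect K om h w j u * Γ.dx (K.ddζ j.1.1 (sheetCoord j u)) := by
  have ht := K.sheetCoord_mem_target hα j hu
  have h0 := K.sheetCoord_ne_zero hα j hu0
  have hdx := K.dx_ddζ_ne_zero (sheet_ram hα j) ht h0
  have h1 : om h (K.ddζ j.1.1 (sheetCoord j u) ::ₘ Finset.univ.val.map w) =
      Γ.dx (K.ddζ j.1.1 (sheetCoord j u)) *
        disconn' om h {j} (fun k => K.sheetVec k u) w := by
    rw [disconn'_singleton om (by omega : 0 < h + n), K.sheetVec_eq hα j hu hu0,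
      ← K.dx_ddζ (sheet_ram hα j) ht, smulVec_cons _ (hom.linear h), ← mul_assoc,
      mul_inv_cancel₀ hdx, one_mul]
  rw [defect, h1, recursionForm_sheetCoord hα h w j hu hu0]
  ring

-- The central identity: evaluated at a sheet, the left side of the master loop equation factors
-- into the product of the differences of `y` and the defect.
open scoped Classical in
theorem sum_loopCoeff_mul_pow [IsManifold 𝓘(ℂ) ⊤ Ct] (O : BranchOrder K) (hnd : K.Nondegenerate)
    (hom : IsCorrelatorFamily K om) (hα : α ∈ Γ.ramPts) {h n : ℕ}
    (hn : 2 < h + (n + 1)) (w : Fin n → TangentBundle 𝓘(ℂ) Ct) :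
    ∀ᶠ u in 𝓝[≠] (0 : ℂ), ∀ j : Γ.Sheet α, ∑ i ∈ Finset.Icc 1 (Γ.rTot α),
      loopCoeff K om α h i w (finVal (Γ.x α) + u ^ Γ.coverDeg α) *
        (-K.sheetY j u) ^ (Γ.rTot α - i) =
      (∏ k ∈ Finset.univ.erase j, (K.sheetY k u - K.sheetY j u)) * sheetDefect K om h w j u := by
  have hcard : (Finset.univ : Finset (Γ.Sheet α)).card = Γ.rTot α := by
    rw [Finset.card_univ, Fintype.card_coe, K.card_sheets hα]
  have hne : ∀ᶠ u in 𝓝[≠] (0 : ℂ), ∀ j k : Γ.Sheet α, k ≠ j → K.sheetY k u ≠ K.sheetY j u := by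
    refine eventually_all.2 fun j => eventually_all.2 fun k => ?_
    by_cases hkj : k = j
    · exact Eventually.of_forall fun _ h => absurd hkj h
    · exact (BranchOrder.eventually_sheetY_ne O hnd hα hkj).mono fun _ h _ => h
  filter_upwards [K.eventually_small hα, hne, eventually_all.2 fun j => K.om_zero_sheetVec hom hα j]
    with u hu hYne hY j
  have hmain := sum_powersetCard_mul_pow_eq_prod_mul (Finset.univ : Finset (Γ.Sheet α))
    (Finset.mem_univ j) (fun k => K.sheetY k u)
    (fun Z => disconn om h Z (fun k => K.sheetVec k u) w)
    (fun Z => disconn' om h Z (fun k => K.sheetVec k u) w)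
    (disconn'_empty om (by omega) _ _)
    (fun Z _ => by
      rw [disconn_eq_sum_powerset]
      refine Finset.sum_congr rfl fun A _ => ?_
      congr 1
      exact Finset.prod_congr rfl fun k _ => hY k)
    (fun k hk => hYne j k (Finset.ne_of_mem_erase hk))
  rw [hcard] at hmain
  rw [sheetDefect, ← hmain]
  refine Finset.sum_congr rfl fun i _ => ?_
  rw [loopCoeff_eq_sum_sheets hα h i w hu.1 hu.2]

end Combinatorial

/-! ### Meromorphy of loop coefficients, defects and recursion forms. -/

section Meromorphy

variable {K : LocalCoords Γ} {om : ℕ → Multiset (TangentBundle 𝓘(ℂ) Ct) → ℂ} {α : C}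

theorem LocalCoords.eventually_pt_ne {μ : Ct} (hμ : μ ∈ Γ.ram) {p : Ct} (hp : p ∉ Γ.ramSet) :
    ∀ᶠ ξ in 𝓝 (0 : ℂ), K.pt μ ξ ≠ p := by
  by_cases hps : p ∈ (K.ζ μ).source
  · have h0 : K.ζ μ p ≠ 0 := by
      intro h
      apply hp
      have : p = μ := by rw [← K.pt_zero hμ, ← h]; exact ((K.ζ μ).left_inv hps).symm
      rw [this, Γ.mem_ramSet]; exact hμ
    filter_upwards [K.eventually_mem_target hμ, isOpen_ne.mem_nhds h0.symm] with ξ h1 h2 h3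
    apply h2
    rw [← h3]
    exact ((K.ζ μ).right_inv h1).symm
  · filter_upwards [K.eventually_mem_target hμ] with ξ h1 h2
    exact hps (h2 ▸ K.pt_mem_source h1)

theorem LocalCoords.eventually_sheetPt_ne (hα : α ∈ Γ.ramPts) (j : Γ.Sheet α) {p : Ct}
    (hp : p ∉ Γ.ramSet) : ∀ᶠ u in 𝓝[≠] (0 : ℂ), K.sheetPt j u ≠ p :=
  (K.tendsto_sheetCoord hα j).eventually
    ((K.eventually_pt_ne (sheet_ram hα j) hp).filter_mono nhdsWithin_le_nhds)

theorem eventually_sheetVec_proj_ne (hα : α ∈ Γ.ramPts) (j k : Γ.Sheet α) (hjk : j ≠ k) :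
    ∀ᶠ u in 𝓝[≠] (0 : ℂ), (K.sheetVec j u).proj ≠ (K.sheetVec k u).proj := by
  filter_upwards [K.eventually_small hα] with u hu h
  exact hjk (K.sheetPt_injective hα hu.1 hu.2 h)

/-- The sheet through the branch `μ` with trivial root of unity. -/
def mainSheet (K : LocalCoords Γ) (hα : α ∈ Γ.ramPts) {μ : Ct} (hμ : μ ∈ Γ.branches α) : Γ.Sheet α :=
  ⟨⟨μ, 1⟩, (K.mem_sheets hα).2 ⟨hμ, one_pow _⟩⟩

theorem sheetCoord_mainSheet (hα : α ∈ Γ.ramPts) {μ : Ct} (hμ : μ ∈ Γ.branches α) (u : ℂ) :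
    sheetCoord (mainSheet K hα hμ) u = u ^ Γ.coverExp α μ := by
  rw [sheetCoord]
  exact one_mul _

variable [IsManifold 𝓘(ℂ) ⊤ Ct]

theorem meromorphicAt_om_zero_sheetVec (hom : IsCorrelatorFamily K om) (hα : α ∈ Γ.ramPts)
    (j : Γ.Sheet α) : MeromorphicAt (fun u => om 0 {K.sheetVec j u}) 0 := by
  refine (K.meromorphicAt_sheetY hα j).congr ?_
  filter_upwards [K.om_zero_sheetVec hom hα j] with u hu using hu.symm

theorem meromorphicAt_disconn_sheetVec (hom : IsCorrelatorFamily K om) (hα : α ∈ Γ.ramPts) {n : ℕ}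
    {w : Fin n → TangentBundle 𝓘(ℂ) Ct} (hw : ∀ j, (w j).proj ∉ Γ.ramSet) (h : ℕ)
    (Z : Finset (Γ.Sheet α)) :
    MeromorphicAt (fun u => disconn om h Z (fun k => K.sheetVec k u) w) 0 :=
  meromorphicAt_disconn hom hw (K.isVecCurve_sheetVec hα) (meromorphicAt_om_zero_sheetVec hom hα)
    (eventually_sheetVec_proj_ne hα) (fun i j => K.eventually_sheetPt_ne hα i (hw j)) h Z

theorem meromorphicAt_disconn'_sheetVec (hom : IsCorrelatorFamily K om) (hα : α ∈ Γ.ramPts) {n : ℕ}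
    {w : Fin n → TangentBundle 𝓘(ℂ) Ct} (hw : ∀ j, (w j).proj ∉ Γ.ramSet) (h : ℕ)
    (Z : Finset (Γ.Sheet α)) :
    MeromorphicAt (fun u => disconn' om h Z (fun k => K.sheetVec k u) w) 0 :=
  meromorphicAt_disconn' hom hw (K.isVecCurve_sheetVec hα) (meromorphicAt_om_zero_sheetVec hom hα)
    (eventually_sheetVec_proj_ne hα) (fun i j => K.eventually_sheetPt_ne hα i (hw j)) h Z

/-- In the root `u` it is a finite sum of meromorphic functions over fixed sets of sheets; being a
function of `τ = u ^ N`, it descends. -/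
theorem meromorphicAt_loopCoeff (hom : IsCorrelatorFamily K om) (hα : α ∈ Γ.ramPts) {n : ℕ}
    {w : Fin n → TangentBundle 𝓘(ℂ) Ct} (hw : ∀ j, (w j).proj ∉ Γ.ramSet) (h i : ℕ) :
    MeromorphicAt (fun τ => loopCoeff K om α h i w (finVal (Γ.x α) + τ)) 0 := by
  refine meromorphicAt_of_comp_pow (K.coverDeg_ne_zero hα) ?_
  refine MeromorphicAt.congr (f := fun u => ∑ Z ∈ (Finset.univ : Finset (Γ.Sheet α)).powersetCard i,
    disconn om h Z (fun k => K.sheetVec k u) w) (MeromorphicAt.fun_sum fun Z _ =>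
    meromorphicAt_disconn_sheetVec hom hα hw h Z) ?_
  filter_upwards [K.eventually_small hα] with u hu
  exact (loopCoeff_eq_sum_sheets hα h i w hu.1 hu.2).symm

theorem meromorphicAt_sheetDefect (hom : IsCorrelatorFamily K om) (hα : α ∈ Γ.ramPts) {n : ℕ}
    {w : Fin n → TangentBundle 𝓘(ℂ) Ct} (hw : ∀ j, (w j).proj ∉ Γ.ramSet) (h : ℕ)
    (j : Γ.Sheet α) : MeromorphicAt (sheetDefect K om h w j) 0 := by
  classical
  refine (meromorphicAt_disconn'_sheetVec hom hα hw h {j}).add (MeromorphicAt.fun_sum fun A _ => ?_)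
  exact (meromorphicAt_disconn'_sheetVec hom hα hw h _).div (MeromorphicAt.fun_prod fun k _ =>
    (K.meromorphicAt_sheetY hα k).sub (K.meromorphicAt_sheetY hα j))

/-- The main sheet has coordinate `ζ = u ^ m`, so meromorphy in `u` descends to `ζ`. -/
theorem meromorphicAt_defect (hom : IsCorrelatorFamily K om) (hα : α ∈ Γ.ramPts) {μ : Ct}
    (hμ : μ ∈ Γ.branches α) {h n : ℕ} (hn : 2 < h + (n + 1))
    {w : Fin n → TangentBundle 𝓘(ℂ) Ct} (hw : ∀ j, (w j).proj ∉ Γ.ramSet) :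
    MeromorphicAt (defect K om α μ h w) 0 := by
  refine meromorphicAt_of_comp_pow (K.coverExp_ne_zero hα hμ) ?_
  have hr := K.r_pos (Γ.mem_ram_of_mem_branches hα hμ)
  refine MeromorphicAt.congr (f := fun u => sheetDefect K om h w (mainSheet K hα hμ) u *
    (Γ.r μ * (u ^ Γ.coverExp α μ) ^ (Γ.r μ - 1)))
    ((meromorphicAt_sheetDefect hom hα hw h _).mul ?_) ?_
  · exact AnalyticAt.meromorphicAt (by fun_prop)
  · filter_upwards [K.eventually_small hα] with u hu
    have h1 := defect_sheetCoord hom hα hn w (mainSheet K hα hμ) hu.1 hu.2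
    have h2 := K.dx_ddζ (sheet_ram hα (mainSheet K hα hμ))
      (K.sheetCoord_mem_target hα (mainSheet K hα hμ) hu.1)
    rw [h2] at h1
    simp only [sheetCoord_mainSheet] at h1
    exact h1.symm

theorem meromorphicAt_om_ddζ (hom : IsCorrelatorFamily K om) (hα : α ∈ Γ.ramPts) {μ : Ct}
    (hμ : μ ∈ Γ.branches α) {h n : ℕ} (hn : 2 < h + (n + 1))
    {w : Fin n → TangentBundle 𝓘(ℂ) Ct} (hw : ∀ j, (w j).proj ∉ Γ.ramSet) :
    MeromorphicAt (fun ξ => om h (K.ddζ μ ξ ::ₘ Finset.univ.val.map w)) 0 := by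
  refine meromorphicAt_of_comp_pow (K.coverExp_ne_zero hα hμ) ?_
  have hst := hom.stable h (n + 1) (by omega) hn
  have := meromorphicAt_multidifferential_add (hom.linear h) ({()} : Finset Unit)
    (Finset.univ : Finset (Fin n))
    (by rw [Finset.card_singleton, Finset.card_univ, Fintype.card_fin, add_comm]; exact hst)
    (V := fun _ => fun u => K.ddζ μ (sheetCoord (mainSheet K hα hμ) u))
    (fun _ _ => K.isVecCurve_ddζ hα (mainSheet K hα hμ)) (W := fun j _ => w j)
    fun j => isVecCurve_const (hw j)
  simp only [sheetCoord_mainSheet] at this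
  exact this

theorem meromorphicAt_recursionForm (hom : IsCorrelatorFamily K om) (hα : α ∈ Γ.ramPts) {μ : Ct}
    (hμ : μ ∈ Γ.branches α) {h n : ℕ} (hn : 2 < h + (n + 1))
    {w : Fin n → TangentBundle 𝓘(ℂ) Ct} (hw : ∀ j, (w j).proj ∉ Γ.ramSet) :
    MeromorphicAt (recursionForm K om α μ h w) 0 := by
  refine ((meromorphicAt_om_ddζ hom hα hμ hn hw).sub (meromorphicAt_defect hom hα hμ hn hw)).congr ?_
  exact Eventually.of_forall fun ξ => sub_sub_cancel _ _

end Meromorphy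

end LoopEq
end

/-! ### From abstract to master loop equations, and from these to defects with simple poles. -/

noncomputable section

namespace LoopEq

open LocalCoords

theorem IsBigO_zpow_mul {f g : ℂ → ℂ} {a b : ℤ} (hf : f =O[𝓝[≠] 0] fun u => u ^ a)
    (hg : g =O[𝓝[≠] 0] fun u => u ^ b) :
    (fun u => f u * g u) =O[𝓝[≠] 0] fun u => u ^ (a + b) := by
  refine (hf.mul hg).congr' EventuallyEq.rfl ?_
  filter_upwards [self_mem_nhdsWithin] with u hu
  rw [zpow_add₀ hu]

theorem IsBigO_zpow_pow {f : ℂ → ℂ} {a : ℤ} (hf : f =O[𝓝[≠] 0] fun u => u ^ a) (n : ℕ) :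
    (fun u => f u ^ n) =O[𝓝[≠] 0] fun u => u ^ (a * n) := by
  refine (hf.pow n).congr_right fun u => ?_
  rw [zpow_mul, zpow_natCast]

section Bidifferential

variable {Ct : Type*} [TopologicalSpace Ct] [ChartedSpace ℂ Ct] [IsManifold 𝓘(ℂ) ⊤ Ct]

theorem analyticAt_bidifferential_coordVec {F : Multiset (TangentBundle 𝓘(ℂ) Ct) → ℂ}
    (hF : ∀ (p : Ct) (c : ℂ) (v : TangentSpace 𝓘(ℂ) p)
    (m : Multiset (TangentBundle 𝓘(ℂ) Ct)), F (⟨p, c • v⟩ ::ₘ m) = c * F (⟨p, v⟩ ::ₘ m))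
    (hb : IsFundamentalBidifferential F) {φ ψ : OpenPartialHomeomorph Ct ℂ}
    (hφ : φ ∈ IsManifold.maximalAtlas 𝓘(ℂ) ⊤ Ct) (hψ : ψ ∈ IsManifold.maximalAtlas 𝓘(ℂ) ⊤ Ct)
    {u v : ℂ} (hu : u ∈ φ.target) (hv : v ∈ ψ.target) (hne : φ.symm u ≠ ψ.symm v) :
    AnalyticAt ℂ (fun x : ℂ × ℂ => F {coordVec φ x.1, coordVec ψ x.2}) (u, v) := by
  set p := φ.symm u
  set q := ψ.symm v
  have hp := IsManifold.chart_mem_maximalAtlas (I := 𝓘(ℂ)) (n := ⊤) (M := Ct) p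
  have hq := IsManifold.chart_mem_maximalAtlas (I := 𝓘(ℂ)) (n := ⊤) (M := Ct) q
  have ha := analyticAt_transition hp hφ hu (mem_chart_source ℂ p)
  have hb' := analyticAt_transition hq hψ hv (mem_chart_source ℂ q)
  have heu0 : ∀ᶠ a in 𝓝 u, a ∈ φ.target ∧ φ.symm a ∈ (chartAt ℂ p).source :=
    (φ.open_target.eventually_mem hu).and ((φ.continuousAt_symm hu).eventually
      ((chartAt ℂ p).open_source.eventually_mem (mem_chart_source ℂ p)))
  have heu : ∀ᶠ x : ℂ × ℂ in 𝓝 (u, v), x.1 ∈ φ.target ∧ φ.symm x.1 ∈ (chartAt ℂ p).source :=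
    (continuous_fst.tendsto (u, v)).eventually heu0
  have hev0 : ∀ᶠ a in 𝓝 v, a ∈ ψ.target ∧ ψ.symm a ∈ (chartAt ℂ q).source :=
    (ψ.open_target.eventually_mem hv).and ((ψ.continuousAt_symm hv).eventually
      ((chartAt ℂ q).open_source.eventually_mem (mem_chart_source ℂ q)))
  have hev : ∀ᶠ x : ℂ × ℂ in 𝓝 (u, v), x.2 ∈ ψ.target ∧ ψ.symm x.2 ∈ (chartAt ℂ q).source :=
    (continuous_snd.tendsto (u, v)).eventually hev0
  have hfst : AnalyticAt ℂ (fun x : ℂ × ℂ => x.1) (u, v) := analyticAt_fst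
  have hsnd : AnalyticAt ℂ (fun x : ℂ × ℂ => x.2) (u, v) := analyticAt_snd
  have h1 : AnalyticAt ℂ (fun x : ℂ × ℂ => chartAt ℂ p (φ.symm x.1)) (u, v) :=
    AnalyticAt.fun_comp (g := fun v => chartAt ℂ p (φ.symm v)) ha hfst
  have h2 : AnalyticAt ℂ (fun x : ℂ × ℂ => chartAt ℂ q (ψ.symm x.2)) (u, v) :=
    AnalyticAt.fun_comp (g := fun v => chartAt ℂ q (ψ.symm v)) hb' hsnd
  have h3 : AnalyticAt ℂ (fun x : ℂ × ℂ => deriv (fun v => chartAt ℂ p (φ.symm v)) x.1) (u, v) :=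
    AnalyticAt.fun_comp (g := deriv (fun v => chartAt ℂ p (φ.symm v))) ha.deriv hfst
  have h4 : AnalyticAt ℂ (fun x : ℂ × ℂ => deriv (fun v => chartAt ℂ q (ψ.symm v)) x.2) (u, v) :=
    AnalyticAt.fun_comp (g := deriv (fun v => chartAt ℂ q (ψ.symm v))) hb'.deriv hsnd
  have h5 : AnalyticAt ℂ (fun x : ℂ × ℂ => F {coordVec (chartAt ℂ p) (chartAt ℂ p (φ.symm x.1)),
      coordVec (chartAt ℂ q) (chartAt ℂ q (ψ.symm x.2))}) (u, v) :=
    AnalyticAt.fun_comp (g := fun x : ℂ × ℂ =>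
      F {coordVec (chartAt ℂ p) x.1, coordVec (chartAt ℂ q) x.2})
      (f := fun x : ℂ × ℂ => (chartAt ℂ p (φ.symm x.1), chartAt ℂ q (ψ.symm x.2)))
      (hb.1 p q hne) (h1.prod h2)
  refine ((h3.mul h4).mul h5).congr ?_
  filter_upwards [heu, hev] with x hx hx'
  rw [coordVec_eq_smulVec hp hφ hx.1 hx.2, coordVec_eq_smulVec hq hψ hx'.1 hx'.2, smulVec_pair F hF]
  rfl

end Bidifferential

variable {Ct C : Type*} [TopologicalSpace Ct] [ChartedSpace ℂ Ct] {Γ : SpectralCurve Ct C}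
  {K : LocalCoords Γ} {om : ℕ → Multiset (TangentBundle 𝓘(ℂ) Ct) → ℂ} {α : C}

section Local

theorem eventually_xval_pt (hα : α ∈ Γ.ramPts) {μ : Ct} (hμ : μ ∈ Γ.branches α) :
    ∀ᶠ ξ in 𝓝 (0 : ℂ), Γ.xval (K.pt μ ξ) = finVal (Γ.x α) + ξ ^ Γ.r μ := by
  have hram := Γ.mem_ram_of_mem_branches hα hμ
  filter_upwards [K.eventually_mem_target hram] with ξ hξ
  rw [K.xval_pt hram hξ, finVal_x hμ]

theorem eventually_dx_ddζ {μ : Ct} (hμ : μ ∈ Γ.ram) :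
    ∀ᶠ ξ in 𝓝 (0 : ℂ), Γ.dx (K.ddζ μ ξ) = Γ.r μ * ξ ^ (Γ.r μ - 1) :=
  (K.eventually_mem_target hμ).mono fun _ hξ => K.dx_ddζ hμ hξ

theorem isBigO_dx_ddζ {μ : Ct} (hμ : μ ∈ Γ.ram) :
    (fun ξ => Γ.dx (K.ddζ μ ξ)) =O[𝓝[≠] 0] fun ξ => ξ ^ ((Γ.r μ : ℤ) - 1) := by
  have hr := K.r_pos hμ
  have h1 : (fun ξ : ℂ => (Γ.r μ : ℂ) * ξ ^ (Γ.r μ - 1)) =O[𝓝[≠] 0]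
      fun ξ => ξ ^ ((Γ.r μ : ℤ) - 1) := by
    refine (Asymptotics.isBigO_refl _ _).const_mul_left _ |>.congr_right fun ξ => ?_
    rw [← zpow_natCast, Nat.cast_sub hr, Nat.cast_one]
  refine h1.congr' ?_ EventuallyEq.rfl
  filter_upwards [(eventually_dx_ddζ (K := K) hμ).filter_mono nhdsWithin_le_nhds] with ξ hξ using hξ.symm

variable [IsManifold 𝓘(ℂ) ⊤ Ct]

theorem eventually_om_zero_ddx (hom : IsCorrelatorFamily K om) {μ : Ct} (hμ : μ ∈ Γ.ram) :
    ∀ᶠ ξ in 𝓝[≠] (0 : ℂ), om 0 {Γ.ddx (K.pt μ ξ)} = Γ.yval (K.pt μ ξ) := by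
  filter_upwards [(K.eventually_mem_target hμ).filter_mono nhdsWithin_le_nhds, self_mem_nhdsWithin,
    (K.meromorphicAt_yval hμ).2] with ξ h1 h2 h3
  have h4 : Γ.dx (Γ.ddx (K.pt μ ξ)) = 1 := by
    rw [K.ddx_pt hμ h1 h2, Γ.dx_smulVec, inv_mul_cancel₀ (K.dx_ddζ_ne_zero hμ h1 h2)]
  have h5 := hom.zero_one (Γ.ddx (K.pt μ ξ)) (K.xt_pt_ne_infty hμ h1) h3
  rw [h5, h4, mul_one]
  rfl

theorem isBigO_yval {μ : Ct} (hμ : μ ∈ Γ.ram) (hs : K.s μ ≠ ⊤) :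
    (fun ξ => Γ.yval (K.pt μ ξ)) =O[𝓝[≠] 0] fun ξ => ξ ^ (K.sInt μ - (Γ.r μ : ℤ)) := by
  rw [isBigO_zpow_iff_isBigO_one]
  exact (K.tendsto_yval hμ hs).isBigO_one ℂ

/-- Abstract loop equations imply master loop equations. -/
theorem masterLoopEquations_of_abstractLoopEquations (O : BranchOrder K) (hnd : K.Nondegenerate)
    (hom : IsCorrelatorFamily K om) (hA : AbstractLoopEquations O om) :
    MasterLoopEquations O om := by
  intro h n w hn hw α hα μ hμ
  have hram := Γ.mem_ram_of_mem_branches hα hμ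
  have hr := K.r_pos hram
  set R := Γ.rTot α with hR
  set E : ℤ := -1 + O.vExp μ + ((Γ.r μ : ℤ) - 1) * ((R : ℤ) - 1) with hE
  have hterm : ∀ i ∈ Finset.Icc 1 R, (fun ξ : ℂ =>
      loopCoeff K om α h i w (finVal (Γ.x α) + ξ ^ Γ.r μ) * (-Γ.yval (K.pt μ ξ)) ^ (R - i) *
        Γ.dx (K.ddζ μ ξ) ^ R) =O[𝓝[≠] 0] fun ξ => ξ ^ E := by
    intro i hi
    obtain ⟨hi1, hi2⟩ := Finset.mem_Icc.1 hi
    obtain ⟨lam, hlam, hl1, hl2⟩ := O.exists_branch hα hi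
    -- The abstract loop equation at `τ = ξ ^ r_μ`.
    have h1 := (isBigO_zpow_comp_pow_iff hr.ne' _).2 (hA h n w hn hw α hα i hi lam hlam hl1 hl2)
    have h3 := IsBigO_zpow_pow (isBigO_dx_ddζ (K := K) hram) R
    -- If `y` vanishes identically on the branch, only the term `i = R` survives.
    by_cases hs : K.s μ = ⊤ ∧ i < R
    · have h0 : (fun ξ : ℂ => loopCoeff K om α h i w (finVal (Γ.x α) + ξ ^ Γ.r μ) *
          (-Γ.yval (K.pt μ ξ)) ^ (R - i) * Γ.dx (K.ddζ μ ξ) ^ R) =ᶠ[𝓝[≠] 0] fun _ => 0 := by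
        filter_upwards [K.eventually_yval_eq_zero hs.1] with ξ hξ
        rw [hξ, neg_zero, zero_pow (by omega), mul_zero, zero_mul]
      exact (Asymptotics.isBigO_zero _ _).congr' h0.symm EventuallyEq.rfl
    · have htop : K.s μ = ⊤ → i = R := fun ht => by
        by_contra hne
        exact hs ⟨ht, by omega⟩
      have hexp := O.master_exponent_le hnd hα hμ hlam hl1 hl2 htop
      have h2 : (fun ξ => (-Γ.yval (K.pt μ ξ)) ^ (R - i)) =O[𝓝[≠] 0]
          fun ξ => ξ ^ ((K.sInt μ - (Γ.r μ : ℤ)) * ((R - i : ℕ) : ℤ)) := by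
        by_cases ht : K.s μ = ⊤
        · rw [htop ht]
          simpa using Asymptotics.isBigO_refl (fun _ : ℂ => (1 : ℂ)) _
        · exact IsBigO_zpow_pow (isBigO_yval hram ht).neg_left _
      refine (IsBigO_zpow_mul (IsBigO_zpow_mul h1 h2) h3).trans (zpow_isBigO_zpow_iff.2 ?_)
      rw [hE, BranchOrder.vExp, BranchOrder.Delta, Γ.mem_branches.1 hμ, ← hR, Nat.cast_sub hi2]
      -- After collecting terms, the required inequality of exponents is precisely `hexp`.
      nlinarith [hexp]
  refine (Asymptotics.IsBigO.sum hterm).congr' ?_ EventuallyEq.rfl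
  filter_upwards [(eventually_xval_pt (K := K) hα hμ).filter_mono nhdsWithin_le_nhds,
    eventually_om_zero_ddx hom hram] with ξ h1 h2
  rw [h1, h2, Finset.sum_mul, Finset.sum_apply]

/-- Master loop equations imply that the defects have at most simple poles. -/
theorem isBigO_defect_of_masterLoopEquations (O : BranchOrder K) (hnd : K.Nondegenerate)
    (hom : IsCorrelatorFamily K om) (hM : MasterLoopEquations O om) {h n : ℕ}
    (hn : 2 < h + (n + 1)) {w : Fin n → TangentBundle 𝓘(ℂ) Ct} (hw : ∀ j, (w j).proj ∉ Γ.ramSet)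
    (hα : α ∈ Γ.ramPts) {μ : Ct} (hμ : μ ∈ Γ.branches α) :
    (defect K om α μ h w) =O[𝓝[≠] 0] fun ξ => ξ ^ (-1 : ℤ) := by
  classical
  have hram := Γ.mem_ram_of_mem_branches hα hμ
  have hr := K.r_pos hram
  have hm0 := K.coverExp_ne_zero hα hμ
  set m := Γ.coverExp α μ with hm
  set R := Γ.rTot α with hR
  have hR1 : 1 ≤ R := le_trans hr (Finset.single_le_sum (fun _ _ => Nat.zero_le _) hμ)
  set j := mainSheet K hα hμ with hj
  have hjμ : j.1.1 = μ := rfl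
  have hcoord : ∀ u, sheetCoord j u = u ^ m := sheetCoord_mainSheet hα hμ
  obtain ⟨c, hc, hlim⟩ := O.tendsto_prod_sheetY_sub hnd hα j
  rw [hjμ, ← hm] at hlim
  -- Division by the product of differences costs exactly its order, because the normalised limit is
  -- nonzero.
  have hG := (hlim.inv₀ hc).isBigO_one ℂ
  have hF := (isBigO_zpow_comp_pow_iff hm0 _).2 (hM h n w hn hw α hα μ hμ)
  rw [← isBigO_zpow_comp_pow_iff hm0]
  -- The master loop equation carries `R` factors `dx`, the defect only one; the other `R - 1` are
  -- divided out.
  have hD : (fun u : ℂ => ((Γ.r μ : ℂ) * (u ^ m) ^ (Γ.r μ - 1))⁻¹ ^ (R - 1)) =O[𝓝[≠] 0]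
      fun u => u ^ (-((m : ℤ) * ((Γ.r μ : ℤ) - 1)) * ((R - 1 : ℕ) : ℤ)) := by
    refine IsBigO_zpow_pow ?_ _
    refine ((Asymptotics.isBigO_refl _ _).const_mul_left ((Γ.r μ : ℂ)⁻¹)).congr_left fun u => ?_
    rw [mul_inv, zpow_neg, zpow_mul, ← zpow_natCast (u ^ m), Nat.cast_sub hr, Nat.cast_one, zpow_natCast]
  have hall := IsBigO_zpow_mul (IsBigO_zpow_mul (IsBigO_zpow_mul hF
    (hG.congr_right (g₂ := fun u => u ^ (0 : ℤ)) fun u => (zpow_zero u).symm))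
    (Asymptotics.isBigO_refl (fun u : ℂ => u ^ (-((m : ℤ) * O.vExp μ))) _)) hD
  refine (hall.congr' ?_ EventuallyEq.rfl).trans (zpow_isBigO_zpow_iff.2 (le_of_eq ?_))
  · filter_upwards [K.eventually_small hα, sum_loopCoeff_mul_pow O hnd hom hα hn w,
      K.om_zero_sheetVec hom hα j, hlim.eventually_ne hc] with u hu h1 h2 h3
    have ht := K.sheetCoord_mem_target hα j hu.1
    have hdx := K.dx_ddζ hram ht
    have hdx0 := K.dx_ddζ_ne_zero hram ht (K.sheetCoord_ne_zero hα j hu.2)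
    have hdef := defect_sheetCoord hom hα hn w j hu.1 hu.2
    have hx : Γ.xval (K.pt j.1.1 (sheetCoord j u)) = finVal (Γ.x α) + u ^ Γ.coverDeg α :=
      K.xval_sheetPt hα j hu.1
    have hy : om 0 {Γ.ddx (K.pt j.1.1 (sheetCoord j u))} = K.sheetY j u := h2
    have h4 := h1 j
    rw [hjμ, hcoord] at hx hy hdef
    rw [hcoord] at hdx hdx0
    rw [hdx] at hdx0
    have h5 := left_ne_zero_of_mul h3
    have h6 := right_ne_zero_of_mul h3
    rw [hdef, hx, hy, h4, hdx, mul_inv]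
    set P := ∏ k ∈ Finset.univ.erase j, (K.sheetY k u - K.sheetY j u)
    set X := (Γ.r μ : ℂ) * (u ^ m) ^ (Γ.r μ - 1)
    set V := u ^ (-((m : ℤ) * O.vExp μ))
    have hX : X ^ R = X ^ (R - 1) * X := by rw [← pow_succ]; congr 1; omega
    rw [hX, inv_pow]
    have hX1 := pow_ne_zero (R - 1) hdx0
    field_simp
  · rw [Nat.cast_sub hR1]
    push_cast
    ring

end Local

/-! ### The primitive of `ω_{0,2}` and residues against it. -/

section Primitive

theorem primitive_zero {μ : Ct} {v : TangentBundle 𝓘(ℂ) Ct} : primitive K om μ v 0 = 0 := by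
  simp [primitive]

/-- On a disc where the integrand is holomorphic the primitive has the expected derivative. -/
theorem hasDerivAt_primitive {μ : Ct} {v : TangentBundle 𝓘(ℂ) Ct} {R : ℝ}
    (hd : DifferentiableOn ℂ (fun ξ => om 0 {K.ddζ μ ξ, v}) (Metric.ball 0 R)) {u : ℂ}
    (hu : u ∈ Metric.ball (0 : ℂ) R) :
    HasDerivAt (primitive K om μ v) (om 0 {K.ddζ μ u, v}) u := by
  -- A holomorphic function on a disc has an antiderivative `g` with `g 0 = 0`; integrating along
  -- the segment from `0` shows that it is `primitive`.
  obtain ⟨g, hg0, hg⟩ := hd.isExactOn_ball.with_val_at 0 0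
  have heq : ∀ ξ ∈ Metric.ball (0 : ℂ) R, primitive K om μ v ξ = g ξ := by
    intro ξ hξ
    have hmem : ∀ t ∈ Set.uIcc (0 : ℝ) 1, (t : ℂ) * ξ ∈ Metric.ball (0 : ℂ) R := by
      intro t ht
      rw [Set.uIcc_of_le zero_le_one] at ht
      rw [mem_ball_zero_iff] at hξ ⊢
      rw [norm_mul, Complex.norm_real, Real.norm_eq_abs, abs_of_nonneg ht.1]
      exact lt_of_le_of_lt (mul_le_of_le_one_left (norm_nonneg _) ht.2) hξ
    have hder : ∀ t ∈ Set.uIcc (0 : ℝ) 1,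
        HasDerivAt (fun t : ℝ => g ((t : ℂ) * ξ)) (ξ * om 0 {K.ddζ μ ((t : ℂ) * ξ), v}) t := by
      intro t ht
      have h1 : HasDerivAt (fun t : ℂ => t * ξ) ξ (t : ℂ) := by
        simpa using (hasDerivAt_id (t : ℂ)).mul_const ξ
      have h2 := (hg _ (hmem t ht)).comp (t : ℂ) h1
      rw [mul_comm] at h2
      exact h2.comp_ofReal
    have hcont : ContinuousOn (fun t : ℝ => ξ * om 0 {K.ddζ μ ((t : ℂ) * ξ), v})
        (Set.uIcc (0 : ℝ) 1) := by
      refine continuousOn_const.mul (hd.continuousOn.comp (by fun_prop) hmem)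
    rw [primitive, intervalIntegral.integral_eq_sub_of_hasDerivAt hder hcont.intervalIntegrable]
    simp [hg0]
  refine (hg u hu).congr_of_eventuallyEq ?_
  filter_upwards [Metric.isOpen_ball.mem_nhds hu] with ξ hξ using heq ξ hξ

variable [IsManifold 𝓘(ℂ) ⊤ Ct]

theorem analyticAt_om_zero_ddζ (hom : IsCorrelatorFamily K om) {μ : Ct} (hμ : μ ∈ Γ.ram)
    {v : TangentBundle 𝓘(ℂ) Ct} {ξ : ℂ} (hξ : ξ ∈ (K.ζ μ).target) (hv : K.pt μ ξ ≠ v.proj) :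
    AnalyticAt ℂ (fun ξ => om 0 {K.ddζ μ ξ, v}) ξ := by
  have hch := IsManifold.chart_mem_maximalAtlas (I := 𝓘(ℂ)) (n := ⊤) (M := Ct) v.proj
  have hsrc := mem_chart_source ℂ v.proj
  obtain ⟨c, hc⟩ := exists_eq_smulVec_coordVec hch v hsrc
  have h1 := analyticAt_bidifferential_coordVec (hom.linear 0) hom.zero_two (K.holomorphic μ hμ) hch
    hξ ((chartAt ℂ v.proj).map_source hsrc)
    (by rw [(chartAt ℂ v.proj).left_inv hsrc]; exact hv)
  have h2 : AnalyticAt ℂ (fun ξ : ℂ => om 0 {K.ddζ μ ξ,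
      coordVec (chartAt ℂ v.proj) (chartAt ℂ v.proj v.proj)}) ξ :=
    AnalyticAt.fun_comp (f := fun ξ : ℂ => (ξ, chartAt ℂ v.proj v.proj)) (g := fun x : ℂ × ℂ =>
      om 0 {coordVec (K.ζ μ) x.1, coordVec (chartAt ℂ v.proj) x.2}) h1
      (analyticAt_id.prod analyticAt_const)
  have h3 : ∀ x, om 0 {x, v} =
      c * om 0 {x, coordVec (chartAt ℂ v.proj) (chartAt ℂ v.proj v.proj)} := by
    intro x
    have h4 := smulVec_cons _ (hom.linear 0) c
      (coordVec (chartAt ℂ v.proj) (chartAt ℂ v.proj v.proj)) {x}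
    rw [← hc] at h4
    rw [Multiset.pair_comm x v, Multiset.pair_comm x]
    exact h4
  simp only [h3]
  exact analyticAt_const.mul h2

theorem exists_differentiableOn_om_zero_ddζ (hom : IsCorrelatorFamily K om) {μ : Ct}
    (hμ : μ ∈ Γ.ram) {v : TangentBundle 𝓘(ℂ) Ct} (hv : v.proj ∉ Γ.ramSet) :
    ∃ R > 0, DifferentiableOn ℂ (fun ξ => om 0 {K.ddζ μ ξ, v}) (Metric.ball 0 R) := by
  obtain ⟨R, hR, h⟩ := Metric.eventually_nhds_iff_ball.1
    ((K.eventually_mem_target hμ).and (eventually_pt_ne (K := K) hμ hv))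
  exact ⟨R, hR, fun ξ hξ => (analyticAt_om_zero_ddζ hom hμ (h ξ hξ).1
    (h ξ hξ).2).differentiableAt.differentiableWithinAt⟩

theorem analyticAt_primitive (hom : IsCorrelatorFamily K om) {μ : Ct} (hμ : μ ∈ Γ.ram)
    {v : TangentBundle 𝓘(ℂ) Ct} (hv : v.proj ∉ Γ.ramSet) : AnalyticAt ℂ (primitive K om μ v) 0 := by
  obtain ⟨R, hR, hd⟩ := exists_differentiableOn_om_zero_ddζ hom hμ hv
  have h : DifferentiableOn ℂ (primitive K om μ v) (Metric.ball 0 R) := fun ξ hξ =>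
    (hasDerivAt_primitive hd hξ).differentiableAt.differentiableWithinAt
  exact h.analyticAt (Metric.ball_mem_nhds 0 hR)

/-- The integral starts at `μ`, so the primitive has a zero there, which cancels a simple pole of
the defect. -/
theorem isBigO_primitive (hom : IsCorrelatorFamily K om) {μ : Ct} (hμ : μ ∈ Γ.ram)
    {v : TangentBundle 𝓘(ℂ) Ct} (hv : v.proj ∉ Γ.ramSet) :
    (primitive K om μ v) =O[𝓝[≠] 0] fun ξ => ξ ^ (1 : ℤ) := by
  have h := (analyticAt_primitive hom hμ hv).differentiableAt.isBigO_sub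
  simp only [primitive_zero, sub_zero] at h
  simpa using h.mono nhdsWithin_le_nhds

/-- If the defects have at most simple poles, the correlator and the recursion form have the same
residues against primitives. -/
theorem res_primitive_mul_eq (hom : IsCorrelatorFamily K om) (hα : α ∈ Γ.ramPts) {μ : Ct}
    (hμ : μ ∈ Γ.branches α) {h n : ℕ} (hn : 2 < h + (n + 1)) {v : TangentBundle 𝓘(ℂ) Ct}
    (hv : v.proj ∉ Γ.ramSet) {w : Fin n → TangentBundle 𝓘(ℂ) Ct}
    (hw : ∀ j, (w j).proj ∉ Γ.ramSet)
    (hD : (defect K om α μ h w) =O[𝓝[≠] 0] fun ξ => ξ ^ (-1 : ℤ)) :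
    res (fun ξ => primitive K om μ v ξ * om h (K.ddζ μ ξ ::ₘ Finset.univ.val.map w)) =
      res (recursionIntegrand K om α μ h v w) := by
  have hram := Γ.mem_ram_of_mem_branches hα hμ
  have hP := (analyticAt_primitive hom hram hv).meromorphicAt
  have h1 : (fun ξ => primitive K om μ v ξ * om h (K.ddζ μ ξ ::ₘ Finset.univ.val.map w)) =
      fun ξ => primitive K om μ v ξ * defect K om α μ h w ξ + recursionIntegrand K om α μ h v w ξ := by
    funext ξ
    rw [recursionIntegrand_eq, defect]
    ring
  have h2 : MeromorphicAt (recursionIntegrand K om α μ h v w) 0 := by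
    rw [show recursionIntegrand K om α μ h v w = fun ξ => _ from
      funext fun ξ => recursionIntegrand_eq K om α μ h v w ξ]
    exact hP.mul (meromorphicAt_recursionForm hom hα hμ hn hw)
  have h3 : MeromorphicAt (fun ξ => primitive K om μ v ξ * defect K om α μ h w ξ) 0 :=
    hP.mul (meromorphicAt_defect hom hα hμ hn hw)
  rw [h1, res_add h3 h2, res_eq_zero_of_isBigO_one h3, zero_add]
  simpa using IsBigO_zpow_mul (isBigO_primitive hom hram hv) hD

/-- Master loop equations and projection property imply the recursion formula. -/
theorem topologicalRecursion_of_masterLoopEquations (O : BranchOrder K) (hnd : K.Nondegenerate)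
    (hom : IsCorrelatorFamily K om) (hM : MasterLoopEquations O om) (hP : ProjectionProperty K om) :
    TopologicalRecursion K om := by
  intro h n v w hn hv hw
  rw [hP h v _ (by simpa using hn) hv (by simpa using hw), Γ.sum_ram]
  refine Finset.sum_congr rfl fun α hα => Finset.sum_congr rfl fun μ hμ => ?_
  exact res_primitive_mul_eq hom hα hμ hn hv hw
    (isBigO_defect_of_masterLoopEquations O hnd hom hM hn hw hα hμ)

end Primitive

end LoopEq
end

noncomputable section

namespace LoopEq

open LocalCoords

/-! ## Uniqueness -/

theorem exists_eq_univ_map {X : Type*} (m : Multiset X) :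
    ∃ (n : ℕ) (w : Fin n → X), m = Finset.univ.val.map w := by
  obtain ⟨l, rfl⟩ := Quot.exists_rep m
  exact ⟨l.length, l.get, by rw [Fin.univ_val_map, List.ofFn_get]; rfl⟩

variable {Ct C : Type*} [TopologicalSpace Ct] [ChartedSpace ℂ Ct] {Γ : SpectralCurve Ct C}
  {K : LocalCoords Γ} {om om' : ℕ → Multiset (TangentBundle 𝓘(ℂ) Ct) → ℂ} {α : C}

theorem tendsto_sheetPt (hα : α ∈ Γ.ramPts) (j : Γ.Sheet α) :
    Tendsto (K.sheetPt j) (𝓝[≠] 0) (𝓝[≠] j.1.1) := by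
  have hram := sheet_ram hα j
  refine tendsto_nhdsWithin_iff.2 ⟨?_, ?_⟩
  · have h1 := (K.continuousAt_pt (K.zero_mem_target hram)).tendsto
    rw [K.pt_zero hram] at h1
    exact h1.comp ((K.tendsto_sheetCoord hα j).mono_right nhdsWithin_le_nhds)
  · filter_upwards [K.eventually_small hα] with u hu h
    have h2 : K.pt j.1.1 (sheetCoord j u) = K.pt j.1.1 0 := by rw [K.pt_zero hram]; exact h
    exact K.sheetCoord_ne_zero hα j hu.2
      (K.pt_injOn (K.sheetCoord_mem_target hα j hu.1) (K.zero_mem_target hram) h2)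

/-- Properties that hold off isolated points hold on the fibres near a branch. -/
theorem eventually_forall_fibre (hα : α ∈ Γ.ramPts) {μ : Ct} (hμ : μ ∈ Γ.branches α) {P : Ct → Prop}
    (hP : ∀ ν ∈ Γ.branches α, ∀ᶠ q in 𝓝[≠] ν, P q) :
    ∀ᶠ ξ in 𝓝[≠] (0 : ℂ), ∀ z ∈ fibre K α (Γ.xval (K.pt μ ξ)), P z := by
  classical
  rw [← map_pow_nhdsNE (K.coverExp_ne_zero hα hμ), eventually_map]
  filter_upwards [K.eventually_small hα, eventually_all.2 fun j : Γ.Sheet α =>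
    (tendsto_sheetPt (K := K) hα j).eventually (hP _ (sheet_branch j))] with u hu h z hz
  have hx := K.xval_sheetPt hα (mainSheet K hα hμ) hu.1
  rw [sheetPt, sheetCoord_mainSheet] at hx
  have hx' : Γ.xval (K.pt μ (u ^ Γ.coverExp α μ)) = finVal (Γ.x α) + u ^ Γ.coverDeg α := hx
  rw [hx', K.fibre_eq_image hα hu.1 hu.2] at hz
  obtain ⟨j, -, rfl⟩ := Finset.mem_image.1 hz
  exact h j

theorem eventually_notMem_ramSet {μ : Ct} (K : LocalCoords Γ) (hμ : μ ∈ Γ.ram) :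
    ∀ᶠ q in 𝓝[≠] μ, q ∉ Γ.ramSet := by
  filter_upwards [((K.ζ μ).open_source.eventually_mem (K.mem_source μ hμ)).filter_mono
    nhdsWithin_le_nhds, self_mem_nhdsWithin] with q hq hne
  have h1 := K.pt_notMem_ramSet hμ ((K.ζ μ).map_source hq) (by
    intro h
    rw [← K.map_self μ hμ] at h
    exact hne ((K.ζ μ).injOn hq (K.mem_source μ hμ) h))
  rwa [pt, (K.ζ μ).left_inv hq] at h1

theorem pt_mem_fibre (hμ : μ ∈ Γ.ram) (hα : Γ.proj μ = α) {ξ : ℂ} (hξ : ξ ∈ (K.ζ μ).target) :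
    K.pt μ ξ ∈ fibre K α (Γ.xval (K.pt μ ξ)) := by
  rw [fibre, Set.Finite.mem_toFinset]
  refine ⟨?_, μ, Γ.mem_branches.2 hα, K.pt_mem_source hξ⟩
  rw [K.xval_pt hμ hξ]
  exact K.x_eq μ hμ ξ hξ

theorem eventually_primitive_eq (hsame : SameUnstable om om') {μ : Ct} (hμ : μ ∈ Γ.ram)
    {v : TangentBundle 𝓘(ℂ) Ct} (hv : v.proj ∉ Γ.ramSet) :
    ∀ᶠ ξ in 𝓝 (0 : ℂ), primitive K om μ v ξ = primitive K om' μ v ξ := by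
  obtain ⟨R, hR, h⟩ := Metric.eventually_nhds_iff_ball.1 (eventually_pt_ne (K := K) hμ hv)
  filter_upwards [Metric.ball_mem_nhds 0 hR] with ξ hξ
  refine intervalIntegral.integral_congr fun t ht => ?_
  rw [Set.uIcc_of_le zero_le_one] at ht
  refine congrArg (ξ * ·) (hsame.1 _ _ (h _ ?_))
  rw [mem_ball_zero_iff] at hξ ⊢
  rw [norm_mul, Complex.norm_real, Real.norm_eq_abs, abs_of_nonneg ht.1]
  exact lt_of_le_of_lt (mul_le_of_le_one_left (norm_nonneg _) ht.2) hξ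

theorem eventually_ne_of_notMem [T2Space Ct] {S : Set Ct} {n : ℕ}
    {w : Fin n → TangentBundle 𝓘(ℂ) Ct} (hw : ∀ j, (w j).proj ∉ S) {ν : Ct} (hν : ν ∈ S) (j : Fin n) :
    ∀ᶠ q in 𝓝[≠] ν, q ≠ (w j).proj :=
  eventually_ne_nhdsWithin fun h => hw j (h ▸ hν)

/-- Strong induction on `h + n`, that is on `2g + n`. Both recursion integrands agree near each `μ`:
the primitives depend on `ω_{0,2}` only, and every factor of `𝒲'` at two or more points is unstable
data or covered by the induction hypothesis. -/
theorem eq_of_topologicalRecursion [T2Space Ct] (hsame : SameUnstable om om')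
    (hT : TopologicalRecursion K om) (hT' : TopologicalRecursion K om') (h : ℕ)
    (m : Multiset (TangentBundle 𝓘(ℂ) Ct)) (hm : m ≠ 0) (hst : 2 < h + m.card)
    (hmr : ∀ v ∈ m, v.proj ∉ Γ.ramSet) : om h m = om' h m := by
  classical
  induction hN : h + m.card using Nat.strong_induction_on generalizing h m with
  | _ N ih =>
  obtain ⟨v, hvm⟩ := Multiset.exists_mem_of_ne_zero hm
  obtain ⟨m', rfl⟩ := Multiset.exists_cons_of_mem hvm
  obtain ⟨n, w, rfl⟩ := exists_eq_univ_map m'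
  have hcard : (v ::ₘ Finset.univ.val.map w).card = n + 1 := by simp
  rw [hcard] at hst hN
  have hv := hmr v (Multiset.mem_cons_self _ _)
  have hwr : ∀ j, (w j).proj ∉ Γ.ramSet := by
    intro j
    refine hmr _ (Multiset.mem_cons_of_mem ?_)
    exact Multiset.mem_map_of_mem _ (Finset.mem_univ_val j)
  rw [hT h n v w hst hv hwr, hT' h n v w hst hv hwr]
  refine Finset.sum_congr rfl fun α hα => Finset.sum_congr rfl fun μ hμ => res_congr ?_
  have hram := Γ.mem_ram_of_mem_branches hα hμ
  -- Close to `μ` the points of the fibre avoid `𝔞̃`, the isolated points where the two `ω_{1/2,1}`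
  -- may differ, and the spectators, as the comparisons of the factors require.
  have e1 := eventually_forall_fibre (K := K) hα hμ (P := fun q => q ∉ Γ.ramSet)
    fun ν hν => eventually_notMem_ramSet K (Γ.mem_ram_of_mem_branches hα hν)
  have e2 := eventually_forall_fibre (K := K) hα hμ
    (P := fun q => ∀ u : TangentSpace 𝓘(ℂ) q, om 1 {⟨q, u⟩} = om' 1 {⟨q, u⟩}) fun ν _ => hsame.2 ν
  have e3 := (eventually_primitive_eq (K := K) hsame hram hv).filter_mono
    (nhdsWithin_le_nhds (s := {0}ᶜ))
  have e4 := eventually_forall_fibre (K := K) hα hμ (P := fun q => ∀ j, q ≠ (w j).proj)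
    fun ν hν => eventually_all.2 fun j => eventually_ne_of_notMem hwr
      (Γ.mem_ramSet.2 (Γ.mem_ram_of_mem_branches hα hν)) j
  filter_upwards [e1, e2, e3, e4, (K.eventually_mem_target hram).filter_mono nhdsWithin_le_nhds]
    with ξ h1 h2 h3 h6 h4
  have hpt := pt_mem_fibre (K := K) hram (Γ.mem_branches.1 hμ) h4
  rw [recursionIntegrand, recursionIntegrand, h3]
  refine congrArg (· * Γ.dx (K.ddζ μ ξ)) (Finset.sum_congr rfl fun Z hZ => ?_)
  rw [Finset.mem_filter, Finset.mem_powerset] at hZ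
  have hsub : insert (K.pt μ ξ) Z ⊆ fibre K α (Γ.xval (K.pt μ ξ)) :=
    Finset.insert_subset hpt (hZ.1.trans (Finset.erase_subset _ _))
  refine congrArg (_ * ·) (disconn'_congr ?_ fun A M k hA hAZ hd hd' => ?_)
  · rw [Finset.card_insert_of_notMem fun h => Finset.notMem_erase _ _ (hZ.1 h)]
    have := hZ.2.card_pos
    omega
  have hAr : ∀ z ∈ A, z ∉ Γ.ramSet := fun z hz => h1 z (hsub (hAZ hz))
  have hA1 := hA.card_pos
  rcases hd.lt_or_eq with hlt | heq
  · refine ih (k + (A.card + M.card)) (by omega) k _ ?_ (by simpa using hlt) ?_ (by simp)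
    · intro h0
      have := congrArg Multiset.card h0
      simp at this
      exact hA.ne_empty this.1
    · intro x hx
      rcases Multiset.mem_add.1 hx with hx | hx
      · obtain ⟨z, hz, rfl⟩ := Multiset.mem_map.1 hx
        exact hAr z hz
      · obtain ⟨j, -, rfl⟩ := Multiset.mem_map.1 hx
        exact hwr j
  -- Complexity exactly `2` with `A` nonempty: `ω_{0,2}` at two points of the fibre, `ω_{1/2,1}` at
  -- one, or `ω_{0,2}` at a point of the fibre and a spectator.
  · rcases Nat.lt_or_ge 1 A.card with h5 | h5
    · obtain ⟨z, z', hne, rfl⟩ := Finset.card_eq_two.1 (show A.card = 2 by omega)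
      have hM : M = ∅ := Finset.card_eq_zero.1 (by omega)
      have hk : k = 0 := by omega
      subst hM hk
      rw [Finset.insert_val_of_notMem (by simpa using hne)]
      simpa using hsame.1 (Γ.ddx z) (Γ.ddx z') hne
    · obtain ⟨z, rfl⟩ := Finset.card_eq_one.1 (show A.card = 1 by omega)
      rcases Nat.eq_zero_or_pos M.card with hM0 | hM1
      · have hM : M = ∅ := Finset.card_eq_zero.1 hM0
        have hk : k = 1 := by simp [hM] at heq; omega
        subst hM hk
        simp only [Finset.singleton_val, Multiset.map_singleton, Finset.empty_val, Multiset.map_zero,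
          add_zero]
        exact h2 z (hsub (hAZ (Finset.mem_singleton_self z))) _
      · obtain ⟨j, rfl⟩ := Finset.card_eq_one.1
          (show M.card = 1 by rw [Finset.card_singleton] at heq; omega)
        have hk : k = 0 := by simp at heq; omega
        subst hk
        exact hsame.1 (Γ.ddx z) (w j) (h6 z (hsub (hAZ (Finset.mem_singleton_self z))) j)

end LoopEq
end

noncomputable section

namespace LoopEq

/-! ## The fundamental bidifferential near the diagonal -/

theorem analyticAt_dslope {f : ℂ → ℂ} {c : ℂ} (hf : AnalyticAt ℂ f c) : AnalyticAt ℂ (dslope f c) c := by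
  obtain ⟨p, hp⟩ := hf
  exact ⟨_, hp.has_fpower_series_dslope_fslope⟩

theorem sub_mul_dslope (f : ℂ → ℂ) (c v : ℂ) : (v - c) * dslope f c v = f v - f c := by
  simpa using sub_smul_dslope f c v

/-- A function with value `1` and vanishing derivative at a point, divided by the square of the
distance, has no residue there. -/
theorem exists_analyticAt_div_sq {f : ℂ → ℂ} {c : ℂ} (hf : AnalyticAt ℂ f c) (h1 : f c = 1)
    (h2 : deriv f c = 0) : ∃ J : ℂ → ℂ, AnalyticAt ℂ J c ∧
      ∀ v, v ≠ c → f v * ((v - c) ^ 2)⁻¹ = ((v - c) ^ 2)⁻¹ + J v := by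
  refine ⟨dslope (dslope f c) c, analyticAt_dslope (analyticAt_dslope hf), fun v hv => ?_⟩
  have hv0 := sub_ne_zero.2 hv
  have e1 := sub_mul_dslope f c v
  have e2 := sub_mul_dslope (dslope f c) c v
  rw [dslope_same, h2, sub_zero] at e2
  rw [← e2, h1] at e1
  have e3 : f v = 1 + (v - c) ^ 2 * dslope (dslope f c) c v := by linear_combination -e1
  rw [e3]
  field_simp

/-- The pullback of the double pole `dT₁ dT₂ / (T₁ - T₂)²` has no residue. -/
theorem exists_analyticAt_pullback {T : ℂ → ℂ} {c : ℂ} (hT : AnalyticAt ℂ T c)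
    (h0 : deriv T c ≠ 0) : ∃ J : ℂ → ℂ, AnalyticAt ℂ J c ∧
      ∀ᶠ v in 𝓝[≠] c, deriv T c * deriv T v * ((T v - T c) ^ 2)⁻¹ = ((v - c) ^ 2)⁻¹ + J v := by
  set D := dslope T c with hDdef
  have hD : AnalyticAt ℂ D c := analyticAt_dslope hT
  have hDc : D c = deriv T c := dslope_same _ _
  have hDc0 : D c ≠ 0 := by rw [hDc]; exact h0
  have hDinv : AnalyticAt ℂ (fun v => (D v)⁻¹) c := hD.inv hDc0
  -- The function `1/(T v - T c)` equals `1/(T'(c) (v - c))` plus the analytic function `E`.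
  -- Differentiating in `v` produces the double pole with no residue term.
  set E := dslope (fun v => (D v)⁻¹) c with hE
  have hEa : AnalyticAt ℂ E c := analyticAt_dslope hDinv
  refine ⟨fun v => -(deriv T c * deriv E v), (analyticAt_const.mul hEa.deriv).neg, ?_⟩
  have hDne : ∀ᶠ v in 𝓝 c, D v ≠ 0 := hD.continuousAt.eventually_ne hDc0
  have hTsub : ∀ v, v ≠ c → D v ≠ 0 → T v - T c ≠ 0 := fun v hv hDv => by
    rw [← sub_mul_dslope]; exact mul_ne_zero (sub_ne_zero.2 hv) hDv
  have hid : ∀ v, v ≠ c → D v ≠ 0 →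
      (T v - T c)⁻¹ = (deriv T c)⁻¹ * (v - c)⁻¹ + E v := by
    intro v hv hDv
    have hv0 := sub_ne_zero.2 hv
    have e1 := sub_mul_dslope (fun v => (D v)⁻¹) c v
    rw [← sub_mul_dslope T c v, mul_inv, ← hDc]
    have e2 : (D v)⁻¹ = (D c)⁻¹ + (v - c) * E v := by rw [hE, e1]; ring
    rw [← hDdef, e2, mul_add, ← mul_assoc, inv_mul_cancel₀ hv0, one_mul, mul_comm]
  filter_upwards [(hDne.eventually_nhds).filter_mono nhdsWithin_le_nhds,
    (hT.eventually_analyticAt).filter_mono nhdsWithin_le_nhds,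
    (hEa.eventually_analyticAt).filter_mono nhdsWithin_le_nhds, self_mem_nhdsWithin]
    with v h1 h2 h3 h4
  have h4 : v ≠ c := h4
  have hloc : (fun v => (T v - T c)⁻¹) =ᶠ[𝓝 v] fun v => (deriv T c)⁻¹ * (v - c)⁻¹ + E v := by
    filter_upwards [h1, isOpen_ne.eventually_mem h4] with x hx hx' using hid x hx' hx
  have d1 := ((h2.differentiableAt.hasDerivAt).sub_const (T c)).inv (hTsub v h4 h1.self_of_nhds)
  have d2 := ((((hasDerivAt_id v).sub_const c).inv (sub_ne_zero.2 h4)).const_mul (deriv T c)⁻¹).add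
    h3.differentiableAt.hasDerivAt
  have d3 := d1.unique (d2.congr_of_eventuallyEq hloc)
  have hT0 := hTsub v h4 h1.self_of_nhds
  have hv0 := sub_ne_zero.2 h4
  simp only [id] at d3
  rw [mul_assoc]
  have d4 : deriv T v * ((T v - T c) ^ 2)⁻¹ =
      (deriv T c)⁻¹ * ((v - c) ^ 2)⁻¹ - deriv E v := by
    simp only [div_eq_mul_inv] at d3
    linear_combination -d3
  rw [d4, mul_sub, ← mul_assoc, mul_inv_cancel₀ h0, one_mul, sub_eq_add_neg]

section Bidifferential

variable {Ct : Type*} [TopologicalSpace Ct] [ChartedSpace ℂ Ct]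
  {F : Multiset (TangentBundle 𝓘(ℂ) Ct) → ℂ}

theorem eventually_pullback_pair
    (hF : ∀ (p : Ct) (c : ℂ) (v : TangentSpace 𝓘(ℂ) p)
    (m : Multiset (TangentBundle 𝓘(ℂ) Ct)), F (⟨p, c • v⟩ ::ₘ m) = c * F (⟨p, v⟩ ::ₘ m))
    {φ χ : OpenPartialHomeomorph Ct ℂ} (hφ : φ ∈ IsManifold.maximalAtlas 𝓘(ℂ) ⊤ Ct)
    (hχ : χ ∈ IsManifold.maximalAtlas 𝓘(ℂ) ⊤ Ct)
    {c : ℂ} (hc : c ∈ φ.target) (hc' : φ.symm c ∈ χ.source) :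
    ∀ᶠ v in 𝓝[≠] c, χ (φ.symm v) ≠ χ (φ.symm c) ∧
      F {coordVec φ c, coordVec φ v} =
        deriv (fun v => χ (φ.symm v)) c * deriv (fun v => χ (φ.symm v)) v *
          F {coordVec χ (χ (φ.symm c)), coordVec χ (χ (φ.symm v))} := by
  have hev : ∀ᶠ v in 𝓝[≠] c, v ∈ φ.target ∧ φ.symm v ∈ χ.source :=
    ((φ.open_target.eventually_mem hc).and ((φ.continuousAt_symm hc).eventually
      (χ.open_source.eventually_mem hc'))).filter_mono nhdsWithin_le_nhds
  filter_upwards [hev, self_mem_nhdsWithin] with v hv hne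
  refine ⟨fun h => hne (φ.symm.injOn hv.1 hc (χ.injOn hv.2 hc' h)), ?_⟩
  rw [coordVec_eq_smulVec hχ hφ hc hc', coordVec_eq_smulVec hχ hφ hv.1 hv.2, smulVec_pair F hF]

theorem tendsto_transition_nhdsNE {φ χ : OpenPartialHomeomorph Ct ℂ}
    (hφ : φ ∈ IsManifold.maximalAtlas 𝓘(ℂ) ⊤ Ct) (hχ : χ ∈ IsManifold.maximalAtlas 𝓘(ℂ) ⊤ Ct)
    {c : ℂ} (hc : c ∈ φ.target) (hc' : φ.symm c ∈ χ.source) :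
    Tendsto (fun v => χ (φ.symm v)) (𝓝[≠] c) (𝓝[≠] (χ (φ.symm c))) := by
  refine tendsto_nhdsWithin_iff.2 ⟨(analyticAt_transition hχ hφ hc hc').continuousAt.tendsto.mono_left
    nhdsWithin_le_nhds, ?_⟩
  exact (eventually_pullback_pair (F := fun _ => 0) (by simp) hφ hχ hc hc').mono fun _ h => h.1

variable [IsManifold 𝓘(ℂ) ⊤ Ct]

/-- The biresidue is independent of the coordinate: the factors `T'(c) T'(v)` of the coordinate
change cancel against `((T v - T c)/(v - c))²` in the limit. -/
theorem tendsto_bidifferential_mul_sq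
    (hF : ∀ (p : Ct) (c : ℂ) (v : TangentSpace 𝓘(ℂ) p)
    (m : Multiset (TangentBundle 𝓘(ℂ) Ct)), F (⟨p, c • v⟩ ::ₘ m) = c * F (⟨p, v⟩ ::ₘ m))
    (hb : IsFundamentalBidifferential F) {φ : OpenPartialHomeomorph Ct ℂ}
    (hφ : φ ∈ IsManifold.maximalAtlas 𝓘(ℂ) ⊤ Ct) {c : ℂ} (hc : c ∈ φ.target) :
    Tendsto (fun v => F {coordVec φ c, coordVec φ v} * (c - v) ^ 2) (𝓝[≠] c) (𝓝 1) := by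
  set p := φ.symm c with hp
  have hχ := IsManifold.chart_mem_maximalAtlas (I := 𝓘(ℂ)) (n := ⊤) (M := Ct) p
  have hc' : φ.symm c ∈ (chartAt ℂ p).source := mem_chart_source ℂ p
  set T := fun v => chartAt ℂ p (φ.symm v) with hTdef
  have hT : AnalyticAt ℂ T c := analyticAt_transition hχ hφ hc hc'
  have hT0 : deriv T c ≠ 0 := deriv_transition_ne_zero hχ hφ hc hc'
  have hTc : T c = chartAt ℂ p p := rfl
  obtain ⟨G, hG, hG1, hFG⟩ := hb.2 p
  rw [← hTc] at hG hG1 hFG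
  have hlimT := tendsto_transition_nhdsNE hφ hχ hc hc'
  have hpair : Tendsto (fun v => (T c, T v)) (𝓝[≠] c) (𝓝 (T c, T c)) :=
    tendsto_const_nhds.prodMk_nhds (hlimT.mono_right nhdsWithin_le_nhds)
  have hlim : Tendsto (fun v => deriv T c * deriv T v * G (T c, T v) * ((dslope T c v) ^ 2)⁻¹)
      (𝓝[≠] c) (𝓝 (deriv T c * deriv T c * 1 * ((deriv T c) ^ 2)⁻¹)) := by
    have h1 : Tendsto (fun v => G (T c, T v)) (𝓝[≠] c) (𝓝 1) := by
      rw [← hG1]; exact hG.continuousAt.tendsto.comp hpair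
    have h2 : Tendsto (deriv T) (𝓝[≠] c) (𝓝 (deriv T c)) :=
      hT.deriv.continuousAt.tendsto.mono_left nhdsWithin_le_nhds
    have h3 : Tendsto (dslope T c) (𝓝[≠] c) (𝓝 (deriv T c)) := by
      have := (analyticAt_dslope hT).continuousAt.tendsto
      rw [dslope_same] at this
      exact this.mono_left nhdsWithin_le_nhds
    exact ((tendsto_const_nhds.mul h2).mul h1).mul ((h3.pow 2).inv₀ (pow_ne_zero 2 hT0))
  have hone : deriv T c * deriv T c * 1 * ((deriv T c) ^ 2)⁻¹ = 1 := by field_simp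
  rw [hone] at hlim
  refine hlim.congr' ?_
  filter_upwards [eventually_pullback_pair hF hφ hχ hc hc', hpair.eventually hFG,
    self_mem_nhdsWithin] with v h1 h2 h3
  have h4 := h2 (Ne.symm h1.1)
  have h5 := sub_mul_dslope T c v
  have h6 : T v - T c ≠ 0 := sub_ne_zero.2 h1.1
  have h3 : v ≠ c := h3
  have h7 := sub_ne_zero.2 h3
  have h8 : dslope T c v ≠ 0 := by
    intro h; rw [h, mul_zero] at h5; exact h6 h5.symm
  rw [h1.2, ← h4]
  have h9 : T c - T v = -((v - c) * dslope T c v) := by rw [h5]; ring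
  rw [h9]
  field_simp
  ring

/-- Write the bidifferential as `G/(a - b)²`. Since `G` is symmetric and equal to `1` along the
diagonal, both first derivatives vanish at the centre, which excludes a simple pole. -/
theorem exists_analyticAt_chart
    (hF : ∀ (p : Ct) (c : ℂ) (v : TangentSpace 𝓘(ℂ) p)
    (m : Multiset (TangentBundle 𝓘(ℂ) Ct)), F (⟨p, c • v⟩ ::ₘ m) = c * F (⟨p, v⟩ ::ₘ m))
    (hb : IsFundamentalBidifferential F) (p : Ct) : ∃ J : ℂ → ℂ, AnalyticAt ℂ J (chartAt ℂ p p) ∧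
      ∀ᶠ b in 𝓝[≠] (chartAt ℂ p p), F {coordVec (chartAt ℂ p) (chartAt ℂ p p),
        coordVec (chartAt ℂ p) b} = ((b - chartAt ℂ p p) ^ 2)⁻¹ + J b := by
  have hχ := IsManifold.chart_mem_maximalAtlas (I := 𝓘(ℂ)) (n := ⊤) (M := Ct) p
  obtain ⟨G, hG, hG1, hFG⟩ := hb.2 p
  set a := chartAt ℂ p p with ha
  have hat : a ∈ (chartAt ℂ p).target := mem_chart_target ℂ p
  have hcdiag : Continuous fun b : ℂ => (b, b) := by fun_prop
  -- The definition normalises `G` only at the centre of the preferred chart. At a nearby point `b`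
  -- the normalisation comes from the chart centred there, by coordinate independence.
  have hdiag : (fun b => G (b, b)) =ᶠ[𝓝 a] fun _ => 1 := by
    filter_upwards [hcdiag.continuousAt.eventually (hG.eventually_analyticAt.and hFG.eventually_nhds),
      (chartAt ℂ p).open_target.eventually_mem hat] with b hb1 hb2
    have hcb : Tendsto (fun v : ℂ => (b, v)) (𝓝[≠] b) (𝓝 (b, b)) :=
      ((by fun_prop : Continuous fun v : ℂ => (b, v)).tendsto b).mono_left nhdsWithin_le_nhds
    have hl1 : Tendsto (fun v => G (b, v)) (𝓝[≠] b) (𝓝 (G (b, b))) :=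
      hb1.1.continuousAt.tendsto.comp hcb
    refine tendsto_nhds_unique hl1 ((tendsto_bidifferential_mul_sq hF hb hχ hb2).congr' ?_)
    filter_upwards [hcb.eventually hb1.2, self_mem_nhdsWithin] with v h1 h2
    exact h1 (Ne.symm h2)
  have hswap : (fun x : ℂ × ℂ => G (x.2, x.1)) =ᶠ[𝓝 (a, a)] G := by
    have hcs : Tendsto (fun x : ℂ × ℂ => (x.2, x.1)) (𝓝 (a, a)) (𝓝 (a, a)) :=
      (by fun_prop : Continuous fun x : ℂ × ℂ => (x.2, x.1)).tendsto (a, a)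
    filter_upwards [hFG, hcs.eventually hFG] with x h1 h2
    by_cases hx : x.1 = x.2
    · rw [← hx, show (x.1, x.1) = x from Prod.ext rfl hx]
    · have e1 := h1 hx
      have e2 := h2 (Ne.symm hx)
      rw [← e2, ← e1, Multiset.pair_comm]
      ring
  obtain ⟨L, hL⟩ := hG.differentiableAt
  have hd1 : HasDerivAt (fun b => G (b, b)) (L (1, 1)) a :=
    HasFDerivAt.comp_hasDerivAt (f := fun b : ℂ => (b, b)) a hL
      ((hasDerivAt_id a).prodMk (hasDerivAt_id a))
  have hd1' : L (1, 1) = 0 := hd1.unique ((hasDerivAt_const a (1 : ℂ)).congr_of_eventuallyEq hdiag)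
  have hd2 : HasDerivAt (fun b => G (a, b)) (L (0, 1)) a :=
    HasFDerivAt.comp_hasDerivAt (f := fun b : ℂ => (a, b)) a hL
      ((hasDerivAt_const a a).prodMk (hasDerivAt_id a))
  have hd3 : HasDerivAt (fun b => G (b, a)) (L (1, 0)) a :=
    HasFDerivAt.comp_hasDerivAt (f := fun b : ℂ => (b, a)) a hL
      ((hasDerivAt_id a).prodMk (hasDerivAt_const a a))
  -- Symmetry makes the two partial derivatives equal; constancy on the diagonal makes their sum
  -- zero.
  have hd4 : L (1, 0) = L (0, 1) := by
    refine hd3.unique (hd2.congr_of_eventuallyEq ?_)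
    have hcb : Tendsto (fun b : ℂ => (a, b)) (𝓝 a) (𝓝 (a, a)) :=
      (by fun_prop : Continuous fun b : ℂ => (a, b)).tendsto a
    exact hcb.eventually hswap
  have hd5 : L (0, 1) = 0 := by
    have : L (1, 1) = L (1, 0) + L (0, 1) := by rw [← map_add]; simp
    rw [hd1', hd4] at this
    linear_combination -(1 / 2 : ℂ) * this
  have hf : AnalyticAt ℂ (fun b => G (a, b)) a :=
    AnalyticAt.fun_comp (f := fun b : ℂ => (a, b)) hG (analyticAt_const.prod analyticAt_id)
  obtain ⟨J, hJ, hJe⟩ := exists_analyticAt_div_sq hf hG1 (by rw [hd2.deriv, hd5])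
  refine ⟨J, hJ, ?_⟩
  have hcb : Tendsto (fun v : ℂ => (a, v)) (𝓝[≠] a) (𝓝 (a, a)) :=
    ((by fun_prop : Continuous fun v : ℂ => (a, v)).tendsto a).mono_left nhdsWithin_le_nhds
  filter_upwards [hcb.eventually hFG, self_mem_nhdsWithin] with b h1 h2
  have h2 : b ≠ a := h2
  rw [← hJe b h2, ← h1 h2.symm]
  have := sub_ne_zero.2 h2
  have h3 : (a - b) ^ 2 = (b - a) ^ 2 := by ring
  rw [h3, mul_assoc, mul_inv_cancel₀ (pow_ne_zero 2 this), mul_one]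

/-- In any coordinate the fundamental bidifferential is `(v - c)⁻²` plus a holomorphic function. -/
theorem exists_analyticAt_bidifferential
    (hF : ∀ (p : Ct) (c : ℂ) (v : TangentSpace 𝓘(ℂ) p)
    (m : Multiset (TangentBundle 𝓘(ℂ) Ct)), F (⟨p, c • v⟩ ::ₘ m) = c * F (⟨p, v⟩ ::ₘ m))
    (hb : IsFundamentalBidifferential F) {φ : OpenPartialHomeomorph Ct ℂ}
    (hφ : φ ∈ IsManifold.maximalAtlas 𝓘(ℂ) ⊤ Ct) {c : ℂ} (hc : c ∈ φ.target) :
    ∃ J : ℂ → ℂ, AnalyticAt ℂ J c ∧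
      ∀ᶠ v in 𝓝[≠] c, F {coordVec φ c, coordVec φ v} = ((v - c) ^ 2)⁻¹ + J v := by
  set p := φ.symm c with hp
  have hχ := IsManifold.chart_mem_maximalAtlas (I := 𝓘(ℂ)) (n := ⊤) (M := Ct) p
  have hc' : φ.symm c ∈ (chartAt ℂ p).source := mem_chart_source ℂ p
  set T := fun v => chartAt ℂ p (φ.symm v) with hTdef
  have hT : AnalyticAt ℂ T c := analyticAt_transition hχ hφ hc hc'
  have hT0 : deriv T c ≠ 0 := deriv_transition_ne_zero hχ hφ hc hc'
  have hTc : T c = chartAt ℂ p p := rfl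
  obtain ⟨J, hJ, hJe⟩ := exists_analyticAt_chart hF hb p
  obtain ⟨J', hJ', hJe'⟩ := exists_analyticAt_pullback hT hT0
  rw [← hTc] at hJ hJe
  refine ⟨fun v => J' v + deriv T c * deriv T v * J (T v),
    hJ'.add ((analyticAt_const.mul hT.deriv).mul (hJ.fun_comp hT)), ?_⟩
  filter_upwards [eventually_pullback_pair hF hφ hχ hc hc',
    (tendsto_transition_nhdsNE hφ hχ hc hc').eventually hJe, hJe'] with v h1 h2 h3
  rw [h1.2]
  have h4 : F {coordVec (chartAt ℂ p) (chartAt ℂ p (φ.symm c)),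
      coordVec (chartAt ℂ p) (chartAt ℂ p (φ.symm v))} = ((T v - T c) ^ 2)⁻¹ + J (T v) := h2
  rw [h4, mul_add, h3]
  ring

end Bidifferential

end LoopEq
end

noncomputable section

namespace LoopEq

open LocalCoords

/-! ## Contour integrals of the fundamental bidifferential and of its primitive -/

section Bidifferential

variable {Ct : Type*} [TopologicalSpace Ct] [ChartedSpace ℂ Ct] [IsManifold 𝓘(ℂ) ⊤ Ct]
  {F : Multiset (TangentBundle 𝓘(ℂ) Ct) → ℂ}

theorem differentiableAt_bidifferential_right
    (hF : ∀ (p : Ct) (c : ℂ) (v : TangentSpace 𝓘(ℂ) p)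
    (m : Multiset (TangentBundle 𝓘(ℂ) Ct)), F (⟨p, c • v⟩ ::ₘ m) = c * F (⟨p, v⟩ ::ₘ m))
    (hb : IsFundamentalBidifferential F) {φ ψ : OpenPartialHomeomorph Ct ℂ}
    (hφ : φ ∈ IsManifold.maximalAtlas 𝓘(ℂ) ⊤ Ct) (hψ : ψ ∈ IsManifold.maximalAtlas 𝓘(ℂ) ⊤ Ct)
    {c v : ℂ} (hc : c ∈ φ.target) (hv : v ∈ ψ.target) (hne : φ.symm c ≠ ψ.symm v) :
    DifferentiableAt ℂ (fun v => F {coordVec φ c, coordVec ψ v}) v :=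
  (AnalyticAt.fun_comp (f := fun v : ℂ => (c, v))
    (analyticAt_bidifferential_coordVec hF hb hφ hψ hc hv hne)
    (analyticAt_const.prod analyticAt_id)).differentiableAt

theorem circleIntegral_pow_mul_bidifferential_of_ne
    (hF : ∀ (p : Ct) (c : ℂ) (v : TangentSpace 𝓘(ℂ) p)
    (m : Multiset (TangentBundle 𝓘(ℂ) Ct)), F (⟨p, c • v⟩ ::ₘ m) = c * F (⟨p, v⟩ ::ₘ m))
    (hb : IsFundamentalBidifferential F) {φ ψ : OpenPartialHomeomorph Ct ℂ}
    (hφ : φ ∈ IsManifold.maximalAtlas 𝓘(ℂ) ⊤ Ct) (hψ : ψ ∈ IsManifold.maximalAtlas 𝓘(ℂ) ⊤ Ct)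
    {c : ℂ} {δ : ℝ} (hδ : 0 < δ) (hc : c ∈ φ.target) (hball : Metric.closedBall 0 δ ⊆ ψ.target)
    (hne : ∀ v ∈ Metric.closedBall 0 δ, φ.symm c ≠ ψ.symm v) (k : ℕ) :
    (∮ v in C(0, δ), v ^ k * F {coordVec φ c, coordVec ψ v}) = 0 := by
  have hd : ∀ v ∈ Metric.closedBall (0 : ℂ) δ,
      DifferentiableAt ℂ (fun v => v ^ k * F {coordVec φ c, coordVec ψ v}) v := fun v hv =>
    (differentiableAt_pow k).mul
      (differentiableAt_bidifferential_right hF hb hφ hψ hc (hball hv) (hne v hv))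
  exact Complex.circleIntegral_eq_zero_of_differentiable_on_off_countable hδ.le Set.countable_empty
    (fun v hv => (hd v hv).continuousAt.continuousWithinAt)
    fun v hv => hd v (Metric.ball_subset_closedBall hv.1)

/-- Only the pure double pole at `c` contributes, and Cauchy's formula for the derivative evaluates
it as the derivative of `v ^ k`. -/
theorem circleIntegral_pow_mul_bidifferential_self
    (hF : ∀ (p : Ct) (c : ℂ) (v : TangentSpace 𝓘(ℂ) p)
    (m : Multiset (TangentBundle 𝓘(ℂ) Ct)), F (⟨p, c • v⟩ ::ₘ m) = c * F (⟨p, v⟩ ::ₘ m))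
    (hb : IsFundamentalBidifferential F) {φ : OpenPartialHomeomorph Ct ℂ}
    (hφ : φ ∈ IsManifold.maximalAtlas 𝓘(ℂ) ⊤ Ct)
    {c : ℂ} {δ : ℝ} (hc : c ∈ Metric.ball 0 δ) (hball : Metric.closedBall 0 δ ⊆ φ.target) (k : ℕ) :
    (∮ v in C(0, δ), v ^ k * F {coordVec φ c, coordVec φ v}) =
      2 * (Real.pi : ℂ) * Complex.I * (k * c ^ (k - 1)) := by
  have hδ : 0 < δ := Metric.pos_of_mem_ball hc
  have hct := hball (Metric.ball_subset_closedBall hc)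
  obtain ⟨J₀, hJ₀, hJe⟩ := exists_analyticAt_bidifferential hF hb hφ hct
  -- The bidifferential minus its double pole, with the removable singularity at `c` filled in.
  set J : ℂ → ℂ := Function.update
    (fun v => F {coordVec φ c, coordVec φ v} - ((v - c) ^ 2)⁻¹) c (J₀ c) with hJdef
  have hJne : ∀ v, v ≠ c → J v = F {coordVec φ c, coordVec φ v} - ((v - c) ^ 2)⁻¹ := fun v hv =>
    Function.update_of_ne hv _ _
  have hJd : ∀ v ∈ Metric.closedBall (0 : ℂ) δ, DifferentiableAt ℂ J v := by
    intro v hv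
    by_cases hvc : v = c
    · subst hvc
      refine hJ₀.differentiableAt.congr_of_eventuallyEq ?_
      rw [eventually_nhdsWithin_iff] at hJe
      filter_upwards [hJe] with x hx
      by_cases hxv : x = v
      · rw [hxv, hJdef, Function.update_self]
      · rw [hJne x hxv, hx hxv, add_sub_cancel_left]
    · have h1 := differentiableAt_bidifferential_right hF hb hφ hφ hct (hball hv)
        fun h => hvc (φ.symm.injOn hct (hball hv) h).symm
      have h2 : DifferentiableAt ℂ (fun v => ((v - c) ^ 2)⁻¹) v :=
        ((differentiableAt_id.sub_const c).pow 2).inv (pow_ne_zero 2 (sub_ne_zero.2 hvc))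
      refine (h1.sub h2).congr_of_eventuallyEq ?_
      filter_upwards [isOpen_ne.eventually_mem hvc] with x hx using hJne x hx
  have hne : ∀ v ∈ Metric.sphere (0 : ℂ) δ, v ≠ c := fun v hv h =>
    Metric.sphere_disjoint_ball.ne_of_mem hv hc h
  have hpJ : ∀ v ∈ Metric.closedBall (0 : ℂ) δ, DifferentiableAt ℂ (fun v => v ^ k * J v) v :=
    fun v hv => (differentiableAt_pow k).mul (hJd v hv)
  have h0 : (∮ v in C(0, δ), v ^ k * J v) = 0 :=
    Complex.circleIntegral_eq_zero_of_differentiable_on_off_countable hδ.le Set.countable_empty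
      (fun v hv => (hpJ v hv).continuousAt.continuousWithinAt)
      fun v hv => hpJ v (Metric.ball_subset_closedBall hv.1)
  have h1 := Complex.two_pi_I_inv_smul_circleIntegral_sub_sq_inv_smul_of_differentiable
    (f := fun v : ℂ => v ^ k) isOpen_univ (Set.subset_univ _)
    (differentiable_pow k).differentiableOn hc
  rw [deriv_pow_field] at h1
  have hcong : (∮ v in C(0, δ), v ^ k * F {coordVec φ c, coordVec φ v}) =
      ∮ v in C(0, δ), (((v - c) ^ 2)⁻¹ • v ^ k + v ^ k * J v) := by
    refine circleIntegral.integral_congr hδ.le fun v hv => ?_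
    rw [hJne v (hne v hv), smul_eq_mul]
    ring
  have hi1 : CircleIntegrable (fun v => ((v - c) ^ 2)⁻¹ • v ^ k) 0 δ := by
    refine ContinuousOn.circleIntegrable hδ.le fun v hv => ContinuousAt.continuousWithinAt ?_
    have : DifferentiableAt ℂ (fun v => ((v - c) ^ 2)⁻¹) v :=
      ((differentiableAt_id.sub_const c).pow 2).inv (pow_ne_zero 2 (sub_ne_zero.2 (hne v hv)))
    exact this.continuousAt.smul (continuous_pow k).continuousAt
  have hi2 : CircleIntegrable (fun v => v ^ k * J v) 0 δ :=
    ContinuousOn.circleIntegrable hδ.le fun v hv =>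
      (hpJ v (Metric.sphere_subset_closedBall hv)).continuousAt.continuousWithinAt
  rw [hcong, circleIntegral.integral_add hi1 hi2, h0, add_zero, ← h1, smul_eq_mul, ← mul_assoc,
    mul_inv_cancel₀ Complex.two_pi_I_ne_zero, one_mul]

end Bidifferential

section Family

variable {Ct C : Type*} [TopologicalSpace Ct] [ChartedSpace ℂ Ct]
  {Γ : SpectralCurve Ct C}
  {K : LocalCoords Γ} {om : ℕ → Multiset (TangentBundle 𝓘(ℂ) Ct) → ℂ} {μ ν : Ct} {δ : ℝ}

theorem pt_ne_pt (hμ : μ ∈ Γ.ram) (hν : ν ∈ Γ.ram) {u v : ℂ} (hu : u ∈ (K.ζ μ).target)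
    (hv : v ∈ (K.ζ ν).target) (h : μ ≠ ν ∨ u ≠ v) : K.pt μ u ≠ K.pt ν v := by
  intro he
  by_cases hμν : μ = ν
  · subst hμν
    exact (h.resolve_left fun h => h rfl) (K.pt_injOn hu hv he)
  · refine Set.disjoint_left.1 (K.disjoint μ hμ ν hν hμν) (K.pt_mem_source hu) ?_
    rw [he]
    exact K.pt_mem_source hv

theorem mul_mem_ball {u : ℂ} (hu : u ∈ Metric.ball (0 : ℂ) δ) {t : ℝ} (ht : t ∈ Set.Icc (0 : ℝ) 1) :
    (t : ℂ) * u ∈ Metric.ball (0 : ℂ) δ := by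
  rw [mem_ball_zero_iff] at hu ⊢
  rw [norm_mul, Complex.norm_real, Real.norm_eq_abs, abs_of_nonneg ht.1]
  exact lt_of_le_of_lt (mul_le_of_le_one_left (norm_nonneg _) ht.2) hu

variable [IsManifold 𝓘(ℂ) ⊤ Ct]

open scoped Classical in
theorem circleIntegral_pow_mul_om (hom : IsCorrelatorFamily K om) (hμ : μ ∈ Γ.ram) (hν : ν ∈ Γ.ram)
    (hbμ : Metric.closedBall 0 δ ⊆ (K.ζ μ).target) (hbν : Metric.closedBall 0 δ ⊆ (K.ζ ν).target)
    {c : ℂ} (hc : c ∈ Metric.ball 0 δ) (k : ℕ) :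
    (∮ v in C(0, δ), v ^ k * om 0 {K.ddζ μ c, K.ddζ ν v}) =
      2 * (Real.pi : ℂ) * Complex.I * (if μ = ν then k * c ^ (k - 1) else 0) := by
  have hct := hbμ (Metric.ball_subset_closedBall hc)
  split_ifs with h
  · subst h
    exact circleIntegral_pow_mul_bidifferential_self (hom.linear 0) hom.zero_two
      (K.holomorphic μ hμ) hc hbμ k
  · rw [mul_zero]
    exact circleIntegral_pow_mul_bidifferential_of_ne (hom.linear 0) hom.zero_two
      (K.holomorphic μ hμ) (K.holomorphic ν hν) (Metric.pos_of_mem_ball hc) hct hbν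
      (fun v hv => pt_ne_pt (K := K) hμ hν hct (hbν hv) (Or.inl h)) k

theorem continuousOn_om_ddζ (hom : IsCorrelatorFamily K om) (hμ : μ ∈ Γ.ram) (hν : ν ∈ Γ.ram)
    (hbμ : Metric.closedBall 0 δ ⊆ (K.ζ μ).target) (hbν : Metric.closedBall 0 δ ⊆ (K.ζ ν).target) :
    ContinuousOn (fun x : ℂ × ℂ => om 0 {K.ddζ μ x.1, K.ddζ ν x.2})
      (Metric.ball 0 δ ×ˢ Metric.sphere 0 δ) := by
  rintro ⟨u, v⟩ ⟨hu, hv⟩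
  have hut := hbμ (Metric.ball_subset_closedBall hu)
  have hvt := hbν (Metric.sphere_subset_closedBall hv)
  exact (analyticAt_bidifferential_coordVec (hom.linear 0) hom.zero_two (K.holomorphic μ hμ)
    (K.holomorphic ν hν) hut hvt (pt_ne_pt (K := K) hμ hν hut hvt
      (Or.inr (Metric.sphere_disjoint_ball.ne_of_mem hv hu).symm))).continuousAt.continuousWithinAt

-- Exchange the contour in `v` with the segment from `0` to `u`: the inner integral is `k (t u) ^ (k
-- - 1)`, and integrating over the segment gives `u ^ k`. The constant moment is lost, which is why
-- the recursion sees only the moments `k ≥ 1`.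
open scoped Classical in
theorem circleIntegral_pow_mul_primitive (hom : IsCorrelatorFamily K om) (hμ : μ ∈ Γ.ram)
    (hν : ν ∈ Γ.ram) (hbμ : Metric.closedBall 0 δ ⊆ (K.ζ μ).target)
    (hbν : Metric.closedBall 0 δ ⊆ (K.ζ ν).target) {u : ℂ} (hu : u ∈ Metric.ball 0 δ) (k : ℕ) :
    (∮ v in C(0, δ), v ^ k * primitive K om μ (K.ddζ ν v) u) =
      2 * (Real.pi : ℂ) * Complex.I * (if μ = ν ∧ k ≠ 0 then u ^ k else 0) := by
  have hδ : 0 < δ := Metric.pos_of_mem_ball hu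
  set B : ℂ → ℂ → ℂ := fun c v => om 0 {K.ddζ μ c, K.ddζ ν v} with hB
  -- The segment stays in the open disc while `v` is on its boundary, so the pole on the diagonal is
  -- never met.
  have hcont : ContinuousOn (fun x : ℝ × ℝ => deriv (circleMap 0 δ) x.1 *
      (circleMap 0 δ x.1 ^ k * (u * B ((x.2 : ℂ) * u) (circleMap 0 δ x.1))))
      (Set.univ ×ˢ Set.Icc (0 : ℝ) 1) := by
    have h1 : ContinuousOn (fun x : ℝ × ℝ => B ((x.2 : ℂ) * u) (circleMap 0 δ x.1))
        (Set.univ ×ˢ Set.Icc (0 : ℝ) 1) := by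
      refine ContinuousOn.comp (f := fun x : ℝ × ℝ => ((x.2 : ℂ) * u, circleMap 0 δ x.1))
        (continuousOn_om_ddζ hom hμ hν hbμ hbν) ?_ ?_
      · exact (by fun_prop : Continuous fun x : ℝ × ℝ =>
          ((x.2 : ℂ) * u, circleMap 0 δ x.1)).continuousOn
      · rintro ⟨θ, t⟩ ⟨-, ht⟩
        exact ⟨mul_mem_ball hu ht, circleMap_mem_sphere 0 hδ.le θ⟩
    simp only [deriv_circleMap]
    refine ContinuousOn.mul ?_ (ContinuousOn.mul ?_ (continuousOn_const.mul h1))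
    · exact (by fun_prop : Continuous fun x : ℝ × ℝ => circleMap 0 δ x.1 * Complex.I).continuousOn
    · exact (by fun_prop : Continuous fun x : ℝ × ℝ => circleMap 0 δ x.1 ^ k).continuousOn
  have hint : MeasureTheory.IntegrableOn (Function.uncurry fun θ t : ℝ => deriv (circleMap 0 δ) θ *
      (circleMap 0 δ θ ^ k * (u * B ((t : ℂ) * u) (circleMap 0 δ θ))))
      (Set.uIoc 0 (2 * Real.pi) ×ˢ Set.uIoc (0 : ℝ) 1) := by
    refine MeasureTheory.IntegrableOn.mono_set (t := Set.uIcc 0 (2 * Real.pi) ×ˢ Set.uIcc (0 : ℝ) 1) ?_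
      (Set.prod_mono Set.uIoc_subset_uIcc Set.uIoc_subset_uIcc)
    refine ContinuousOn.integrableOn_compact (isCompact_uIcc.prod isCompact_uIcc) ?_
    refine hcont.mono (Set.prod_mono (Set.subset_univ _) ?_)
    rw [Set.uIcc_of_le zero_le_one]
  have hswap := MeasureTheory.intervalIntegral_intervalIntegral_swap hint
  have hl : (∮ v in C(0, δ), v ^ k * primitive K om μ (K.ddζ ν v) u) =
      ∫ θ in (0 : ℝ)..2 * Real.pi, ∫ t in (0 : ℝ)..1, deriv (circleMap 0 δ) θ *
        (circleMap 0 δ θ ^ k * (u * B ((t : ℂ) * u) (circleMap 0 δ θ))) := by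
    simp only [circleIntegral, smul_eq_mul, primitive, intervalIntegral.integral_const_mul]
    rfl
  have hr : ∀ t ∈ Set.uIcc (0 : ℝ) 1, (∫ θ in (0 : ℝ)..2 * Real.pi, deriv (circleMap 0 δ) θ *
        (circleMap 0 δ θ ^ k * (u * B ((t : ℂ) * u) (circleMap 0 δ θ)))) =
      2 * (Real.pi : ℂ) * Complex.I * (if μ = ν then u ^ k * (k * (t : ℂ) ^ (k - 1)) else 0) := by
    intro t ht
    rw [Set.uIcc_of_le zero_le_one] at ht
    have h1 := circleIntegral_pow_mul_om hom hμ hν hbμ hbν (mul_mem_ball hu ht) k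
    have h2 : (∫ θ in (0 : ℝ)..2 * Real.pi, deriv (circleMap 0 δ) θ *
        (circleMap 0 δ θ ^ k * (u * B ((t : ℂ) * u) (circleMap 0 δ θ)))) =
        u * ∮ v in C(0, δ), v ^ k * om 0 {K.ddζ μ ((t : ℂ) * u), K.ddζ ν v} := by
      rw [circleIntegral, ← intervalIntegral.integral_const_mul]
      refine intervalIntegral.integral_congr fun θ _ => ?_
      simp only [smul_eq_mul, hB]
      ring
    rw [h2, h1]
    split_ifs
    · rcases Nat.eq_zero_or_pos k with rfl | hk
      · simp
      · have hk1 : u ^ k = u ^ (k - 1) * u := by rw [← pow_succ]; congr 1; omega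
        rw [hk1, mul_pow]
        ring
    · ring
  rw [hl, hswap, intervalIntegral.integral_congr hr, intervalIntegral.integral_const_mul]
  congr 1
  by_cases h : μ = ν
  · rcases Nat.eq_zero_or_pos k with rfl | hk
    · simp
    · have hk0 : k ≠ 0 := hk.ne'
      simp only [h, true_and, if_true, ne_eq, hk0, not_false_eq_true,
        intervalIntegral.integral_const_mul]
      have h3 : (∫ t in (0 : ℝ)..1, (t : ℂ) ^ (k - 1)) = (k : ℂ)⁻¹ := by
        have h4 := integral_pow (a := 0) (b := 1) (k - 1)
        have h5 : (∫ t in (0 : ℝ)..1, (t : ℂ) ^ (k - 1)) = ((∫ t in (0 : ℝ)..1, t ^ (k - 1) : ℝ) : ℂ) := by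
          rw [← intervalIntegral.integral_ofReal]
          push_cast
          rfl
        rw [h5, h4, Nat.sub_add_cancel hk, one_pow, zero_pow hk0, Nat.cast_sub hk]
        push_cast
        ring
      rw [h3, mul_inv_cancel₀ (Nat.cast_ne_zero.2 hk0), mul_one]
  · simp [h]

/-- The primitive is jointly continuous on a product of circles. -/
theorem continuous_primitive_circleMap (hom : IsCorrelatorFamily K om) (hμ : μ ∈ Γ.ram)
    (hν : ν ∈ Γ.ram) (hbμ : Metric.closedBall 0 δ ⊆ (K.ζ μ).target)
    (hbν : Metric.closedBall 0 δ ⊆ (K.ζ ν).target) {ε : ℝ} (hε : 0 < ε) (hεδ : ε < δ) :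
    Continuous fun x : ℝ × ℝ =>
      primitive K om μ (K.ddζ ν (circleMap 0 δ x.1)) (circleMap 0 ε x.2) := by
  have hδ := hε.trans hεδ
  -- Clamping `t` to `[0, 1]` makes the integrand continuous for all real `t` without changing the
  -- integral.
  have hc : Continuous (Function.uncurry fun (x : ℝ × ℝ) (t : ℝ) => circleMap 0 ε x.2 *
      om 0 {K.ddζ μ (((max 0 (min 1 t) : ℝ) : ℂ) * circleMap 0 ε x.2),
        K.ddζ ν (circleMap 0 δ x.1)}) := by
    refine Continuous.mul (by fun_prop) ?_
    refine ContinuousOn.comp_continuous (f := fun x : (ℝ × ℝ) × ℝ =>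
      (((max 0 (min 1 x.2) : ℝ) : ℂ) * circleMap 0 ε x.1.2, circleMap 0 δ x.1.1))
      (continuousOn_om_ddζ hom hμ hν hbμ hbν) (by fun_prop) fun x => ⟨?_, ?_⟩
    · refine mul_mem_ball ?_ ⟨le_max_left _ _, max_le zero_le_one (min_le_left _ _)⟩
      rw [mem_ball_zero_iff, norm_circleMap_zero, abs_of_pos hε]
      exact hεδ
    · exact circleMap_mem_sphere 0 hδ.le _
  refine (intervalIntegral.continuous_parametric_intervalIntegral_of_continuous'
    (μ := MeasureTheory.volume) hc 0 1).congr fun x => ?_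
  refine intervalIntegral.integral_congr fun t ht => ?_
  rw [Set.uIcc_of_le zero_le_one] at ht
  rw [min_eq_right ht.2, max_eq_right ht.1]

end Family

end LoopEq
end

noncomputable section

namespace LoopEq

open LocalCoords

/-! ## Residues of the correlators given by the recursion formula -/

theorem circleIntegral_circleIntegral_swap {f : ℂ → ℂ → ℂ} {δ ε : ℝ}
    (hf : Continuous fun x : ℝ × ℝ => f (circleMap 0 δ x.1) (circleMap 0 ε x.2)) :
    (∮ v in C(0, δ), ∮ u in C(0, ε), f v u) = ∮ u in C(0, ε), ∮ v in C(0, δ), f v u := by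
  simp only [circleIntegral, smul_eq_mul, ← intervalIntegral.integral_const_mul]
  rw [MeasureTheory.intervalIntegral_intervalIntegral_swap]
  · refine intervalIntegral.integral_congr fun θ _ => intervalIntegral.integral_congr fun θ' _ => ?_
    ring
  · have hc : Continuous (Function.uncurry fun x y : ℝ => deriv (circleMap 0 δ) x *
        (deriv (circleMap 0 ε) y * f (circleMap 0 δ x) (circleMap 0 ε y))) := by
      simp only [deriv_circleMap]
      refine Continuous.mul ?_ (Continuous.mul ?_ hf)
      · exact (by fun_prop : Continuous fun x : ℝ × ℝ => circleMap 0 δ x.1 * Complex.I)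
      · exact (by fun_prop : Continuous fun x : ℝ × ℝ => circleMap 0 ε x.2 * Complex.I)
    refine MeasureTheory.IntegrableOn.mono_set (t := Set.uIcc 0 (2 * Real.pi) ×ˢ
      Set.uIcc 0 (2 * Real.pi)) ?_ (Set.prod_mono Set.uIoc_subset_uIcc Set.uIoc_subset_uIcc)
    exact hc.continuousOn.integrableOn_compact (isCompact_uIcc.prod isCompact_uIcc)

variable {Ct C : Type*} [TopologicalSpace Ct] [ChartedSpace ℂ Ct] [IsManifold 𝓘(ℂ) ⊤ Ct]
  {Γ : SpectralCurve Ct C}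
  {K : LocalCoords Γ} {om : ℕ → Multiset (TangentBundle 𝓘(ℂ) Ct) → ℂ}

/-- Insert the recursion formula for `v` on a circle of radius `δ`, with residues taken on a smaller
circle of radius `ε`, and integrate over `v` first. The moments of the primitive select the branch
`ν` and the exponents `k ≥ 1`. -/
theorem res_pow_mul_om_of_topologicalRecursion (hom : IsCorrelatorFamily K om)
    (hT : TopologicalRecursion K om) {h n : ℕ} (hn : 2 < h + (n + 1))
    {w : Fin n → TangentBundle 𝓘(ℂ) Ct} (hw : ∀ j, (w j).proj ∉ Γ.ramSet) {ν : Ct} (hν : ν ∈ Γ.ram)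
    (k : ℕ) :
    res (fun v => v ^ k * om h (K.ddζ ν v ::ₘ Finset.univ.val.map w)) =
      if k = 0 then 0 else res (fun u => u ^ k * recursionForm K om (Γ.proj ν) ν h w u) := by
  classical
  set I : Ct → ℂ → ℂ := fun μ => recursionForm K om (Γ.proj μ) μ h w with hI
  set W : ℂ → ℂ := fun v => om h (K.ddζ ν v ::ₘ Finset.univ.val.map w) with hW
  have hbr : ∀ μ ∈ Γ.ram, Γ.proj μ ∈ Γ.ramPts ∧ μ ∈ Γ.branches (Γ.proj μ) := fun μ hμ =>
    ⟨Γ.mem_ram.1 hμ, Γ.mem_branches.2 rfl⟩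
  have hIm : ∀ μ ∈ Γ.ram, MeromorphicAt (I μ) 0 := fun μ hμ =>
    meromorphicAt_recursionForm hom (hbr μ hμ).1 (hbr μ hμ).2 hn hw
  have hWm : MeromorphicAt W 0 := meromorphicAt_om_ddζ hom (hbr ν hν).1 (hbr ν hν).2 hn hw
  obtain ⟨R, hR, hball⟩ : ∃ R > 0, ∀ u : ℂ, ‖u‖ < R → (∀ μ ∈ Γ.ram, u ∈ (K.ζ μ).target) ∧
      (u ≠ 0 → (∀ μ ∈ Γ.ram, DifferentiableAt ℂ (I μ) u) ∧ DifferentiableAt ℂ W u) := by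
    have h1 : ∀ᶠ u in 𝓝 (0 : ℂ), ∀ μ ∈ Γ.ram, u ∈ (K.ζ μ).target :=
      (Finset.eventually_all _).2 fun μ hμ => K.eventually_mem_target hμ
    have h2 : ∀ᶠ u in 𝓝[≠] (0 : ℂ), (∀ μ ∈ Γ.ram, DifferentiableAt ℂ (I μ) u) ∧
        DifferentiableAt ℂ W u :=
      ((Finset.eventually_all _).2 fun μ hμ => (hIm μ hμ).eventually_analyticAt.mono
        fun _ h => h.differentiableAt).and (hWm.eventually_analyticAt.mono
          fun _ h => h.differentiableAt)
    rw [eventually_nhdsWithin_iff] at h2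
    obtain ⟨R, hR, h3⟩ := Metric.eventually_nhds_iff.1 (h1.and h2)
    exact ⟨R, hR, fun u hu => h3 (by simpa using hu)⟩
  obtain ⟨δ, hδ, hδR⟩ := exists_between hR
  obtain ⟨ε, hε, hεδ⟩ := exists_between hδ
  have hsub : ∀ μ ∈ Γ.ram, Metric.closedBall 0 δ ⊆ (K.ζ μ).target := fun μ hμ u hu =>
    (hball u (lt_of_le_of_lt (mem_closedBall_zero_iff.1 hu) hδR)).1 μ hμ
  have hIc : ∀ μ ∈ Γ.ram, Continuous fun θ : ℝ => I μ (circleMap 0 ε θ) := by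
    intro μ hμ
    refine continuous_iff_continuousAt.2 fun θ => ?_
    have hn1 : ‖circleMap 0 ε θ‖ < R := by
      rw [norm_circleMap_zero, abs_of_pos hε]; exact hεδ.trans hδR
    have h1 := (((hball _ hn1).2 (circleMap_ne_center hε.ne')).1 μ hμ).continuousAt
    exact ContinuousAt.comp (f := fun θ : ℝ => circleMap 0 ε θ) h1 (continuous_circleMap 0 ε).continuousAt
  set P : Ct → ℂ → ℂ → ℂ := fun μ v u => primitive K om μ (K.ddζ ν v) u with hP
  have hcirc : ∀ v ∈ Metric.sphere (0 : ℂ) δ, W v =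
      ∑ μ ∈ Γ.ram, (2 * (Real.pi : ℂ) * Complex.I)⁻¹ * ∮ u in C(0, ε), P μ v u * I μ u := by
    intro v hv
    have hvt := hsub ν hν (Metric.sphere_subset_closedBall hv)
    have hv0 : v ≠ 0 := by rintro rfl; simp at hv; exact hδ.ne hv
    rw [hW]
    dsimp only
    rw [hT h n _ w hn (K.pt_notMem_ramSet hν hvt hv0) hw]
    rw [show (∑ α ∈ Γ.ramPts, ∑ μ ∈ Γ.branches α, res (recursionIntegrand K om α μ h (K.ddζ ν v) w)) =
      ∑ μ ∈ Γ.ram, res (recursionIntegrand K om (Γ.proj μ) μ h (K.ddζ ν v) w) by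
        rw [Γ.sum_ram]
        refine Finset.sum_congr rfl fun α _ => Finset.sum_congr rfl fun μ hμ => ?_
        rw [Γ.mem_branches.1 hμ]]
    refine Finset.sum_congr rfl fun μ hμ => ?_
    have hfun : recursionIntegrand K om (Γ.proj μ) μ h (K.ddζ ν v) w = fun u => P μ v u * I μ u :=
      funext fun u => recursionIntegrand_eq K om _ μ h _ w u
    rw [hfun]
    -- The primitive is holomorphic for `‖u‖ < δ = ‖v‖` only, so the residue contour must have
    -- radius `ε < δ`.
    refine res_eq_circleIntegral (R := δ) (fun u hu0 hu => ?_) hε hεδ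
    have hd : DifferentiableOn ℂ (fun ξ => om 0 {K.ddζ μ ξ, K.ddζ ν v}) (Metric.ball 0 δ) := by
      intro ξ hξ
      have hξt := hsub μ hμ (Metric.ball_subset_closedBall hξ)
      exact (analyticAt_om_zero_ddζ hom hμ hξt (pt_ne_pt hμ hν hξt hvt
        (Or.inr (Metric.sphere_disjoint_ball.ne_of_mem hv hξ).symm))).differentiableAt.differentiableWithinAt
    exact (hasDerivAt_primitive hd (mem_ball_zero_iff.2 hu)).differentiableAt.mul
      (((hball u (hu.trans hδR)).2 hu0).1 μ hμ)
  have hPc : ∀ μ ∈ Γ.ram, Continuous fun x : ℝ × ℝ => circleMap 0 δ x.1 ^ k *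
      (P μ (circleMap 0 δ x.1) (circleMap 0 ε x.2) * I μ (circleMap 0 ε x.2)) := fun μ hμ =>
    Continuous.mul (by fun_prop) ((continuous_primitive_circleMap hom hμ hν (hsub μ hμ) (hsub ν hν)
      hε hεδ).mul ((hIc μ hμ).comp continuous_snd))
  have hres : res (fun v => v ^ k * W v) =
      (2 * (Real.pi : ℂ) * Complex.I)⁻¹ * ∮ v in C(0, δ), v ^ k * W v :=
    res_eq_circleIntegral (R := R)
      (fun u hu0 hu => (differentiableAt_pow k).mul ((hball u hu).2 hu0).2) hδ hδR
  have hsum : (∮ v in C(0, δ), v ^ k * W v) = ∑ μ ∈ Γ.ram, (2 * (Real.pi : ℂ) * Complex.I)⁻¹ *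
      ∮ v in C(0, δ), ∮ u in C(0, ε), v ^ k * (P μ v u * I μ u) := by
    have h1 : (∮ v in C(0, δ), v ^ k * W v) = ∮ v in C(0, δ), ∑ μ ∈ Γ.ram,
        (2 * (Real.pi : ℂ) * Complex.I)⁻¹ * ∮ u in C(0, ε), v ^ k * (P μ v u * I μ u) := by
      refine circleIntegral.integral_congr hδ.le fun v hv => ?_
      simp only [circleIntegral.integral_const_mul]
      rw [hcirc v hv, Finset.mul_sum]
      exact Finset.sum_congr rfl fun μ _ => by ring
    rw [h1, circleIntegral]
    simp only [smul_eq_mul, Finset.mul_sum]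
    rw [intervalIntegral.integral_finsetSum]
    · refine Finset.sum_congr rfl fun μ _ => ?_
      rw [← circleIntegral.integral_const_mul, circleIntegral]
      simp only [smul_eq_mul]
    · intro μ hμ
      have h2 : Continuous fun θ : ℝ => ∮ u in C(0, ε), circleMap 0 δ θ ^ k *
          (P μ (circleMap 0 δ θ) u * I μ u) := by
        have h3 : Continuous (Function.uncurry fun θ φ : ℝ => deriv (circleMap 0 ε) φ •
            (circleMap 0 δ θ ^ k *
              (P μ (circleMap 0 δ θ) (circleMap 0 ε φ) * I μ (circleMap 0 ε φ)))) := by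
          simp only [deriv_circleMap, smul_eq_mul]
          exact Continuous.mul (by fun_prop : Continuous fun x : ℝ × ℝ => circleMap 0 ε x.2 * Complex.I)
            (hPc μ hμ)
        exact intervalIntegral.continuous_parametric_intervalIntegral_of_continuous'
          (μ := MeasureTheory.volume) h3 0 (2 * Real.pi)
      have h4 : Continuous fun θ : ℝ => deriv (circleMap 0 δ) θ *
          ((2 * (Real.pi : ℂ) * Complex.I)⁻¹ * ∮ u in C(0, ε), circleMap 0 δ θ ^ k *
          (P μ (circleMap 0 δ θ) u * I μ u)) := by
        simp only [deriv_circleMap]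
        exact Continuous.mul (by fun_prop) (continuous_const.mul h2)
      exact h4.intervalIntegrable _ _
  have hterm : ∀ μ ∈ Γ.ram, (∮ v in C(0, δ), ∮ u in C(0, ε), v ^ k * (P μ v u * I μ u)) =
      2 * (Real.pi : ℂ) * Complex.I *
        if μ = ν ∧ k ≠ 0 then ∮ u in C(0, ε), u ^ k * I μ u else 0 := by
    intro μ hμ
    rw [circleIntegral_circleIntegral_swap (hPc μ hμ)]
    have h1 : ∀ u ∈ Metric.sphere (0 : ℂ) ε, (∮ v in C(0, δ), v ^ k * (P μ v u * I μ u)) =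
        2 * (Real.pi : ℂ) * Complex.I * ((if μ = ν ∧ k ≠ 0 then u ^ k else 0) * I μ u) := by
      intro u hu
      have hub : u ∈ Metric.ball (0 : ℂ) δ := by
        rw [mem_ball_zero_iff, mem_sphere_zero_iff_norm.1 hu]; exact hεδ
      rw [← mul_assoc, ← circleIntegral_pow_mul_primitive hom hμ hν (hsub μ hμ) (hsub ν hν) hub k,
        mul_comm _ (I μ u), ← circleIntegral.integral_const_mul]
      refine circleIntegral.integral_congr hδ.le fun v _ => ?_
      simp only [hP]
      ring
    rw [circleIntegral.integral_congr hε.le h1, circleIntegral.integral_const_mul]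
    congr 1
    split_ifs
    · rfl
    · simp [circleIntegral]
  have h2pi := Complex.two_pi_I_ne_zero
  rw [hres, hsum, Finset.sum_congr rfl fun μ hμ => by rw [hterm μ hμ, ← mul_assoc,
    inv_mul_cancel₀ h2pi, one_mul]]
  split_ifs with hk
  · simp [hk]
  · have h3 : ∀ μ, (μ = ν ∧ k ≠ 0) ↔ μ = ν := fun μ => and_iff_left hk
    simp only [h3, Finset.sum_ite_eq', if_pos hν]
    exact (res_eq_circleIntegral (R := R) (fun u hu0 hu => (differentiableAt_pow k).mul
      (((hball u hu).2 hu0).1 ν hν)) hε (hεδ.trans hδR)).symm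

variable {α : C}

/-- All moments `k ≥ 1` of the defect vanish, so no pole of order two or more is possible. Nothing
is claimed for `k = 0`, hence the exponent `-1`. -/
theorem isBigO_defect_of_topologicalRecursion (hom : IsCorrelatorFamily K om)
    (hT : TopologicalRecursion K om) {h n : ℕ} (hn : 2 < h + (n + 1))
    {w : Fin n → TangentBundle 𝓘(ℂ) Ct} (hw : ∀ j, (w j).proj ∉ Γ.ramSet)
    (hα : α ∈ Γ.ramPts) {μ : Ct} (hμ : μ ∈ Γ.branches α) :
    (defect K om α μ h w) =O[𝓝[≠] 0] fun ξ => ξ ^ (-1 : ℤ) := by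
  have hram := Γ.mem_ram_of_mem_branches hα hμ
  refine isBigO_of_res_pow_mul_eq_zero (meromorphicAt_defect hom hα hμ hn hw) 1 fun k hk => ?_
  have h1 := res_pow_mul_om_of_topologicalRecursion hom hT hn hw hram k
  rw [if_neg (by omega), Γ.mem_branches.1 hμ] at h1
  have hpk : MeromorphicAt (fun u : ℂ => u ^ k) 0 := (MeromorphicAt.id 0).pow k
  have hm1 : MeromorphicAt (fun u => u ^ k * defect K om α μ h w u) 0 :=
    hpk.mul (meromorphicAt_defect hom hα hμ hn hw)
  have hm2 : MeromorphicAt (fun u => u ^ k * recursionForm K om α μ h w u) 0 :=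
    hpk.mul (meromorphicAt_recursionForm hom hα hμ hn hw)
  have h2 : (fun u => u ^ k * om h (K.ddζ μ u ::ₘ Finset.univ.val.map w)) = fun u =>
      u ^ k * defect K om α μ h w u + u ^ k * recursionForm K om α μ h w u := by
    funext u
    rw [defect]; ring
  rw [h2, res_add hm1 hm2] at h1
  exact add_eq_right.1 h1

/-- Once the defects have at most simple poles, correlator and recursion form are interchangeable
under residues against the primitive. -/
theorem projectionProperty_of_topologicalRecursion (hom : IsCorrelatorFamily K om)
    (hT : TopologicalRecursion K om) : ProjectionProperty K om := by
  intro h v m hn hv hm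
  obtain ⟨n, w, rfl⟩ := exists_eq_univ_map m
  have hw : ∀ j, (w j).proj ∉ Γ.ramSet := fun j =>
    hm _ (Multiset.mem_map_of_mem _ (Finset.mem_univ_val j))
  have hn : 2 < h + (n + 1) := by simpa using hn
  rw [hT h n v w hn hv hw, Γ.sum_ram]
  refine Finset.sum_congr rfl fun α hα => Finset.sum_congr rfl fun μ hμ => ?_
  exact (res_primitive_mul_eq hom hα hμ hn hv hw
    (isBigO_defect_of_topologicalRecursion hom hT hn hw hα hμ)).symm

end LoopEq
end

noncomputable section

namespace LoopEq

open LocalCoords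

/-! ## The recursion formula implies the abstract loop equations -/

variable {Ct C : Type*} [TopologicalSpace Ct] [ChartedSpace ℂ Ct]
  {Γ : SpectralCurve Ct C}
  {K : LocalCoords Γ} {om : ℕ → Multiset (TangentBundle 𝓘(ℂ) Ct) → ℂ} {α : C} {h n : ℕ}
  {w : Fin n → TangentBundle 𝓘(ℂ) Ct}

theorem sheetExp_cast (hα : α ∈ Γ.ramPts) (j : Γ.Sheet α) :
    (K.sheetExp j : ℚ) = Γ.coverDeg α * (BranchOrder.slopeQ K j.1.1 - 1) := by
  have h1 : (Γ.r j.1.1 : ℚ) ≠ 0 := Nat.cast_ne_zero.2 (K.r_pos (sheet_ram hα j)).ne'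
  have h2 : ((K.sheetExp j : ℤ) : ℚ) * Γ.r j.1.1 =
      Γ.coverDeg α * (K.sInt j.1.1 - (Γ.r j.1.1 : ℚ)) := mod_cast K.sheetExp_mul_r j
  rw [BranchOrder.slopeQ]
  field_simp
  linarith

theorem loopCoeff_one_eq (hn : 2 < h + (n + 1)) (hα : α ∈ Γ.ramPts) {u : ℂ}
    (hu : ‖u‖ ^ Γ.coverDeg α < K.radius α) (hu0 : u ≠ 0) :
    loopCoeff K om α h 1 w (finVal (Γ.x α) + u ^ Γ.coverDeg α) =
      ∑ j : Γ.Sheet α, om h (K.sheetVec j u ::ₘ Finset.univ.val.map w) := by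
  classical
  rw [loopCoeff_eq_sum_sheets hα h 1 w hu hu0, Finset.powersetCard_one, Finset.sum_map]
  refine Finset.sum_congr rfl fun j _ => ?_
  have h0 : 0 < h + n := by omega
  have h1 : (({j} : Finset (Γ.Sheet α)).powerset) = {∅, {j}} := by
    ext A; simp [Finset.subset_singleton_iff]
  rw [disconn_eq_sum_powerset]
  change ∑ A ∈ ({j} : Finset (Γ.Sheet α)).powerset, _ = _
  rw [h1, Finset.sum_pair (Finset.singleton_ne_empty j).symm, disconn'_empty om h0, zero_mul, zero_add,
    disconn'_singleton om h0]
  simp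

variable [IsManifold 𝓘(ℂ) ⊤ Ct]

/-- The defect is at worst of the size of `dζ/ζ`, that is of `dx/τ` up to a constant; divided by
`dx` this is `1/τ = u ^ (-N)`. -/
theorem isBigO_sheetDefect (hom : IsCorrelatorFamily K om) (hT : TopologicalRecursion K om)
    (hn : 2 < h + (n + 1)) (hw : ∀ j, (w j).proj ∉ Γ.ramSet) (hα : α ∈ Γ.ramPts)
    (j : Γ.Sheet α) :
    (sheetDefect K om h w j) =O[𝓝[≠] 0] fun u => u ^ (-(Γ.coverDeg α : ℤ)) := by
  have hram := sheet_ram hα j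
  have hr := K.r_pos hram
  have hr0 : (Γ.r j.1.1 : ℂ) ≠ 0 := Nat.cast_ne_zero.2 hr.ne'
  have hμ := sheet_branch j
  set m := Γ.coverExp α j.1.1 with hm
  have hmr : (m : ℤ) * Γ.r j.1.1 = Γ.coverDeg α := mod_cast SpectralCurve.coverExp_mul_r hμ
  have hθ := K.sheet_root_ne_zero hα j
  have h1 := (isBigO_defect_of_topologicalRecursion hom hT hn hw hα hμ).comp_tendsto
    (K.tendsto_sheetCoord hα j)
  have h2 : (fun u => sheetCoord j u) =O[𝓝[≠] 0] fun u => u ^ (m : ℤ) := by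
    refine ((Asymptotics.isBigO_refl _ _).const_mul_left j.1.2).congr_left fun u => ?_
    rw [sheetCoord, zpow_natCast]
  have h3 : (fun u => (sheetCoord j u)⁻¹) =O[𝓝[≠] 0] fun u => u ^ (-(m : ℤ)) := by
    refine ((Asymptotics.isBigO_refl _ _).const_mul_left (j.1.2)⁻¹).congr_left fun u => ?_
    rw [sheetCoord, mul_inv, zpow_neg, zpow_natCast]
  have h4 : (fun u => defect K om α j.1.1 h w (sheetCoord j u)) =O[𝓝[≠] 0]
      fun u => u ^ (-(m : ℤ)) := by
    refine Asymptotics.IsBigO.trans ?_ h3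
    refine h1.congr_right fun u => ?_
    simp
  have h5 := IsBigO_zpow_mul h4 ((IsBigO_zpow_pow h3 (Γ.r j.1.1 - 1)).const_mul_left
    (Γ.r j.1.1 : ℂ)⁻¹)
  have he : -(m : ℤ) + -(m : ℤ) * ((Γ.r j.1.1 - 1 : ℕ) : ℤ) = -(Γ.coverDeg α : ℤ) := by
    rw [Nat.cast_sub hr, ← hmr]; push_cast; ring
  rw [he] at h5
  refine h5.congr' ?_ EventuallyEq.rfl
  filter_upwards [K.eventually_small hα] with u hu
  have ht := K.sheetCoord_mem_target hα j hu.1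
  have h6 := defect_sheetCoord hom hα hn w j hu.1 hu.2
  have h7 := K.sheetCoord_ne_zero hα j hu.2
  rw [h6, K.dx_ddζ hram ht]
  have h8 := pow_ne_zero (Γ.r j.1.1 - 1) h7
  rw [inv_pow]
  field_simp

-- The values of the loop polynomial at the nodes `-Y_j` are known in terms of the defects, and by
-- non-degeneracy the nodes are distinct; interpolation returns the coefficients.
open scoped Classical in
theorem eventually_loopCoeff_eq (O : BranchOrder K) (hnd : K.Nondegenerate)
    (hom : IsCorrelatorFamily K om) (hn : 2 < h + (n + 1)) (hα : α ∈ Γ.ramPts) {i : ℕ}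
    (hi : i ∈ Finset.Icc 1 (Γ.rTot α)) :
    ∀ᶠ u in 𝓝[≠] (0 : ℂ), loopCoeff K om α h i w (finVal (Γ.x α) + u ^ Γ.coverDeg α) =
      ∑ j : Γ.Sheet α, sheetDefect K om h w j u *
        ∑ S ∈ (Finset.univ.erase j).powersetCard (i - 1), ∏ k ∈ S, K.sheetY k u := by
  have hcard : (Finset.univ : Finset (Γ.Sheet α)).card = Γ.rTot α := by
    rw [Finset.card_univ, Fintype.card_coe, K.card_sheets hα]
  have hne : ∀ᶠ u in 𝓝[≠] (0 : ℂ), ∀ j k : Γ.Sheet α, k ≠ j → K.sheetY k u ≠ K.sheetY j u := by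
    refine eventually_all.2 fun j => eventually_all.2 fun k => ?_
    by_cases hkj : k = j
    · exact Eventually.of_forall fun _ h => absurd hkj h
    · exact (BranchOrder.eventually_sheetY_ne O hnd hα hkj).mono fun _ h _ => h
  filter_upwards [sum_loopCoeff_mul_pow O hnd hom hα hn w, hne] with u h1 h2
  refine coeff_eq_sum_of_values Finset.univ (fun k => K.sheetY k u) ?_
    (fun i => loopCoeff K om α h i w (finVal (Γ.x α) + u ^ Γ.coverDeg α))
    (fun j => sheetDefect K om h w j u) (fun j _ => ?_) (by rw [hcard]; exact hi)
  · intro j _ k _ hjk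
    by_contra hne
    exact h2 k j hne hjk
  · rw [hcard]; exact h1 j

theorem isBigO_sheetY (hα : α ∈ Γ.ramPts) (j : Γ.Sheet α) (hs : K.s j.1.1 ≠ ⊤) :
    (K.sheetY j) =O[𝓝[≠] 0] fun u => u ^ K.sheetExp j := by
  rw [isBigO_zpow_iff_isBigO_one]
  exact (K.tendsto_sheetY hα j hs).isBigO_one ℂ

theorem isBigO_prod_sheetY (hα : α ∈ Γ.ramPts) (S : Finset (Γ.Sheet α))
    (hS : ∀ k ∈ S, K.s k.1.1 ≠ ⊤) :
    (fun u => ∏ k ∈ S, K.sheetY k u) =O[𝓝[≠] 0] fun u => u ^ ∑ k ∈ S, K.sheetExp k := by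
  classical
  induction S using Finset.induction_on with
  | empty => simpa using Asymptotics.isBigO_refl (fun _ : ℂ => (1 : ℂ)) _
  | insert k S hk ih =>
    simp only [Finset.prod_insert hk, Finset.sum_insert hk]
    exact IsBigO_zpow_mul (isBigO_sheetY hα k (hS k (Finset.mem_insert_self _ _)))
      (ih fun l hl => hS l (Finset.mem_insert_of_mem hl))

theorem isBigO_loopCoeff_of_ne_one (O : BranchOrder K) (hnd : K.Nondegenerate)
    (hom : IsCorrelatorFamily K om) (hT : TopologicalRecursion K om)
    (hn : 2 < h + (n + 1)) (hw : ∀ j, (w j).proj ∉ Γ.ramSet) (hα : α ∈ Γ.ramPts) {i : ℕ}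
    (hi : i ∈ Finset.Icc 1 (Γ.rTot α)) {lam : Ct} (hlam : lam ∈ Γ.branches α)
    (h1 : O.rSeg lam < i) (h2 : i ≤ O.rSeg lam + Γ.r lam) (hi1 : i ≠ 1) :
    (fun τ : ℂ => loopCoeff K om α h i w (finVal (Γ.x α) + τ)) =O[𝓝[≠] (0 : ℂ)]
      fun τ : ℂ => τ ^ (-(O.dExp lam i - 1 - (if i = 1 then 1 else 0)) - (i : ℤ)) := by
  classical
  have hN := K.coverDeg_ne_zero hα
  set k₀ : ℤ := -(O.dExp lam i - 1 - (if i = 1 then 1 else 0)) - (i : ℤ) with hk₀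
  -- As the order in `τ` is an integer, an order in `u` just above `N (k₀ - 1)` is enough.
  refine isBigO_zpow_of_comp_pow (e := Γ.coverDeg α * (k₀ - 1) + 1)
    (meromorphicAt_loopCoeff hom hα hw h i) hN ?_ (by omega)
  refine Asymptotics.IsBigO.congr' (f₁ := fun u => ∑ j : Γ.Sheet α,
    ∑ S ∈ (Finset.univ.erase j).powersetCard (i - 1),
      sheetDefect K om h w j u * ∏ k ∈ S, K.sheetY k u) ?_ ?_ EventuallyEq.rfl
  · refine Asymptotics.IsBigO.fun_sum fun j _ => Asymptotics.IsBigO.fun_sum fun S hS => ?_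
    have hScard := (Finset.mem_powersetCard.1 hS).2
    -- A product containing a branch on which `y` vanishes contributes nothing.
    by_cases htop : ∃ k ∈ S, K.s k.1.1 = ⊤
    · obtain ⟨k, hk, hs⟩ := htop
      refine (Asymptotics.isBigO_zero _ _).congr' ?_ EventuallyEq.rfl
      filter_upwards [K.eventually_sheetY_eq_zero hα k hs] with u hu
      rw [Finset.prod_eq_zero hk hu, mul_zero]
    · replace htop : ∀ k ∈ S, K.s k.1.1 ≠ ⊤ := fun k hk hs => htop ⟨k, hk, hs⟩
      refine (IsBigO_zpow_mul (isBigO_sheetDefect hom hT hn hw hα j)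
        (isBigO_prod_sheetY hα S htop)).trans (zpow_isBigO_zpow_iff.2 ?_)
      have hlt := O.exponent_lt_sum_slopes hnd hα hlam h1 h2 hi1 S hScard htop
      have hsum : ((∑ k ∈ S, K.sheetExp k : ℤ) : ℚ) =
          Γ.coverDeg α * (∑ k ∈ S, BranchOrder.slopeQ K k.1.1 - ((i : ℚ) - 1)) := by
        push_cast
        rw [Finset.sum_congr rfl fun k _ => sheetExp_cast hα k, ← Finset.mul_sum,
          Finset.sum_sub_distrib, Finset.sum_const, hScard, nsmul_eq_mul, mul_one,
          Nat.cast_sub (Finset.mem_Icc.1 hi).1, Nat.cast_one]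
      have hNpos : (0 : ℚ) < Γ.coverDeg α := Nat.cast_pos.2 (Nat.pos_of_ne_zero hN)
      have hfin : ((Γ.coverDeg α * (k₀ - 1) : ℤ) : ℚ) <
          ((-(Γ.coverDeg α : ℤ) + ∑ k ∈ S, K.sheetExp k : ℤ) : ℚ) := by
        rw [Int.cast_add, hsum]
        have h3 : ((Γ.coverDeg α * (k₀ - 1) : ℤ) : ℚ) = Γ.coverDeg α *
            (((1 + (if i = 1 then 1 else 0) - O.dExp lam i : ℤ) : ℚ) - 1 - i) := by
          rw [hk₀]; push_cast; ring
        have h4 : ((-(Γ.coverDeg α : ℤ) : ℤ) : ℚ) + Γ.coverDeg α *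
            (∑ k ∈ S, BranchOrder.slopeQ K k.1.1 - ((i : ℚ) - 1)) =
            Γ.coverDeg α * (∑ k ∈ S, BranchOrder.slopeQ K k.1.1 - i) := by push_cast; ring
        rw [h3, h4]
        exact mul_lt_mul_of_pos_left (by linarith) hNpos
      have := Int.cast_lt.1 hfin
      omega
  · filter_upwards [eventually_loopCoeff_eq (w := w) O hnd hom hn hα hi] with u hu
    rw [hu]
    exact Finset.sum_congr rfl fun j _ => (Finset.mul_sum _ _ _).symm

/-- Pulled back along `τ = u ^ N`, the first loop coefficient times `dτ` is the sum over the sheets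
of the pullbacks of the correlator along `ζ = θ u ^ m`. Each has residue zero because the recursion
formula gives correlators without residues. -/
theorem res_loopCoeff_one (hom : IsCorrelatorFamily K om) (hT : TopologicalRecursion K om)
    (hn : 2 < h + (n + 1)) (hw : ∀ j, (w j).proj ∉ Γ.ramSet) (hα : α ∈ Γ.ramPts) :
    res (fun τ : ℂ => loopCoeff K om α h 1 w (finVal (Γ.x α) + τ)) = 0 := by
  have hN := K.coverDeg_ne_zero hα
  have h1 := res_comp_mul_pow (meromorphicAt_loopCoeff hom hα hw h 1) (a := 1) norm_one hN
  have hωm : ∀ j : Γ.Sheet α, MeromorphicAt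
      (fun ξ => om h (K.ddζ j.1.1 ξ ::ₘ Finset.univ.val.map w)) 0 := fun j =>
    meromorphicAt_om_ddζ hom hα (sheet_branch j) hn hw
  have h2 : ∀ j : Γ.Sheet α, res (fun u => om h (K.ddζ j.1.1 (j.1.2 * u ^ Γ.coverExp α j.1.1) ::ₘ
      Finset.univ.val.map w) * (j.1.2 * Γ.coverExp α j.1.1 * u ^ (Γ.coverExp α j.1.1 - 1))) = 0 := by
    intro j
    rw [res_comp_mul_pow (hωm j) (K.norm_sheet_root hα j) (K.coverExp_ne_zero hα (sheet_branch j))]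
    have h3 := res_pow_mul_om_of_topologicalRecursion hom hT hn hw (sheet_ram hα j) 0
    simp only [pow_zero, one_mul, if_true] at h3
    rw [h3, mul_zero]
  have hm : ∀ j : Γ.Sheet α, MeromorphicAt (fun u => om h (K.ddζ j.1.1
      (j.1.2 * u ^ Γ.coverExp α j.1.1) ::ₘ Finset.univ.val.map w) *
        (j.1.2 * Γ.coverExp α j.1.1 * u ^ (Γ.coverExp α j.1.1 - 1))) 0 := by
    intro j
    refine MeromorphicAt.mul ?_ (AnalyticAt.meromorphicAt (by fun_prop))
    have h0 := K.sheetCoord_zero hα j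
    exact MeromorphicAt.comp_analyticAt
      (f := fun ξ => om h (K.ddζ j.1.1 ξ ::ₘ Finset.univ.val.map w)) (g := sheetCoord j)
      (by rw [h0]; exact hωm j) (analyticAt_sheetCoord j 0)
  have h4 : res (fun u : ℂ => loopCoeff K om α h 1 w (finVal (Γ.x α) + 1 * u ^ Γ.coverDeg α) *
      (1 * Γ.coverDeg α * u ^ (Γ.coverDeg α - 1))) = 0 := by
    have h5 := res_sum Finset.univ (f := fun (j : Γ.Sheet α) u => om h (K.ddζ j.1.1
      (j.1.2 * u ^ Γ.coverExp α j.1.1) ::ₘ Finset.univ.val.map w) *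
        (j.1.2 * Γ.coverExp α j.1.1 * u ^ (Γ.coverExp α j.1.1 - 1))) fun j _ => hm j
    rw [Finset.sum_eq_zero fun j _ => h2 j] at h5
    rw [← h5]
    refine res_congr ?_
    filter_upwards [K.eventually_small hα] with u hu
    rw [one_mul, one_mul, loopCoeff_one_eq hn hα hu.1 hu.2, Finset.sum_mul]
    refine Finset.sum_congr rfl fun j _ => ?_
    have hr := K.r_pos (sheet_ram hα j)
    have hm0 := K.coverExp_ne_zero hα (sheet_branch j)
    have hmr := SpectralCurve.coverExp_mul_r (sheet_branch j)
    have hθ := K.sheet_root hα j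
    have hθ0 := K.sheet_root_ne_zero hα j
    rw [K.sheetVec_eq hα j hu.1 hu.2, smulVec_cons _ (hom.linear h), ← hmr, sheetCoord]
    set m := Γ.coverExp α j.1.1
    set r := Γ.r j.1.1
    have e1 : u ^ (m * r - 1) = u ^ (m - 1) * (u ^ m) ^ (r - 1) := by
      rw [← pow_mul, ← pow_add]
      congr 1
      obtain ⟨r', hr'⟩ : ∃ r', r = r' + 1 := ⟨r - 1, by omega⟩
      obtain ⟨m', hm'⟩ : ∃ m', m = m' + 1 := ⟨m - 1, by omega⟩
      rw [hr', hm', Nat.add_sub_cancel, Nat.add_sub_cancel]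
      ring_nf
      omega
    -- The root of unity from `dζ` cancels the one from `dx = r ζ ^ (r - 1) dζ`.
    have e2 : j.1.2 * j.1.2 ^ (r - 1) = 1 := by
      rw [← pow_succ', Nat.sub_add_cancel hr, hθ]
    have hr0 : (r : ℂ) ≠ 0 := Nat.cast_ne_zero.2 hr.ne'
    have hu0 := pow_ne_zero (r - 1) (pow_ne_zero m hu.2)
    have hθ1 := pow_ne_zero (r - 1) hθ0
    rw [e1, mul_pow]
    push_cast
    field_simp
    rw [mul_comm (j.1.2 ^ (r - 1)) j.1.2, e2, one_mul]
  rw [h4] at h1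
  exact (mul_eq_zero.1 h1.symm).resolve_left (Nat.cast_ne_zero.2 hN)

/-- The interpolation formula alone gives `O(τ⁻¹)`; the remaining simple pole is removed by the
vanishing residue. -/
theorem isBigO_loopCoeff_one (O : BranchOrder K) (hnd : K.Nondegenerate)
    (hom : IsCorrelatorFamily K om) (hT : TopologicalRecursion K om)
    (hn : 2 < h + (n + 1)) (hw : ∀ j, (w j).proj ∉ Γ.ramSet) (hα : α ∈ Γ.ramPts)
    (hi : 1 ∈ Finset.Icc 1 (Γ.rTot α)) :
    (fun τ : ℂ => loopCoeff K om α h 1 w (finVal (Γ.x α) + τ)) =O[𝓝[≠] (0 : ℂ)]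
      fun τ : ℂ => τ ^ (0 : ℤ) := by
  classical
  have hN := K.coverDeg_ne_zero hα
  have hf := meromorphicAt_loopCoeff hom hα hw h 1
  have h1 : (fun τ : ℂ => loopCoeff K om α h 1 w (finVal (Γ.x α) + τ)) =O[𝓝[≠] (0 : ℂ)]
      fun τ : ℂ => τ ^ (-1 : ℤ) := by
    rw [← isBigO_zpow_comp_pow_iff hN]
    refine Asymptotics.IsBigO.congr' (f₁ := fun u => ∑ j : Γ.Sheet α, sheetDefect K om h w j u)
      (Asymptotics.IsBigO.fun_sum fun j _ => ?_) ?_ EventuallyEq.rfl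
    · rw [mul_neg_one]
      exact isBigO_sheetDefect hom hT hn hw hα j
    · filter_upwards [eventually_loopCoeff_eq (w := w) O hnd hom hn hα hi] with u hu
      rw [hu]
      simp
  refine isBigO_of_res_pow_mul_eq_zero hf 0 fun k _ => ?_
  rcases Nat.eq_zero_or_pos k with rfl | hk
  · simpa using res_loopCoeff_one hom hT hn hw hα
  · have hpk : MeromorphicAt (fun u : ℂ => u ^ k) 0 := (MeromorphicAt.id 0).pow k
    refine res_eq_zero_of_isBigO_one (hpk.mul hf) ?_
    have h2 := (IsBigO_zpow_mul (Asymptotics.isBigO_refl (fun u : ℂ => u ^ (k : ℤ)) _) h1).trans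
      (zpow_isBigO_zpow_iff.2 (by omega : (0 : ℤ) ≤ (k : ℤ) + -1))
    simpa using h2

theorem abstractLoopEquations_of_topologicalRecursion (O : BranchOrder K) (hnd : K.Nondegenerate)
    (hom : IsCorrelatorFamily K om) (hT : TopologicalRecursion K om) :
    AbstractLoopEquations O om := by
  intro h n w hn hw α hα i hi lam hlam h1 h2
  by_cases hi1 : i = 1
  -- The index `1` belongs to the first branch, where `𝐫` and `𝐬` of the segment vanish. Thus
  -- `𝔡_α(1) = 1`, and the equation asks for a bounded coefficient.
  · subst hi1
    have hr0 : O.rSeg lam = 0 := by omega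
    have hs0 : O.sSeg lam = 0 := by
      have : O.seg lam = ∅ := by
        rw [Finset.eq_empty_iff_forall_notMem]
        intro ν hν
        have h3 := (Finset.sum_eq_zero_iff.1 hr0) ν hν
        have h4 := BranchOrder.r_pos_of_mem K hα (O.seg_subset hlam hν)
        omega
      rw [BranchOrder.sSeg, this, Finset.sum_empty]
    have he : -(O.dExp lam 1 - 1 - (if 1 = 1 then 1 else 0)) - ((1 : ℕ) : ℤ) = 0 := by
      rw [BranchOrder.dExp, hr0, hs0]
      simp
    rw [he]
    exact isBigO_loopCoeff_one O hnd hom hT hn hw hα hi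
  · exact isBigO_loopCoeff_of_ne_one O hnd hom hT hn hw hα hi hlam h1 h2 hi1

end LoopEq
end

theorem mainTheorem4
    {Ct C : Type*} [TopologicalSpace Ct] [T2Space Ct] [ChartedSpace ℂ Ct]
    [IsManifold 𝓘(ℂ) ⊤ Ct]
    (Γ : LoopEq.SpectralCurve Ct C) (K : LoopEq.LocalCoords Γ) (O : LoopEq.BranchOrder K)
    (hnd : K.Nondegenerate) :
    -- the abstract loop equations imply the master loop equations
    (∀ om : ℕ → Multiset (TangentBundle 𝓘(ℂ) Ct) → ℂ, LoopEq.IsCorrelatorFamily K om →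
      LoopEq.AbstractLoopEquations O om → LoopEq.MasterLoopEquations O om) ∧
    -- master loop equations and projection property imply the recursion formula
    (∀ om : ℕ → Multiset (TangentBundle 𝓘(ℂ) Ct) → ℂ, LoopEq.IsCorrelatorFamily K om →
      LoopEq.MasterLoopEquations O om → LoopEq.ProjectionProperty K om →
      LoopEq.TopologicalRecursion K om) ∧
    -- the solutions of the abstract loop equations with the projection property are exactly the
    -- families of correlators that are given by the recursion formula
    (∀ om : ℕ → Multiset (TangentBundle 𝓘(ℂ) Ct) → ℂ, LoopEq.IsCorrelatorFamily K om →
      ((LoopEq.AbstractLoopEquations O om ∧ LoopEq.ProjectionProperty K om) ↔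
        LoopEq.TopologicalRecursion K om)) ∧
    -- for fixed unstable data there is at most one solution
    (∀ om om' : ℕ → Multiset (TangentBundle 𝓘(ℂ) Ct) → ℂ,
      LoopEq.IsCorrelatorFamily K om → LoopEq.IsCorrelatorFamily K om' →
      LoopEq.SameUnstable om om' →
      LoopEq.AbstractLoopEquations O om → LoopEq.ProjectionProperty K om →
      LoopEq.AbstractLoopEquations O om' → LoopEq.ProjectionProperty K om' →
      ∀ (h : ℕ) (m : Multiset (TangentBundle 𝓘(ℂ) Ct)), m ≠ 0 → 2 < h + m.card →
        (∀ v ∈ m, v.proj ∉ Γ.ramSet) → om h m = om' h m) := by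
  have h12 := fun om (hom : LoopEq.IsCorrelatorFamily K om)
      (hA : LoopEq.AbstractLoopEquations O om) (hP : LoopEq.ProjectionProperty K om) =>
    LoopEq.topologicalRecursion_of_masterLoopEquations O hnd hom
      (LoopEq.masterLoopEquations_of_abstractLoopEquations O hnd hom hA) hP
  refine ⟨fun om hom hA => LoopEq.masterLoopEquations_of_abstractLoopEquations O hnd hom hA,
    fun om hom hM hP => LoopEq.topologicalRecursion_of_masterLoopEquations O hnd hom hM hP,
    fun om hom => ⟨fun hAP => h12 om hom hAP.1 hAP.2, fun hT =>
      ⟨LoopEq.abstractLoopEquations_of_topologicalRecursion O hnd hom hT,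
        LoopEq.projectionProperty_of_topologicalRecursion hom hT⟩⟩,
    fun om om' hom hom' hsame hA hP hA' hP' h m hm hst hmr => ?_⟩
  exact LoopEq.eq_of_topologicalRecursion hsame (h12 om hom hA hP) (h12 om' hom' hA' hP')
    h m hm hst hmr
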